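/- Fix $-\tfrac12<s<0$ and a choice of sign $\pm$ (upper sign: defocusing, lower sign: focusing), and write $r:=\pm\bar q$. Let $\hat q(\xi)=(2\pi)^{-1/2}\int e^{-i\xi x}q(x)\,dx$, $\|q\|_{H^s}^2=\int(4+\xi^2)^s|\hat q(\xi)|^2\,d\xi$, $B_\delta=\{q\in H^s(\mathbb R):\|q\|_{H^s}\le\delta\}$, and let $\mathscr S$ be the Schwartz class of complex-valued functions on $\mathbb R$. For real $|\kappa|\ge1$ put $\Lambda=(\kappa-\partial)^{-1/2}q(\kappa+\partial)^{-1/2}$ and $\Gamma=(\kappa+\partial)^{-1/2}r(\kappa-\partial)^{-1/2}$, where the fractional powers are Fourier multipliers defined with $\arg\in(-\pi,\pi]$. Let $$L(\kappa)=\begin{bmatrix}\kappa-\partial&q\\-r&\kappa+\partial\end{bmatrix}=L_0(\kappa)+\begin{bmatrix}0&q\\-r&0\end{bmatrix},\qquad R_0=L_0(\kappa)^{-1},$$ let $G(x,y;\kappa)$ be the matrix-valued integral kernel of the inverse of $L(\kappa)$ given by the series $$R(\kappa)=R_0+\sum_{\ell\ge1}(-1)^\ell\sqrt{R_0}\begin{bmatrix}0&\Lambda\\-\Gamma&0\end{bmatrix}^{\ell}\sqrt{R_0},$$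 whose off-diagonal entries are continuous for small $q\in H^s$, and set $$g_{12}(x;\kappa)=\operatorname{sgn}(\kappa)\,G_{12}(x,x;\kappa),\qquad A(\kappa;q)=\operatorname{sgn}(\kappa)\sum_{m\ge1}\tfrac{(-1)^{m-1}}m\operatorname{tr}\{(\Lambda\Gamma)^m\},\qquad \alpha(\kappa;q)=\pm\operatorname{Re}A(\kappa;q).$$ Let $M=\int qr\,dx$, $P=\tfrac1i\int qr'\,dx$, and, for $\kappa\ge1$, $$H^\kappa_{\mathrm{NLS}}=-8\kappa^3\operatorname{Re}A(\kappa)+4\kappa^2M,\qquad H^\kappa_{\mathrm{mKdV}}=16\kappa^4\operatorname{Im}A(\kappa)+4\kappa^2P.$$ The functional derivatives of $F$ are defined by $\frac{d}{d\theta}\big|_{\theta=0}F(q+\theta f)=\int f\,\tfrac{\delta F}{\delta q}\,dx\pm\int\bar f\,\tfrac{\delta F}{\delta r}\,dx$ for $f\in\mathscr S$, and the Hamiltonian flow of a real-valued $H$ is $i\frac{d}{dt}q=\tfrac{\delta H}{\delta r}$. **Proposition.** There exists $\delta>0$ (depending only on $s$) such that the following holds for all $\kappa\ge1$. On $B_\delta\cap\mathscr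 S$ the Hamiltonian flow equations of the (real-valued) Hamiltonians $H^\kappa_{\mathrm{NLS}}$ and $H^\kappa_{\mathrm{mKdV}}$ are, respectively, $$i\tfrac{d}{dt}q=4\kappa^3\big(g_{12}(\kappa)-g_{12}(-\kappa)\big)+4\kappa^2q,\tag{NLS$_\kappa$}$$ $$\tfrac{d}{dt}q=8\kappa^4\big(g_{12}(\kappa)+g_{12}(-\kappa)\big)+4\kappa^2q'.\tag{mKdV$_\kappa$}$$ Each of these two equations is globally well-posed for initial data in $B_\delta$: there is a map $\Phi:\mathbb R\times B_\delta\to H^s$, jointly continuous, such that for every $q_0\in B_\delta$ the curve $t\mapsto\Phi(t,q_0)$ is a solution on $\mathbb R$ with $\Phi(0,q_0)=q_0$, and every solution on an open time interval containing $0$ with value $q_0$ at time $0$ agrees with it on that interval. Here a solution on an open time interval is a continuous $H^s$-valued function of $t$ that is differentiable, and satisfies the equation, at every time in $H^s$ for (NLS$_\kappa$), and in $H^{s-1}$ for (mKdV$_\kappa$). For every $q_0\in B_\delta$, every $\varkappa\ge1$ and every $t\in\mathbb R$, the series defining $\alpha(\varkappa;\Phi(t,q_0))$ converges absolutely and $\alpha(\varkappa;\Phi(t,q_0))=\alpha(\varkappa;q_0)$.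 If moreover $q_0\in\mathscr S$, then $\Phi(t,q_0)\in\mathscr S$ for all $t\in\mathbb R$. -/

import Mathlib

open MeasureTheory Set
open scoped SchwartzMap ComplexConjugate

namespace AKNS

noncomputable section

/-! ### Fourier transform and Sobolev spaces -/

/-- The unitary Fourier transform `f̂(ξ) = (2π)^(-1/2) ∫ e^{-iξx} f(x) dx`. -/
def fourierT (f : ℝ → ℂ) (ξ : ℝ) : ℂ :=
  ((Real.sqrt (2 * Real.pi) : ℝ) : ℂ)⁻¹ * ∫ x : ℝ, Complex.exp (-(Complex.I * ξ * x)) * f x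

/-- The measure `(4 + ξ²)^σ dξ` on the frequency line. -/
def sobolevMeasure (σ : ℝ) : Measure ℝ :=
  volume.withDensity fun ξ => ENNReal.ofReal ((4 + ξ ^ 2) ^ σ)

/-- The Sobolev space `H^σ(ℝ)` of complex tempered distributions `q` whose Fourier transform is a
function `q̂` with `‖q‖² = ∫ (4 + ξ²)^σ |q̂(ξ)|² dξ < ∞`.  The distribution `q` is recorded by its
Fourier transform: an element `u` of this Hilbert space is the distribution with `q̂ = u`. -/
abbrev Hs (σ : ℝ) : Type := Lp ℂ 2 (sobolevMeasure σ)

/-- The action `∫ q φ dx = ∫ q̂(ξ) φ̂(-ξ) dξ` of the distribution `q ∈ H^σ` on a Schwartz function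
`φ` (bilinear, no complex conjugation). -/
def pair {σ : ℝ} (q : Hs σ) (φ : 𝓢(ℝ, ℂ)) : ℂ := ∫ ξ : ℝ, q ξ * fourierT φ (-ξ)

/-- The distribution `q ∈ H^σ` is the Schwartz function `f`. -/
def IsOfSchwartz {σ : ℝ} (q : Hs σ) (f : 𝓢(ℝ, ℂ)) : Prop := ∀ᵐ ξ : ℝ, q ξ = fourierT f ξ

lemma sobolevMeasure_sub_one_le (σ : ℝ) : sobolevMeasure (σ - 1) ≤ sobolevMeasure σ := by
  refine withDensity_mono (Filter.Eventually.of_forall fun ξ => ENNReal.ofReal_le_ofReal ?_)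
  exact Real.rpow_le_rpow_of_exponent_le (by nlinarith [sq_nonneg ξ]) (by linarith)

/-- The inclusion `H^σ ⊆ H^(σ-1)`. -/
def incl {σ : ℝ} (q : Hs σ) : Hs (σ - 1) :=
  ((Lp.memLp q).mono_measure (sobolevMeasure_sub_one_le σ)).toLp q

/-! ### Integral kernels on the Fourier side

An operator `T` on functions of `x` is described by the kernel `K` with
`(T f)^(ξ) = ∫ K(ξ, η) f̂(η) dη`.  Below `w` stands for the Fourier transform of `q`; the unit
`ε = 1` is the defocusing case and `ε = -1` the focusing case, so that `r = ε q̄`. -/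

/-- The Fourier transform of `r = ± q̄`. -/
def rHat (ε : ℤˣ) (w : ℝ → ℂ) (ξ : ℝ) : ℂ := ((ε : ℤ) : ℂ) * conj (w (-ξ))

/-- The symbol `(κ - iξ)^(-1/2)` of `(κ - ∂)^(-1/2)`, with `arg ∈ (-π, π]`. -/
def symMinus (κ ξ : ℝ) : ℂ := ((κ : ℂ) - Complex.I * ξ) ^ (-(1 / 2) : ℂ)

/-- The symbol `(κ + iξ)^(-1/2)` of `(κ + ∂)^(-1/2)`, with `arg ∈ (-π, π]`. -/
def symPlus (κ ξ : ℝ) : ℂ := ((κ : ℂ) + Complex.I * ξ) ^ (-(1 / 2) : ℂ)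

/-- The kernel of `Λ = (κ - ∂)^(-1/2) q (κ + ∂)^(-1/2)`. -/
def kerLambda (κ : ℝ) (w : ℝ → ℂ) (ξ η : ℝ) : ℂ :=
  symMinus κ ξ * (((Real.sqrt (2 * Real.pi) : ℝ) : ℂ)⁻¹ * w (ξ - η)) * symPlus κ η

/-- The kernel of `Γ = (κ + ∂)^(-1/2) r (κ - ∂)^(-1/2)`. -/
def kerGamma (ε : ℤˣ) (κ : ℝ) (w : ℝ → ℂ) (ξ η : ℝ) : ℂ :=
  symPlus κ ξ * (((Real.sqrt (2 * Real.pi) : ℝ) : ℂ)⁻¹ * rHat ε w (ξ - η)) * symMinus κ η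

/-- The kernel of a composition of operators. -/
def kerComp (K L : ℝ → ℝ → ℂ) (ξ η : ℝ) : ℂ := ∫ ζ : ℝ, K ξ ζ * L ζ η

/-- The kernel of `(ΛΓ)^m Λ = Λ(ΓΛ)^m`. -/
def kerOdd (ε : ℤˣ) (κ : ℝ) (w : ℝ → ℂ) : ℕ → ℝ → ℝ → ℂ
  | 0 => kerLambda κ w
  | m + 1 => kerComp (kerLambda κ w) (kerComp (kerGamma ε κ w) (kerOdd ε κ w m))

/-- `tr {(ΛΓ)^(m+1)}`: the integral over the diagonal of the kernel of this product of
Hilbert-Schmidt operators. -/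
def traceTerm (ε : ℤˣ) (κ : ℝ) (w : ℝ → ℂ) (m : ℕ) : ℂ :=
  ∫ ξ : ℝ, kerComp (kerOdd ε κ w m) (kerGamma ε κ w) ξ ξ

/-! ### The perturbation determinant -/

/-- The term of index `m + 1` in the series that defines `A`. -/
def ATerm (ε : ℤˣ) (κ : ℝ) (w : ℝ → ℂ) (m : ℕ) : ℂ :=
  (-1) ^ m / ((m : ℂ) + 1) * traceTerm ε κ w m

/-- The logarithmic perturbation determinant
`A(κ; q) = sgn(κ) ∑_{m ≥ 1} (-1)^(m-1)/m · tr {(ΛΓ)^m}`. -/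
def A (ε : ℤˣ) (κ : ℝ) (w : ℝ → ℂ) : ℂ := (Real.sign κ : ℂ) * ∑' m : ℕ, ATerm ε κ w m

/-- `α(κ; q) = ± Re A(κ; q)`. -/
def alpha (ε : ℤˣ) (κ : ℝ) (w : ℝ → ℂ) : ℝ := ((ε : ℤ) : ℝ) * (A ε κ w).re

/-! ### The diagonal Green's function

The Lax operator is `L = L₀ + [[0, q], [-r, 0]]` with `L₀ = diag(κ - ∂, κ + ∂)`, and with
`R₀ = L₀⁻¹` its inverse is
`R = R₀ + ∑_{ℓ ≥ 1} (-1)^ℓ √R₀ (√R₀ (L - L₀) √R₀)^ℓ √R₀`, where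
`√R₀ (L - L₀) √R₀ = [[0, Λ], [-Γ, 0]]`.  In the entry `(1, 2)` only `ℓ = 2m + 1` contributes, with
`(-1)^(m+1) (κ - ∂)^(-1/2) Λ(ΓΛ)^m (κ + ∂)^(-1/2)`. -/

/-- The Fourier-side kernel of the entry `(1, 2)` of the resolvent `R(κ)`. -/
def resolvent12 (ε : ℤˣ) (κ : ℝ) (w : ℝ → ℂ) (ξ η : ℝ) : ℂ :=
  ∑' m : ℕ, (-1) ^ (m + 1) * (symMinus κ ξ * kerOdd ε κ w m ξ η * symPlus κ η)

/-- The entry `G₁₂(x, y; κ)` of the Green's function, i.e. the (continuous) integral kernel in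
physical space of the entry `(1, 2)` of `R(κ)`. -/
def green12 (ε : ℤˣ) (κ : ℝ) (w : ℝ → ℂ) (x y : ℝ) : ℂ :=
  ((2 * Real.pi : ℝ) : ℂ)⁻¹ *
    ∫ p : ℝ × ℝ, Complex.exp (Complex.I * (x * p.1 - y * p.2)) * resolvent12 ε κ w p.1 p.2

/-- `g₁₂(x; κ) = sgn(κ) G₁₂(x, x; κ)`. -/
def g12 (ε : ℤˣ) (κ : ℝ) (w : ℝ → ℂ) (x : ℝ) : ℂ := (Real.sign κ : ℂ) * green12 ε κ w x x

/-! ### Hamiltonians and functional derivatives on Schwartz space -/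

/-- The mass `M = ∫ q r dx`. -/
def mass (ε : ℤˣ) (q : 𝓢(ℝ, ℂ)) : ℂ := ∫ x : ℝ, q x * (((ε : ℤ) : ℂ) * conj (q x))

/-- The momentum `P = (1/i) ∫ q r' dx`. -/
def momentum (ε : ℤˣ) (q : 𝓢(ℝ, ℂ)) : ℂ :=
  Complex.I⁻¹ * ∫ x : ℝ, q x * deriv (fun y : ℝ => ((ε : ℤ) : ℂ) * conj (q y)) x

/-- The regularized Hamiltonian `- 8κ³ Re A(κ) + 4κ² M`. -/
def hamNLS (ε : ℤˣ) (κ : ℝ) (q : 𝓢(ℝ, ℂ)) : ℂ :=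
  -8 * (κ : ℂ) ^ 3 * ((A ε κ (fourierT q)).re : ℂ) + 4 * (κ : ℂ) ^ 2 * mass ε q

/-- The regularized Hamiltonian `16κ⁴ Im A(κ) + 4κ² P`. -/
def hamMKdV (ε : ℤˣ) (κ : ℝ) (q : 𝓢(ℝ, ℂ)) : ℂ :=
  16 * (κ : ℂ) ^ 4 * ((A ε κ (fourierT q)).im : ℂ) + 4 * (κ : ℂ) ^ 2 * momentum ε q

/-- The functions `a` and `b` are the functional derivatives `δF/δq` and `δF/δr` at `q`:
`d/dθ F(q + θf) = ∫ f a dx ± ∫ f̄ b dx` at `θ = 0`, for all Schwartz `f`. -/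
def HasFunctDeriv (ε : ℤˣ) (F : 𝓢(ℝ, ℂ) → ℂ) (q : 𝓢(ℝ, ℂ)) (a b : ℝ → ℂ) : Prop :=
  ∀ f : 𝓢(ℝ, ℂ), HasDerivAt (fun θ : ℝ => F (q + θ • f))
    ((∫ x : ℝ, f x * a x) + ((ε : ℤ) : ℂ) * ∫ x : ℝ, conj (f x) * b x) 0

/-- The real Hamiltonian `H` generates at `q` the vector field `V`, i.e. `i d/dt q = δH/δr` is the
equation `i d/dt q = V` there.  As `H` is real, `δH/δq` is `±` the complex conjugate of `δH/δr`. -/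
def GeneratesAt (ε : ℤˣ) (H : 𝓢(ℝ, ℂ) → ℂ) (q : 𝓢(ℝ, ℂ)) (V : ℝ → ℂ) : Prop :=
  (∀ f, (H f).im = 0) ∧ HasFunctDeriv ε H q (fun x => ((ε : ℤ) : ℂ) * conj (V x)) V

/-! ### The regularized flows -/

/-- `q` solves `i d/dt q = 4κ³ (g₁₂(κ) - g₁₂(-κ)) + 4κ² q` for times in the open set `J`, as an
ordinary differential equation in `H^s`. -/
def IsNLSSolution (ε : ℤˣ) {s : ℝ} (κ : ℝ) (J : Set ℝ) (q : ℝ → Hs s) : Prop :=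
  ContinuousOn q J ∧ ∀ t ∈ J, ∃ v : Hs s, HasDerivAt q v t ∧ ∀ φ : 𝓢(ℝ, ℂ),
    Complex.I * pair v φ =
      4 * (κ : ℂ) ^ 3 * (∫ x : ℝ, (g12 ε κ (q t) x - g12 ε (-κ) (q t) x) * φ x)
        + 4 * (κ : ℂ) ^ 2 * pair (q t) φ

/-- `q` solves `d/dt q = 8κ⁴ (g₁₂(κ) + g₁₂(-κ)) + 4κ² q'` for times in the open set `J`: the map
`q` is continuous with values in `H^s` and satisfies the equation in `H^(s-1)`, where the
distribution `q'` acts by `φ ↦ -⟨q, φ'⟩`. -/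
def IsMKdVSolution (ε : ℤˣ) {s : ℝ} (κ : ℝ) (J : Set ℝ) (q : ℝ → Hs s) : Prop :=
  ContinuousOn q J ∧ ∀ t ∈ J, ∃ v : Hs (s - 1), HasDerivAt (fun τ => incl (q τ)) v t ∧
    ∀ φ : 𝓢(ℝ, ℂ),
      pair v φ =
        8 * (κ : ℂ) ^ 4 * (∫ x : ℝ, (g12 ε κ (q t) x + g12 ε (-κ) (q t) x) * φ x)
          - 4 * (κ : ℂ) ^ 2 * pair (q t) (SchwartzMap.derivCLM ℂ ℂ φ)

/-- `Φ` is a global solution map for data in `B`: existence of global solutions, their uniqueness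
(on every open time interval around `0`), and joint continuity in time and data. -/
structure IsGlobalSolutionMap {E : Type*} [TopologicalSpace E]
    (IsSol : Set ℝ → (ℝ → E) → Prop) (B : Set E) (Φ : ℝ → E → E) : Prop where
  initial : ∀ q₀ ∈ B, Φ 0 q₀ = q₀
  solves : ∀ q₀ ∈ B, IsSol univ fun t => Φ t q₀
  unique : ∀ q₀ ∈ B, ∀ J : Set ℝ, IsOpen J → J.OrdConnected → (0 : ℝ) ∈ J →
    ∀ q : ℝ → E, IsSol J q → q 0 = q₀ → ∀ t ∈ J, q t = Φ t q₀
  continuous : ContinuousOn (fun p : ℝ × E => Φ p.1 p.2) (univ ×ˢ B)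

/-- The flow `Φ` conserves `α(ϰ)` for every `ϰ ≥ 1` on data in `B`; in particular the series that
defines `α(ϰ)` converges absolutely along the flow. -/
def ConservesAlpha (ε : ℤˣ) {s : ℝ} (B : Set (Hs s)) (Φ : ℝ → Hs s → Hs s) : Prop :=
  ∀ q₀ ∈ B, ∀ ϰ : ℝ, 1 ≤ ϰ → ∀ t : ℝ,
    Summable (fun m => ‖ATerm ε ϰ (Φ t q₀) m‖) ∧ alpha ε ϰ (Φ t q₀) = alpha ε ϰ q₀

/-- The flow `Φ` maps Schwartz data in `B` to Schwartz functions. -/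
def PreservesSchwartz {s : ℝ} (B : Set (Hs s)) (Φ : ℝ → Hs s → Hs s) : Prop :=
  ∀ q₀ ∈ B, (∃ f, IsOfSchwartz q₀ f) → ∀ t : ℝ, ∃ f, IsOfSchwartz (Φ t q₀) f

end

end AKNS

open AKNS

namespace AKNS

noncomputable section

/-! ### Alternating products in a Banach algebra with a trace -/

section TraceAlgebra

variable {H : Type*} [NormedAddCommGroup H] [NormedSpace ℂ H]

/-- A continuous associative product together with a trace form `tr x y`, the trace of `x y`. -/
structure IsTraceAlgebra (mul : H →L[ℂ] H →L[ℂ] H) (tr : H →L[ℂ] H →L[ℂ] ℂ) : Prop where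
  norm_mul : ∀ x y, ‖mul x y‖ ≤ ‖x‖ * ‖y‖
  norm_tr : ∀ x y, ‖tr x y‖ ≤ ‖x‖ * ‖y‖
  assoc : ∀ x y z, mul (mul x y) z = mul x (mul y z)
  tr_comm : ∀ x y, tr x y = tr y x
  tr_assoc : ∀ x y z, tr (mul x y) z = tr x (mul y z)

/-- The alternating product `x (y x) ^ m`. -/
def alt (mul : H →L[ℂ] H →L[ℂ] H) (x y : H) : ℕ → H
  | 0 => x
  | m + 1 => mul x (mul y (alt mul x y m))

/-- The sum of the alternating products `x (y x) ^ m`. -/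
def altSum (mul : H →L[ℂ] H →L[ℂ] H) (x y : H) : H := ∑' m, alt mul x y m

/-- `- log det (1 - x y)`. -/
def logDet (mul : H →L[ℂ] H →L[ℂ] H) (tr : H →L[ℂ] H →L[ℂ] ℂ) (x y : H) : ℂ :=
  ∑' m : ℕ, ((m : ℂ) + 1)⁻¹ * tr (alt mul x y m) y

lemma hasDerivAt_bilin [NormedSpace ℝ H] [IsScalarTower ℝ ℂ H]
    {G : Type*} [NormedAddCommGroup G] [NormedSpace ℂ G] [NormedSpace ℝ G]
    [IsScalarTower ℝ ℂ G] {H' : Type*} [NormedAddCommGroup H'] [NormedSpace ℂ H']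
    [NormedSpace ℝ H'] [IsScalarTower ℝ ℂ H']
    (B : H →L[ℂ] H' →L[ℂ] G) {x : ℝ → H} {y : ℝ → H'} {x' : H} {y' : H'} {t : ℝ}
    (hx : HasDerivAt x x' t) (hy : HasDerivAt y y' t) :
    HasDerivAt (fun t => B (x t) (y t)) (B x' (y t) + B (x t) y') t := by
  have h := (B.isBoundedBilinearMap.hasFDerivAt (x t, y t)).restrictScalars ℝ
  have h2 := h.comp_hasDerivAt t (hx.prodMk hy)
  refine HasDerivAt.congr_deriv h2 ?_
  simp [add_comm]

variable {mul : H →L[ℂ] H →L[ℂ] H} {tr : H →L[ℂ] H →L[ℂ] ℂ} (hA : IsTraceAlgebra mul tr)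
include hA

namespace IsTraceAlgebra

lemma norm_mul_mul_le (x y z : H) : ‖mul x (mul y z)‖ ≤ ‖x‖ * (‖y‖ * ‖z‖) :=
  (hA.norm_mul _ _).trans (mul_le_mul_of_nonneg_left (hA.norm_mul _ _) (norm_nonneg _))

lemma norm_alt_le (x y : H) (m : ℕ) : ‖alt mul x y m‖ ≤ ‖x‖ * (‖x‖ * ‖y‖) ^ m := by
  induction m with
  | zero => simp [alt]
  | succ m ih =>
    calc ‖alt mul x y (m + 1)‖ ≤ ‖x‖ * (‖y‖ * ‖alt mul x y m‖) :=
          (hA.norm_mul _ _).trans (by gcongr; exact hA.norm_mul _ _)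
      _ ≤ ‖x‖ * (‖y‖ * (‖x‖ * (‖x‖ * ‖y‖) ^ m)) := by gcongr
      _ = _ := by ring

lemma mul_alt_swap (x y : H) (m : ℕ) : mul x (alt mul y x m) = mul (alt mul x y m) y := by
  induction m with
  | zero => rfl
  | succ m ih => simp only [alt, ih, hA.assoc]

lemma mul_alt_mul_alt (x y : H) (m k : ℕ) :
    mul (mul y (alt mul x y m)) (alt mul y x k) = alt mul y x (m + k + 1) := by
  induction m with
  | zero => simp only [alt, hA.assoc, Nat.zero_add]
  | succ m ih =>
    rw [show m + 1 + k + 1 = (m + k + 1) + 1 by ring]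
    simp only [alt, hA.assoc] at ih ⊢
    rw [ih]

lemma alt_mul_alt_mul (x y : H) (m k : ℕ) :
    mul (alt mul x y m) (mul (alt mul y x k) x) = alt mul x y (m + k + 1) := by
  rw [← hA.mul_alt_swap y x k]
  induction m with
  | zero => simp only [alt, Nat.zero_add]
  | succ m ih =>
    rw [show m + 1 + k + 1 = (m + k + 1) + 1 by ring]
    simp only [alt, hA.assoc] at ih ⊢
    rw [ih]

lemma alt_mul_mul (x y : H) (k : ℕ) :
    mul (mul (alt mul y x k) x) y = alt mul y x (k + 1) := by
  rw [← hA.mul_alt_swap y x k, hA.assoc, ← hA.mul_alt_swap x y k]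
  rfl

lemma tr_alt_swap (x y : H) (m : ℕ) : tr (alt mul x y m) y = tr (alt mul y x m) x := by
  cases m with
  | zero => exact hA.tr_comm _ _
  | succ m =>
    rw [hA.tr_comm (alt mul y x (m + 1)) x]
    change tr (mul x (mul y (alt mul x y m))) y = _
    rw [hA.tr_assoc, hA.assoc, ← hA.mul_alt_swap]
    rfl

/-- The derivative of an alternating product, traced against an alternating product. -/
lemma exists_hasDerivAt_alt [NormedSpace ℝ H] [IsScalarTower ℝ ℂ H]
    {x y : ℝ → H} {x' y' : H} {t : ℝ}
    (hx : HasDerivAt x x' t) (hy : HasDerivAt y y' t) (m : ℕ) :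
    ∃ u : H, HasDerivAt (fun t => alt mul (x t) (y t) m) u t ∧
      ∀ k, tr u (alt mul (y t) (x t) k) =
        ((m : ℂ) + 1) * tr x' (alt mul (y t) (x t) (m + k)) +
          (m : ℂ) * tr y' (alt mul (x t) (y t) (m + k)) := by
  induction m with
  | zero => exact ⟨x', hx, fun k => by simp⟩
  | succ m ih =>
    obtain ⟨u, hu, hk⟩ := ih
    refine ⟨_, hasDerivAt_bilin mul hx (hasDerivAt_bilin mul hy hu), fun k => ?_⟩
    have e1 : tr (mul x' (mul (y t) (alt mul (x t) (y t) m))) (alt mul (y t) (x t) k) =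
        tr x' (alt mul (y t) (x t) (m + k + 1)) := by
      rw [hA.tr_assoc, hA.mul_alt_mul_alt]
    have e2 : tr (mul (x t) (mul y' (alt mul (x t) (y t) m))) (alt mul (y t) (x t) k) =
        tr y' (alt mul (x t) (y t) (m + k + 1)) := by
      rw [hA.tr_comm, ← hA.tr_assoc, hA.tr_comm, hA.tr_assoc, hA.alt_mul_alt_mul]
    have e3 : tr (mul (x t) (mul (y t) u)) (alt mul (y t) (x t) k) =
        tr u (alt mul (y t) (x t) (k + 1)) := by
      rw [hA.tr_comm, ← hA.tr_assoc, ← hA.tr_assoc, hA.alt_mul_mul, hA.tr_comm]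
    simp only [map_add, add_apply]
    rw [e1, e2, e3, hk (k + 1), show m + 1 + k = m + k + 1 by ring,
      show m + (k + 1) = m + k + 1 by ring]
    push_cast
    ring

lemma hasDerivAt_tr_alt [NormedSpace ℝ H] [IsScalarTower ℝ ℂ H]
    {x y : ℝ → H} {x' y' : H} {t : ℝ}
    (hx : HasDerivAt x x' t) (hy : HasDerivAt y y' t) (m : ℕ) :
    HasDerivAt (fun t => ((m : ℂ) + 1)⁻¹ * tr (alt mul (x t) (y t) m) (y t))
      (tr x' (alt mul (y t) (x t) m) + tr (alt mul (x t) (y t) m) y') t := by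
  obtain ⟨u, hu, hk⟩ := hA.exists_hasDerivAt_alt hx hy m
  have h := (hasDerivAt_bilin tr hu hy).const_mul (((m : ℂ) + 1)⁻¹)
  refine h.congr_deriv ?_
  have h0 : ((m : ℂ) + 1) ≠ 0 := by exact_mod_cast Nat.succ_ne_zero m
  have h1 := hk 0
  simp only [alt, add_zero] at h1
  rw [h1, hA.tr_comm y']
  field_simp
  ring

lemma norm_alt_le' {x y : H} {r : ℝ} (hx : ‖x‖ ≤ r) (hy : ‖y‖ ≤ r) (m : ℕ) :
    ‖alt mul x y m‖ ≤ r * (r ^ 2) ^ m := by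
  have h0 : 0 ≤ r := (norm_nonneg x).trans hx
  refine (hA.norm_alt_le x y m).trans ?_
  rw [sq]
  gcongr

lemma norm_logDet_term_le {x y : H} {r : ℝ} (hx : ‖x‖ ≤ r) (hy : ‖y‖ ≤ r) (m : ℕ) :
    ‖((m : ℂ) + 1)⁻¹ * tr (alt mul x y m) y‖ ≤ r ^ 2 * (r ^ 2) ^ m := by
  have h0 : 0 ≤ r := (norm_nonneg x).trans hx
  have h1 : ‖((m : ℂ) + 1)⁻¹‖ ≤ 1 := by
    rw [norm_inv]
    refine inv_le_one_of_one_le₀ ?_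
    have : ((m : ℂ) + 1) = ((m + 1 : ℕ) : ℂ) := by push_cast; rfl
    rw [this, Complex.norm_natCast]
    exact_mod_cast Nat.le_add_left 1 m
  rw [_root_.norm_mul]
  calc ‖((m : ℂ) + 1)⁻¹‖ * ‖tr (alt mul x y m) y‖ ≤ 1 * (r * (r ^ 2) ^ m * r) := by
        refine mul_le_mul h1 ((hA.norm_tr _ _).trans ?_) (norm_nonneg _) zero_le_one
        exact mul_le_mul (hA.norm_alt_le' hx hy m) hy (norm_nonneg _) (by positivity)
    _ = _ := by ring

lemma summable_norm_alt {x y : H} {r : ℝ} (hx : ‖x‖ ≤ r) (hy : ‖y‖ ≤ r) (hr : r < 1) :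
    Summable fun m => ‖alt mul x y m‖ := by
  have h0 : 0 ≤ r := (norm_nonneg x).trans hx
  refine Summable.of_nonneg_of_le (fun _ => norm_nonneg _) (hA.norm_alt_le' hx hy) ?_
  exact (summable_geometric_of_lt_one (by positivity) (by nlinarith)).mul_left r

lemma summable_logDet {x y : H} {r : ℝ} (hx : ‖x‖ ≤ r) (hy : ‖y‖ ≤ r) (hr : r < 1) :
    Summable fun m : ℕ => ‖((m : ℂ) + 1)⁻¹ * tr (alt mul x y m) y‖ := by
  have h0 : 0 ≤ r := (norm_nonneg x).trans hx
  refine Summable.of_nonneg_of_le (fun _ => norm_nonneg _) (hA.norm_logDet_term_le hx hy) ?_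
  exact (summable_geometric_of_lt_one (by positivity) (by nlinarith)).mul_left _

/-- The logarithmic determinant is its leading term up to a quartic error. -/
lemma norm_logDet_sub_le {x y : H} {r : ℝ} (hx : ‖x‖ ≤ r) (hy : ‖y‖ ≤ r) (hr : r ≤ 1 / 2) :
    ‖logDet mul tr x y - tr x y‖ ≤ 2 * r ^ 4 := by
  have h0 : 0 ≤ r := (norm_nonneg x).trans hx
  have hs := hA.summable_logDet hx hy (by linarith)
  have e : logDet mul tr x y - tr x y =
      ∑' m : ℕ, (((m + 1 : ℕ) : ℂ) + 1)⁻¹ * tr (alt mul x y (m + 1)) y := by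
    rw [logDet, hs.of_norm.tsum_eq_zero_add]
    simp [alt]
  rw [e]
  have hg : HasSum (fun m : ℕ => r ^ 4 * (r ^ 2) ^ m) (r ^ 4 * (1 - r ^ 2)⁻¹) :=
    (hasSum_geometric_of_lt_one (by positivity) (by nlinarith)).mul_left _
  refine (tsum_of_norm_bounded hg fun m => ?_).trans ?_
  · refine (hA.norm_logDet_term_le hx hy (m + 1)).trans (le_of_eq ?_)
    ring
  · rw [mul_comm 2]
    gcongr
    rw [inv_le_comm₀ (by nlinarith) (by norm_num)]
    nlinarith

variable [CompleteSpace H]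

lemma summable_alt {x y : H} {r : ℝ} (hx : ‖x‖ ≤ r) (hy : ‖y‖ ≤ r) (hr : r < 1) :
    Summable fun m => alt mul x y m := (hA.summable_norm_alt hx hy hr).of_norm

lemma altSum_eq {x y : H} {r : ℝ} (hx : ‖x‖ ≤ r) (hy : ‖y‖ ≤ r) (hr : r < 1) :
    altSum mul x y = x + mul x (mul y (altSum mul x y)) := by
  have hs := hA.summable_alt hx hy hr
  have e : mul x (mul y (altSum mul x y)) = ∑' m, alt mul x y (m + 1) := by
    rw [altSum, ContinuousLinearMap.map_tsum _ hs,
      ContinuousLinearMap.map_tsum _ ((mul y).summable hs)]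
    rfl
  rw [e, altSum, hs.tsum_eq_zero_add]
  rfl

lemma mul_altSum_swap {x y : H} {r : ℝ} (hx : ‖x‖ ≤ r) (hy : ‖y‖ ≤ r) (hr : r < 1) :
    mul x (altSum mul y x) = mul (altSum mul x y) y := by
  have hs := hA.summable_alt hx hy hr
  have hs' := hA.summable_alt hy hx hr
  rw [altSum, ContinuousLinearMap.map_tsum _ hs', altSum]
  change _ = mul.flip y _
  rw [ContinuousLinearMap.map_tsum _ hs]
  exact tsum_congr fun m => hA.mul_alt_swap x y m

lemma altSum_eq' {x y : H} {r : ℝ} (hx : ‖x‖ ≤ r) (hy : ‖y‖ ≤ r) (hr : r < 1) :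
    altSum mul x y = x + mul (mul x (altSum mul y x)) x := by
  conv_lhs => rw [hA.altSum_eq hx hy hr]
  rw [hA.assoc, ← hA.mul_altSum_swap hy hx hr]

lemma tr_altSum_swap {x y : H} {r : ℝ} (hx : ‖x‖ ≤ r) (hy : ‖y‖ ≤ r) (hr : r < 1) :
    tr (altSum mul x y) y = tr (altSum mul y x) x := by
  have hs := hA.summable_alt hx hy hr
  have hs' := hA.summable_alt hy hx hr
  change tr.flip y _ = tr.flip x _
  rw [altSum, ContinuousLinearMap.map_tsum _ hs, altSum, ContinuousLinearMap.map_tsum _ hs']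
  exact tsum_congr fun m => hA.tr_alt_swap x y m

lemma norm_altSum_le {x y : H} (hx : ‖x‖ ≤ 1 / 2) (hy : ‖y‖ ≤ 1 / 2) :
    ‖altSum mul x y‖ ≤ 2 * ‖x‖ := by
  have h := hA.altSum_eq hx hy (by norm_num)
  have h1 : ‖altSum mul x y‖ ≤ ‖x‖ + ‖x‖ * (‖y‖ * ‖altSum mul x y‖) := by
    conv_lhs => rw [h]
    exact (norm_add_le _ _).trans (add_le_add le_rfl (hA.norm_mul_mul_le _ _ _))
  have h2 : ‖x‖ * (‖y‖ * ‖altSum mul x y‖) ≤ 1 / 2 * (1 / 2 * ‖altSum mul x y‖) := by gcongr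
  nlinarith [norm_nonneg x]

lemma norm_altSum_sub_le {x y x' y' : H} (hx : ‖x‖ ≤ 1 / 2) (hy : ‖y‖ ≤ 1 / 2)
    (hx' : ‖x'‖ ≤ 1 / 2) (hy' : ‖y'‖ ≤ 1 / 2) :
    ‖altSum mul x y - altSum mul x' y'‖ ≤ 2 * (‖x - x'‖ + ‖y - y'‖) := by
  set S := altSum mul x y with hS
  set S' := altSum mul x' y' with hS'
  have e : S - S' = (x - x') + mul (x - x') (mul y S) + mul x' (mul (y - y') S)
      + mul x' (mul y' (S - S')) := by
    have h := hA.altSum_eq hx hy (by norm_num)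
    have h' := hA.altSum_eq hx' hy' (by norm_num)
    rw [← hS] at h
    rw [← hS'] at h'
    conv_lhs => rw [h, h']
    simp only [map_sub, sub_apply]
    abel
  have hSn : ‖S‖ ≤ 1 := (hA.norm_altSum_le hx hy).trans (by linarith)
  have b1 : ‖mul (x - x') (mul y S)‖ ≤ ‖x - x'‖ * (1 / 2 * 1) :=
    (hA.norm_mul_mul_le _ _ _).trans (by gcongr)
  have b2 : ‖mul x' (mul (y - y') S)‖ ≤ 1 / 2 * (‖y - y'‖ * 1) :=
    (hA.norm_mul_mul_le _ _ _).trans (by gcongr)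
  have b3 : ‖mul x' (mul y' (S - S'))‖ ≤ 1 / 2 * (1 / 2 * ‖S - S'‖) :=
    (hA.norm_mul_mul_le _ _ _).trans (by gcongr)
  have h1 : ‖S - S'‖ ≤ ‖x - x'‖ + ‖x - x'‖ * (1 / 2 * 1) + 1 / 2 * (‖y - y'‖ * 1)
      + 1 / 2 * (1 / 2 * ‖S - S'‖) := by
    conv_lhs => rw [e]
    exact (norm_add_le _ _).trans (add_le_add ((norm_add_le _ _).trans
      (add_le_add ((norm_add_le _ _).trans (add_le_add le_rfl b1)) b2)) b3)
  nlinarith [norm_nonneg (x - x'), norm_nonneg (y - y')]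

lemma hasDerivAt_logDet [NormedSpace ℝ H] [IsScalarTower ℝ ℂ H]
    {x y x' y' : ℝ → H} {I : Set ℝ} (hI : IsOpen I) (hI' : IsPreconnected I)
    {r C : ℝ} (hr : r < 1) (hx : ∀ t ∈ I, HasDerivAt x (x' t) t)
    (hy : ∀ t ∈ I, HasDerivAt y (y' t) t) (hxr : ∀ t ∈ I, ‖x t‖ ≤ r) (hyr : ∀ t ∈ I, ‖y t‖ ≤ r)
    (hxC : ∀ t ∈ I, ‖x' t‖ ≤ C) (hyC : ∀ t ∈ I, ‖y' t‖ ≤ C) {t : ℝ} (ht : t ∈ I) :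
    HasDerivAt (fun t => logDet mul tr (x t) (y t))
      (tr (x' t) (altSum mul (y t) (x t)) + tr (altSum mul (x t) (y t)) (y' t)) t := by
  have h0 : 0 ≤ r := (norm_nonneg _).trans (hxr t ht)
  have hC : 0 ≤ C := (norm_nonneg _).trans (hxC t ht)
  have key := hasDerivAt_tsum_of_isPreconnected (u := fun m : ℕ => (2 * C * r) * (r ^ 2) ^ m)
    (g := fun (m : ℕ) t => ((m : ℂ) + 1)⁻¹ * tr (alt mul (x t) (y t) m) (y t))
    (g' := fun m t => tr (x' t) (alt mul (y t) (x t) m) + tr (alt mul (x t) (y t) m) (y' t))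
    (t := I) (y₀ := t) (y := t)
    ((summable_geometric_of_lt_one (by positivity) (by nlinarith)).mul_left _) hI hI'
    (fun m s hs => hA.hasDerivAt_tr_alt (hx s hs) (hy s hs) m) ?_ ht
    (hA.summable_logDet (hxr t ht) (hyr t ht) hr).of_norm ht
  · refine key.congr_deriv ?_
    have hs := hA.summable_alt (hxr t ht) (hyr t ht) hr
    have hs' := hA.summable_alt (hyr t ht) (hxr t ht) hr
    have e1 : tr (x' t) (altSum mul (y t) (x t)) = ∑' m, tr (x' t) (alt mul (y t) (x t) m) := by
      rw [altSum, ContinuousLinearMap.map_tsum _ hs']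
    have e2 : tr (altSum mul (x t) (y t)) (y' t) = ∑' m, tr (alt mul (x t) (y t) m) (y' t) := by
      change tr.flip (y' t) _ = _
      rw [altSum, ContinuousLinearMap.map_tsum _ hs]
      rfl
    rw [e1, e2]
    exact Summable.tsum_add ((tr (x' t)).summable hs') ((tr.flip (y' t)).summable hs)
  · intro m s hs
    have b1 : ‖tr (x' s) (alt mul (y s) (x s) m)‖ ≤ C * (r * (r ^ 2) ^ m) :=
      (hA.norm_tr _ _).trans (mul_le_mul (hxC s hs) (hA.norm_alt_le' (hyr s hs) (hxr s hs) m)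
        (norm_nonneg _) hC)
    have b2 : ‖tr (alt mul (x s) (y s) m) (y' s)‖ ≤ (r * (r ^ 2) ^ m) * C :=
      (hA.norm_tr _ _).trans (mul_le_mul (hA.norm_alt_le' (hxr s hs) (hyr s hs) m) (hyC s hs)
        (norm_nonneg _) (by positivity))
    exact (norm_add_le _ _).trans ((add_le_add b1 b2).trans (le_of_eq (by ring)))

end IsTraceAlgebra

end TraceAlgebra

end

end AKNS

namespace AKNS

noncomputable section

open scoped ENNReal NNReal

/-! ### Weighted `L²` spaces -/

/-- `μ` has the positive finite density `ρ` with respect to Lebesgue measure. -/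
structure IsWeighted {α : Type*} [MeasureSpace α] (μ : Measure α) (ρ : α → ℝ≥0∞) : Prop where
  meas : Measurable ρ
  ne_zero : ∀ x, ρ x ≠ 0
  ne_top : ∀ x, ρ x ≠ ⊤
  eq : μ = volume.withDensity ρ

namespace IsWeighted

variable {α : Type*} [MeasureSpace α] {μ : Measure α} {ρ : α → ℝ≥0∞} (h : IsWeighted μ ρ)
include h

lemma ac : μ ≪ volume := by rw [h.eq]; exact withDensity_absolutelyContinuous _ _

lemma ac' : volume ≪ μ := by
  rw [h.eq]
  exact withDensity_absolutelyContinuous' h.meas.aemeasurable (.of_forall h.ne_zero)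

lemma ae_iff {p : α → Prop} : (∀ᵐ x ∂μ, p x) ↔ ∀ᵐ x, p x :=
  ⟨fun hp => h.ac'.ae_le hp, fun hp => h.ac.ae_le hp⟩

lemma ae_eq_iff {β : Type*} {f g : α → β} : f =ᵐ[μ] g ↔ f =ᵐ[volume] g := h.ae_iff

lemma eLpNorm_sq (f : α → ℂ) : eLpNorm f 2 μ ^ 2 = ∫⁻ x, ρ x * ‖f x‖ₑ ^ 2 := by
  rw [eLpNorm_eq_lintegral_rpow_enorm_toReal (by norm_num) (by norm_num), h.eq,
    lintegral_withDensity_eq_lintegral_mul_non_measurable _ h.meas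
      (.of_forall fun x => (h.ne_top x).lt_top)]
  simp only [ENNReal.toReal_ofNat, ENNReal.rpow_ofNat, Pi.mul_apply, one_div]
  rw [← ENNReal.rpow_natCast, ← ENNReal.rpow_mul]
  norm_num

lemma enorm_sq (f : Lp ℂ 2 μ) : ‖f‖ₑ ^ 2 = ∫⁻ x, ρ x * ‖f x‖ₑ ^ 2 := by
  rw [Lp.enorm_def, h.eLpNorm_sq]

lemma aesm {f : α → ℂ} (hf : AEStronglyMeasurable f) : AEStronglyMeasurable f μ :=
  hf.mono_ac h.ac

lemma eLpNorm_le {f : α → ℂ} {C : ℝ≥0∞} (hC : ∫⁻ x, ρ x * ‖f x‖ₑ ^ 2 ≤ C ^ 2) :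
    eLpNorm f 2 μ ≤ C := by
  rw [← h.eLpNorm_sq] at hC
  exact (ENNReal.pow_le_pow_left_iff two_ne_zero).1 hC

lemma memLp {f : α → ℂ} (hf : AEStronglyMeasurable f)
    (hfin : ∫⁻ x, ρ x * ‖f x‖ₑ ^ 2 < ⊤) : MemLp f 2 μ := by
  refine ⟨h.aesm hf, ?_⟩
  rw [← h.eLpNorm_sq] at hfin
  simpa using hfin

lemma lintegral_lt_top (f : Lp ℂ 2 μ) : ∫⁻ x, ρ x * ‖f x‖ₑ ^ 2 < ⊤ := by
  rw [← h.enorm_sq]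
  exact ENNReal.pow_lt_top enorm_lt_top

end IsWeighted

lemma sq_lintegral_mul_le {α : Type*} [MeasurableSpace α] {μ : Measure α} {f g : α → ℝ≥0∞}
    (hf : AEMeasurable f μ) (hg : AEMeasurable g μ) :
    (∫⁻ x, f x * g x ∂μ) ^ 2 ≤ (∫⁻ x, f x ^ 2 ∂μ) * ∫⁻ x, g x ^ 2 ∂μ := by
  have h := ENNReal.lintegral_mul_le_Lp_mul_Lq μ Real.HolderConjugate.two_two hf hg
  calc (∫⁻ x, f x * g x ∂μ) ^ 2 ≤ _ := pow_le_pow_left' h 2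
    _ = _ := by
      rw [mul_pow, ← ENNReal.rpow_natCast, ← ENNReal.rpow_mul, ← ENNReal.rpow_natCast,
        ← ENNReal.rpow_mul]
      norm_num

/-- A map on functions that induces a bounded linear operator between `L²` spaces. -/
structure IsL2Op (𝕜 : Type*) [RCLike 𝕜] [Module 𝕜 ℂ] {α β : Type*} [MeasurableSpace α]
    [MeasurableSpace β] (μ : Measure α) (ν : Measure β) (Φ : (α → ℂ) → β → ℂ) (C : ℝ≥0) :
    Prop where
  congr : ∀ f g, f =ᵐ[μ] g → Φ f =ᵐ[ν] Φ g
  meas : ∀ f : Lp ℂ 2 μ, AEStronglyMeasurable (Φ f) ν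
  bound : ∀ f : Lp ℂ 2 μ, eLpNorm (Φ f) 2 ν ≤ C * ‖f‖ₑ
  add : ∀ f g : Lp ℂ 2 μ, Φ (⇑f + ⇑g) =ᵐ[ν] Φ f + Φ g
  smul : ∀ (c : 𝕜) (f : Lp ℂ 2 μ), Φ (c • ⇑f) =ᵐ[ν] c • Φ f

namespace IsL2Op

variable {𝕜 : Type*} [RCLike 𝕜] [NormedSpace 𝕜 ℂ] {α β : Type*} [MeasurableSpace α]
  [MeasurableSpace β] {μ : Measure α} {ν : Measure β} {Φ : (α → ℂ) → β → ℂ} {C : ℝ≥0}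
  (h : IsL2Op 𝕜 μ ν Φ C)
include h

lemma memLp (f : Lp ℂ 2 μ) : MemLp (Φ f) 2 ν := by
  have := h.bound f
  exact ⟨h.meas f, this.trans_lt (ENNReal.mul_lt_top ENNReal.coe_lt_top enorm_lt_top)⟩

/-- The operator induced by a map on functions. -/
def toCLM : Lp ℂ 2 μ →L[𝕜] Lp ℂ 2 ν :=
  LinearMap.mkContinuous
    { toFun := fun f => (h.memLp f).toLp (Φ f)
      map_add' := fun f g => by
        rw [← MemLp.toLp_add]
        exact MemLp.toLp_congr _ _ ((h.congr _ _ (Lp.coeFn_add f g)).trans (h.add f g))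
      map_smul' := fun c f => by
        rw [RingHom.id_apply, ← MemLp.toLp_const_smul]
        exact MemLp.toLp_congr _ _ ((h.congr _ _ (Lp.coeFn_smul c f)).trans (h.smul c f)) } C
    fun f => by
      change ‖(h.memLp f).toLp (Φ f)‖ ≤ _
      rw [Lp.norm_toLp]
      have := ENNReal.toReal_mono (by finiteness) (h.bound f)
      rwa [ENNReal.toReal_mul, toReal_enorm, ENNReal.coe_toReal] at this

lemma coeFn (f : Lp ℂ 2 μ) : h.toCLM f =ᵐ[ν] Φ f := (h.memLp f).coeFn_toLp

lemma norm_le (f : Lp ℂ 2 μ) : ‖h.toCLM f‖ ≤ C * ‖f‖ := by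
  change ‖(h.memLp f).toLp (Φ f)‖ ≤ _
  rw [Lp.norm_toLp]
  have := ENNReal.toReal_mono (by finiteness) (h.bound f)
  rwa [ENNReal.toReal_mul, toReal_enorm, ENNReal.coe_toReal] at this

end IsL2Op

/-- Multiplication by a bounded measurable function on `L²`. -/
lemma isL2Op_mul {α : Type*} [MeasurableSpace α] {μ : Measure α} {m : α → ℂ} (hm : Measurable m)
    {C : ℝ≥0} (hC : ∀ x, ‖m x‖ₑ ≤ C) : IsL2Op ℂ μ μ (fun f x => m x * f x) C where
  congr f g hfg := by filter_upwards [hfg] with x hx; rw [hx]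
  meas f := (hm.aestronglyMeasurable).mul (Lp.aestronglyMeasurable f)
  bound f := by
    rw [Lp.enorm_def]
    refine eLpNorm_le_nnreal_smul_eLpNorm_of_ae_le_mul (.of_forall fun x => ?_) 2
    have := hC x
    rw [← ENNReal.coe_le_coe, ENNReal.coe_mul]
    change ‖m x * f x‖ₑ ≤ C * ‖f x‖ₑ
    rw [enorm_mul]
    gcongr
  add f g := .of_forall fun x => mul_add _ _ _
  smul c f := .of_forall fun x => by simp only [Pi.smul_apply, smul_eq_mul]; ring

/-! ### Composition of integral kernels -/

/-- The composition of two kernels. -/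
def kcomp (f g : ℝ × ℝ → ℂ) (p : ℝ × ℝ) : ℂ := ∫ ζ, f (p.1, ζ) * g (ζ, p.2)

/-- The composition of two nonnegative kernels. -/
def acomp (F G : ℝ × ℝ → ℝ≥0∞) (p : ℝ × ℝ) : ℝ≥0∞ := ∫⁻ ζ, F (p.1, ζ) * G (ζ, p.2)

/-- A submultiplicative weight for kernels. -/
structure IsKernelWeight (τ : ℝ × ℝ → ℝ≥0∞) : Prop where
  meas : Measurable τ
  one_le : ∀ p, 1 ≤ τ p
  ne_top : ∀ p, τ p ≠ ⊤
  submul : ∀ x y z, τ (x, z) ≤ τ (x, y) * τ (y, z)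

/-- The measure with density `τ ^ 2`. -/
def kmeas (τ : ℝ × ℝ → ℝ≥0∞) : Measure (ℝ × ℝ) := volume.withDensity fun p => τ p ^ 2

lemma measurable_acomp {F G : ℝ × ℝ → ℝ≥0∞} (hF : Measurable F) (hG : Measurable G) :
    Measurable (acomp F G) := by
  unfold acomp
  refine Measurable.lintegral_prod_right' (f := fun q : (ℝ × ℝ) × ℝ => F (q.1.1, q.2) * G (q.2, q.1.2)) ?_
  fun_prop

lemma stronglyMeasurable_kcomp {f g : ℝ × ℝ → ℂ} (hf : StronglyMeasurable f)
    (hg : StronglyMeasurable g) : StronglyMeasurable (kcomp f g) := by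
  unfold kcomp
  refine StronglyMeasurable.integral_prod_right'
    (f := fun q : (ℝ × ℝ) × ℝ => f (q.1.1, q.2) * g (q.2, q.1.2)) ?_
  exact (hf.comp_measurable (by fun_prop)).mul (hg.comp_measurable (by fun_prop))

lemma enorm_kcomp_le (f g : ℝ × ℝ → ℂ) (p : ℝ × ℝ) :
    ‖kcomp f g p‖ₑ ≤ acomp (fun q => ‖f q‖ₑ) (fun q => ‖g q‖ₑ) p := by
  unfold kcomp acomp
  refine (enorm_integral_le_lintegral_enorm _).trans (le_of_eq ?_)
  simp only [enorm_mul]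

lemma ae_prod_fst {p : ℝ → Prop} (h : ∀ᵐ x, p x) : ∀ᵐ q : ℝ × ℝ, p q.1 :=
  (Measure.quasiMeasurePreserving_fst (μ := (volume : Measure ℝ)) (ν := (volume : Measure ℝ))).ae h

lemma ae_prod_snd {p : ℝ → Prop} (h : ∀ᵐ x, p x) : ∀ᵐ q : ℝ × ℝ, p q.2 :=
  (Measure.quasiMeasurePreserving_snd (μ := (volume : Measure ℝ)) (ν := (volume : Measure ℝ))).ae h

lemma ae_swap {p : ℝ × ℝ → Prop} (h : ∀ᵐ q, p q) : ∀ᵐ q : ℝ × ℝ, p q.swap :=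
  (Measure.measurePreserving_swap (μ := (volume : Measure ℝ))
    (ν := (volume : Measure ℝ))).quasiMeasurePreserving.ae h

lemma ae_sections {p : ℝ × ℝ → Prop} (h : ∀ᵐ q, p q) :
    ∀ᵐ q : ℝ × ℝ, (∀ᵐ ζ, p (q.1, ζ)) ∧ ∀ᵐ ζ, p (ζ, q.2) := by
  have h1 : ∀ᵐ x : ℝ, ∀ᵐ ζ : ℝ, p (x, ζ) := Measure.ae_ae_of_ae_prod h
  have h2 : ∀ᵐ y : ℝ, ∀ᵐ ζ : ℝ, p (ζ, y) := Measure.ae_ae_of_ae_prod (ae_swap h)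
  filter_upwards [ae_prod_fst h1, ae_prod_snd h2] with q hq1 hq2 using ⟨hq1, hq2⟩

lemma kcomp_congr {f f' g g' : ℝ × ℝ → ℂ} (hf : f =ᵐ[volume] f') (hg : g =ᵐ[volume] g') :
    kcomp f g =ᵐ[volume] kcomp f' g' := by
  filter_upwards [ae_sections hf, ae_sections hg] with p hp hp'
  refine integral_congr_ae ?_
  filter_upwards [hp.1, hp'.2] with ζ h1 h2
  rw [h1, h2]

namespace IsKernelWeight

variable {τ : ℝ × ℝ → ℝ≥0∞} (hτ : IsKernelWeight τ)
include hτ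

lemma isWeighted : IsWeighted (kmeas τ) (fun p => τ p ^ 2) where
  meas := hτ.meas.pow_const 2
  ne_zero p := by
    have := hτ.one_le p
    exact pow_ne_zero 2 (zero_lt_one.trans_le this).ne'
  ne_top p := ENNReal.pow_ne_top (hτ.ne_top p)
  eq := rfl

lemma lintegral_acomp_le {F G : ℝ × ℝ → ℝ≥0∞} (hF : Measurable F) (hG : Measurable G) :
    ∫⁻ p, τ p ^ 2 * acomp F G p ^ 2 ≤ (∫⁻ p, τ p ^ 2 * F p ^ 2) * ∫⁻ p, τ p ^ 2 * G p ^ 2 := by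
  have hm := hτ.meas
  have key : ∀ p : ℝ × ℝ, τ p ^ 2 * acomp F G p ^ 2 ≤
      (∫⁻ ζ, τ (p.1, ζ) ^ 2 * F (p.1, ζ) ^ 2) * ∫⁻ ζ, τ (ζ, p.2) ^ 2 * G (ζ, p.2) ^ 2 := by
    intro p
    rw [← mul_pow]
    have h1 : τ p * acomp F G p ≤
        ∫⁻ ζ, (τ (p.1, ζ) * F (p.1, ζ)) * (τ (ζ, p.2) * G (ζ, p.2)) := by
      unfold acomp
      rw [← lintegral_const_mul _ (by fun_prop)]
      refine lintegral_mono fun ζ => ?_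
      calc τ p * (F (p.1, ζ) * G (ζ, p.2))
          ≤ (τ (p.1, ζ) * τ (ζ, p.2)) * (F (p.1, ζ) * G (ζ, p.2)) := by
            gcongr; exact hτ.submul p.1 ζ p.2
        _ = _ := by ring
    refine (pow_le_pow_left' h1 2).trans ((sq_lintegral_mul_le ?_ ?_).trans (le_of_eq ?_))
    · fun_prop
    · fun_prop
    · simp only [mul_pow]
  refine (lintegral_mono key).trans (le_of_eq ?_)
  change ∫⁻ p, _ ∂(volume.prod volume) = _
  rw [lintegral_prod_mul (f := fun x => ∫⁻ ζ, τ (x, ζ) ^ 2 * F (x, ζ) ^ 2)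
    (g := fun y => ∫⁻ ζ, τ (ζ, y) ^ 2 * G (ζ, y) ^ 2)]
  · congr 1
    · exact (lintegral_prod (fun q : ℝ × ℝ => τ q ^ 2 * F q ^ 2) (by fun_prop)).symm
    · exact (lintegral_prod_symm' (fun q : ℝ × ℝ => τ q ^ 2 * G q ^ 2) (by fun_prop)).symm
  · exact (Measurable.lintegral_prod_right' (f := fun q : ℝ × ℝ => τ q ^ 2 * F q ^ 2)
      (by fun_prop)).aemeasurable
  · exact (Measurable.lintegral_prod_right' (f := fun q : ℝ × ℝ => τ q.swap ^ 2 * G q.swap ^ 2)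
      (by fun_prop)).aemeasurable

/-- The absolute value of a square integrable kernel, with its norm. -/
lemma abs_lt_top (f : Lp ℂ 2 (kmeas τ)) : ∫⁻ p, τ p ^ 2 * ‖f p‖ₑ ^ 2 < ⊤ :=
  hτ.isWeighted.lintegral_lt_top f

lemma ae_lt_top_of_lintegral {F : ℝ × ℝ → ℝ≥0∞} (hF : Measurable F)
    (h : ∫⁻ p, τ p ^ 2 * F p ^ 2 < ⊤) : ∀ᵐ p, F p < ⊤ := by
  have hm := hτ.meas
  filter_upwards [MeasureTheory.ae_lt_top (by fun_prop) h.ne] with p hp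
  by_contra hc
  rw [not_lt, top_le_iff] at hc
  rw [hc] at hp
  have h1 : τ p ^ 2 ≠ 0 := hτ.isWeighted.ne_zero p
  simp [ENNReal.mul_top, h1] at hp

omit hτ in
lemma measurable_enorm_coe (f : Lp ℂ 2 (kmeas τ)) : Measurable fun p => ‖f p‖ₑ :=
  (Lp.stronglyMeasurable f).enorm

lemma lintegral_acomp_lt_top {F G : ℝ × ℝ → ℝ≥0∞} (hF : Measurable F) (hG : Measurable G)
    (h1 : ∫⁻ p, τ p ^ 2 * F p ^ 2 < ⊤) (h2 : ∫⁻ p, τ p ^ 2 * G p ^ 2 < ⊤) :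
    ∫⁻ p, τ p ^ 2 * acomp F G p ^ 2 < ⊤ :=
  (hτ.lintegral_acomp_le hF hG).trans_lt (ENNReal.mul_lt_top h1 h2)

lemma ae_integrable_mul (f g : Lp ℂ 2 (kmeas τ)) :
    ∀ᵐ p : ℝ × ℝ, Integrable fun ζ => f (p.1, ζ) * g (ζ, p.2) := by
  have mf := measurable_enorm_coe f
  have mg := measurable_enorm_coe g
  have h := hτ.lintegral_acomp_lt_top mf mg (hτ.abs_lt_top f) (hτ.abs_lt_top g)
  filter_upwards [hτ.ae_lt_top_of_lintegral (measurable_acomp mf mg) h] with p hp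
  refine ⟨((Lp.stronglyMeasurable f).comp_measurable (by fun_prop)).mul
    ((Lp.stronglyMeasurable g).comp_measurable (by fun_prop)) |>.aestronglyMeasurable, ?_⟩
  rw [HasFiniteIntegral]
  simpa only [enorm_mul, acomp] using hp

lemma eLpNorm_kcomp_le (f g : Lp ℂ 2 (kmeas τ)) :
    eLpNorm (kcomp f g) 2 (kmeas τ) ≤ ‖f‖ₑ * ‖g‖ₑ := by
  refine hτ.isWeighted.eLpNorm_le ?_
  rw [mul_pow, hτ.isWeighted.enorm_sq, hτ.isWeighted.enorm_sq]
  refine le_trans (lintegral_mono fun p => ?_)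
    (hτ.lintegral_acomp_le (measurable_enorm_coe f) (measurable_enorm_coe g))
  gcongr
  exact enorm_kcomp_le _ _ _

lemma kcomp_add_right (f g g' : Lp ℂ 2 (kmeas τ)) :
    kcomp f (⇑g + ⇑g') =ᵐ[volume] kcomp f g + kcomp f g' := by
  filter_upwards [hτ.ae_integrable_mul f g, hτ.ae_integrable_mul f g'] with p h1 h2
  simp only [kcomp, Pi.add_apply, mul_add]
  exact integral_add h1 h2

lemma kcomp_add_left (f f' g : Lp ℂ 2 (kmeas τ)) :
    kcomp (⇑f + ⇑f') g =ᵐ[volume] kcomp f g + kcomp f' g := by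
  filter_upwards [hτ.ae_integrable_mul f g, hτ.ae_integrable_mul f' g] with p h1 h2
  simp only [kcomp, Pi.add_apply, add_mul]
  exact integral_add h1 h2

omit hτ in
lemma kcomp_smul_right (c : ℂ) (f g : ℝ × ℝ → ℂ) : kcomp f (c • g) = c • kcomp f g := by
  ext p
  simp only [kcomp, Pi.smul_apply, smul_eq_mul, ← integral_const_mul]
  congr 1; ext ζ; ring

omit hτ in
lemma kcomp_smul_left (c : ℂ) (f g : ℝ × ℝ → ℂ) : kcomp (c • f) g = c • kcomp f g := by
  ext p
  simp only [kcomp, Pi.smul_apply, smul_eq_mul, ← integral_const_mul]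
  congr 1; ext ζ; ring

lemma isL2Op_kcomp (f : Lp ℂ 2 (kmeas τ)) :
    IsL2Op ℂ (kmeas τ) (kmeas τ) (fun g => kcomp f g) ‖f‖₊ where
  congr g g' h := hτ.isWeighted.ae_eq_iff.2
    (kcomp_congr Filter.EventuallyEq.rfl (hτ.isWeighted.ae_eq_iff.1 h))
  meas g := (stronglyMeasurable_kcomp (Lp.stronglyMeasurable f)
    (Lp.stronglyMeasurable g)).aestronglyMeasurable
  bound g := hτ.eLpNorm_kcomp_le f g
  add g g' := hτ.isWeighted.ae_eq_iff.2 (hτ.kcomp_add_right f g g')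
  smul c g := .of_forall fun p => by rw [kcomp_smul_right]

/-- Composition of square integrable kernels. -/
def mul : Lp ℂ 2 (kmeas τ) →L[ℂ] Lp ℂ 2 (kmeas τ) →L[ℂ] Lp ℂ 2 (kmeas τ) :=
  LinearMap.mkContinuous
    { toFun := fun f => (hτ.isL2Op_kcomp f).toCLM
      map_add' := fun f f' => by
        ext1 g
        refine Lp.ext (hτ.isWeighted.ae_eq_iff.2 ?_)
        have h := fun f => hτ.isWeighted.ae_eq_iff.1 ((hτ.isL2Op_kcomp f).coeFn g)
        refine (h _).trans ?_
        refine (kcomp_congr (hτ.isWeighted.ae_eq_iff.1 (Lp.coeFn_add f f'))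
          Filter.EventuallyEq.rfl).trans ((hτ.kcomp_add_left f f' g).trans ?_)
        refine Filter.EventuallyEq.trans ?_ (hτ.isWeighted.ae_eq_iff.1 (Lp.coeFn_add _ _)).symm
        exact ((h f).add (h f')).symm
      map_smul' := fun c f => by
        ext1 g
        refine Lp.ext (hτ.isWeighted.ae_eq_iff.2 ?_)
        have h := fun f => hτ.isWeighted.ae_eq_iff.1 ((hτ.isL2Op_kcomp f).coeFn g)
        refine (h _).trans ?_
        refine (kcomp_congr (hτ.isWeighted.ae_eq_iff.1 (Lp.coeFn_smul c f))
          Filter.EventuallyEq.rfl).trans ?_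
        rw [kcomp_smul_left]
        refine Filter.EventuallyEq.trans ?_ (hτ.isWeighted.ae_eq_iff.1 (Lp.coeFn_smul _ _)).symm
        exact ((h f).const_smul c).symm } 1
    fun f => by
      rw [one_mul]
      exact ContinuousLinearMap.opNorm_le_bound _ (norm_nonneg _) fun g =>
        (hτ.isL2Op_kcomp f).norm_le g

lemma coeFn_mul (f g : Lp ℂ 2 (kmeas τ)) : hτ.mul f g =ᵐ[volume] kcomp f g :=
  hτ.isWeighted.ae_eq_iff.1 ((hτ.isL2Op_kcomp f).coeFn g)

lemma mul_assoc (f g k : Lp ℂ 2 (kmeas τ)) : hτ.mul (hτ.mul f g) k = hτ.mul f (hτ.mul g k) := by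
  refine Lp.ext (hτ.isWeighted.ae_eq_iff.2 ?_)
  refine (hτ.coeFn_mul _ _).trans ((kcomp_congr (hτ.coeFn_mul _ _)
    Filter.EventuallyEq.rfl).trans ?_)
  refine Filter.EventuallyEq.trans ?_ (((hτ.coeFn_mul _ _).trans (kcomp_congr
    Filter.EventuallyEq.rfl (hτ.coeFn_mul _ _))).symm)
  have mf := measurable_enorm_coe f
  have mg := measurable_enorm_coe g
  have mk := measurable_enorm_coe k
  have h := hτ.lintegral_acomp_lt_top mf (measurable_acomp mg mk) (hτ.abs_lt_top f)
    (hτ.lintegral_acomp_lt_top mg mk (hτ.abs_lt_top g) (hτ.abs_lt_top k))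
  filter_upwards [hτ.ae_lt_top_of_lintegral (measurable_acomp mf (measurable_acomp mg mk)) h]
    with p hp
  simp only [kcomp, ← integral_mul_const, ← integral_const_mul]
  rw [integral_integral_swap]
  · simp only [_root_.mul_assoc]
  · have hm : StronglyMeasurable (Function.uncurry fun ζ' ζ : ℝ =>
        f (p.1, ζ) * g (ζ, ζ') * k (ζ', p.2)) :=
      (((Lp.stronglyMeasurable f).comp_measurable (by fun_prop)).mul
        ((Lp.stronglyMeasurable g).comp_measurable (by fun_prop))).mul
        ((Lp.stronglyMeasurable k).comp_measurable (by fun_prop))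
    refine ⟨hm.aestronglyMeasurable, ?_⟩
    rw [HasFiniteIntegral, lintegral_prod_symm' _ hm.enorm]
    refine lt_of_eq_of_lt ?_ hp
    unfold acomp
    refine lintegral_congr fun ζ => ?_
    rw [← lintegral_const_mul _ (by fun_prop)]
    refine lintegral_congr fun ζ' => ?_
    simp only [Function.uncurry_apply_pair, enorm_mul, _root_.mul_assoc]

lemma lintegral_mul_swap_le {F G : ℝ × ℝ → ℝ≥0∞} (hF : Measurable F) (hG : Measurable G) :
    (∫⁻ p, F p * G p.swap) ^ 2 ≤ (∫⁻ p, τ p ^ 2 * F p ^ 2) * ∫⁻ p, τ p ^ 2 * G p ^ 2 := by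
  refine (sq_lintegral_mul_le hF.aemeasurable (hG.comp measurable_swap).aemeasurable).trans ?_
  have h1 : ∀ p, 1 ≤ τ p ^ 2 := fun p => one_le_pow₀ (hτ.one_le p)
  refine mul_le_mul' (lintegral_mono fun p => le_mul_of_one_le_left' (h1 p)) ?_
  have e : ∫⁻ p : ℝ × ℝ, G p.swap ^ 2 = ∫⁻ p, G p ^ 2 :=
    (Measure.measurePreserving_swap (μ := (volume : Measure ℝ))
      (ν := (volume : Measure ℝ))).lintegral_comp (f := fun p => G p ^ 2) (hG.pow_const 2)
  change ∫⁻ p : ℝ × ℝ, G p.swap ^ 2 ≤ _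
  rw [e]
  exact lintegral_mono fun p => le_mul_of_one_le_left' (h1 p)

lemma lintegral_tr_le (f g : Lp ℂ 2 (kmeas τ)) :
    ∫⁻ p, ‖f p * g p.swap‖ₑ ≤ ‖f‖ₑ * ‖g‖ₑ := by
  refine (ENNReal.pow_le_pow_left_iff two_ne_zero).1 ?_
  rw [mul_pow, hτ.isWeighted.enorm_sq, hτ.isWeighted.enorm_sq]
  simp only [enorm_mul]
  exact hτ.lintegral_mul_swap_le (measurable_enorm_coe f) (measurable_enorm_coe g)

lemma integrable_tr (f g : Lp ℂ 2 (kmeas τ)) : Integrable fun p => f p * g p.swap := by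
  refine ⟨((Lp.stronglyMeasurable f).mul ((Lp.stronglyMeasurable g).comp_measurable
    measurable_swap)).aestronglyMeasurable, ?_⟩
  exact (hτ.lintegral_tr_le f g).trans_lt (ENNReal.mul_lt_top enorm_lt_top enorm_lt_top)

lemma coeFn_add_vol (f g : Lp ℂ 2 (kmeas τ)) : ⇑(f + g) =ᵐ[volume] ⇑f + ⇑g :=
  hτ.isWeighted.ae_eq_iff.1 (Lp.coeFn_add f g)

lemma coeFn_smul_vol (c : ℂ) (f : Lp ℂ 2 (kmeas τ)) : ⇑(c • f) =ᵐ[volume] c • ⇑f :=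
  hτ.isWeighted.ae_eq_iff.1 (Lp.coeFn_smul c f)

/-- The trace of the composition of two square integrable kernels. -/
def tr : Lp ℂ 2 (kmeas τ) →L[ℂ] Lp ℂ 2 (kmeas τ) →L[ℂ] ℂ :=
  LinearMap.mkContinuous₂ (LinearMap.mk₂ ℂ (fun f g => ∫ p, f p * g p.swap)
    (fun f f' g => by
      rw [← integral_add (hτ.integrable_tr f g) (hτ.integrable_tr f' g)]
      refine integral_congr_ae ?_
      filter_upwards [hτ.coeFn_add_vol f f'] with p hp
      rw [hp, Pi.add_apply, add_mul])
    (fun c f g => by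
      rw [smul_eq_mul, ← integral_const_mul]
      refine integral_congr_ae ?_
      filter_upwards [hτ.coeFn_smul_vol c f] with p hp
      rw [hp, Pi.smul_apply, smul_eq_mul, _root_.mul_assoc])
    (fun f g g' => by
      rw [← integral_add (hτ.integrable_tr f g) (hτ.integrable_tr f g')]
      refine integral_congr_ae ?_
      filter_upwards [ae_swap (hτ.coeFn_add_vol g g')] with p hp
      rw [hp, Pi.add_apply, mul_add])
    (fun c f g => by
      rw [smul_eq_mul, ← integral_const_mul]
      refine integral_congr_ae ?_
      filter_upwards [ae_swap (hτ.coeFn_smul_vol c g)] with p hp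
      rw [hp, Pi.smul_apply, smul_eq_mul]
      ring)) 1 fun f g => by
    rw [one_mul]
    change ‖∫ p, f p * g p.swap‖ ≤ _
    have h := (enorm_integral_le_lintegral_enorm _).trans (hτ.lintegral_tr_le f g)
    have := ENNReal.toReal_mono (by finiteness) h
    rwa [ENNReal.toReal_mul, toReal_enorm, toReal_enorm, toReal_enorm] at this

lemma tr_apply (f g : Lp ℂ 2 (kmeas τ)) : hτ.tr f g = ∫ p, f p * g p.swap := rfl

lemma tr_assoc (f g k : Lp ℂ 2 (kmeas τ)) : hτ.tr (hτ.mul f g) k = hτ.tr f (hτ.mul g k) := by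
  have mf := measurable_enorm_coe f
  have mg := measurable_enorm_coe g
  have mk := measurable_enorm_coe k
  have e1 : hτ.tr (hτ.mul f g) k =
      ∫ ξ, ∫ η, ∫ ζ, f (ξ, ζ) * g (ζ, η) * k (η, ξ) := by
    rw [tr_apply]
    have : ∫ p, hτ.mul f g p * k p.swap = ∫ p : ℝ × ℝ, kcomp f g p * k p.swap := by
      refine integral_congr_ae ?_
      filter_upwards [hτ.coeFn_mul f g] with p hp
      rw [hp]
    rw [this]
    change ∫ p, _ ∂(volume.prod volume) = _
    rw [integral_prod]
    · simp only [kcomp, ← integral_mul_const, Prod.swap_prod_mk]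
    · refine (hτ.integrable_tr (hτ.mul f g) k).congr ?_
      filter_upwards [hτ.coeFn_mul f g] with p hp
      rw [hp]
  have e2 : hτ.tr f (hτ.mul g k) =
      ∫ ξ, ∫ ζ, ∫ η, f (ξ, ζ) * g (ζ, η) * k (η, ξ) := by
    rw [tr_apply]
    have : ∫ p, f p * hτ.mul g k p.swap = ∫ p : ℝ × ℝ, f p * kcomp g k p.swap := by
      refine integral_congr_ae ?_
      filter_upwards [ae_swap (hτ.coeFn_mul g k)] with p hp
      rw [hp]
    rw [this]
    change ∫ p, _ ∂(volume.prod volume) = _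
    rw [integral_prod]
    · simp only [kcomp, ← integral_const_mul, Prod.swap_prod_mk, _root_.mul_assoc]
    · refine (hτ.integrable_tr f (hτ.mul g k)).congr ?_
      filter_upwards [ae_swap (hτ.coeFn_mul g k)] with p hp
      rw [hp]
  rw [e1, e2]
  have hfin : ∫⁻ p : ℝ × ℝ, ‖f p‖ₑ * acomp (fun q => ‖g q‖ₑ) (fun q => ‖k q‖ₑ) p.swap < ⊤ := by
    have h := hτ.lintegral_mul_swap_le mf (measurable_acomp mg mk)
    have h2 := h.trans_lt (ENNReal.mul_lt_top (hτ.abs_lt_top f)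
      (hτ.lintegral_acomp_lt_top mg mk (hτ.abs_lt_top g) (hτ.abs_lt_top k)))
    simpa using h2
  have mc := measurable_acomp mg mk
  change ∫⁻ p, _ ∂(volume.prod volume) < ⊤ at hfin
  rw [lintegral_prod _ (by fun_prop)] at hfin
  have hae := MeasureTheory.ae_lt_top (by
    exact Measurable.lintegral_prod_right' (f := fun q : ℝ × ℝ => ‖f q‖ₑ *
      acomp (fun q => ‖g q‖ₑ) (fun q => ‖k q‖ₑ) q.swap) (by fun_prop)) hfin.ne
  refine integral_congr_ae ?_
  filter_upwards [hae] with ξ hξ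
  rw [integral_integral_swap]
  have hm : StronglyMeasurable (Function.uncurry fun η ζ : ℝ =>
        f (ξ, ζ) * g (ζ, η) * k (η, ξ)) :=
      (((Lp.stronglyMeasurable f).comp_measurable (by fun_prop)).mul
        ((Lp.stronglyMeasurable g).comp_measurable (by fun_prop))).mul
        ((Lp.stronglyMeasurable k).comp_measurable (by fun_prop))
  refine ⟨hm.aestronglyMeasurable, ?_⟩
  rw [HasFiniteIntegral, lintegral_prod_symm' _ hm.enorm]
  refine lt_of_eq_of_lt ?_ hξ
  unfold acomp
  refine lintegral_congr fun ζ => ?_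
  rw [← lintegral_const_mul _ (by fun_prop)]
  refine lintegral_congr fun ζ' => ?_
  simp only [Function.uncurry_apply_pair, enorm_mul, _root_.mul_assoc, Prod.swap_prod_mk]

lemma tr_comm (f g : Lp ℂ 2 (kmeas τ)) : hτ.tr f g = hτ.tr g f := by
  rw [tr_apply, tr_apply]
  have := (Measure.measurePreserving_swap (μ := (volume : Measure ℝ))
    (ν := (volume : Measure ℝ))).integral_comp
    (MeasurableEquiv.prodComm (α := ℝ) (β := ℝ)).measurableEmbedding (fun p => f p * g p.swap)
  refine this.symm.trans (integral_congr_ae (.of_forall fun p => ?_))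
  simp only [Prod.swap_swap]
  exact mul_comm _ _

lemma isTraceAlgebra : IsTraceAlgebra hτ.mul hτ.tr where
  norm_mul f g := (hτ.isL2Op_kcomp f).norm_le g
  norm_tr f g := by
    rw [tr_apply]
    have h := (enorm_integral_le_lintegral_enorm _).trans (hτ.lintegral_tr_le f g)
    have := ENNReal.toReal_mono (by finiteness) h
    rwa [ENNReal.toReal_mul, toReal_enorm, toReal_enorm, toReal_enorm] at this
  assoc := hτ.mul_assoc
  tr_comm := hτ.tr_comm
  tr_assoc := hτ.tr_assoc

end IsKernelWeight

end

end AKNS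

namespace AKNS

noncomputable section

open scoped ENNReal NNReal

/-! ### The shear `(ξ, h) ↦ (ξ, ξ - h)` -/

/-- The measure preserving involution `(ξ, h) ↦ (ξ, ξ - h)`. -/
def shear (p : ℝ × ℝ) : ℝ × ℝ := (p.1, p.1 - p.2)

lemma measurable_shear : Measurable shear := by unfold shear; fun_prop

lemma shear_shear (p : ℝ × ℝ) : shear (shear p) = p := by simp [shear]

/-- The shear as a measurable equivalence. -/
def shearEquiv : (ℝ × ℝ) ≃ᵐ (ℝ × ℝ) where
  toFun := shear
  invFun := shear
  left_inv := shear_shear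
  right_inv := shear_shear
  measurable_toFun := measurable_shear
  measurable_invFun := measurable_shear

lemma measurePreserving_shear : MeasurePreserving shear := by
  have h1 : MeasurePreserving (fun p : ℝ × ℝ => (p.1, -p.2)) :=
    (MeasurePreserving.id (volume : Measure ℝ)).prod (Measure.measurePreserving_neg volume)
  have h2 : MeasurePreserving (fun p : ℝ × ℝ => (p.1, p.1 + p.2)) :=
    measurePreserving_prod_add (volume : Measure ℝ) (volume : Measure ℝ)
  have h := h2.comp h1
  have e : shear = (fun p : ℝ × ℝ => (p.1, p.1 + p.2)) ∘ fun p : ℝ × ℝ => (p.1, -p.2) := by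
    ext p <;> simp [shear, sub_eq_add_neg]
  rwa [e]

lemma ae_shear {p : ℝ × ℝ → Prop} (h : ∀ᵐ q, p q) : ∀ᵐ q, p (shear q) :=
  measurePreserving_shear.quasiMeasurePreserving.ae h

lemma lintegral_shear (F : ℝ × ℝ → ℝ≥0∞) : ∫⁻ p, F (shear p) = ∫⁻ p, F p :=
  measurePreserving_shear.lintegral_comp_emb shearEquiv.measurableEmbedding F

lemma integral_shear (F : ℝ × ℝ → ℂ) : ∫ p, F (shear p) = ∫ p, F p :=
  measurePreserving_shear.integral_comp shearEquiv.measurableEmbedding F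

lemma integrable_shear {F : ℝ × ℝ → ℂ} (h : Integrable F) : Integrable fun p => F (shear p) :=
  (measurePreserving_shear.integrable_comp_emb shearEquiv.measurableEmbedding).2 h

lemma ae_shear_sections {p : ℝ × ℝ → Prop} (h : ∀ᵐ q, p q) : ∀ᵐ k : ℝ, ∀ᵐ ξ : ℝ, p (ξ, ξ - k) :=
  Measure.ae_ae_of_ae_prod (ae_swap (ae_shear h))

lemma ae_diff {p : ℝ → Prop} (h : ∀ᵐ x, p x) : ∀ᵐ q : ℝ × ℝ, p (q.1 - q.2) :=
  ae_shear (p := fun q => p q.2) (ae_prod_snd h)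

/-! ### Japanese brackets -/

/-- The power `(1 + ξ²) ^ r`. -/
def jp (r ξ : ℝ) : ℝ := (1 + ξ ^ 2) ^ r

lemma jp_pos (r ξ : ℝ) : 0 < jp r ξ := Real.rpow_pos_of_pos (by positivity) r

lemma jp_add (r r' ξ : ℝ) : jp (r + r') ξ = jp r ξ * jp r' ξ := Real.rpow_add (by positivity) r r'

lemma jp_zero (ξ : ℝ) : jp 0 ξ = 1 := Real.rpow_zero _

lemma one_le_jp {r : ℝ} (hr : 0 ≤ r) (ξ : ℝ) : 1 ≤ jp r ξ :=
  Real.one_le_rpow (by nlinarith [sq_nonneg ξ]) hr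

lemma jp_le_one {r : ℝ} (hr : r ≤ 0) (ξ : ℝ) : jp r ξ ≤ 1 :=
  Real.rpow_le_one_of_one_le_of_nonpos (by nlinarith [sq_nonneg ξ]) hr

@[fun_prop]
lemma measurable_jp (r : ℝ) : Measurable (jp r) := by unfold jp; fun_prop

lemma integrable_jp {r : ℝ} (hr : 1 / 2 < r) : Integrable (jp (-r)) := by
  have h := integrable_rpow_neg_one_add_norm_sq (E := ℝ) (μ := volume) (r := 2 * r)
    (by simp; linarith)
  refine h.congr (.of_forall fun x => ?_)
  simp only [jp, Real.norm_eq_abs, sq_abs]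
  congr 1; ring

/-- The integral of `(1 + ξ²) ^ (-r)`. -/
def jpInt (r : ℝ) : ℝ≥0∞ := ∫⁻ ξ, ENNReal.ofReal (jp (-r) ξ)

lemma jpInt_lt_top {r : ℝ} (hr : 1 / 2 < r) : jpInt r < ⊤ :=
  (integrable_jp hr).lintegral_lt_top

lemma lintegral_jp_sub (r k : ℝ) : ∫⁻ ξ, ENNReal.ofReal (jp (-r) (ξ - k)) = jpInt r :=
  lintegral_sub_right_eq_self (fun ξ => ENNReal.ofReal (jp (-r) ξ)) k

lemma jp_mul_jp_le {α β : ℝ} (hα : 0 ≤ α) (hβ : 0 ≤ β) (x y : ℝ) :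
    jp (-α) x * jp (-β) y ≤ jp (-(α + β)) x + jp (-(α + β)) y := by
  have hx : (0 : ℝ) < 1 + x ^ 2 := by positivity
  have hy : (0 : ℝ) < 1 + y ^ 2 := by positivity
  rcases le_total (1 + x ^ 2) (1 + y ^ 2) with h | h
  · have h1 : jp (-β) y ≤ jp (-β) x := Real.rpow_le_rpow_of_nonpos hx h (by linarith)
    calc jp (-α) x * jp (-β) y ≤ jp (-α) x * jp (-β) x := by
          gcongr; exact (jp_pos _ _).le
      _ = jp (-(α + β)) x := by rw [← jp_add]; congr 1; ring
      _ ≤ _ := le_add_of_nonneg_right (jp_pos _ _).le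
  · have h1 : jp (-α) x ≤ jp (-α) y := Real.rpow_le_rpow_of_nonpos hy h (by linarith)
    calc jp (-α) x * jp (-β) y ≤ jp (-α) y * jp (-β) y := by
          gcongr; exact (jp_pos _ _).le
      _ = jp (-(α + β)) y := by rw [← jp_add]; congr 1; ring
      _ ≤ _ := le_add_of_nonneg_left (jp_pos _ _).le

lemma jp_le_of_half_le {s : ℝ} (hs : s ≤ 0) {x k : ℝ} (h : |k| / 2 ≤ |x|) :
    jp s x ≤ 4 ^ (-s) * (4 + k ^ 2) ^ s := by
  have h1 : (4 + k ^ 2) / 4 ≤ 1 + x ^ 2 := by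
    have : (|k| / 2) ^ 2 ≤ |x| ^ 2 := by gcongr
    rw [sq_abs, div_pow, sq_abs] at this
    linarith
  have h2 : jp s x ≤ ((4 + k ^ 2) / 4) ^ s :=
    Real.rpow_le_rpow_of_nonpos (by positivity) h1 hs
  refine h2.trans (le_of_eq ?_)
  rw [Real.div_rpow (by positivity) (by norm_num), Real.rpow_neg (by norm_num)]
  ring

lemma jp_conv_le {s p : ℝ} (hs : s ≤ 0) (hp : 0 ≤ p) (hps : 0 ≤ p + s) (ξ k : ℝ) :
    jp (-p) ξ * jp (-p) (ξ - k) ≤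
      4 ^ (-s) * (4 + k ^ 2) ^ s * (jp (-(2 * p + s)) ξ + jp (-(2 * p + s)) (ξ - k)) := by
  have e : 2 * p + s = p + (p + s) := by ring
  have e' : 2 * p + s = (p + s) + p := by ring
  have hor : |k| / 2 ≤ |ξ - k| ∨ |k| / 2 ≤ |ξ| := by
    by_contra hc
    push Not at hc
    have := abs_sub_abs_le_abs_sub k ξ
    rw [abs_sub_comm] at this
    linarith [hc.1, hc.2]
  have f : ∀ x, jp (-p) x = jp s x * jp (-(p + s)) x := fun x => by
    rw [← jp_add]; congr 1; ring
  rcases hor with h | h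
  · have h1 := jp_le_of_half_le hs h
    calc jp (-p) ξ * jp (-p) (ξ - k) = jp s (ξ - k) * (jp (-p) ξ * jp (-(p + s)) (ξ - k)) := by
          rw [f (ξ - k)]; ring
      _ ≤ _ := by
        rw [e]
        exact mul_le_mul h1 (jp_mul_jp_le hp hps _ _)
          (mul_pos (jp_pos _ _) (jp_pos _ _)).le (by positivity)
  · have h1 := jp_le_of_half_le hs h
    calc jp (-p) ξ * jp (-p) (ξ - k) = jp s ξ * (jp (-(p + s)) ξ * jp (-p) (ξ - k)) := by
          rw [f ξ]; ring
      _ ≤ _ := by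
        rw [e']
        exact mul_le_mul h1 (jp_mul_jp_le hps hp _ _)
          (mul_pos (jp_pos _ _) (jp_pos _ _)).le (by positivity)

/-- The constant in the bound for the convolution of two brackets. -/
def convConst (s p : ℝ) : ℝ≥0∞ := ENNReal.ofReal (4 ^ (-s)) * (2 * jpInt (2 * p + s))

lemma convConst_lt_top {s p : ℝ} (hps : 1 / 2 < 2 * p + s) : convConst s p < ⊤ :=
  ENNReal.mul_lt_top ENNReal.ofReal_lt_top (ENNReal.mul_lt_top (by simp) (jpInt_lt_top hps))

lemma lintegral_jp_conv_le {s p : ℝ} (hs : s ≤ 0) (hp : 0 ≤ p) (hps : 0 ≤ p + s) (k : ℝ) :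
    ∫⁻ ξ, ENNReal.ofReal (jp (-p) ξ * jp (-p) (ξ - k)) ≤
      convConst s p * ENNReal.ofReal ((4 + k ^ 2) ^ s) := by
  have h4 : (0 : ℝ) < 4 + k ^ 2 := by positivity
  calc ∫⁻ ξ, ENNReal.ofReal (jp (-p) ξ * jp (-p) (ξ - k))
      ≤ ∫⁻ ξ, ENNReal.ofReal (4 ^ (-s) * (4 + k ^ 2) ^ s) *
        (ENNReal.ofReal (jp (-(2 * p + s)) ξ) + ENNReal.ofReal (jp (-(2 * p + s)) (ξ - k))) := by
        refine lintegral_mono fun ξ => ?_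
        rw [← ENNReal.ofReal_add (jp_pos _ _).le (jp_pos _ _).le,
          ← ENNReal.ofReal_mul (by positivity)]
        exact ENNReal.ofReal_le_ofReal (jp_conv_le hs hp hps ξ k)
    _ = _ := by
        rw [lintegral_const_mul _ (by fun_prop), lintegral_add_left (by fun_prop),
          lintegral_jp_sub, convConst, ENNReal.ofReal_mul (by positivity)]
        change _ * (jpInt _ + _) = _
        ring

/-! ### Weights on the frequency line -/

/-- An even submultiplicative weight on the frequency line. -/
structure IsFreqWeight (ω : ℝ → ℝ) : Prop where
  meas : Measurable ω
  one_le : ∀ x, 1 ≤ ω x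
  even : ∀ x, ω (-x) = ω x
  submul : ∀ x y, ω (x + y) ≤ ω x * ω y

lemma isFreqWeight_one : IsFreqWeight fun _ => 1 :=
  ⟨measurable_const, fun _ => le_rfl, fun _ => rfl, fun _ _ => by norm_num⟩

/-- The density `ω² (4 + ξ²) ^ s`. -/
def dens (s : ℝ) (ω : ℝ → ℝ) (ξ : ℝ) : ℝ≥0∞ :=
  ENNReal.ofReal (ω ξ) ^ 2 * ENNReal.ofReal ((4 + ξ ^ 2) ^ s)

/-- The weight `ω(ξ - η) ⟨ξ⟩^θ ⟨η⟩^θ` on kernels, with `θ = 2 t`. -/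
def kw (t : ℝ) (ω : ℝ → ℝ) (p : ℝ × ℝ) : ℝ≥0∞ :=
  ENNReal.ofReal (ω (p.1 - p.2)) * ENNReal.ofReal (jp t p.1 * jp t p.2)

/-- The exponent of the brackets in the kernel weight that is used for `H^s`. -/
def tex (s : ℝ) : ℝ := (1 / 2 + s) / 8

namespace IsFreqWeight

variable {ω : ℝ → ℝ} (hω : IsFreqWeight ω)
include hω

lemma isKernelWeight {t : ℝ} (ht : 0 ≤ t) : IsKernelWeight (kw t ω) where
  meas := by
    have := hω.meas
    unfold kw
    fun_prop
  one_le p := by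
    refine one_le_mul ?_ ?_
    · rw [ENNReal.one_le_ofReal]; exact hω.one_le _
    · rw [ENNReal.one_le_ofReal]
      exact one_le_mul_of_one_le_of_one_le (one_le_jp ht _) (one_le_jp ht _)
  ne_top p := by unfold kw; finiteness
  submul x y z := by
    have h0 : ∀ x, 0 ≤ ω x := fun x => zero_le_one.trans (hω.one_le x)
    unfold kw
    rw [← ENNReal.ofReal_mul (h0 _), ← ENNReal.ofReal_mul (h0 _), ← ENNReal.ofReal_mul (h0 _),
      ← ENNReal.ofReal_mul (mul_nonneg (h0 _) (mul_pos (jp_pos _ _) (jp_pos _ _)).le)]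
    refine ENNReal.ofReal_le_ofReal ?_
    simp only
    have h1 : ω (x - z) ≤ ω (x - y) * ω (y - z) := by
      have := hω.submul (x - y) (y - z)
      rwa [sub_add_sub_cancel] at this
    have hx := jp_pos t x
    have hz := jp_pos t z
    have hy := one_le_jp ht y
    have h2 : 1 ≤ jp t y * jp t y := one_le_mul_of_one_le_of_one_le hy hy
    calc ω (x - z) * (jp t x * jp t z)
        ≤ ω (x - y) * ω (y - z) * (jp t x * jp t z) := by gcongr
      _ ≤ ω (x - y) * ω (y - z) * (jp t x * jp t z) * (jp t y * jp t y) :=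
          le_mul_of_one_le_right (mul_nonneg (mul_nonneg (h0 _) (h0 _)) (by positivity)) h2
      _ = _ := by ring

end IsFreqWeight

lemma measurable_dens {s : ℝ} {ω : ℝ → ℝ} (hω : IsFreqWeight ω) : Measurable (dens s ω) := by
  have := hω.meas
  unfold dens
  fun_prop

lemma isWeighted_dens {s : ℝ} {ω : ℝ → ℝ} (hω : IsFreqWeight ω) :
    IsWeighted (volume.withDensity (dens s ω)) (dens s ω) where
  meas := measurable_dens hω
  ne_zero x := by
    refine mul_ne_zero (pow_ne_zero _ ?_) ?_
    · simpa using zero_lt_one.trans_le (hω.one_le x)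
    · simpa using Real.rpow_pos_of_pos (by positivity) _
  ne_top x := by unfold dens; finiteness
  eq := rfl

lemma isWeighted_sobolev (s : ℝ) : IsWeighted (sobolevMeasure s) (dens s fun _ => 1) := by
  have h := isWeighted_dens (s := s) isFreqWeight_one
  refine ⟨h.meas, h.ne_zero, h.ne_top, ?_⟩
  have e : (fun ξ : ℝ => ENNReal.ofReal ((4 + ξ ^ 2) ^ s)) = dens s fun _ => 1 :=
    funext fun ξ => by simp [dens]
  rw [sobolevMeasure, e]

/-! ### Multiplication operators on kernels -/

/-- A bounded measurable multiplier. -/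
structure IsMult (p : ℝ → ℂ) (C : ℝ≥0) : Prop where
  meas : Measurable p
  bound : ∀ x, ‖p x‖ₑ ≤ C

section Mult

variable {τ : ℝ × ℝ → ℝ≥0∞} {p : ℝ → ℂ} {C : ℝ≥0}

/-- Multiplication of a kernel by a function of the first variable. -/
def lmul (τ : ℝ × ℝ → ℝ≥0∞) (h : IsMult p C) : Lp ℂ 2 (kmeas τ) →L[ℂ] Lp ℂ 2 (kmeas τ) :=
  (isL2Op_mul (m := fun q : ℝ × ℝ => p q.1) (h.meas.comp measurable_fst)
    fun q => h.bound q.1).toCLM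

/-- Multiplication of a kernel by a function of the second variable. -/
def rmul (τ : ℝ × ℝ → ℝ≥0∞) (h : IsMult p C) : Lp ℂ 2 (kmeas τ) →L[ℂ] Lp ℂ 2 (kmeas τ) :=
  (isL2Op_mul (m := fun q : ℝ × ℝ => p q.2) (h.meas.comp measurable_snd)
    fun q => h.bound q.2).toCLM

lemma norm_lmul_le (h : IsMult p C) (f : Lp ℂ 2 (kmeas τ)) : ‖lmul τ h f‖ ≤ C * ‖f‖ :=
  IsL2Op.norm_le _ f

lemma norm_rmul_le (h : IsMult p C) (f : Lp ℂ 2 (kmeas τ)) : ‖rmul τ h f‖ ≤ C * ‖f‖ :=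
  IsL2Op.norm_le _ f

variable (hτ : IsKernelWeight τ)
include hτ

lemma coeFn_lmul (h : IsMult p C) (f : Lp ℂ 2 (kmeas τ)) :
    lmul τ h f =ᵐ[volume] fun q => p q.1 * f q :=
  hτ.isWeighted.ae_eq_iff.1 (IsL2Op.coeFn _ f)

lemma coeFn_rmul (h : IsMult p C) (f : Lp ℂ 2 (kmeas τ)) :
    rmul τ h f =ᵐ[volume] fun q => p q.2 * f q :=
  hτ.isWeighted.ae_eq_iff.1 (IsL2Op.coeFn _ f)

lemma tr_rmul (h : IsMult p C) (f g : Lp ℂ 2 (kmeas τ)) :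
    hτ.tr (rmul τ h f) g = hτ.tr f (lmul τ h g) := by
  rw [hτ.tr_apply, hτ.tr_apply]
  refine integral_congr_ae ?_
  filter_upwards [coeFn_rmul hτ h f, ae_swap (coeFn_lmul hτ h g)] with q h1 h2
  rw [h1, h2, Prod.fst_swap]
  ring

end Mult

end

end AKNS

namespace AKNS

noncomputable section

open scoped ENNReal NNReal

/-! ### Diagonals of integrable kernels -/

/-- The constant `(2π)^(-1/2)`. -/
def cpi : ℂ := ((Real.sqrt (2 * Real.pi) : ℝ) : ℂ)⁻¹

lemma cpi_eq : cpi = ((Real.sqrt (2 * Real.pi) : ℝ) : ℂ)⁻¹ := rfl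

lemma cpi_ne_zero : cpi ≠ 0 := by
  have : Real.sqrt (2 * Real.pi) ≠ 0 := (Real.sqrt_pos.2 (by positivity)).ne'
  exact inv_ne_zero (by exact_mod_cast this)

lemma cpi_mul_cpi : cpi * cpi = ((2 * Real.pi : ℝ) : ℂ)⁻¹ := by
  rw [cpi, ← mul_inv, ← Complex.ofReal_mul, Real.mul_self_sqrt (by positivity)]

lemma enorm_cpi_le : ‖cpi‖ₑ ≤ 1 := by
  rw [← ofReal_norm, ENNReal.ofReal_le_one]
  rw [cpi, norm_inv, Complex.norm_real, Real.norm_of_nonneg (Real.sqrt_nonneg _)]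
  refine inv_le_one_of_one_le₀ ?_
  rw [Real.one_le_sqrt]
  linarith [Real.pi_gt_three]

/-- The function `h ↦ ∫ K(ξ, ξ - h) dξ`. -/
def diag (K : ℝ × ℝ → ℂ) (k : ℝ) : ℂ := ∫ ξ, K (shear (ξ, k))

lemma diag_congr {K L : ℝ × ℝ → ℂ} (h : K =ᵐ[volume] L) : diag K =ᵐ[volume] diag L := by
  filter_upwards [ae_shear_sections h] with k hk
  exact integral_congr_ae hk

lemma integrable_diag {K : ℝ × ℝ → ℂ} (h : Integrable K) : Integrable (diag K) :=
  (integrable_shear h).integral_prod_right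

lemma ae_integrable_diag {K : ℝ × ℝ → ℂ} (h : Integrable K) :
    ∀ᵐ k, Integrable fun ξ => K (shear (ξ, k)) :=
  (integrable_shear h).prod_left_ae

lemma integral_diag_mul {K : ℝ × ℝ → ℂ} {f : ℝ → ℂ}
    (h : Integrable fun p : ℝ × ℝ => K p * f (p.1 - p.2)) :
    ∫ k, diag K k * f k = ∫ p : ℝ × ℝ, K p * f (p.1 - p.2) := by
  rw [← integral_shear]
  change _ = ∫ p, _ ∂(volume.prod volume)
  rw [integral_prod_symm _ (integrable_shear h)]
  refine integral_congr_ae (.of_forall fun k => ?_)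
  simp only [diag, shear, sub_sub_cancel, integral_mul_const]

/-- The kernel `⟨ξ⟩^(-1/2) X(ξ, η) ⟨η⟩^(-1/2)`. -/
def flat (X : ℝ × ℝ → ℂ) (p : ℝ × ℝ) : ℂ := (jp (-(1 / 4)) p.1 * jp (-(1 / 4)) p.2 : ℝ) * X p

lemma flat_congr {X Y : ℝ × ℝ → ℂ} (h : X =ᵐ[volume] Y) : flat X =ᵐ[volume] flat Y := by
  filter_upwards [h] with p hp
  rw [flat, hp, flat]

/-- The kernel `(2π)^(-1/2) ⟨ξ⟩^(-1/2) u(ξ - η) ⟨η⟩^(-1/2)`. -/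
def qker (u : ℝ → ℂ) : ℝ × ℝ → ℂ := flat fun p => cpi * u (p.1 - p.2)

/-- The diagonal of a kernel, as a Fourier transform. -/
def dker (X : ℝ × ℝ → ℂ) (k : ℝ) : ℂ := cpi * diag (flat X) k

/-- The standing assumptions: `μ` is the weighted measure that defines the space of functions `w`
with `ω w` in `H^s`. -/
structure IsSob (s : ℝ) (ω : ℝ → ℝ) (μ : Measure ℝ) : Prop where
  hs : s ∈ Ioo (-(1 / 2) : ℝ) 0
  hω : IsFreqWeight ω
  hμ : IsWeighted μ (dens s ω)

/-- The norm of the embedding of potentials into kernels. -/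
def qConst (s : ℝ) : ℝ≥0 := NNReal.sqrt (convConst s (1 / 2 - 2 * tex s)).toNNReal

/-- The norm of the diagonal map from kernels to functions. -/
def dConst (s : ℝ) : ℝ≥0 := (jpInt (1 / 2 + 2 * tex s)).toNNReal + 1

lemma tex_pos {s : ℝ} (hs : s ∈ Ioo (-(1 / 2) : ℝ) 0) : 0 < tex s := by
  have := hs.1
  unfold tex
  linarith

lemma ofReal_sq {a : ℝ} (ha : 0 ≤ a) : ENNReal.ofReal a ^ 2 = ENNReal.ofReal (a ^ 2) :=
  (ENNReal.ofReal_pow ha 2).symm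

lemma dens_le {s : ℝ} (hs : s ≤ 0) (ω : ℝ → ℝ) (ξ : ℝ) : dens s ω ξ ≤ ENNReal.ofReal (ω ξ) ^ 2 := by
  refine mul_le_of_le_one_right' ?_
  rw [ENNReal.ofReal_le_one]
  exact Real.rpow_le_one_of_one_le_of_nonpos (by nlinarith [sq_nonneg ξ]) hs

lemma lintegral_prod_symm_shear {F : ℝ × ℝ → ℝ≥0∞} (hF : AEMeasurable F) :
    ∫⁻ p, F p = ∫⁻ k, ∫⁻ ξ, F (shear (ξ, k)) := by
  rw [← lintegral_shear]
  exact lintegral_prod_symm _ (hF.comp_quasiMeasurePreserving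
    measurePreserving_shear.quasiMeasurePreserving)

lemma enorm_jp_mul (r x y : ℝ) (z : ℂ) :
    ‖((jp r x * jp r y : ℝ) : ℂ) * z‖ₑ = ENNReal.ofReal (jp r x * jp r y) * ‖z‖ₑ := by
  rw [enorm_mul, ← ofReal_norm, Complex.norm_real,
    Real.norm_of_nonneg (mul_pos (jp_pos _ _) (jp_pos _ _)).le]

namespace IsSob

variable {s : ℝ} {ω : ℝ → ℝ} {μ : Measure ℝ} (S : IsSob s ω μ)
include S

lemma isKW : IsKernelWeight (kw (tex s) ω) := S.hω.isKernelWeight (tex_pos S.hs).le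

omit S in
lemma aesm_coe (u : Lp ℂ 2 μ) : AEStronglyMeasurable (fun p : ℝ × ℝ => u (p.1 - p.2)) :=
  ((Lp.stronglyMeasurable u).comp_measurable (by fun_prop)).aestronglyMeasurable

omit S in
lemma measurable_flat {X : ℝ × ℝ → ℂ} (hX : AEStronglyMeasurable X) :
    AEStronglyMeasurable (flat X) := by
  unfold flat
  exact (Measurable.aestronglyMeasurable (by fun_prop)).mul hX

omit S in
lemma kw_qker (u : ℝ → ℂ) (p : ℝ × ℝ) :
    kw (tex s) ω p ^ 2 * ‖qker u p‖ₑ ^ 2 ≤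
      ENNReal.ofReal (ω (p.1 - p.2)) ^ 2 * ‖u (p.1 - p.2)‖ₑ ^ 2 *
        ENNReal.ofReal (jp (-(1 / 2 - 2 * tex s)) p.1 * jp (-(1 / 2 - 2 * tex s)) p.2) := by
  have e : (jp (tex s) p.1 * jp (tex s) p.2) ^ 2 * (jp (-(1 / 4)) p.1 * jp (-(1 / 4)) p.2) ^ 2 =
      jp (-(1 / 2 - 2 * tex s)) p.1 * jp (-(1 / 2 - 2 * tex s)) p.2 := by
    rw [show -(1 / 2 - 2 * tex s) = tex s + tex s + -(1 / 4) + -(1 / 4) by ring]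
    simp only [jp_add]
    ring
  have h1 := (jp_pos (tex s) p.1).le
  have h2 := (jp_pos (tex s) p.2).le
  have h3 := (jp_pos (-(1 / 4)) p.1).le
  have h4 := (jp_pos (-(1 / 4)) p.2).le
  rw [← e, ENNReal.ofReal_mul (by positivity), ← ofReal_sq (by positivity),
    ← ofReal_sq (by positivity), qker, flat, enorm_jp_mul, enorm_mul, kw]
  calc _ = ENNReal.ofReal (ω (p.1 - p.2)) ^ 2 * ‖u (p.1 - p.2)‖ₑ ^ 2 *
        (ENNReal.ofReal (jp (tex s) p.1 * jp (tex s) p.2) ^ 2 *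
          ENNReal.ofReal (jp (-(1 / 4)) p.1 * jp (-(1 / 4)) p.2) ^ 2) * ‖cpi‖ₑ ^ 2 := by ring
    _ ≤ _ := mul_le_of_le_one_right' (pow_le_one' enorm_cpi_le 2)

lemma lintegral_qker_le (u : Lp ℂ 2 μ) :
    ∫⁻ p, kw (tex s) ω p ^ 2 * ‖qker u p‖ₑ ^ 2 ≤ (qConst s * ‖u‖ₑ) ^ 2 := by
  have ht := tex_pos S.hs
  have hm := S.hω.meas
  have hu : Measurable fun x => ‖u x‖ₑ := (Lp.stronglyMeasurable u).enorm
  have htop : convConst s (1 / 2 - 2 * tex s) < ⊤ := by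
    refine convConst_lt_top ?_
    have := S.hs.1
    unfold tex
    linarith
  have hC : (qConst s : ℝ≥0∞) ^ 2 = convConst s (1 / 2 - 2 * tex s) := by
    rw [qConst, ← ENNReal.coe_pow, NNReal.sq_sqrt, ENNReal.coe_toNNReal htop.ne]
  rw [mul_pow, hC, S.hμ.enorm_sq, ← lintegral_const_mul _ (by
    have := measurable_dens (s := s) S.hω
    fun_prop)]
  refine (lintegral_mono (kw_qker u)).trans ?_
  rw [lintegral_prod_symm_shear (by fun_prop)]
  refine lintegral_mono fun k => ?_
  simp only [shear, sub_sub_cancel]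
  rw [lintegral_const_mul _ (by fun_prop)]
  have hb := lintegral_jp_conv_le (s := s) (p := 1 / 2 - 2 * tex s) S.hs.2.le
    (by have := S.hs.2; unfold tex; linarith) (by have := S.hs.1; unfold tex; linarith) k
  refine (mul_le_mul_right hb _).trans (le_of_eq ?_)
  rw [dens]
  ring

lemma isL2Op_qker : IsL2Op ℂ μ (kmeas (kw (tex s) ω)) qker (qConst s) where
  congr f g h := S.isKW.isWeighted.ae_eq_iff.2 (by
    filter_upwards [ae_diff (S.hμ.ae_eq_iff.1 h)] with p hp
    simp only [qker, flat, hp])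
  meas f := S.isKW.isWeighted.aesm (measurable_flat ((aesm_coe f).const_mul _))
  bound f := S.isKW.isWeighted.eLpNorm_le (S.lintegral_qker_le f)
  add f g := .of_forall fun p => by simp only [qker, flat, Pi.add_apply]; ring
  smul c f := .of_forall fun p => by simp only [qker, flat, Pi.smul_apply, smul_eq_mul]; ring

/-- The map from potentials to kernels. -/
def Q : Lp ℂ 2 μ →L[ℂ] Lp ℂ 2 (kmeas (kw (tex s) ω)) := S.isL2Op_qker.toCLM

lemma coeFn_Q (u : Lp ℂ 2 μ) : S.Q u =ᵐ[volume] qker u :=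
  S.isKW.isWeighted.ae_eq_iff.1 (S.isL2Op_qker.coeFn u)

lemma norm_Q_le (u : Lp ℂ 2 μ) : ‖S.Q u‖ ≤ qConst s * ‖u‖ := S.isL2Op_qker.norm_le u

omit S in
lemma enorm_flat (X : ℝ × ℝ → ℂ) (p : ℝ × ℝ) : ‖flat X p‖ₑ =
    ENNReal.ofReal (jp (-(1 / 4 + tex s)) p.1 * jp (-(1 / 4 + tex s)) p.2) *
      (ENNReal.ofReal (jp (tex s) p.1 * jp (tex s) p.2) * ‖X p‖ₑ) := by
  have h1 := (jp_pos (-(1 / 4 + tex s)) p.1).le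
  have h2 := (jp_pos (-(1 / 4 + tex s)) p.2).le
  rw [flat, enorm_jp_mul, ← mul_assoc, ← ENNReal.ofReal_mul (by positivity)]
  congr 2
  rw [show -(1 / 4 : ℝ) = -(1 / 4 + tex s) + tex s by ring]
  simp only [jp_add]
  ring

lemma jpInt_tex_lt_top : jpInt (1 / 2 + 2 * tex s) < ⊤ :=
  jpInt_lt_top (by linarith [tex_pos S.hs])

lemma one_le_ofReal_ω (x : ℝ) : 1 ≤ ENNReal.ofReal (ω x) := by
  rw [ENNReal.one_le_ofReal]; exact S.hω.one_le x

lemma lintegral_flat_le (X : Lp ℂ 2 (kmeas (kw (tex s) ω))) :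
    ∫⁻ p, ‖flat X p‖ₑ ≤ jpInt (1 / 2 + 2 * tex s) * ‖X‖ₑ := by
  have hX : Measurable fun x => ‖X x‖ₑ := (Lp.stronglyMeasurable X).enorm
  refine (ENNReal.pow_le_pow_left_iff two_ne_zero).1 ?_
  rw [mul_pow, S.isKW.isWeighted.enorm_sq]
  simp only [enorm_flat (s := s)]
  refine (sq_lintegral_mul_le (by fun_prop) (by fun_prop)).trans ?_
  refine mul_le_mul' (le_of_eq ?_) (lintegral_mono fun p => ?_)
  · change ∫⁻ p, _ ∂(volume.prod volume) = _
    have e : ∀ p : ℝ × ℝ, ENNReal.ofReal (jp (-(1 / 4 + tex s)) p.1 * jp (-(1 / 4 + tex s)) p.2) ^ 2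
        = ENNReal.ofReal (jp (-(1 / 2 + 2 * tex s)) p.1) *
          ENNReal.ofReal (jp (-(1 / 2 + 2 * tex s)) p.2) := by
      intro p
      have h1 := (jp_pos (-(1 / 4 + tex s)) p.1).le
      have h2 := (jp_pos (-(1 / 4 + tex s)) p.2).le
      rw [← ENNReal.ofReal_mul (jp_pos _ _).le, ofReal_sq (by positivity),
        show -(1 / 2 + 2 * tex s) = -(1 / 4 + tex s) + -(1 / 4 + tex s) by ring]
      simp only [jp_add]
      congr 1
      ring
    simp only [e]
    rw [lintegral_prod_mul (f := fun x => ENNReal.ofReal (jp (-(1 / 2 + 2 * tex s)) x))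
      (g := fun x => ENNReal.ofReal (jp (-(1 / 2 + 2 * tex s)) x)) (by fun_prop) (by fun_prop), ← sq]
    rfl
  · rw [mul_pow, kw]
    gcongr
    exact le_mul_of_one_le_left' (S.one_le_ofReal_ω _)

lemma integrable_flat (X : Lp ℂ 2 (kmeas (kw (tex s) ω))) : Integrable (flat X) :=
  ⟨measurable_flat (Lp.stronglyMeasurable X).aestronglyMeasurable,
    (S.lintegral_flat_le X).trans_lt (ENNReal.mul_lt_top S.jpInt_tex_lt_top enorm_lt_top)⟩

lemma dens_dker_le (X : Lp ℂ 2 (kmeas (kw (tex s) ω))) (k : ℝ) :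
    ENNReal.ofReal (ω k) ^ 2 * ‖dker X k‖ₑ ^ 2 ≤ jpInt (1 / 2 + 2 * tex s) *
      ∫⁻ ξ, kw (tex s) ω (shear (ξ, k)) ^ 2 * ‖X (shear (ξ, k))‖ₑ ^ 2 := by
  have hX : Measurable fun x => ‖X x‖ₑ := (Lp.stronglyMeasurable X).enorm
  have hsh := measurable_shear
  have h1 : ENNReal.ofReal (ω k) * ‖dker X k‖ₑ ≤
      ∫⁻ ξ, ENNReal.ofReal (jp (-(1 / 4 + tex s)) ξ * jp (-(1 / 4 + tex s)) (ξ - k)) *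
        (kw (tex s) ω (shear (ξ, k)) * ‖X (shear (ξ, k))‖ₑ) := by
    have h2 : ‖dker X k‖ₑ ≤ ∫⁻ ξ, ‖flat X (shear (ξ, k))‖ₑ := by
      rw [dker, enorm_mul]
      exact (mul_le_of_le_one_left' enorm_cpi_le).trans (enorm_integral_le_lintegral_enorm _)
    refine (mul_le_mul_right h2 _).trans ?_
    rw [← lintegral_const_mul' _ _ ENNReal.ofReal_ne_top]
    refine lintegral_mono fun ξ => le_of_eq ?_
    simp only [enorm_flat (s := s), kw, shear, sub_sub_cancel]
    ring
  rw [← mul_pow]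
  refine (pow_le_pow_left' h1 2).trans ((sq_lintegral_mul_le (by fun_prop) ?_).trans ?_)
  · have := S.isKW.meas
    fun_prop
  simp only [mul_pow]
  gcongr
  refine lintegral_mono fun ξ => ?_
  have h3 := (jp_pos (-(1 / 4 + tex s)) ξ).le
  have h4 := (jp_pos (-(1 / 4 + tex s)) (ξ - k)).le
  rw [ofReal_sq (by positivity)]
  refine ENNReal.ofReal_le_ofReal ?_
  rw [show -(1 / 2 + 2 * tex s) = -(1 / 4 + tex s) + -(1 / 4 + tex s) by ring, jp_add, mul_pow]
  have h5 : jp (-(1 / 4 + tex s)) (ξ - k) ^ 2 ≤ 1 :=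
    pow_le_one₀ h4 (jp_le_one (by linarith [tex_pos S.hs]) _)
  nlinarith [mul_nonneg h3 h3]

lemma lintegral_dker_le (X : Lp ℂ 2 (kmeas (kw (tex s) ω))) :
    ∫⁻ k, ENNReal.ofReal (ω k) ^ 2 * ‖dker X k‖ₑ ^ 2 ≤ jpInt (1 / 2 + 2 * tex s) * ‖X‖ₑ ^ 2 := by
  have hX : Measurable fun x => ‖X x‖ₑ := (Lp.stronglyMeasurable X).enorm
  have hsh := measurable_shear
  have hk := S.isKW.meas
  refine (lintegral_mono (S.dens_dker_le X)).trans (le_of_eq ?_)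
  rw [lintegral_const_mul' _ _ S.jpInt_tex_lt_top.ne, S.isKW.isWeighted.enorm_sq,
    lintegral_prod_symm_shear (by fun_prop)]

lemma isL2Op_dker : IsL2Op ℂ (kmeas (kw (tex s) ω)) μ dker (dConst s) where
  congr X Y h := S.hμ.ae_eq_iff.2 (by
    filter_upwards [diag_congr (flat_congr (S.isKW.isWeighted.ae_eq_iff.1 h))] with k hk
    rw [dker, hk, dker])
  meas X := S.hμ.aesm ((integrable_diag (S.integrable_flat X)).aestronglyMeasurable.const_mul _)
  bound X := by
    refine S.hμ.eLpNorm_le ?_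
    calc ∫⁻ k, dens s ω k * ‖dker X k‖ₑ ^ 2
        ≤ ∫⁻ k, ENNReal.ofReal (ω k) ^ 2 * ‖dker X k‖ₑ ^ 2 :=
          lintegral_mono fun k => mul_le_mul_left (dens_le S.hs.2.le ω k) _
      _ ≤ _ := S.lintegral_dker_le X
      _ ≤ _ := by
        rw [mul_pow]
        gcongr
        rw [dConst, ENNReal.coe_add, ENNReal.coe_toNNReal S.jpInt_tex_lt_top.ne, ENNReal.coe_one]
        set a := jpInt (1 / 2 + 2 * tex s)
        calc a ≤ a + 1 := le_self_add
          _ ≤ (a + 1) ^ 2 := le_self_pow (le_add_self) two_ne_zero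
  add X Y := S.hμ.ae_eq_iff.2 (by
    filter_upwards [ae_integrable_diag (S.integrable_flat X),
      ae_integrable_diag (S.integrable_flat Y)] with k h1 h2
    simp only [dker, diag, Pi.add_apply]
    rw [← mul_add, ← integral_add h1 h2]
    simp only [flat, Pi.add_apply, mul_add])
  smul c X := .of_forall fun k => by
    simp only [dker, diag, flat, Pi.smul_apply, smul_eq_mul]
    rw [mul_left_comm c, ← integral_const_mul c]
    congr 2
    ext ξ
    ring

/-- The diagonal map from kernels to functions. -/
def D : Lp ℂ 2 (kmeas (kw (tex s) ω)) →L[ℂ] Lp ℂ 2 μ := S.isL2Op_dker.toCLM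

lemma coeFn_D (X : Lp ℂ 2 (kmeas (kw (tex s) ω))) : S.D X =ᵐ[volume] dker X :=
  S.hμ.ae_eq_iff.1 (S.isL2Op_dker.coeFn X)

lemma norm_D_le (X : Lp ℂ 2 (kmeas (kw (tex s) ω))) : ‖S.D X‖ ≤ dConst s * ‖X‖ :=
  S.isL2Op_dker.norm_le X

lemma tr_Q (X : Lp ℂ 2 (kmeas (kw (tex s) ω))) (u : Lp ℂ 2 μ) :
    S.isKW.tr X (S.Q u) = ∫ k, S.D X k * u (-k) := by
  have h1 : S.isKW.tr X (S.Q u) = ∫ p : ℝ × ℝ, flat X p * (cpi * u (-(p.1 - p.2))) := by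
    rw [S.isKW.tr_apply]
    refine integral_congr_ae ?_
    filter_upwards [ae_swap (S.coeFn_Q u)] with p hp
    rw [hp, qker, flat, flat, Prod.fst_swap, Prod.snd_swap, neg_sub, mul_comm (jp _ p.2)]
    ring
  have h2 : Integrable fun p : ℝ × ℝ => flat X p * (cpi * u (-(p.1 - p.2))) := by
    refine (S.isKW.integrable_tr X (S.Q u)).congr ?_
    filter_upwards [ae_swap (S.coeFn_Q u)] with p hp
    rw [hp, qker, flat, flat, Prod.fst_swap, Prod.snd_swap, neg_sub, mul_comm (jp _ p.2)]
    ring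
  rw [h1, ← integral_diag_mul (f := fun k => cpi * u (-k)) h2]
  refine integral_congr_ae ?_
  filter_upwards [S.coeFn_D X] with k hk
  rw [hk, dker]
  ring

end IsSob

end

end AKNS

namespace AKNS

noncomputable section

open scoped ENNReal NNReal

/-! ### The normalized resolvent symbols -/

/-- The symbol `⟨ξ⟩ (κ - iξ)⁻¹` for `|κ| ≥ 1` (and `0` for other values of `κ`). -/
def sym (κ ξ : ℝ) : ℂ := if 1 ≤ |κ| then (jp (1 / 2) ξ : ℂ) * ((κ : ℂ) - Complex.I * ξ)⁻¹ else 0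

lemma sym_eq {κ : ℝ} (hκ : 1 ≤ |κ|) (ξ : ℝ) :
    sym κ ξ = (jp (1 / 2) ξ : ℂ) * ((κ : ℂ) - Complex.I * ξ)⁻¹ := if_pos hκ

lemma normSq_res (κ ξ : ℝ) : Complex.normSq ((κ : ℂ) - Complex.I * ξ) = κ ^ 2 + ξ ^ 2 := by
  simp [Complex.normSq_apply]
  ring

lemma norm_res (κ ξ : ℝ) : ‖(κ : ℂ) - Complex.I * ξ‖ = Real.sqrt (κ ^ 2 + ξ ^ 2) := by
  rw [← normSq_res, Complex.normSq_eq_norm_sq, Real.sqrt_sq (norm_nonneg _)]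

lemma res_ne_zero {κ : ℝ} (hκ : 1 ≤ |κ|) (ξ : ℝ) : (κ : ℂ) - Complex.I * ξ ≠ 0 := by
  intro h
  have := congrArg Complex.re h
  simp at this
  rw [this] at hκ
  norm_num at hκ

lemma jp_half (ξ : ℝ) : jp (1 / 2) ξ = Real.sqrt (1 + ξ ^ 2) := (Real.sqrt_eq_rpow _).symm

lemma norm_sym_le (κ ξ : ℝ) : ‖sym κ ξ‖ ≤ 1 := by
  unfold sym
  split_ifs with h
  · rw [norm_mul, norm_inv, norm_res, Complex.norm_real, Real.norm_of_nonneg (jp_pos _ _).le,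
      jp_half, ← div_eq_mul_inv]
    refine div_le_one_of_le₀ (Real.sqrt_le_sqrt ?_) (Real.sqrt_nonneg _)
    have : (1 : ℝ) ≤ κ ^ 2 := by
      rw [← sq_abs]
      exact one_le_pow₀ h
    linarith
  · simp

lemma isMult_sym (κ : ℝ) : IsMult (sym κ) 1 where
  meas := by
    unfold sym
    split_ifs <;> fun_prop
  bound x := by
    rw [← ofReal_norm, ENNReal.coe_one, ENNReal.ofReal_le_one]
    exact norm_sym_le κ x

lemma conj_sym_neg (κ ξ : ℝ) : conj (sym κ (-ξ)) = sym κ ξ := by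
  unfold sym
  split_ifs with h
  · simp only [jp, map_mul, map_inv₀, map_sub, Complex.conj_ofReal, Complex.conj_I,
      Complex.ofReal_neg, even_two, Even.neg_pow, map_neg]
    congr 2
    ring
  · simp

lemma int_units_mul_self (ε : ℤˣ) : (((ε : ℤ) : ℂ)) * ((ε : ℤ) : ℂ) = 1 := by
  rcases Int.units_eq_one_or ε with h | h <;> simp [h]

lemma enorm_int_units (ε : ℤˣ) : ‖(((ε : ℤ) : ℂ))‖ₑ = 1 := by
  rcases Int.units_eq_one_or ε with h | h <;> simp [h]

lemma conj_int_units (ε : ℤˣ) : conj (((ε : ℤ) : ℂ)) = ((ε : ℤ) : ℂ) := by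
  rcases Int.units_eq_one_or ε with h | h <;> simp [h]

lemma ae_neg {p : ℝ → Prop} (h : ∀ᵐ x, p x) : ∀ᵐ x, p (-x) :=
  (Measure.measurePreserving_neg (volume : Measure ℝ)).quasiMeasurePreserving.ae h

lemma measurePreserving_neg_prod : MeasurePreserving (fun q : ℝ × ℝ => (-q.1, -q.2)) :=
  (Measure.measurePreserving_neg (volume : Measure ℝ)).prod
    (Measure.measurePreserving_neg (volume : Measure ℝ))

lemma ae_neg_prod {p : ℝ × ℝ → Prop} (h : ∀ᵐ q, p q) : ∀ᵐ q : ℝ × ℝ, p (-q.1, -q.2) :=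
  measurePreserving_neg_prod.quasiMeasurePreserving.ae h

/-- The kernel `± conj X(-ξ, -η)`. -/
def kconj (ε : ℤˣ) (X : ℝ × ℝ → ℂ) (p : ℝ × ℝ) : ℂ := ((ε : ℤ) : ℂ) * conj (X (-p.1, -p.2))

namespace IsSob

variable {s : ℝ} {ω : ℝ → ℝ} {μ : Measure ℝ} (S : IsSob s ω μ)
include S

lemma isL2Op_rHat (ε : ℤˣ) : IsL2Op ℝ μ μ (rHat ε) 1 where
  congr f g h := S.hμ.ae_eq_iff.2 (by
    filter_upwards [ae_neg (S.hμ.ae_eq_iff.1 h)] with x hx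
    rw [rHat, hx, rHat])
  meas f := by
    unfold rHat
    exact ((Complex.continuous_conj.comp_stronglyMeasurable ((Lp.stronglyMeasurable f).comp_measurable
      measurable_neg)).const_mul _).aestronglyMeasurable
  bound f := by
    refine S.hμ.eLpNorm_le ?_
    rw [ENNReal.coe_one, one_mul, S.hμ.enorm_sq]
    refine le_of_eq ?_
    rw [← lintegral_neg_eq_self (μ := (volume : Measure ℝ)) (fun x => dens s ω x * ‖f x‖ₑ ^ 2)]
    refine lintegral_congr fun x => ?_
    simp [rHat, enorm_mul, enorm_int_units, dens, S.hω.even]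
  add f g := .of_forall fun x => by simp only [rHat, Pi.add_apply, map_add, mul_add]
  smul c f := .of_forall fun x => by
    simp only [rHat, Pi.smul_apply, Complex.real_smul, map_mul, Complex.conj_ofReal]
    ring

/-- The involution `q ↦ ± q̄` on the Fourier side. -/
def J (ε : ℤˣ) : Lp ℂ 2 μ →L[ℝ] Lp ℂ 2 μ := (S.isL2Op_rHat ε).toCLM

lemma coeFn_J (ε : ℤˣ) (u : Lp ℂ 2 μ) : S.J ε u =ᵐ[volume] rHat ε u :=
  S.hμ.ae_eq_iff.1 ((S.isL2Op_rHat ε).coeFn u)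

lemma norm_J_le (ε : ℤˣ) (u : Lp ℂ 2 μ) : ‖S.J ε u‖ ≤ ‖u‖ := by
  have := (S.isL2Op_rHat ε).norm_le u
  rw [NNReal.coe_one, one_mul] at this
  exact this

lemma J_J (ε : ℤˣ) (u : Lp ℂ 2 μ) : S.J ε (S.J ε u) = u := by
  refine Lp.ext (S.hμ.ae_eq_iff.2 ?_)
  filter_upwards [S.coeFn_J ε (S.J ε u), ae_neg (S.coeFn_J ε u)] with x h1 h2
  rw [h1, rHat, h2, rHat]
  simp only [map_mul, conj_int_units, neg_neg, Complex.conj_conj]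
  rw [← mul_assoc, int_units_mul_self, one_mul]

lemma J_smul (ε : ℤˣ) (c : ℂ) (u : Lp ℂ 2 μ) : S.J ε (c • u) = conj c • S.J ε u := by
  refine Lp.ext (S.hμ.ae_eq_iff.2 ?_)
  filter_upwards [S.coeFn_J ε (c • u), S.coeFn_J ε u,
    ae_neg (S.hμ.ae_eq_iff.1 (Lp.coeFn_smul c u)),
    S.hμ.ae_eq_iff.1 (Lp.coeFn_smul (conj c) (S.J ε u))] with x h1 h2 h3 h4
  rw [h1, h4, Pi.smul_apply, h2, rHat, h3, rHat, Pi.smul_apply, smul_eq_mul, smul_eq_mul, map_mul]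
  ring

lemma isL2Op_kconj (ε : ℤˣ) :
    IsL2Op ℝ (kmeas (kw (tex s) ω)) (kmeas (kw (tex s) ω)) (kconj ε) 1 where
  congr f g h := S.isKW.isWeighted.ae_eq_iff.2 (by
    filter_upwards [ae_neg_prod (S.isKW.isWeighted.ae_eq_iff.1 h)] with x hx
    rw [kconj, hx, kconj])
  meas f := by
    unfold kconj
    exact ((Complex.continuous_conj.comp_stronglyMeasurable ((Lp.stronglyMeasurable f).comp_measurable
      (by fun_prop))).const_mul _).aestronglyMeasurable
  bound f := by
    refine S.isKW.isWeighted.eLpNorm_le ?_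
    rw [ENNReal.coe_one, one_mul, S.isKW.isWeighted.enorm_sq]
    refine le_of_eq ?_
    have hX : Measurable fun x => ‖f x‖ₑ := (Lp.stronglyMeasurable f).enorm
    have hk := S.isKW.meas
    rw [← measurePreserving_neg_prod.lintegral_comp
      (f := fun p => kw (tex s) ω p ^ 2 * ‖f p‖ₑ ^ 2) (by fun_prop)]
    refine lintegral_congr fun p => ?_
    have e : kw (tex s) ω (-p.1, -p.2) = kw (tex s) ω p := by
      simp only [kw, jp, even_two, Even.neg_pow]
      rw [show -p.1 - -p.2 = -(p.1 - p.2) by ring, S.hω.even]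
    simp [kconj, enorm_mul, enorm_int_units, e]
  add f g := .of_forall fun x => by simp only [kconj, Pi.add_apply, map_add, mul_add]
  smul c f := .of_forall fun x => by
    simp only [kconj, Pi.smul_apply, Complex.real_smul, map_mul, Complex.conj_ofReal]
    ring

/-- The kernel version of the involution `q ↦ ± q̄`. -/
def KJ (ε : ℤˣ) : Lp ℂ 2 (kmeas (kw (tex s) ω)) →L[ℝ] Lp ℂ 2 (kmeas (kw (tex s) ω)) :=
  (S.isL2Op_kconj ε).toCLM

lemma coeFn_KJ (ε : ℤˣ) (X : Lp ℂ 2 (kmeas (kw (tex s) ω))) : S.KJ ε X =ᵐ[volume] kconj ε X :=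
  S.isKW.isWeighted.ae_eq_iff.1 ((S.isL2Op_kconj ε).coeFn X)

omit S in
lemma kconj_congr (ε : ℤˣ) {X Y : ℝ × ℝ → ℂ} (h : X =ᵐ[volume] Y) :
    kconj ε X =ᵐ[volume] kconj ε Y := by
  filter_upwards [ae_neg_prod h] with x hx
  rw [kconj, hx, kconj]

omit S in
lemma kconj_kcomp (ε : ℤˣ) (X Y : ℝ × ℝ → ℂ) :
    ((ε : ℤ) : ℂ) • kconj ε (kcomp X Y) = kcomp (kconj ε X) (kconj ε Y) := by
  ext p
  simp only [Pi.smul_apply, kconj, kcomp, smul_eq_mul]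
  rw [← integral_conj, ← integral_neg_eq_self, ← integral_const_mul, ← integral_const_mul]
  congr 1
  ext ζ
  simp only [map_mul]
  ring

lemma KJ_mul (ε : ℤˣ) (X Y : Lp ℂ 2 (kmeas (kw (tex s) ω))) :
    ((ε : ℤ) : ℂ) • S.KJ ε (S.isKW.mul X Y) = S.isKW.mul (S.KJ ε X) (S.KJ ε Y) := by
  refine Lp.ext (S.isKW.isWeighted.ae_eq_iff.2 ?_)
  refine (S.isKW.coeFn_smul_vol _ _).trans ?_
  refine .trans ?_ ((S.isKW.coeFn_mul _ _).trans
    (kcomp_congr (S.coeFn_KJ ε X) (S.coeFn_KJ ε Y))).symm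
  rw [← kconj_kcomp]
  exact ((S.coeFn_KJ ε _).trans (kconj_congr ε (S.isKW.coeFn_mul X Y))).const_smul _

lemma KJ_mul_mul (ε : ℤˣ) (X Y Z : Lp ℂ 2 (kmeas (kw (tex s) ω))) :
    S.KJ ε (S.isKW.mul X (S.isKW.mul Y Z)) =
      S.isKW.mul (S.KJ ε X) (S.isKW.mul (S.KJ ε Y) (S.KJ ε Z)) := by
  rw [← S.KJ_mul, map_smul, ← S.KJ_mul, smul_smul, int_units_mul_self, one_smul]

lemma KJ_lmul (ε : ℤˣ) (κ : ℝ) (X : Lp ℂ 2 (kmeas (kw (tex s) ω))) :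
    S.KJ ε (lmul _ (isMult_sym κ) X) = lmul _ (isMult_sym κ) (S.KJ ε X) := by
  refine Lp.ext (S.isKW.isWeighted.ae_eq_iff.2 ?_)
  filter_upwards [S.coeFn_KJ ε (lmul _ (isMult_sym κ) X),
    ae_neg_prod (coeFn_lmul S.isKW (isMult_sym κ) X), coeFn_lmul S.isKW (isMult_sym κ) (S.KJ ε X),
    S.coeFn_KJ ε X] with p h1 h2 h3 h4
  rw [h1, h3, h4, kconj, h2, kconj, map_mul, conj_sym_neg]
  ring

lemma KJ_rmul (ε : ℤˣ) (κ : ℝ) (X : Lp ℂ 2 (kmeas (kw (tex s) ω))) :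
    S.KJ ε (rmul _ (isMult_sym κ) X) = rmul _ (isMult_sym κ) (S.KJ ε X) := by
  refine Lp.ext (S.isKW.isWeighted.ae_eq_iff.2 ?_)
  filter_upwards [S.coeFn_KJ ε (rmul _ (isMult_sym κ) X),
    ae_neg_prod (coeFn_rmul S.isKW (isMult_sym κ) X), coeFn_rmul S.isKW (isMult_sym κ) (S.KJ ε X),
    S.coeFn_KJ ε X] with p h1 h2 h3 h4
  rw [h1, h3, h4, kconj, h2, kconj, map_mul, conj_sym_neg]
  ring

omit S in
lemma conj_cpi : conj cpi = cpi := by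
  rw [cpi, map_inv₀, Complex.conj_ofReal]

lemma KJ_Q (ε : ℤˣ) (u : Lp ℂ 2 μ) : S.KJ ε (S.Q u) = S.Q (S.J ε u) := by
  refine Lp.ext (S.isKW.isWeighted.ae_eq_iff.2 ?_)
  filter_upwards [S.coeFn_KJ ε (S.Q u), ae_neg_prod (S.coeFn_Q u), S.coeFn_Q (S.J ε u),
    ae_diff (S.coeFn_J ε u)] with p h1 h2 h3 h4
  rw [h1, h3, kconj, h2]
  simp only [qker, flat, h4, rHat, jp, even_two, Even.neg_pow, map_mul, Complex.conj_ofReal, conj_cpi]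
  rw [show -p.1 - -p.2 = -(p.1 - p.2) by ring]
  ring

omit S in
lemma diag_flat_kconj (ε : ℤˣ) (X : ℝ × ℝ → ℂ) (k : ℝ) :
    diag (flat (kconj ε X)) k = ((ε : ℤ) : ℂ) * conj (diag (flat X) (-k)) := by
  simp only [diag]
  rw [← integral_conj, ← integral_const_mul, ← integral_neg_eq_self]
  refine integral_congr_ae (.of_forall fun ξ => ?_)
  simp only [flat, kconj, shear, jp, even_two, Even.neg_pow, map_mul, Complex.conj_ofReal, neg_neg]
  rw [show -(-ξ - k) = ξ - -k by ring, show (-ξ - k) ^ 2 = (ξ - -k) ^ 2 by ring]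
  ring

lemma D_KJ (ε : ℤˣ) (X : Lp ℂ 2 (kmeas (kw (tex s) ω))) : S.D (S.KJ ε X) = S.J ε (S.D X) := by
  refine Lp.ext (S.hμ.ae_eq_iff.2 ?_)
  filter_upwards [S.coeFn_D (S.KJ ε X), S.coeFn_J ε (S.D X), ae_neg (S.coeFn_D X),
    diag_congr (flat_congr (S.coeFn_KJ ε X))] with k h1 h2 h3 h4
  rw [h1, h2, rHat, h3, dker, dker, h4, map_mul, conj_cpi, diag_flat_kconj]
  ring

/-! ### The resolvent as a kernel -/

/-- The kernel of `q` preceded by the resolvent `(κ - ∂)⁻¹`, normalized. -/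
def X (κ : ℝ) : Lp ℂ 2 μ →L[ℂ] Lp ℂ 2 (kmeas (kw (tex s) ω)) :=
  (lmul (kw (tex s) ω) (isMult_sym κ)).comp S.Q

lemma X_apply (κ : ℝ) (u : Lp ℂ 2 μ) : S.X κ u = lmul _ (isMult_sym κ) (S.Q u) := rfl

lemma norm_X_le (κ : ℝ) (u : Lp ℂ 2 μ) : ‖S.X κ u‖ ≤ qConst s * ‖u‖ := by
  have := norm_lmul_le (isMult_sym κ) (S.Q u)
  rw [NNReal.coe_one, one_mul] at this
  exact this.trans (S.norm_Q_le u)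

/-- The sum `∑ X (X' X)^m` with `X = X_κ(w)` and `X' = X_{-κ}(v)`. -/
def Z (κ : ℝ) (w v : Lp ℂ 2 μ) : Lp ℂ 2 (kmeas (kw (tex s) ω)) :=
  altSum S.isKW.mul (S.X κ w) (S.X (-κ) v)

/-- The Fourier transform of `sgn κ · g₁₂(κ)`, as a function of independent `q` and `r`. -/
def G (κ : ℝ) (w v : Lp ℂ 2 μ) : Lp ℂ 2 μ := S.D (rmul _ (isMult_sym (-κ)) (S.Z κ w v))

/-- `- sgn κ · A(κ)`, as a function of independent `q` and `r`. -/
def logd (κ : ℝ) (w v : Lp ℂ 2 μ) : ℂ := logDet S.isKW.mul S.isKW.tr (S.X κ w) (S.X (-κ) v)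

omit S in
/-- A radius on which all series converge geometrically. -/
def _root_.AKNS.rad (s : ℝ) : ℝ := (2 * (qConst s + 1))⁻¹

omit S in
lemma rad_pos : 0 < rad s := by unfold rad; positivity

lemma norm_X_le_half (κ : ℝ) {u : Lp ℂ 2 μ} (hu : ‖u‖ ≤ rad s) : ‖S.X κ u‖ ≤ 1 / 2 := by
  refine (S.norm_X_le κ u).trans ?_
  have hq : (0 : ℝ) ≤ qConst s := (qConst s).2
  calc (qConst s : ℝ) * ‖u‖ ≤ (qConst s + 1) * rad s := by gcongr; linarith
    _ = 1 / 2 := by rw [rad]; field_simp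

omit S in
lemma norm_rmul_sym_le (κ : ℝ) (Y : Lp ℂ 2 (kmeas (kw (tex s) ω))) :
    ‖rmul _ (isMult_sym κ) Y‖ ≤ ‖Y‖ := by
  have := norm_rmul_le (isMult_sym κ) Y
  rwa [NNReal.coe_one, one_mul] at this

lemma norm_Z_le (κ : ℝ) {w v : Lp ℂ 2 μ} (hw : ‖w‖ ≤ rad s) (hv : ‖v‖ ≤ rad s) :
    ‖S.Z κ w v‖ ≤ 2 * (qConst s * ‖w‖) :=
  (S.isKW.isTraceAlgebra.norm_altSum_le (S.norm_X_le_half κ hw) (S.norm_X_le_half _ hv)).trans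
    (by gcongr; exact S.norm_X_le κ w)

lemma norm_Z_sub_le (κ : ℝ) {w v w' v' : Lp ℂ 2 μ} (hw : ‖w‖ ≤ rad s) (hv : ‖v‖ ≤ rad s)
    (hw' : ‖w'‖ ≤ rad s) (hv' : ‖v'‖ ≤ rad s) :
    ‖S.Z κ w v - S.Z κ w' v'‖ ≤ 2 * qConst s * (‖w - w'‖ + ‖v - v'‖) := by
  refine (S.isKW.isTraceAlgebra.norm_altSum_sub_le (S.norm_X_le_half κ hw)
    (S.norm_X_le_half _ hv) (S.norm_X_le_half _ hw') (S.norm_X_le_half _ hv')).trans ?_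
  rw [← map_sub, ← map_sub]
  have h1 := S.norm_X_le κ (w - w')
  have h2 := S.norm_X_le (-κ) (v - v')
  linarith

lemma norm_G_le (κ : ℝ) {w v : Lp ℂ 2 μ} (hw : ‖w‖ ≤ rad s) (hv : ‖v‖ ≤ rad s) :
    ‖S.G κ w v‖ ≤ dConst s * (2 * (qConst s * ‖w‖)) :=
  (S.norm_D_le _).trans (by
    gcongr
    exact (norm_rmul_sym_le _ _).trans (S.norm_Z_le κ hw hv))

lemma norm_G_sub_le (κ : ℝ) {w v w' v' : Lp ℂ 2 μ} (hw : ‖w‖ ≤ rad s) (hv : ‖v‖ ≤ rad s)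
    (hw' : ‖w'‖ ≤ rad s) (hv' : ‖v'‖ ≤ rad s) :
    ‖S.G κ w v - S.G κ w' v'‖ ≤ dConst s * (2 * qConst s * (‖w - w'‖ + ‖v - v'‖)) := by
  rw [G, G, ← map_sub, ← map_sub]
  refine (S.norm_D_le _).trans ?_
  gcongr
  exact (norm_rmul_sym_le _ _).trans (S.norm_Z_sub_le κ hw hv hw' hv')

lemma KJ_alt (ε : ℤˣ) (x y : Lp ℂ 2 (kmeas (kw (tex s) ω))) (m : ℕ) :
    S.KJ ε (alt S.isKW.mul x y m) = alt S.isKW.mul (S.KJ ε x) (S.KJ ε y) m := by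
  induction m with
  | zero => rfl
  | succ m ih => rw [alt, S.KJ_mul_mul, ih, alt]

lemma KJ_X (ε : ℤˣ) (κ : ℝ) (u : Lp ℂ 2 μ) : S.KJ ε (S.X κ u) = S.X κ (S.J ε u) := by
  rw [X_apply, KJ_lmul, KJ_Q, X_apply]

lemma KJ_Z (ε : ℤˣ) (κ : ℝ) {w v : Lp ℂ 2 μ} (hw : ‖w‖ ≤ rad s) (hv : ‖v‖ ≤ rad s) :
    S.KJ ε (S.Z κ w v) = S.Z κ (S.J ε w) (S.J ε v) := by
  have hs := S.isKW.isTraceAlgebra.summable_alt (S.norm_X_le_half κ hw) (S.norm_X_le_half (-κ) hv)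
    (by norm_num)
  rw [Z, altSum, ContinuousLinearMap.map_tsum _ hs, Z, altSum]
  simp only [KJ_alt, KJ_X]

lemma J_G (ε : ℤˣ) (κ : ℝ) {w v : Lp ℂ 2 μ} (hw : ‖w‖ ≤ rad s) (hv : ‖v‖ ≤ rad s) :
    S.J ε (S.G κ w v) = S.G κ (S.J ε w) (S.J ε v) := by
  rw [G, ← D_KJ, KJ_rmul, S.KJ_Z ε κ hw hv, G]

/-! ### The derivative of the logarithmic determinant -/

/-- The derivative of `logd κ` at `(w, v)` in the direction `(f, g)`. -/
def dlogd (κ : ℝ) (w v f g : Lp ℂ 2 μ) : ℂ :=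
  S.isKW.tr (rmul _ (isMult_sym κ) (S.Z (-κ) v w)) (S.Q f) +
    S.isKW.tr (rmul _ (isMult_sym (-κ)) (S.Z κ w v)) (S.Q g)

lemma dlogd_eq_integral (κ : ℝ) (w v f g : Lp ℂ 2 μ) :
    S.dlogd κ w v f g = (∫ k, S.G (-κ) v w k * f (-k)) + ∫ k, S.G κ w v k * g (-k) := by
  rw [dlogd, tr_Q, tr_Q]
  simp only [G, neg_neg]

lemma hasDerivAt_logd (κ : ℝ) {w v w' v' : ℝ → Lp ℂ 2 μ} {I : Set ℝ} (hI : IsOpen I)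
    (hI' : IsPreconnected I) {C : ℝ} (hw : ∀ t ∈ I, HasDerivAt w (w' t) t)
    (hv : ∀ t ∈ I, HasDerivAt v (v' t) t) (hwr : ∀ t ∈ I, ‖w t‖ ≤ rad s)
    (hvr : ∀ t ∈ I, ‖v t‖ ≤ rad s) (hwC : ∀ t ∈ I, ‖w' t‖ ≤ C) (hvC : ∀ t ∈ I, ‖v' t‖ ≤ C)
    {t : ℝ} (ht : t ∈ I) :
    HasDerivAt (fun t => S.logd κ (w t) (v t)) (S.dlogd κ (w t) (v t) (w' t) (v' t)) t := by
  have hX : ∀ κ (u : ℝ → Lp ℂ 2 μ) u' t, HasDerivAt u u' t →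
      HasDerivAt (fun t => S.X κ (u t)) (S.X κ u') t := fun κ u u' t h =>
    ((S.X κ).hasFDerivAt.restrictScalars ℝ).comp_hasDerivAt t h
  have h := S.isKW.isTraceAlgebra.hasDerivAt_logDet (x := fun t => S.X κ (w t))
    (y := fun t => S.X (-κ) (v t)) (x' := fun t => S.X κ (w' t)) (y' := fun t => S.X (-κ) (v' t))
    (r := 1 / 2) (C := qConst s * C) hI hI' (by norm_num) (fun t ht => hX κ w _ t (hw t ht))
    (fun t ht => hX (-κ) v _ t (hv t ht)) (fun t ht => S.norm_X_le_half κ (hwr t ht))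
    (fun t ht => S.norm_X_le_half _ (hvr t ht))
    (fun t ht => (S.norm_X_le κ _).trans (by gcongr; exact hwC t ht))
    (fun t ht => (S.norm_X_le _ _).trans (by gcongr; exact hvC t ht)) ht
  refine h.congr_deriv ?_
  rw [dlogd, tr_rmul S.isKW, tr_rmul S.isKW, S.isKW.tr_comm]
  simp only [Z, neg_neg]
  rfl

lemma dlogd_self (κ : ℝ) {w v : Lp ℂ 2 μ} (hw : ‖w‖ ≤ rad s) (hv : ‖v‖ ≤ rad s) :
    S.dlogd κ w v w (-v) = 0 := by
  have h := S.isKW.isTraceAlgebra.tr_altSum_swap (S.norm_X_le_half κ hw)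
    (S.norm_X_le_half (-κ) hv) (by norm_num)
  rw [dlogd, tr_rmul S.isKW, tr_rmul S.isKW, map_neg, map_neg, map_neg, ← X_apply, ← X_apply,
    ← sub_eq_add_neg, sub_eq_zero, Z, Z, neg_neg]
  exact h.symm

end IsSob

end

end AKNS

namespace AKNS

noncomputable section

open scoped ENNReal NNReal
open Filter Topology

/-! ### Convolutions and diagonals -/

/-- The convolution of two functions on the frequency line. -/
def cv (u f : ℝ → ℂ) (h : ℝ) : ℂ := ∫ k, u (h - k) * f k

/-- The bilinear pairing `∫ f(h) g(-h) dh`. -/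
def bp (f g : ℝ → ℂ) : ℂ := ∫ h, f h * g (-h)

lemma bp_comm (f g : ℝ → ℂ) : bp f g = bp g f := by
  rw [bp, bp, ← integral_neg_eq_self]
  exact integral_congr_ae (.of_forall fun h => by simp only [neg_neg]; ring)

lemma bp_congr {f f' g g' : ℝ → ℂ} (h : f =ᵐ[volume] f') (h' : g =ᵐ[volume] g') :
    bp f g = bp f' g' := by
  refine integral_congr_ae ?_
  filter_upwards [h, ae_neg h'] with x h1 h2
  rw [h1, h2]

lemma integrable_bp {f g : ℝ → ℂ} (hf : MemLp f 2) (hg : MemLp g 2) :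
    Integrable fun h => f h * g (-h) :=
  hf.integrable_mul (hg.comp_measurePreserving (Measure.measurePreserving_neg volume))

lemma ae_integrable_cv_diag {u : ℝ → ℂ} {K : ℝ × ℝ → ℂ} (hu : Integrable u) (hK : Integrable K) :
    ∀ᵐ h : ℝ, Integrable fun p : ℝ × ℝ => u (h - p.2) * K (shear p) := by
  have hN : Integrable fun k => ∫ ξ, ‖K (shear (ξ, k))‖ :=
    (integrable_shear hK).norm.integral_prod_right
  filter_upwards [hN.ae_convolution_exists (ContinuousLinearMap.mul ℝ ℝ) hu.norm] with h hh
  have hh : Integrable fun k => (∫ ξ, ‖K (shear (ξ, k))‖) * ‖u (h - k)‖ := hh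
  have hm : AEStronglyMeasurable (fun p : ℝ × ℝ => u (h - p.2) * K (shear p)) := by
    refine AEStronglyMeasurable.mul ?_ (integrable_shear hK).aestronglyMeasurable
    have h1 : AEStronglyMeasurable (fun k => u (h - k)) :=
      (hu.comp_sub_left h).aestronglyMeasurable
    exact h1.comp_quasiMeasurePreserving Measure.quasiMeasurePreserving_snd
  rw [Measure.volume_eq_prod] at hm ⊢
  rw [integrable_prod_iff' hm]
  refine ⟨?_, ?_⟩
  · filter_upwards [ae_integrable_diag hK] with k hk
    exact hk.const_mul _
  · refine hh.congr (.of_forall fun k => ?_)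
    simp only [norm_mul, integral_const_mul]
    ring

lemma cv_diag {u : ℝ → ℂ} {K : ℝ × ℝ → ℂ} {h : ℝ}
    (hh : Integrable fun p : ℝ × ℝ => u (h - p.2) * K (shear p)) :
    ∫ p : ℝ × ℝ, u (h - p.2) * K (shear p) = cv u (diag K) h := by
  rw [Measure.volume_eq_prod] at hh ⊢
  rw [integral_prod_symm _ hh]
  simp only [integral_const_mul, cv, diag]

lemma measurePreserving_shear_swap (h : ℝ) :
    MeasurePreserving fun p : ℝ × ℝ => (p.2, p.2 + h - p.1) := by
  have h1 : MeasurePreserving (fun p : ℝ × ℝ => (p.1, p.2 + h)) :=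
    (MeasurePreserving.id (volume : Measure ℝ)).prod (measurePreserving_add_right volume h)
  have := h1.comp (measurePreserving_shear.comp
    (Measure.measurePreserving_swap (μ := (volume : Measure ℝ)) (ν := (volume : Measure ℝ))))
  have e : (fun p : ℝ × ℝ => (p.2, p.2 + h - p.1)) =
      (fun p : ℝ × ℝ => (p.1, p.2 + h)) ∘ shear ∘ Prod.swap := by
    ext p <;> simp [shear]
    ring
  rwa [e]

lemma measurableEmbedding_shear_swap (h : ℝ) :
    MeasurableEmbedding fun p : ℝ × ℝ => (p.2, p.2 + h - p.1) := by
  refine MeasurableEmbedding.of_measurable_inverse (g := fun p => (p.1 + h - p.2, p.1))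
    (by fun_prop) ?_ (by fun_prop) ?_
  · have : Function.Surjective fun p : ℝ × ℝ => (p.2, p.2 + h - p.1) :=
      fun p => ⟨(p.1 + h - p.2, p.1), by simp⟩
    rw [this.range_eq]
    exact MeasurableSet.univ
  · intro p
    simp

lemma integrable_left {u : ℝ → ℂ} {K : ℝ × ℝ → ℂ} {h : ℝ}
    (hh : Integrable fun p : ℝ × ℝ => u (h - p.2) * K (shear p)) :
    Integrable (fun p : ℝ × ℝ => u (p.1 - p.2) * K (p.2, p.1 - h)) := by
  refine (((measurePreserving_shear_swap h).integrable_comp_emb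
    (measurableEmbedding_shear_swap h)).2 hh).congr (.of_forall fun p => ?_)
  simp only [Function.comp, shear]
  rw [show h - (p.2 + h - p.1) = p.1 - p.2 by ring, show p.2 - (p.2 + h - p.1) = p.1 - h by ring]

lemma integral_left {u : ℝ → ℂ} {K : ℝ × ℝ → ℂ} {h : ℝ}
    (hh : Integrable fun p : ℝ × ℝ => u (h - p.2) * K (shear p)) :
    ∫ ξ, ∫ ζ, u (ξ - ζ) * K (ζ, ξ - h) = cv u (diag K) h := by
  rw [← cv_diag hh, ← (measurePreserving_shear_swap h).integral_comp
    (measurableEmbedding_shear_swap h), Measure.volume_eq_prod]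
  have h1 := integrable_left hh
  rw [Measure.volume_eq_prod] at h1
  rw [← integral_prod _ h1]
  refine integral_congr_ae (.of_forall fun p => ?_)
  simp only [shear]
  rw [show h - (p.2 + h - p.1) = p.1 - p.2 by ring, show p.2 - (p.2 + h - p.1) = p.1 - h by ring]

lemma integrable_right {u : ℝ → ℂ} {K : ℝ × ℝ → ℂ} {h : ℝ}
    (hh : Integrable fun p : ℝ × ℝ => u (h - p.2) * K (shear p)) :
    Integrable (fun p : ℝ × ℝ => K (p.1, p.2) * u (p.2 - (p.1 - h))) := by
  refine (integrable_shear hh).congr (.of_forall fun p => ?_)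
  simp only [shear_shear]
  rw [mul_comm, shear, show h - (p.1 - p.2) = p.2 - (p.1 - h) by ring]

lemma integral_right {u : ℝ → ℂ} {K : ℝ × ℝ → ℂ} {h : ℝ}
    (hh : Integrable fun p : ℝ × ℝ => u (h - p.2) * K (shear p)) :
    ∫ ξ, ∫ ζ, K (ξ, ζ) * u (ζ - (ξ - h)) = cv u (diag K) h := by
  have h1 := integrable_right hh
  rw [Measure.volume_eq_prod] at h1
  rw [← cv_diag hh, ← integral_shear, Measure.volume_eq_prod, ← integral_prod _ h1]
  refine integral_congr_ae (.of_forall fun p => ?_)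
  simp only [shear]
  rw [mul_comm, show h - (p.1 - p.2) = p.2 - (p.1 - h) by ring, sub_sub_cancel]

/-! ### A partial fraction integral -/

lemma hasDerivAt_partial_fraction {κ : ℝ} (hκ : κ ≠ 0) (h ξ : ℝ) :
    HasDerivAt (fun ξ : ℝ => ((Real.arctan (ξ / κ) + Real.arctan ((ξ - h) / κ) : ℝ) : ℂ) +
        Complex.I * ((Real.log ((κ ^ 2 + ξ ^ 2) / (κ ^ 2 + (ξ - h) ^ 2)) / 2 : ℝ) : ℂ))
      (((κ : ℂ) - Complex.I * ξ)⁻¹ + ((κ : ℂ) + Complex.I * (ξ - h : ℝ))⁻¹) ξ := by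
  have hp : ∀ x : ℝ, 0 < κ ^ 2 + x ^ 2 := fun x => by positivity
  have h1 : HasDerivAt (fun ξ : ℝ => Real.arctan (ξ / κ) + Real.arctan ((ξ - h) / κ))
      (κ / (κ ^ 2 + ξ ^ 2) + κ / (κ ^ 2 + (ξ - h) ^ 2)) ξ := by
    refine (((hasDerivAt_id ξ).div_const κ).arctan.add
      (((hasDerivAt_id ξ).sub_const h).div_const κ).arctan).congr_deriv ?_
    have := hp ξ
    have := hp (ξ - h)
    simp only [id]
    field_simp
  have h2 : HasDerivAt (fun ξ : ℝ => Real.log ((κ ^ 2 + ξ ^ 2) / (κ ^ 2 + (ξ - h) ^ 2)) / 2)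
      (ξ / (κ ^ 2 + ξ ^ 2) - (ξ - h) / (κ ^ 2 + (ξ - h) ^ 2)) ξ := by
    have e : (fun ξ : ℝ => Real.log ((κ ^ 2 + ξ ^ 2) / (κ ^ 2 + (ξ - h) ^ 2)) / 2) =
        fun ξ => (Real.log (κ ^ 2 + ξ ^ 2) - Real.log (κ ^ 2 + (ξ - h) ^ 2)) / 2 :=
      funext fun x => by rw [Real.log_div (hp _).ne' (hp _).ne']
    rw [e]
    have d1 : HasDerivAt (fun ξ : ℝ => κ ^ 2 + ξ ^ 2) (2 * ξ) ξ := by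
      simpa using (hasDerivAt_pow 2 ξ).const_add (κ ^ 2)
    have d2 : HasDerivAt (fun ξ : ℝ => κ ^ 2 + (ξ - h) ^ 2) (2 * (ξ - h)) ξ := by
      simpa using (((hasDerivAt_id ξ).sub_const h).pow 2).const_add (κ ^ 2)
    refine (((d1.log (hp _).ne').sub (d2.log (hp _).ne')).div_const 2).congr_deriv ?_
    ring
  refine (h1.ofReal_comp.add (h2.ofReal_comp.const_mul Complex.I)).congr_deriv ?_
  have inv1 : ∀ x : ℝ, ((κ : ℂ) - Complex.I * x)⁻¹ =
      ((κ / (κ ^ 2 + x ^ 2) : ℝ) : ℂ) + Complex.I * ((x / (κ ^ 2 + x ^ 2) : ℝ) : ℂ) := by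
    intro x
    have hx : ((κ : ℂ) ^ 2 + (x : ℂ) ^ 2) ≠ 0 := by exact_mod_cast (hp x).ne'
    refine inv_eq_of_mul_eq_one_right ?_
    push_cast
    field_simp
    linear_combination (x : ℂ) ^ 2 * (-1) * Complex.I_sq
  have i2 := inv1 (-(ξ - h))
  rw [inv1 ξ, show ((κ : ℂ) + Complex.I * (ξ - h : ℝ)) =
    (κ : ℂ) - Complex.I * ((-(ξ - h) : ℝ) : ℂ) by push_cast; ring, i2, neg_sq]
  push_cast
  ring

lemma tendsto_log_ratio (κ h : ℝ) {l : Filter ℝ} (hl : Tendsto (fun ξ : ℝ => |ξ|) l atTop) :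
    Tendsto (fun ξ : ℝ => Real.log ((κ ^ 2 + ξ ^ 2) / (κ ^ 2 + (ξ - h) ^ 2)) / 2) l (𝓝 0) := by
  have hl' : Tendsto (fun ξ : ℝ => ξ⁻¹) l (𝓝 0) := by
    rw [tendsto_zero_iff_abs_tendsto_zero]
    simp only [Function.comp_def, abs_inv]
    exact hl.inv_tendsto_atTop
  have h1 : Tendsto (fun ξ : ℝ => (κ ^ 2 * ξ⁻¹ ^ 2 + 1) / (κ ^ 2 * ξ⁻¹ ^ 2 + (1 - h * ξ⁻¹) ^ 2)) l
      (𝓝 ((κ ^ 2 * 0 ^ 2 + 1) / (κ ^ 2 * 0 ^ 2 + (1 - h * 0) ^ 2))) :=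
    Tendsto.div (((hl'.pow 2).const_mul _).add_const 1)
      (((hl'.pow 2).const_mul _).add (((hl'.const_mul h).const_sub 1).pow 2)) (by norm_num)
  have h2 : Tendsto (fun ξ : ℝ => (κ ^ 2 + ξ ^ 2) / (κ ^ 2 + (ξ - h) ^ 2)) l (𝓝 1) := by
    have e : ((κ ^ 2 * 0 ^ 2 + 1) / (κ ^ 2 * 0 ^ 2 + (1 - h * 0) ^ 2) : ℝ) = 1 := by norm_num
    rw [e] at h1
    refine h1.congr' ?_
    filter_upwards [hl.eventually_gt_atTop 0] with ξ hξ
    have hξ : ξ ≠ 0 := abs_pos.1 hξ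
    rw [← mul_div_mul_left (κ ^ 2 + ξ ^ 2) _ (pow_ne_zero 2 (inv_ne_zero hξ))]
    congr 1 <;> field_simp
  have h3 := ((Real.continuousAt_log one_ne_zero).tendsto.comp h2).div_const 2
  simpa using h3

lemma integrable_res_mul_res {κ : ℝ} (hκ : 1 ≤ |κ|) (h : ℝ) :
    Integrable fun ξ : ℝ => ((κ : ℂ) - Complex.I * ξ)⁻¹ * ((κ : ℂ) + Complex.I * (ξ - h : ℝ))⁻¹ := by
  have h0 : MemLp (fun ξ : ℝ => ((κ : ℂ) - Complex.I * ξ)⁻¹) 2 := by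
    rw [memLp_two_iff_integrable_sq_norm (by fun_prop)]
    refine Integrable.mono' (g := jp (-1)) (integrable_jp (by norm_num)) (by fun_prop)
      (.of_forall fun ξ => ?_)
    have : (1 : ℝ) ≤ κ ^ 2 := by
      rw [← sq_abs]
      exact one_le_pow₀ hκ
    rw [norm_inv, norm_res, Real.norm_of_nonneg (by positivity), inv_pow,
      Real.sq_sqrt (by positivity), jp, Real.rpow_neg_one]
    gcongr
  have h1 : MemLp (fun ξ : ℝ => ((κ : ℂ) + Complex.I * (ξ - h : ℝ))⁻¹) 2 := by
    have h2 := h0.comp_measurePreserving ((Measure.measurePreserving_neg volume).comp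
      (measurePreserving_sub_right volume h))
    refine (memLp_congr_ae (.of_forall fun ξ => ?_)).1 h2
    simp
    ring
  exact h0.integrable_mul h1

lemma integral_res_mul_res {κ : ℝ} (hκ : 1 ≤ |κ|) (h : ℝ) :
    ((2 * κ : ℂ) - Complex.I * h) *
      ∫ ξ : ℝ, ((κ : ℂ) - Complex.I * ξ)⁻¹ * ((κ : ℂ) + Complex.I * (ξ - h : ℝ))⁻¹ =
      2 * Real.pi * Real.sign κ := by
  have hκ0 : κ ≠ 0 := by
    rintro rfl
    norm_num at hκ
  have e : ∀ ξ : ℝ, ((2 * κ : ℂ) - Complex.I * h) *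
      (((κ : ℂ) - Complex.I * ξ)⁻¹ * ((κ : ℂ) + Complex.I * (ξ - h : ℝ))⁻¹) =
      ((κ : ℂ) - Complex.I * ξ)⁻¹ + ((κ : ℂ) + Complex.I * (ξ - h : ℝ))⁻¹ := by
    intro ξ
    have h1 := res_ne_zero hκ ξ
    have h2 : (κ : ℂ) + Complex.I * (ξ - h : ℝ) ≠ 0 := by
      have := res_ne_zero hκ (-(ξ - h))
      push_cast at this ⊢
      convert this using 1
      ring
    field_simp
    push_cast
    ring
  rw [← integral_const_mul]
  have hint := (integrable_res_mul_res hκ h).const_mul ((2 * κ : ℂ) - Complex.I * h)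
  simp only [e] at hint ⊢
  have hpi : ∀ {l : Filter ℝ} {a : ℝ}, Tendsto (fun ξ : ℝ => |ξ|) l atTop →
      (∀ c : ℝ, Tendsto (fun ξ => Real.arctan ((ξ - c) / κ)) l (𝓝 a)) →
      Tendsto (fun ξ : ℝ => ((Real.arctan (ξ / κ) + Real.arctan ((ξ - h) / κ) : ℝ) : ℂ) +
        Complex.I * ((Real.log ((κ ^ 2 + ξ ^ 2) / (κ ^ 2 + (ξ - h) ^ 2)) / 2 : ℝ) : ℂ)) l
        (𝓝 ((a + a : ℝ) + Complex.I * (0 : ℝ))) := by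
    intro l a hl ha
    have h0 := ha 0
    simp only [sub_zero] at h0
    exact ((Complex.continuous_ofReal.tendsto _).comp (h0.add (ha h))).add
      (((Complex.continuous_ofReal.tendsto _).comp (tendsto_log_ratio κ h hl)).const_mul _)
  have htop : ∀ c : ℝ, Tendsto (fun ξ : ℝ => ξ - c) atTop atTop := fun c =>
    tendsto_atTop_add_const_right _ _ tendsto_id
  have hbot : ∀ c : ℝ, Tendsto (fun ξ : ℝ => ξ - c) atBot atBot := fun c =>
    tendsto_atBot_add_const_right _ _ tendsto_id
  have at1 : Tendsto Real.arctan atTop (𝓝 (Real.pi / 2)) :=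
    Real.tendsto_arctan_atTop.mono_right nhdsWithin_le_nhds
  have at2 : Tendsto Real.arctan atBot (𝓝 (-(Real.pi / 2))) :=
    Real.tendsto_arctan_atBot.mono_right nhdsWithin_le_nhds
  rcases lt_or_gt_of_ne hκ0 with hneg | hpos
  · rw [integral_of_hasDerivAt_of_tendsto (fun ξ => hasDerivAt_partial_fraction hκ0 h ξ) hint
      (hpi (a := Real.pi / 2) tendsto_abs_atBot_atTop fun c =>
        at1.comp (by
        simpa only [div_eq_mul_inv] using (hbot c).atBot_mul_const_of_neg (inv_lt_zero.2 hneg)))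
      (hpi (a := -(Real.pi / 2)) tendsto_abs_atTop_atTop fun c =>
        at2.comp ((htop c).atTop_div_const_of_neg hneg)), Real.sign_of_neg hneg]
    push_cast
    ring
  · rw [integral_of_hasDerivAt_of_tendsto (fun ξ => hasDerivAt_partial_fraction hκ0 h ξ) hint
      (hpi (a := -(Real.pi / 2)) tendsto_abs_atBot_atTop fun c =>
        at2.comp ((hbot c).atBot_div_const hpos))
      (hpi (a := Real.pi / 2) tendsto_abs_atTop_atTop fun c =>
        at1.comp ((htop c).atTop_div_const hpos)), Real.sign_of_pos hpos]
    push_cast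
    ring

end

end AKNS

namespace AKNS

noncomputable section

open scoped ENNReal NNReal
open Filter Topology

namespace IsSob

variable {s : ℝ} {ω : ℝ → ℝ} {μ : Measure ℝ} (S : IsSob s ω μ)
include S

/-! ### The differential equations of the diagonal Green's function -/

lemma coeFn_X (κ : ℝ) (u : Lp ℂ 2 μ) : S.X κ u =ᵐ[volume] fun p => sym κ p.1 * qker u p := by
  filter_upwards [coeFn_lmul S.isKW (isMult_sym κ) (S.Q u), S.coeFn_Q u] with p h1 h2
  rw [X_apply, h1, h2]

omit S in
lemma jp_cancel (ξ : ℝ) : ((jp (-(1 / 4)) ξ : ℝ) : ℂ) * (jp (-(1 / 4)) ξ : ℝ) * (jp (1 / 2) ξ : ℝ) = 1 := by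
  rw [← Complex.ofReal_mul, ← jp_add, ← Complex.ofReal_mul, ← jp_add]
  norm_num [jp_zero]

omit S in
lemma sym_mul_res {κ : ℝ} (hκ : 1 ≤ |κ|) (ξ : ℝ) :
    sym κ ξ * ((κ : ℂ) - Complex.I * ξ) = (jp (1 / 2) ξ : ℝ) := by
  rw [sym_eq hκ, mul_assoc, inv_mul_cancel₀ (res_ne_zero hκ ξ), mul_one]

lemma conv_left {κ : ℝ} (hκ : 1 ≤ |κ|) (σ : ℝ) (u : Lp ℂ 2 μ) (Y : Lp ℂ 2 (kmeas (kw (tex s) ω))) :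
    ∀ᵐ p : ℝ × ℝ, ((κ : ℂ) - Complex.I * p.1) *
        flat (rmul _ (isMult_sym σ) (S.isKW.mul (S.X κ u) Y)) p =
      cpi * ∫ ζ, u (p.1 - ζ) * flat (rmul _ (isMult_sym σ) Y) (ζ, p.2) := by
  have h3 := (S.isKW.coeFn_mul (S.X κ u) Y).trans (kcomp_congr (S.coeFn_X κ u) .rfl)
  filter_upwards [coeFn_rmul S.isKW (isMult_sym σ) (S.isKW.mul (S.X κ u) Y), h3,
    ae_sections (coeFn_rmul S.isKW (isMult_sym σ) Y)] with p h1 h2 h4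
  rw [flat, h1, h2, kcomp, ← integral_const_mul, ← integral_const_mul, ← integral_const_mul,
    ← integral_const_mul]
  refine integral_congr_ae ?_
  filter_upwards [h4.2] with ζ h5
  simp only [flat, h5, qker]
  push_cast
  linear_combination (sym σ p.2 * Y (ζ, p.2) * (jp (-(1 / 4)) p.2) * (jp (-(1 / 4)) ζ) * cpi *
    u (p.1 - ζ)) * (jp_cancel p.1 + (jp (-(1 / 4)) p.1 * jp (-(1 / 4)) p.1) * sym_mul_res hκ p.1)

lemma conv_right (κ : ℝ) {σ : ℝ} (hσ : 1 ≤ |σ|) (u : Lp ℂ 2 μ)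
    (Y : Lp ℂ 2 (kmeas (kw (tex s) ω))) :
    ∀ᵐ p : ℝ × ℝ, ((σ : ℂ) - Complex.I * p.2) *
        flat (rmul _ (isMult_sym σ) (S.isKW.mul Y (S.X κ u))) p =
      cpi * ∫ ζ, flat (rmul _ (isMult_sym κ) Y) (p.1, ζ) * u (ζ - p.2) := by
  have h3 := (S.isKW.coeFn_mul Y (S.X κ u)).trans (kcomp_congr .rfl (S.coeFn_X κ u))
  filter_upwards [coeFn_rmul S.isKW (isMult_sym σ) (S.isKW.mul Y (S.X κ u)), h3,
    ae_sections (coeFn_rmul S.isKW (isMult_sym κ) Y)] with p h1 h2 h4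
  rw [flat, h1, h2, kcomp, ← integral_const_mul, ← integral_const_mul, ← integral_const_mul,
    ← integral_const_mul]
  refine integral_congr_ae ?_
  filter_upwards [h4.1] with ζ h5
  simp only [flat, h5, qker]
  push_cast
  linear_combination (sym κ ζ * Y (p.1, ζ) * (jp (-(1 / 4)) p.1) * (jp (-(1 / 4)) ζ) * cpi *
    u (ζ - p.2)) * (jp_cancel p.2 + (jp (-(1 / 4)) p.2 * jp (-(1 / 4)) p.2) * sym_mul_res hσ p.2)

lemma comm {κ₁ σ : ℝ} (h₁ : 1 ≤ |κ₁|) (hσ : 1 ≤ |σ|) (κ₂ : ℝ) {u₁ u₂ : Lp ℂ 2 μ}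
    (hu₁ : Integrable u₁) (hu₂ : Integrable u₂) {P Y₁ Y₂ : Lp ℂ 2 (kmeas (kw (tex s) ω))}
    (hP₁ : P = S.isKW.mul (S.X κ₁ u₁) Y₁) (hP₂ : P = S.isKW.mul Y₂ (S.X κ₂ u₂)) :
    ∀ᵐ h : ℝ, ((κ₁ - σ : ℂ) - Complex.I * h) * S.D (rmul _ (isMult_sym σ) P) h =
      cpi * (cv u₁ (S.D (rmul _ (isMult_sym σ) Y₁)) h -
        cv u₂ (S.D (rmul _ (isMult_sym κ₂) Y₂)) h) := by
  have hcv : ∀ (u : ℝ → ℂ) (Y : Lp ℂ 2 (kmeas (kw (tex s) ω))) (h : ℝ),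
      cv u (S.D Y) h = cpi * cv u (diag (flat Y)) h := by
    intro u Y h
    rw [cv, cv, ← integral_const_mul]
    have hq : ∀ᵐ k : ℝ, S.D Y k = dker Y k := S.coeFn_D Y
    refine integral_congr_ae ?_
    filter_upwards [hq] with k hk
    rw [hk, dker]
    ring
  have i1 := ae_integrable_cv_diag hu₁ (S.integrable_flat (rmul _ (isMult_sym σ) Y₁))
  have i2 := ae_integrable_cv_diag hu₂ (S.integrable_flat (rmul _ (isMult_sym κ₂) Y₂))
  have l1 := ae_shear_sections (S.conv_left h₁ σ u₁ Y₁)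
  have l2 := ae_shear_sections (S.conv_right κ₂ hσ u₂ Y₂)
  rw [← hP₁] at l1
  rw [← hP₂] at l2
  filter_upwards [i1, i2, l1, l2, S.coeFn_D (rmul _ (isMult_sym σ) P)] with h j1 j2 m1 m2 hD
  rw [hD, hcv, hcv, dker, diag, ← integral_left j1, ← integral_right j2]
  have k1 := integrable_left j1
  have k2 := integrable_right j2
  rw [Measure.volume_eq_prod] at k1 k2
  rw [mul_left_comm, ← integral_const_mul, ← mul_sub, mul_left_comm cpi cpi]
  congr 1
  rw [← integral_sub k1.integral_prod_left k2.integral_prod_left, ← integral_const_mul]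
  refine integral_congr_ae ?_
  filter_upwards [m1, m2] with ξ n1 n2
  simp only [shear]
  rw [mul_sub, ← n1, ← n2]
  push_cast
  ring

lemma D_X {κ : ℝ} (hκ : 1 ≤ |κ|) (u : Lp ℂ 2 μ) :
    ∀ᵐ h : ℝ, ((2 * κ : ℂ) - Complex.I * h) * S.D (rmul _ (isMult_sym (-κ)) (S.X κ u)) h =
      - (Real.sign κ) * u h := by
  have hκ' : 1 ≤ |-κ| := by rwa [abs_neg]
  filter_upwards [S.coeFn_D (rmul _ (isMult_sym (-κ)) (S.X κ u)),
    ae_shear_sections (coeFn_rmul S.isKW (isMult_sym (-κ)) (S.X κ u)),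
    ae_shear_sections (S.coeFn_X κ u)] with h h1 h2 h3
  have e : diag (flat (rmul _ (isMult_sym (-κ)) (S.X κ u))) h =
      -(cpi * u h) * ∫ ξ : ℝ, ((κ : ℂ) - Complex.I * ξ)⁻¹ * ((κ : ℂ) + Complex.I * (ξ - h : ℝ))⁻¹ := by
    rw [← integral_const_mul]
    refine integral_congr_ae ?_
    filter_upwards [h2, h3] with ξ h4 h5
    simp only [flat, shear, h4, h5, qker, sym_eq hκ, sym_eq hκ', sub_sub_cancel]
    have e2 : ((-κ : ℝ) : ℂ) - Complex.I * (ξ - h : ℝ) = -((κ : ℂ) + Complex.I * (ξ - h : ℝ)) := by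
      push_cast; ring
    rw [e2, inv_neg]
    have c1 := jp_cancel ξ
    have c2 := jp_cancel (ξ - h)
    push_cast at c1 c2 ⊢
    linear_combination -(cpi * u h * ((κ : ℂ) - Complex.I * ξ)⁻¹ *
      ((κ : ℂ) + Complex.I * ((ξ : ℂ) - h))⁻¹) * (c1 * (jp (-(1 / 4)) (ξ - h) * jp (-(1 / 4)) (ξ - h) *
        jp (1 / 2) (ξ - h)) + c2)
  rw [h1, dker, e]
  have := integral_res_mul_res hκ h
  have hc := cpi_mul_cpi
  have hpi : (2 * Real.pi : ℂ) ≠ 0 := by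
    have := Real.pi_ne_zero
    exact mul_ne_zero two_ne_zero (by exact_mod_cast this)
  calc _ = -(cpi * cpi * u h) * (((2 * κ : ℂ) - Complex.I * h) *
      ∫ ξ : ℝ, ((κ : ℂ) - Complex.I * ξ)⁻¹ * ((κ : ℂ) + Complex.I * (ξ - h : ℝ))⁻¹) := by ring
    _ = _ := by
      rw [this, hc]
      push_cast
      field_simp

end IsSob

end

end AKNS

namespace AKNS

noncomputable section

open scoped ENNReal NNReal
open Filter Topology

/-! ### The bracket of two diagonal Green's functions, for decaying functions -/

lemma memLp_two_of_lintegral {f : ℝ → ℂ} (hf : AEStronglyMeasurable f)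
    (h : ∫⁻ x, ‖f x‖ₑ ^ 2 < ⊤) : MemLp f 2 := by
  refine ⟨hf, ?_⟩
  rw [eLpNorm_lt_top_iff_lintegral_rpow_enorm_lt_top two_ne_zero ENNReal.ofNat_ne_top]
  simpa using h

lemma MemLp.lintegral_lt_top {f : ℝ → ℂ} (hf : MemLp f 2) : ∫⁻ x, ‖f x‖ₑ ^ 2 < ⊤ := by
  have := hf.2
  rw [eLpNorm_lt_top_iff_lintegral_rpow_enorm_lt_top two_ne_zero ENNReal.ofNat_ne_top] at this
  simpa using this

lemma integrable_cv_mul {u f g : ℝ → ℂ} (hu : Integrable u) (hf : MemLp f 2) (hg : MemLp g 2) :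
    Integrable fun p : ℝ × ℝ => u (p.1 - p.2) * f p.2 * g (-p.1) := by
  have hgn : AEStronglyMeasurable fun x => g (-x) :=
    (hg.comp_measurePreserving (Measure.measurePreserving_neg volume)).1
  have hm : AEStronglyMeasurable fun p : ℝ × ℝ => u (p.1 - p.2) * f p.2 * g (-p.1) := by
    have h1 : AEStronglyMeasurable fun p : ℝ × ℝ => u (p.1 - p.2) :=
      hu.1.comp_quasiMeasurePreserving (quasiMeasurePreserving_sub volume volume)
    have h2 : AEStronglyMeasurable fun p : ℝ × ℝ => f p.2 :=
      hf.1.comp_quasiMeasurePreserving Measure.quasiMeasurePreserving_snd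
    have h3 : AEStronglyMeasurable fun p : ℝ × ℝ => g (-p.1) :=
      hgn.comp_quasiMeasurePreserving Measure.quasiMeasurePreserving_fst
    exact (h1.mul h2).mul h3
  refine ⟨hm, ?_⟩
  rw [hasFiniteIntegral_iff_enorm, lintegral_prod_symm_shear hm.enorm]
  have hb : ∀ k : ℝ, ∫⁻ ξ, ‖u ((shear (ξ, k)).1 - (shear (ξ, k)).2) * f (shear (ξ, k)).2 *
      g (-(shear (ξ, k)).1)‖ₑ ≤
      ‖u k‖ₑ * ((∫⁻ x, ‖f x‖ₑ ^ 2) * ∫⁻ x, ‖g x‖ₑ ^ 2) ^ (1 / 2 : ℝ) := by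
    intro k
    simp only [shear, sub_sub_cancel, enorm_mul, _root_.mul_assoc]
    rw [lintegral_const_mul' _ _ enorm_ne_top]
    gcongr
    rw [← ENNReal.rpow_inv_le_iff (by norm_num)]
    have h := sq_lintegral_mul_le (μ := volume) (f := fun x => ‖f (x - k)‖ₑ)
      (g := fun x => ‖g (-x)‖ₑ)
      (hf.1.comp_quasiMeasurePreserving
        (measurePreserving_sub_right volume k).quasiMeasurePreserving).enorm hgn.enorm
    rw [lintegral_sub_right_eq_self (fun x => ‖f x‖ₑ ^ 2) k,
      lintegral_neg_eq_self (fun x => ‖g x‖ₑ ^ 2)] at h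
    simpa using h
  refine (lintegral_mono hb).trans_lt ?_
  rw [lintegral_mul_const'' _ hu.1.enorm]
  refine ENNReal.mul_lt_top hu.2 (ENNReal.rpow_lt_top_of_nonneg (by norm_num) ?_)
  exact (ENNReal.mul_lt_top (MemLp.lintegral_lt_top hf) (MemLp.lintegral_lt_top hg)).ne

lemma integrable_cv {u f g : ℝ → ℂ} (hu : Integrable u) (hf : MemLp f 2) (hg : MemLp g 2) :
    Integrable fun h => cv u f h * g (-h) := by
  refine (integrable_cv_mul hu hf hg).integral_prod_left.congr (.of_forall fun h => ?_)
  simp only [cv, integral_mul_const]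

lemma bp_cv {u f g : ℝ → ℂ} (hu : Integrable u) (hf : MemLp f 2) (hg : MemLp g 2) :
    bp (cv u f) g = bp f (cv u g) := by
  have h := integrable_cv_mul hu hf hg
  have e1 : bp (cv u f) g = ∫ h, ∫ k, u (h - k) * f k * g (-h) := by
    simp only [bp, cv, integral_mul_const]
  rw [e1, integral_integral_swap h, bp]
  refine integral_congr_ae (.of_forall fun k => ?_)
  simp only [cv]
  rw [← integral_const_mul, ← integral_neg_eq_self]
  refine integral_congr_ae (.of_forall fun l => ?_)
  simp only [neg_neg]
  rw [show -k - l = -l - k by ring]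
  ring

/-- Multiplication by `i h`. -/
def ihm (f : ℝ → ℂ) (h : ℝ) : ℂ := Complex.I * h * f h

lemma bp_ihm (f g : ℝ → ℂ) : bp (ihm f) g = - bp f (ihm g) := by
  rw [bp, bp, ← integral_neg]
  refine integral_congr_ae (.of_forall fun h => ?_)
  simp only [ihm, Complex.ofReal_neg]
  ring

lemma bp_ihm_swap (f g : ℝ → ℂ) : bp (ihm f) g = - bp (ihm g) f := by
  rw [bp_ihm, bp_comm]

lemma bracket_half {w v g g' γ a a' δ : ℝ → ℂ} {κ σ : ℝ}
    (hw : Integrable w) (hv : Integrable v) (hw2 : MemLp w 2) (hv2 : MemLp v 2)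
    (hγ : MemLp γ 2) (ha : MemLp a 2) (ha' : MemLp a' 2)
    (hgh : MemLp (ihm g) 2) (hgh' : MemLp (ihm g') 2)
    (e1 : ∀ᵐ h : ℝ, ((2 * κ : ℂ) - Complex.I * h) * g h = - σ * w h + cpi * cv w γ h)
    (e2 : ∀ᵐ h : ℝ, (-(2 * κ : ℂ) - Complex.I * h) * g' h = σ * v h - cpi * cv v γ h)
    (e3 : ∀ᵐ h : ℝ, - (Complex.I * h) * δ h = 2 * cpi * (cv v a h - cv w a' h))
    (z : bp w a' = bp v a) :
    2 * κ * (bp g a' - bp g' a) = bp (ihm g) a' + bp (ihm g') a + 1 / 2 * bp γ (ihm δ) := by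
  have i1 : Integrable fun h => - (σ : ℂ) * (w h * a' (-h)) + cpi * (cv w γ h * a' (-h)) :=
    ((integrable_bp hw2 ha').const_mul _).add ((integrable_cv hw hγ ha').const_mul _)
  have i2 : Integrable fun h => (σ : ℂ) * (v h * a (-h)) - cpi * (cv v γ h * a (-h)) :=
    ((integrable_bp hv2 ha).const_mul _).sub ((integrable_cv hv hγ ha).const_mul _)
  have s1 : 2 * κ * bp g a' = - σ * bp w a' + cpi * bp (cv w γ) a' + bp (ihm g) a' := by
    simp only [bp]
    rw [← integral_const_mul, ← integral_const_mul, ← integral_const_mul,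
      ← integral_add ((integrable_bp hw2 ha').const_mul _) ((integrable_cv hw hγ ha').const_mul _),
      ← integral_add i1 (integrable_bp hgh ha')]
    refine integral_congr_ae ?_
    filter_upwards [e1] with h h1
    simp only [ihm]
    linear_combination a' (-h) * h1
  have s2 : -(2 * κ) * bp g' a = σ * bp v a - cpi * bp (cv v γ) a + bp (ihm g') a := by
    simp only [bp]
    rw [← integral_const_mul, ← integral_const_mul, ← integral_const_mul,
      ← integral_sub ((integrable_bp hv2 ha).const_mul _) ((integrable_cv hv hγ ha).const_mul _),
      ← integral_add i2 (integrable_bp hgh' ha)]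
    refine integral_congr_ae ?_
    filter_upwards [e2] with h h1
    simp only [ihm]
    linear_combination a (-h) * h1
  have s3 : cpi * (bp γ (cv w a') - bp γ (cv v a)) = 1 / 2 * bp γ (ihm δ) := by
    rw [bp_comm γ, bp_comm γ, bp_comm γ]
    simp only [bp]
    rw [← integral_sub (integrable_cv hw ha' hγ) (integrable_cv hv ha hγ), ← integral_const_mul,
      ← integral_const_mul]
    refine integral_congr_ae ?_
    filter_upwards [e3] with h h1
    simp only [ihm]
    linear_combination γ (-h) / 2 * h1
  rw [bp_cv hw hγ ha'] at s1
  rw [bp_cv hv hγ ha] at s2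
  linear_combination s1 + s2 + s3 - σ * z

namespace IsSob

variable {s : ℝ} {ω : ℝ → ℝ} {μ : Measure ℝ} (S : IsSob s ω μ)
include S

lemma le_dens {c : ℝ} (hc : 0 < c) (hcω : ∀ x, c * (1 + |x|) ^ 2 ≤ ω x) (x : ℝ) :
    ENNReal.ofReal (c ^ 2 / 4) * ENNReal.ofReal (1 + x ^ 2) ≤ dens s ω x := by
  rw [dens, ofReal_sq (zero_le_one.trans (S.hω.one_le x)), ← ENNReal.ofReal_mul (by positivity),
    ← ENNReal.ofReal_mul (by positivity)]
  refine ENNReal.ofReal_le_ofReal ?_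
  have h4 : (0 : ℝ) < 4 + x ^ 2 := by positivity
  have h1 : (4 + x ^ 2)⁻¹ ≤ (4 + x ^ 2) ^ s := by
    rw [← Real.rpow_neg_one]
    exact Real.rpow_le_rpow_of_exponent_le (by nlinarith [sq_nonneg x]) (by linarith [S.hs.1])
  have h2 : (c * (1 + x ^ 2)) ^ 2 ≤ ω x ^ 2 := by
    refine pow_le_pow_left₀ (by positivity) ((mul_le_mul_of_nonneg_left ?_ hc.le).trans (hcω x)) 2
    nlinarith [abs_nonneg x, sq_abs x]
  calc c ^ 2 / 4 * (1 + x ^ 2) ≤ (c * (1 + x ^ 2)) ^ 2 * (4 + x ^ 2)⁻¹ := by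
        rw [← div_eq_mul_inv, le_div_iff₀ h4]
        have : 0 ≤ c ^ 2 * (1 + x ^ 2) * x ^ 2 := by positivity
        nlinarith
    _ ≤ _ := by gcongr

lemma memLp_decay {c : ℝ} (hc : 0 < c) (hcω : ∀ x, c * (1 + |x|) ^ 2 ≤ ω x) (f : Lp ℂ 2 μ)
    {m : ℝ → ℂ} (hm : Measurable m) (hmb : ∀ x, ‖m x‖ₑ ^ 2 ≤ ENNReal.ofReal (1 + x ^ 2)) :
    MemLp (fun x => m x * f x) 2 := by
  refine memLp_two_of_lintegral (hm.aestronglyMeasurable.mul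
    (Lp.stronglyMeasurable f).aestronglyMeasurable) ?_
  have h0 : ENNReal.ofReal (c ^ 2 / 4) ≠ 0 := by
    rw [Ne, ENNReal.ofReal_eq_zero, not_le]
    positivity
  have h1 : ENNReal.ofReal (c ^ 2 / 4) * ∫⁻ x, ‖m x * f x‖ₑ ^ 2 < ⊤ := by
    rw [← lintegral_const_mul' _ _ ENNReal.ofReal_ne_top]
    refine (lintegral_mono fun x => ?_).trans_lt (S.hμ.lintegral_lt_top f)
    rw [enorm_mul, mul_pow, ← _root_.mul_assoc]
    gcongr
    exact (mul_le_mul_right (hmb x) _).trans (S.le_dens hc hcω x)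
  by_contra h
  rw [not_lt, top_le_iff] at h
  rw [h, ENNReal.mul_top h0] at h1
  exact lt_irrefl _ h1

lemma memLp_two {c : ℝ} (hc : 0 < c) (hcω : ∀ x, c * (1 + |x|) ^ 2 ≤ ω x) (f : Lp ℂ 2 μ) :
    MemLp f 2 := by
  have := S.memLp_decay hc hcω f (m := fun _ => 1) measurable_const (fun x => by
    rw [enorm_one, one_pow, ENNReal.one_le_ofReal]
    nlinarith [sq_nonneg x])
  simpa using this

lemma memLp_ihm {c : ℝ} (hc : 0 < c) (hcω : ∀ x, c * (1 + |x|) ^ 2 ≤ ω x) (f : Lp ℂ 2 μ) :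
    MemLp (ihm f) 2 := by
  refine S.memLp_decay hc hcω f (m := fun x => Complex.I * x) (by fun_prop) (fun x => ?_)
  rw [← ofReal_norm, ofReal_sq (norm_nonneg _)]
  refine ENNReal.ofReal_le_ofReal ?_
  simp

lemma integrable_decay {c : ℝ} (hc : 0 < c) (hcω : ∀ x, c * (1 + |x|) ^ 2 ≤ ω x) (f : Lp ℂ 2 μ) :
    Integrable f := by
  have h1 := S.memLp_decay hc hcω f (m := fun x => (jp (1 / 2) x : ℂ)) (by fun_prop) (fun x => by
    rw [← ofReal_norm, ofReal_sq (norm_nonneg _)]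
    refine ENNReal.ofReal_le_ofReal ?_
    rw [Complex.norm_real, Real.norm_of_nonneg (jp_pos _ _).le, jp_half,
      Real.sq_sqrt (by positivity)])
  have h2 : MemLp (fun x => (jp (-(1 / 2)) x : ℂ)) 2 := by
    rw [memLp_two_iff_integrable_sq_norm (by fun_prop)]
    refine (integrable_jp (r := 1) (by norm_num)).congr (.of_forall fun x => ?_)
    simp only
    rw [Complex.norm_real, Real.norm_of_nonneg (jp_pos _ _).le, sq, ← jp_add]
    norm_num
  refine (h2.integrable_mul h1).congr (.of_forall fun x => ?_)
  simp only [Pi.mul_apply]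
  rw [← _root_.mul_assoc, ← Complex.ofReal_mul, ← jp_add]
  norm_num [jp_zero]

/-- The diagonal entry `γ` of the Green's function, up to normalization. -/
def Gam (κ : ℝ) (w v : Lp ℂ 2 μ) : Lp ℂ 2 μ :=
  S.D (rmul _ (isMult_sym (-κ)) (S.isKW.mul (S.X (-κ) v) (S.Z κ w v))) -
    S.D (rmul _ (isMult_sym κ) (S.isKW.mul (S.X κ w) (S.Z (-κ) v w)))

lemma Gam_neg (κ : ℝ) (w v : Lp ℂ 2 μ) : S.Gam (-κ) v w = - S.Gam κ w v := by
  simp only [Gam, neg_neg, neg_sub]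

omit S in
lemma integrable_cv_section {u f : ℝ → ℂ} (hu : MemLp u 2) (hf : MemLp f 2) (h : ℝ) :
    Integrable fun k => u (h - k) * f k :=
  (hu.comp_measurePreserving (Measure.measurePreserving_sub_left volume h)).integrable_mul hf

omit S in
lemma cv_congr (u : ℝ → ℂ) {f g : ℝ → ℂ} (h : f =ᵐ[volume] g) : cv u f = cv u g := by
  ext x
  refine integral_congr_ae ?_
  filter_upwards [h] with k hk
  rw [hk]

lemma coeFn_sub_vol (f g : Lp ℂ 2 μ) : ⇑(f - g) =ᵐ[volume] fun x => f x - g x :=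
  S.hμ.ae_eq_iff.1 (Lp.coeFn_sub f g)

lemma coeFn_add_vol (f g : Lp ℂ 2 μ) : ⇑(f + g) =ᵐ[volume] fun x => f x + g x :=
  S.hμ.ae_eq_iff.1 (Lp.coeFn_add f g)

lemma coeFn_neg_vol (f : Lp ℂ 2 μ) : ⇑(-f) =ᵐ[volume] fun x => - f x :=
  S.hμ.ae_eq_iff.1 (Lp.coeFn_neg f)

lemma cv_sub {c : ℝ} (hc : 0 < c) (hcω : ∀ x, c * (1 + |x|) ^ 2 ≤ ω x) (u f g : Lp ℂ 2 μ)
    (h : ℝ) : cv u (f - g : Lp ℂ 2 μ) h = cv u f h - cv u g h := by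
  rw [cv_congr u (S.coeFn_sub_vol f g), cv, cv, cv,
    ← integral_sub (integrable_cv_section (S.memLp_two hc hcω u) (S.memLp_two hc hcω f) h)
      (integrable_cv_section (S.memLp_two hc hcω u) (S.memLp_two hc hcω g) h)]
  simp only [mul_sub]

lemma G_ode {c : ℝ} (hc : 0 < c) (hcω : ∀ x, c * (1 + |x|) ^ 2 ≤ ω x) {κ : ℝ} (hκ : 1 ≤ |κ|)
    {w v : Lp ℂ 2 μ} (hw : ‖w‖ ≤ rad s) (hv : ‖v‖ ≤ rad s) :
    ∀ᵐ h : ℝ, ((2 * κ : ℂ) - Complex.I * h) * S.G κ w v h =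
      - (Real.sign κ) * w h + cpi * cv w (S.Gam κ w v) h := by
  have hκ' : 1 ≤ |-κ| := by rwa [abs_neg]
  have hx := S.norm_X_le_half κ hw
  have hy := S.norm_X_le_half (-κ) hv
  have e1 := S.isKW.isTraceAlgebra.altSum_eq hx hy (by norm_num)
  have e2 := S.isKW.isTraceAlgebra.altSum_eq' hx hy (by norm_num)
  have hP : S.isKW.mul (S.X κ w) (S.isKW.mul (S.X (-κ) v) (S.Z κ w v)) =
      S.isKW.mul (S.isKW.mul (S.X κ w) (S.Z (-κ) v w)) (S.X κ w) := by
    have e3 := e1.symm.trans e2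
    have e4 := add_left_cancel e3
    rw [Z, Z, neg_neg]
    exact e4
  have hi := S.integrable_decay hc hcω w
  have hG : S.G κ w v = S.D (rmul _ (isMult_sym (-κ)) (S.X κ w)) +
      S.D (rmul _ (isMult_sym (-κ))
        (S.isKW.mul (S.X κ w) (S.isKW.mul (S.X (-κ) v) (S.Z κ w v)))) := by
    rw [← map_add, ← map_add]
    have e3 : S.Z κ w v = _ := e1
    rw [G]
    congr 2
  filter_upwards [S.comm hκ hκ' κ hi hi rfl hP, S.D_X hκ w, S.coeFn_add_vol
    (S.D (rmul _ (isMult_sym (-κ)) (S.X κ w))) (S.D (rmul _ (isMult_sym (-κ))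
        (S.isKW.mul (S.X κ w) (S.isKW.mul (S.X (-κ) v) (S.Z κ w v)))))] with h h1 h2 h3
  rw [hG, h3, Gam, S.cv_sub hc hcω]
  push_cast at h1
  linear_combination h1 + h2

lemma Gam_ode {c : ℝ} (hc : 0 < c) (hcω : ∀ x, c * (1 + |x|) ^ 2 ≤ ω x) {κ : ℝ} (hκ : 1 ≤ |κ|)
    {w v : Lp ℂ 2 μ} (hw : ‖w‖ ≤ rad s) (hv : ‖v‖ ≤ rad s) :
    ∀ᵐ h : ℝ, - (Complex.I * h) * S.Gam κ w v h =
      2 * cpi * (cv v (S.G κ w v) h - cv w (S.G (-κ) v w) h) := by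
  have hκ' : 1 ≤ |-κ| := by rwa [abs_neg]
  have hx := S.norm_X_le_half κ hw
  have hy := S.norm_X_le_half (-κ) hv
  have e1 : S.isKW.mul (S.X κ w) (S.Z (-κ) v w) = S.isKW.mul (S.Z κ w v) (S.X (-κ) v) := by
    rw [Z, Z, neg_neg]
    exact S.isKW.isTraceAlgebra.mul_altSum_swap hx hy (by norm_num)
  have e2 : S.isKW.mul (S.X (-κ) v) (S.Z κ w v) = S.isKW.mul (S.Z (-κ) v w) (S.X κ w) := by
    rw [Z, Z, neg_neg]
    exact S.isKW.isTraceAlgebra.mul_altSum_swap hy hx (by norm_num)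
  have hiw := S.integrable_decay hc hcω w
  have hiv := S.integrable_decay hc hcω v
  have hG' : S.G (-κ) v w = S.D (rmul _ (isMult_sym κ) (S.Z (-κ) v w)) := by
    simp only [G, neg_neg]
  filter_upwards [S.comm hκ' hκ' κ hiv hiw rfl e2, S.comm hκ hκ (-κ) hiw hiv rfl e1,
    S.coeFn_sub_vol (S.D (rmul _ (isMult_sym (-κ)) (S.isKW.mul (S.X (-κ) v) (S.Z κ w v))))
    (S.D (rmul _ (isMult_sym κ) (S.isKW.mul (S.X κ w) (S.Z (-κ) v w))))] with h h1 h2 h3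
  rw [Gam, h3, hG', G]
  push_cast at h1 h2
  linear_combination h1 - h2

lemma bp_G_self (κ : ℝ) {w v : Lp ℂ 2 μ} (hw : ‖w‖ ≤ rad s) (hv : ‖v‖ ≤ rad s) :
    bp w (S.G (-κ) v w) = bp v (S.G κ w v) := by
  have h := S.dlogd_self κ hw hv
  rw [dlogd_eq_integral] at h
  change bp _ _ + bp _ _ = 0 at h
  rw [bp_congr .rfl (S.coeFn_neg_vol v)] at h
  have e : bp (S.G κ w v) (fun x => - v x) = - bp (S.G κ w v) v := by
    simp only [bp, mul_neg, integral_neg]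
  rw [e, ← sub_eq_add_neg, sub_eq_zero] at h
  rw [bp_comm, h, bp_comm]

lemma bracket_decay {c : ℝ} (hc : 0 < c) (hcω : ∀ x, c * (1 + |x|) ^ 2 ≤ ω x) {κ ϰ : ℝ}
    (hκ : 1 ≤ |κ|) (hϰ : 1 ≤ |ϰ|) {w v : Lp ℂ 2 μ} (hw : ‖w‖ ≤ rad s) (hv : ‖v‖ ≤ rad s) :
    bp (S.G κ w v) (S.G (-ϰ) v w) = bp (S.G (-κ) v w) (S.G ϰ w v) := by
  rcases eq_or_ne κ ϰ with rfl | hne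
  · exact bp_comm _ _
  have key : ∀ {κ ϰ : ℝ}, 1 ≤ |κ| → 1 ≤ |ϰ| →
      2 * κ * (bp (S.G κ w v) (S.G (-ϰ) v w) - bp (S.G (-κ) v w) (S.G ϰ w v)) =
      bp (ihm (S.G κ w v)) (S.G (-ϰ) v w) + bp (ihm (S.G (-κ) v w)) (S.G ϰ w v) +
        1 / 2 * bp (S.Gam κ w v) (ihm (S.Gam ϰ w v)) := by
    intro κ ϰ hκ hϰ
    have hκ' : 1 ≤ |-κ| := by rwa [abs_neg]
    have e2 := S.G_ode hc hcω hκ' hv hw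
    have m := fun f => S.memLp_two hc hcω f
    refine bracket_half (σ := Real.sign κ) (S.integrable_decay hc hcω w)
      (S.integrable_decay hc hcω v) (m w) (m v) (m _) (m _) (m _)
      (S.memLp_ihm hc hcω _) (S.memLp_ihm hc hcω _) (S.G_ode hc hcω hκ hw hv) ?_
      (S.Gam_ode hc hcω hϰ hw hv) (S.bp_G_self ϰ hw hv)
    filter_upwards [e2] with h h2
    have h3 : cv v (S.Gam (-κ) v w) h = - cv v (S.Gam κ w v) h := by
      rw [S.Gam_neg, cv_congr v (S.coeFn_neg_vol _), cv, cv, ← integral_neg]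
      simp only [mul_neg]
    rw [h3, Real.sign_neg] at h2
    push_cast at h2
    linear_combination h2
  have k1 := key hκ hϰ
  have k2 := key hϰ hκ
  rw [bp_comm (S.G ϰ w v), bp_comm (S.G (-ϰ) v w), bp_ihm_swap (S.G ϰ w v),
    bp_ihm_swap (S.G (-ϰ) v w), bp_comm (S.Gam ϰ w v), bp_ihm (S.Gam κ w v)] at k2
  have h2 : (2 * (κ : ℂ) - 2 * ϰ) ≠ 0 := by
    rw [← mul_sub]
    refine mul_ne_zero two_ne_zero ?_
    rw [sub_ne_zero]
    exact_mod_cast hne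
  rw [← sub_eq_zero]
  refine (mul_eq_zero.1 (?_ : (2 * (κ : ℂ) - 2 * ϰ) * _ = 0)).resolve_left h2
  linear_combination k1 + k2

end IsSob

end

end AKNS

namespace AKNS

noncomputable section

open scoped ENNReal NNReal
open Filter Topology

/-! ### Polynomial weights -/

/-- The weight `(1 + a |ξ|) ^ N`. -/
def wt (a : ℝ) (N : ℕ) (ξ : ℝ) : ℝ := (1 + a * |ξ|) ^ N

lemma isFreqWeight_wt {a : ℝ} (ha : 0 ≤ a) (N : ℕ) : IsFreqWeight (wt a N) where
  meas := by unfold wt; fun_prop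
  one_le x := one_le_pow₀ (by nlinarith [mul_nonneg ha (abs_nonneg x)])
  even x := by simp [wt]
  submul x y := by
    rw [wt, wt, wt, ← mul_pow]
    have h := abs_add_le x y
    have h1 : a * |x + y| ≤ a * (|x| + |y|) := by gcongr
    have h2 : 0 ≤ (a * |x|) * (a * |y|) := by positivity
    gcongr
    nlinarith

/-- The measure that defines the space of functions `w` with `(1 + a |ξ|) ^ N w` in `H^s`. -/
def wtMeasure (s a : ℝ) (N : ℕ) : Measure ℝ := volume.withDensity (dens s (wt a N))

lemma isSob_wt {s : ℝ} (hs : s ∈ Ioo (-(1 / 2) : ℝ) 0) {a : ℝ} (ha : 0 ≤ a) (N : ℕ) :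
    IsSob s (wt a N) (wtMeasure s a N) :=
  ⟨hs, isFreqWeight_wt ha N, isWeighted_dens (isFreqWeight_wt ha N)⟩

lemma isSob_sobolev {s : ℝ} (hs : s ∈ Ioo (-(1 / 2) : ℝ) 0) :
    IsSob s (fun _ => 1) (sobolevMeasure s) :=
  ⟨hs, isFreqWeight_one, isWeighted_sobolev s⟩

lemma dens_mono (s : ℝ) {ω₀ ω : ℝ → ℝ} (h : ∀ x, ω₀ x ≤ ω x) (x : ℝ) :
    dens s ω₀ x ≤ dens s ω x := by
  unfold dens
  gcongr
  exact h x

namespace IsSob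

variable {s : ℝ} {ω ω₀ : ℝ → ℝ} {μ μ₀ : Measure ℝ} (S : IsSob s ω μ) (S₀ : IsSob s ω₀ μ₀)
  (hle : ∀ x, ω₀ x ≤ ω x)
include S S₀ hle

/-! ### Comparison of weights -/

lemma isL2Op_emb : IsL2Op ℂ μ μ₀ (fun f => f) 1 where
  congr f g h := S₀.hμ.ae_eq_iff.2 (S.hμ.ae_eq_iff.1 h)
  meas f := (Lp.stronglyMeasurable f).aestronglyMeasurable
  bound f := S₀.hμ.eLpNorm_le (by
    rw [ENNReal.coe_one, one_mul, S.hμ.enorm_sq]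
    exact lintegral_mono fun x => mul_le_mul_left (dens_mono s hle x) _)
  add f g := .rfl
  smul c f := .rfl

/-- The inclusion of a space with a larger weight. -/
def emb : Lp ℂ 2 μ →L[ℂ] Lp ℂ 2 μ₀ := (isL2Op_emb S S₀ hle).toCLM

lemma coeFn_emb (f : Lp ℂ 2 μ) : S.emb S₀ hle f =ᵐ[volume] f :=
  S₀.hμ.ae_eq_iff.1 ((isL2Op_emb S S₀ hle).coeFn f)

lemma norm_emb_le (f : Lp ℂ 2 μ) : ‖S.emb S₀ hle f‖ ≤ ‖f‖ := by
  have := (isL2Op_emb S S₀ hle).norm_le f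
  rwa [NNReal.coe_one, one_mul] at this

lemma isL2Op_kemb : IsL2Op ℂ (kmeas (kw (tex s) ω)) (kmeas (kw (tex s) ω₀)) (fun f => f) 1 where
  congr f g h := S₀.isKW.isWeighted.ae_eq_iff.2 (S.isKW.isWeighted.ae_eq_iff.1 h)
  meas f := (Lp.stronglyMeasurable f).aestronglyMeasurable
  bound f := S₀.isKW.isWeighted.eLpNorm_le (by
    rw [ENNReal.coe_one, one_mul, S.isKW.isWeighted.enorm_sq]
    refine lintegral_mono fun x => ?_
    unfold kw
    gcongr
    exact hle _)
  add f g := .rfl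
  smul c f := .rfl

/-- The inclusion of a space of kernels with a larger weight. -/
def kemb : Lp ℂ 2 (kmeas (kw (tex s) ω)) →L[ℂ] Lp ℂ 2 (kmeas (kw (tex s) ω₀)) :=
  (isL2Op_kemb S S₀ hle).toCLM

lemma coeFn_kemb (f : Lp ℂ 2 (kmeas (kw (tex s) ω))) : S.kemb S₀ hle f =ᵐ[volume] f :=
  S₀.isKW.isWeighted.ae_eq_iff.1 ((isL2Op_kemb S S₀ hle).coeFn f)

lemma kemb_ext {X : Lp ℂ 2 (kmeas (kw (tex s) ω))} {Y : Lp ℂ 2 (kmeas (kw (tex s) ω₀))}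
    (h : X =ᵐ[volume] Y) : S.kemb S₀ hle X = Y :=
  Lp.ext (S₀.isKW.isWeighted.ae_eq_iff.2 ((S.coeFn_kemb S₀ hle X).trans h))

lemma kemb_mul (X Y : Lp ℂ 2 (kmeas (kw (tex s) ω))) :
    S.kemb S₀ hle (S.isKW.mul X Y) = S₀.isKW.mul (S.kemb S₀ hle X) (S.kemb S₀ hle Y) :=
  S.kemb_ext S₀ hle ((S.isKW.coeFn_mul X Y).trans (((S₀.isKW.coeFn_mul _ _).trans
    (kcomp_congr (S.coeFn_kemb S₀ hle X) (S.coeFn_kemb S₀ hle Y))).symm))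

lemma kemb_rmul {p : ℝ → ℂ} {C : ℝ≥0} (hp : IsMult p C) (X : Lp ℂ 2 (kmeas (kw (tex s) ω))) :
    S.kemb S₀ hle (rmul _ hp X) = rmul _ hp (S.kemb S₀ hle X) := by
  refine S.kemb_ext S₀ hle ?_
  filter_upwards [coeFn_rmul S.isKW hp X, coeFn_rmul S₀.isKW hp (S.kemb S₀ hle X),
    S.coeFn_kemb S₀ hle X] with p h1 h2 h3
  rw [h1, h2, h3]

lemma kemb_X (κ : ℝ) (u : Lp ℂ 2 μ) : S.kemb S₀ hle (S.X κ u) = S₀.X κ (S.emb S₀ hle u) := by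
  refine S.kemb_ext S₀ hle ?_
  filter_upwards [S.coeFn_X κ u, S₀.coeFn_X κ (S.emb S₀ hle u),
    ae_diff (S.coeFn_emb S₀ hle u)] with p h1 h2 h3
  rw [h1, h2, qker, qker, flat, flat, h3]

lemma emb_D (X : Lp ℂ 2 (kmeas (kw (tex s) ω))) :
    S.emb S₀ hle (S.D X) = S₀.D (S.kemb S₀ hle X) := by
  refine Lp.ext (S₀.hμ.ae_eq_iff.2 ?_)
  filter_upwards [S.coeFn_emb S₀ hle (S.D X), S.coeFn_D X, S₀.coeFn_D (S.kemb S₀ hle X),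
    diag_congr (flat_congr (S.coeFn_kemb S₀ hle X))] with k h1 h2 h3 h4
  rw [h1, h2, h3, dker, dker, h4]

lemma kemb_alt (x y : Lp ℂ 2 (kmeas (kw (tex s) ω))) (m : ℕ) :
    S.kemb S₀ hle (alt S.isKW.mul x y m) =
      alt S₀.isKW.mul (S.kemb S₀ hle x) (S.kemb S₀ hle y) m := by
  induction m with
  | zero => rfl
  | succ m ih => rw [alt, kemb_mul, kemb_mul, ih, alt]

lemma emb_G (κ : ℝ) {w v : Lp ℂ 2 μ} (hw : ‖w‖ ≤ rad s) (hv : ‖v‖ ≤ rad s) :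
    S.emb S₀ hle (S.G κ w v) = S₀.G κ (S.emb S₀ hle w) (S.emb S₀ hle v) := by
  have hs := S.isKW.isTraceAlgebra.summable_alt (S.norm_X_le_half κ hw) (S.norm_X_le_half (-κ) hv)
    (by norm_num)
  rw [G, emb_D, kemb_rmul, Z, altSum, ContinuousLinearMap.map_tsum _ hs, G, Z, altSum]
  simp only [kemb_alt, kemb_X]

omit S₀ hle in
lemma emb_J {S₀ : IsSob s ω₀ μ₀} {hle : ∀ x, ω₀ x ≤ ω x} (ε : ℤˣ) (u : Lp ℂ 2 μ) :
    S.emb S₀ hle (S.J ε u) = S₀.J ε (S.emb S₀ hle u) := by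
  refine Lp.ext (S₀.hμ.ae_eq_iff.2 ?_)
  filter_upwards [S.coeFn_emb S₀ hle (S.J ε u), S.coeFn_J ε u, S₀.coeFn_J ε (S.emb S₀ hle u),
    ae_neg (S.coeFn_emb S₀ hle u)] with k h1 h2 h3 h4
  rw [h1, h2, h3, rHat, rHat, h4]

end IsSob

/-! ### Truncation in frequency -/

/-- The indicator of `[-n, n]`. -/
def cut (n : ℝ) (ξ : ℝ) : ℂ := if |ξ| ≤ n then 1 else 0

lemma measurable_cut (n : ℝ) : Measurable (cut n) :=
  Measurable.ite (measurableSet_le (by fun_prop) (by fun_prop)) measurable_const measurable_const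

lemma enorm_cut_le (n ξ : ℝ) : ‖cut n ξ‖ₑ ≤ 1 := by
  unfold cut
  split_ifs <;> simp

namespace IsSob

variable {s : ℝ} {μ : Measure ℝ} (S : IsSob s (fun _ => 1) μ)
include S

lemma isL2Op_cut (n : ℝ) (N : ℕ) {a : ℝ} (ha : 0 ≤ a) :
    IsL2Op ℂ μ (wtMeasure s a N) (fun f x => cut n x * f x) ((1 + a * |n|) ^ N).toNNReal where
  congr f g h := (isSob_wt S.hs ha N).hμ.ae_eq_iff.2 (by
    filter_upwards [S.hμ.ae_eq_iff.1 h] with x hx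
    rw [hx])
  meas f := (measurable_cut n).aestronglyMeasurable.mul
    (Lp.stronglyMeasurable f).aestronglyMeasurable
  bound f := (isSob_wt S.hs ha N).hμ.eLpNorm_le (by
    rw [mul_pow, S.hμ.enorm_sq, ← lintegral_const_mul' _ _ (by finiteness)]
    refine lintegral_mono fun x => ?_
    unfold cut
    split_ifs with h
    · rw [one_mul, ← _root_.mul_assoc]
      gcongr
      unfold dens
      rw [ENNReal.ofReal_one, one_pow, one_mul]
      gcongr
      refine ENNReal.ofReal_le_ofReal ?_
      exact pow_le_pow_left₀ (by positivity) (by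
        have := mul_le_mul_of_nonneg_left (h.trans (le_abs_self n)) ha
        linarith) N
    · simp)
  add f g := .of_forall fun x => mul_add _ _ _
  smul c f := .of_forall fun x => by simp only [Pi.smul_apply, smul_eq_mul]; ring

omit S in
/-- Truncation to the frequencies `|ξ| ≤ n`. -/
def trunc (μ : Measure ℝ) (n : ℝ) : Lp ℂ 2 μ →L[ℂ] Lp ℂ 2 μ :=
  (isL2Op_mul (measurable_cut n) (C := 1) (enorm_cut_le n)).toCLM

lemma coeFn_trunc (n : ℝ) (f : Lp ℂ 2 μ) : trunc μ n f =ᵐ[volume] fun x => cut n x * f x :=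
  S.hμ.ae_eq_iff.1 ((isL2Op_mul (measurable_cut n) (enorm_cut_le n)).coeFn f)

omit S in
lemma norm_trunc_le (n : ℝ) (f : Lp ℂ 2 μ) : ‖trunc μ n f‖ ≤ ‖f‖ := by
  have := (isL2Op_mul (μ := μ) (measurable_cut n) (C := 1) (enorm_cut_le n)).norm_le f
  rwa [NNReal.coe_one, one_mul] at this

lemma tendsto_trunc (f : Lp ℂ 2 μ) : Tendsto (fun n : ℕ => trunc μ n f) atTop (𝓝 f) := by
  rw [Lp.tendsto_Lp_iff_tendsto_eLpNorm']
  have h1 : ∀ n : ℕ, eLpNorm (⇑(trunc μ n f) - ⇑f) 2 μ ^ 2 =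
      ∫⁻ x, dens s (fun _ => 1) x * ‖cut n x * f x - f x‖ₑ ^ 2 := by
    intro n
    rw [S.hμ.eLpNorm_sq]
    refine lintegral_congr_ae ?_
    filter_upwards [S.coeFn_trunc n f] with x hx
    rw [Pi.sub_apply, hx]
  have h2 : Tendsto (fun n : ℕ => ∫⁻ x, dens s (fun _ => 1) x * ‖cut n x * f x - f x‖ₑ ^ 2) atTop
      (𝓝 (∫⁻ _ : ℝ, 0)) := by
    have hm := measurable_dens (s := s) S.hω
    have hf : Measurable f := (Lp.stronglyMeasurable f).measurable
    refine tendsto_lintegral_of_dominated_convergence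
      (fun x => dens s (fun _ => 1) x * ‖f x‖ₑ ^ 2) (fun n => ?_) (fun n => .of_forall fun x => ?_)
      (S.hμ.lintegral_lt_top f).ne (.of_forall fun x => ?_)
    · have := measurable_cut n
      fun_prop
    · simp only
      gcongr
      unfold cut
      split_ifs <;> simp
    · refine tendsto_const_nhds.congr' ?_
      filter_upwards [eventually_ge_atTop ⌈|x|⌉₊] with n hn
      have : |x| ≤ n := (Nat.le_ceil _).trans (by exact_mod_cast hn)
      simp [cut, this]
  rw [lintegral_zero] at h2
  simp only [← h1] at h2
  have h3 := h2.ennrpow_const (1 / 2 : ℝ)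
  rw [ENNReal.zero_rpow_of_pos (by norm_num)] at h3
  refine h3.congr fun n => ?_
  rw [← ENNReal.rpow_natCast, ← ENNReal.rpow_mul]
  norm_num

lemma bracket_trunc {κ ϰ : ℝ} (hκ : 1 ≤ |κ|) (hϰ : 1 ≤ |ϰ|) {w v : Lp ℂ 2 μ} (hw : ‖w‖ < rad s)
    (hv : ‖v‖ < rad s) (n : ℕ) :
    bp (S.G κ (trunc μ n w) (trunc μ n v)) (S.G (-ϰ) (trunc μ n v) (trunc μ n w)) =
      bp (S.G (-κ) (trunc μ n v) (trunc μ n w)) (S.G ϰ (trunc μ n w) (trunc μ n v)) := by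
  obtain ⟨a, ha0, ha1, haw, hav⟩ : ∃ a : ℝ, 0 < a ∧ a ≤ 1 ∧ (1 + a * |(n : ℝ)|) ^ 2 * ‖w‖ ≤ rad s ∧
      (1 + a * |(n : ℝ)|) ^ 2 * ‖v‖ ≤ rad s := by
    have hc : ∀ u : Lp ℂ 2 μ, ‖u‖ < rad s →
        ∀ᶠ a : ℝ in 𝓝[>] 0, (1 + a * |(n : ℝ)|) ^ 2 * ‖u‖ ≤ rad s := by
      intro u hu
      have h1 : Tendsto (fun a : ℝ => (1 + a * |(n : ℝ)|) ^ 2 * ‖u‖) (𝓝[>] 0)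
          (𝓝 ((1 + 0 * |(n : ℝ)|) ^ 2 * ‖u‖)) :=
        ((Continuous.tendsto (by fun_prop) 0)).mono_left nhdsWithin_le_nhds
      have h2 : (1 + 0 * |(n : ℝ)|) ^ 2 * ‖u‖ < rad s := by simpa using hu
      exact (h1.eventually_lt_const h2).mono fun _ => le_of_lt
    have h1 : ∀ᶠ a : ℝ in 𝓝[>] 0, a ≤ 1 :=
      (eventually_le_nhds zero_lt_one).filter_mono nhdsWithin_le_nhds
    obtain ⟨a, h⟩ := ((hc w hw).and ((hc v hv).and (h1.and self_mem_nhdsWithin))).exists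
    exact ⟨a, h.2.2.2, h.2.2.1, h.1, h.2.1⟩
  set T := isSob_wt S.hs ha0.le 2
  have hle : ∀ x, (fun _ : ℝ => (1 : ℝ)) x ≤ wt a 2 x := T.hω.one_le
  have hop := S.isL2Op_cut n 2 ha0.le
  have hn : ∀ u : Lp ℂ 2 μ, (1 + a * |(n : ℝ)|) ^ 2 * ‖u‖ ≤ rad s → ‖hop.toCLM u‖ ≤ rad s := by
    intro u hu
    have := hop.norm_le u
    rw [Real.coe_toNNReal _ (by positivity)] at this
    exact this.trans hu
  have he : ∀ u, T.emb S hle (hop.toCLM u) = trunc μ n u := by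
    intro u
    refine Lp.ext (S.hμ.ae_eq_iff.2 ?_)
    filter_upwards [T.coeFn_emb S hle (hop.toCLM u), T.hμ.ae_eq_iff.1 (hop.coeFn u),
      S.coeFn_trunc n u] with x h1 h2 h3
    rw [h1, h2, h3]
  have hG : ∀ κ u u', (1 + a * |(n : ℝ)|) ^ 2 * ‖u‖ ≤ rad s →
      (1 + a * |(n : ℝ)|) ^ 2 * ‖u'‖ ≤ rad s → S.G κ (trunc μ n u) (trunc μ n u') =ᵐ[volume]
      T.G κ (hop.toCLM u) (hop.toCLM u') := by
    intro κ u u' hu hu'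
    have := T.emb_G S hle κ (hn u hu) (hn u' hu')
    rw [he, he] at this
    rw [← this]
    exact T.coeFn_emb S hle _
  have hstr : ∀ x, a ^ 2 * (1 + |x|) ^ 2 ≤ wt a 2 x := by
    intro x
    rw [wt, ← mul_pow]
    gcongr
    nlinarith
  have := T.bracket_decay (pow_pos ha0 2) hstr hκ hϰ (hn w haw) (hn v hav)
  rw [bp_congr (hG κ w v haw hav) (hG (-ϰ) v w hav haw), this]
  exact (bp_congr (hG (-κ) v w hav haw) (hG ϰ w v haw hav)).symm

lemma tendsto_Z (κ : ℝ) {w v : Lp ℂ 2 μ} {w' v' : ℕ → Lp ℂ 2 μ} (hw : ‖w‖ ≤ rad s)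
    (hv : ‖v‖ ≤ rad s) (hw' : ∀ n, ‖w' n‖ ≤ rad s) (hv' : ∀ n, ‖v' n‖ ≤ rad s)
    (h : Tendsto w' atTop (𝓝 w)) (h' : Tendsto v' atTop (𝓝 v)) :
    Tendsto (fun n => S.Z κ (w' n) (v' n)) atTop (𝓝 (S.Z κ w v)) := by
  rw [tendsto_iff_norm_sub_tendsto_zero] at h h' ⊢
  have := (h.add h').const_mul (2 * qConst s : ℝ)
  rw [add_zero, mul_zero] at this
  exact squeeze_zero (fun _ => norm_nonneg _)
    (fun n => S.norm_Z_sub_le κ (hw' n) (hv' n) hw hv) this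

lemma bracket {κ ϰ : ℝ} (hκ : 1 ≤ |κ|) (hϰ : 1 ≤ |ϰ|) {w v : Lp ℂ 2 μ} (hw : ‖w‖ < rad s)
    (hv : ‖v‖ < rad s) : S.dlogd ϰ w v (S.G κ w v) (-S.G (-κ) v w) = 0 := by
  have hw' : ∀ n : ℕ, ‖trunc μ n w‖ ≤ rad s := fun n => (norm_trunc_le _ _).trans hw.le
  have hv' : ∀ n : ℕ, ‖trunc μ n v‖ ≤ rad s := fun n => (norm_trunc_le _ _).trans hv.le
  have tZ : ∀ κ, Tendsto (fun n : ℕ => S.Z κ (trunc μ n w) (trunc μ n v)) atTop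
      (𝓝 (S.Z κ w v)) := fun κ =>
    S.tendsto_Z κ hw.le hv.le hw' hv' (S.tendsto_trunc w) (S.tendsto_trunc v)
  have tZ' : ∀ κ, Tendsto (fun n : ℕ => S.Z κ (trunc μ n v) (trunc μ n w)) atTop
      (𝓝 (S.Z κ v w)) := fun κ =>
    S.tendsto_Z κ hv.le hw.le hv' hw' (S.tendsto_trunc v) (S.tendsto_trunc w)
  have tG := fun κ => ((S.D.comp (rmul _ (isMult_sym (-κ)))).continuous.tendsto _).comp (tZ κ)
  have tG' := fun κ => ((S.D.comp (rmul _ (isMult_sym (-κ)))).continuous.tendsto _).comp (tZ' κ)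
  have tt := fun p => S.isKW.tr.continuous₂.tendsto p
  have t1 := (tt (_, _)).comp ((((rmul _ (isMult_sym ϰ)).continuous.tendsto _).comp
    (tZ' (-ϰ))).prodMk_nhds ((S.Q.continuous.tendsto _).comp (tG κ)))
  have t2 := (tt (_, _)).comp ((((rmul _ (isMult_sym (-ϰ))).continuous.tendsto _).comp
    (tZ ϰ)).prodMk_nhds ((S.Q.continuous.tendsto _).comp (tG' (-κ)).neg))
  refine tendsto_nhds_unique (t1.add t2) (tendsto_const_nhds.congr fun n => ?_)
  symm
  change S.dlogd ϰ (trunc μ n w) (trunc μ n v) (S.G κ (trunc μ n w) (trunc μ n v))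
    (-S.G (-κ) (trunc μ n v) (trunc μ n w)) = 0
  have hb := S.bracket_trunc hκ hϰ hw hv n
  rw [dlogd_eq_integral]
  change bp _ _ + bp _ _ = 0
  rw [bp_congr .rfl (S.coeFn_neg_vol _)]
  have e : ∀ f g : ℝ → ℂ, bp f (fun x => - g x) = - bp f g := fun f g => by
    simp only [bp, mul_neg, integral_neg]
  rw [e, bp_comm, hb, bp_comm]
  ring

end IsSob

end

end AKNS

namespace AKNS

noncomputable section

open scoped ENNReal NNReal
open Filter Topology

/-! ### The series of the perturbation determinant and of the Green's function -/

lemma res'_ne_zero {κ : ℝ} (hκ : 1 ≤ |κ|) (ξ : ℝ) : (κ : ℂ) + Complex.I * ξ ≠ 0 := by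
  have := res_ne_zero hκ (-ξ)
  push_cast at this
  rwa [mul_neg, sub_neg_eq_add] at this

lemma symMinus_ne_zero {κ : ℝ} (hκ : 1 ≤ |κ|) (ξ : ℝ) : symMinus κ ξ ≠ 0 := by
  rw [symMinus, Ne, Complex.cpow_eq_zero_iff]
  exact fun h => res_ne_zero hκ ξ h.1

lemma symPlus_ne_zero {κ : ℝ} (hκ : 1 ≤ |κ|) (ξ : ℝ) : symPlus κ ξ ≠ 0 := by
  rw [symPlus, Ne, Complex.cpow_eq_zero_iff]
  exact fun h => res'_ne_zero hκ ξ h.1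

lemma symMinus_sq {κ : ℝ} (hκ : 1 ≤ |κ|) (ξ : ℝ) :
    symMinus κ ξ * symMinus κ ξ = ((κ : ℂ) - Complex.I * ξ)⁻¹ := by
  rw [symMinus, ← Complex.cpow_add _ _ (res_ne_zero hκ ξ), ← Complex.cpow_neg_one]
  norm_num

lemma symPlus_sq {κ : ℝ} (hκ : 1 ≤ |κ|) (ξ : ℝ) :
    symPlus κ ξ * symPlus κ ξ = ((κ : ℂ) + Complex.I * ξ)⁻¹ := by
  rw [symPlus, ← Complex.cpow_add _ _ (res'_ne_zero hκ ξ), ← Complex.cpow_neg_one]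
  norm_num

lemma jp_quarter (ξ : ℝ) : (jp (1 / 4) ξ : ℂ) * jp (-(1 / 4)) ξ = 1 := by
  rw [← Complex.ofReal_mul, ← jp_add]
  norm_num [jp_zero]

lemma jp_half_quarter (ξ : ℝ) : (jp (1 / 2) ξ : ℂ) = jp (1 / 4) ξ * jp (1 / 4) ξ := by
  rw [← Complex.ofReal_mul, ← jp_add]
  norm_num

lemma sym_eq_symMinus {κ : ℝ} (hκ : 1 ≤ |κ|) (ξ : ℝ) :
    sym κ ξ = jp (1 / 4) ξ * jp (1 / 4) ξ * (symMinus κ ξ * symMinus κ ξ) := by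
  rw [sym_eq hκ, symMinus_sq hκ, jp_half_quarter]

lemma sym_neg_eq_symPlus {κ : ℝ} (hκ : 1 ≤ |κ|) (ξ : ℝ) :
    sym (-κ) ξ = -(jp (1 / 4) ξ * jp (1 / 4) ξ * (symPlus κ ξ * symPlus κ ξ)) := by
  rw [sym_eq (by rwa [abs_neg]), symPlus_sq hκ, jp_half_quarter, ← mul_neg, ← inv_neg]
  push_cast
  ring_nf

namespace IsSob

variable {s : ℝ} {ω : ℝ → ℝ} {μ : Measure ℝ} (S : IsSob s ω μ)
include S

lemma ae_tsum {f : ℕ → Lp ℂ 2 (kmeas (kw (tex s) ω))} (hf : Summable fun m => ‖f m‖) :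
    ∀ᵐ p : ℝ × ℝ, HasSum (fun m => f m p) ((∑' m, f m : Lp ℂ 2 (kmeas (kw (tex s) ω))) p) := by
  have h1 : ∀ᵐ p : ℝ × ℝ, Summable fun m => f m p := by
    have hi : ∫⁻ p, ∑' m, ‖flat (f m) p‖ₑ < ⊤ := by
      rw [lintegral_tsum fun m => (S.integrable_flat (f m)).aestronglyMeasurable.enorm]
      refine (ENNReal.tsum_le_tsum fun m => S.lintegral_flat_le (f m)).trans_lt ?_
      rw [ENNReal.tsum_mul_left]
      refine ENNReal.mul_lt_top S.jpInt_tex_lt_top ?_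
      rw [lt_top_iff_ne_top]
      have := hf.tsum_ofReal_ne_top
      simpa only [ofReal_norm] using this
    have hm : AEMeasurable (fun p => ∑' m, ‖flat (f m) p‖ₑ) :=
      AEMeasurable.tsum fun m => (S.integrable_flat (f m)).aestronglyMeasurable.enorm
    filter_upwards [ae_lt_top' hm hi.ne] with p hp
    have h2 : Summable fun m => ‖flat (f m) p‖ := by
      have h3 : (∑' m, ‖flat (f m) p‖ₑ) ≠ ⊤ := hp.ne
      have h4 := ENNReal.summable_toReal h3
      simpa only [toReal_enorm] using h4
    have h5 := h2.of_norm.mul_left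
      ((jp (-(1 / 4)) p.1 * jp (-(1 / 4)) p.2 : ℝ) : ℂ)⁻¹
    refine h5.congr fun m => ?_
    have h0 : ((jp (-(1 / 4)) p.1 * jp (-(1 / 4)) p.2 : ℝ) : ℂ) ≠ 0 := by
      exact_mod_cast (mul_pos (jp_pos _ _) (jp_pos _ _)).ne'
    rw [flat, inv_mul_cancel_left₀ h0]
  have h2 : Tendsto (fun n => ∑ m ∈ Finset.range n, f m) atTop (𝓝 (∑' m, f m)) :=
    hf.of_norm.hasSum.tendsto_sum_nat
  obtain ⟨φ, hφ, hl⟩ := (tendstoInMeasure_of_tendsto_Lp h2).exists_seq_tendsto_ae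
  have h3 : ∀ᵐ p : ℝ × ℝ, ∀ n, (∑ m ∈ Finset.range n, f m : Lp ℂ 2 (kmeas (kw (tex s) ω))) p =
      ∑ m ∈ Finset.range n, f m p := by
    rw [ae_all_iff]
    intro n
    refine S.isKW.isWeighted.ae_eq_iff.1 ?_
    filter_upwards [Lp.coeFn_finsetSum (Finset.range n) f] with p hp
    rw [hp, Finset.sum_apply]
  filter_upwards [h1, S.isKW.isWeighted.ae_iff.1 hl, h3] with p q1 q2 q3
  have q4 := q1.hasSum.tendsto_sum_nat.comp hφ.tendsto_atTop
  have q5 : Tendsto (fun n => ∑ m ∈ Finset.range (φ n), f m p) atTop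
      (𝓝 ((∑' m, f m : Lp ℂ 2 (kmeas (kw (tex s) ω))) p)) := by
    simpa only [q3] using q2
  rw [← tendsto_nhds_unique q4 q5]
  exact q1.hasSum

lemma kerLambda_ae {κ : ℝ} (hκ : 1 ≤ |κ|) {w : ℝ → ℂ} {q : Lp ℂ 2 μ} (hw : w =ᵐ[volume] q) :
    (fun p : ℝ × ℝ => kerLambda κ w p.1 p.2) =ᵐ[volume] fun p =>
      ((symMinus κ p.1)⁻¹ * jp (-(1 / 4)) p.1) * S.X κ q p * (jp (1 / 4) p.2 * symPlus κ p.2) := by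
  filter_upwards [S.coeFn_X κ q, ae_diff hw] with p h1 h2
  have h3 := symMinus_ne_zero hκ p.1
  have h4 := jp_quarter p.1
  have h5 := jp_quarter p.2
  rw [h1, sym_eq_symMinus hκ, qker, flat, kerLambda, h2, ← cpi_eq]
  push_cast
  field_simp
  linear_combination -(cpi * q (p.1 - p.2) * symPlus κ p.2) * (h4 * (jp (1 / 4) p.1 * jp (-(1 / 4)) p.1 *
    (jp (1 / 4) p.2 * jp (-(1 / 4)) p.2)) + h4 * (jp (1 / 4) p.2 * jp (-(1 / 4)) p.2) + h5)

lemma kerGamma_ae {κ : ℝ} (hκ : 1 ≤ |κ|) {ε : ℤˣ} {w : ℝ → ℂ} {v : Lp ℂ 2 μ}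
    (hw : rHat ε w =ᵐ[volume] v) :
    (fun p : ℝ × ℝ => kerGamma ε κ w p.1 p.2) =ᵐ[volume] fun p =>
      -((symPlus κ p.1)⁻¹ * jp (-(1 / 4)) p.1) * S.X (-κ) v p *
        (jp (1 / 4) p.2 * symMinus κ p.2) := by
  filter_upwards [S.coeFn_X (-κ) v, ae_diff hw] with p h1 h2
  have h3 := symPlus_ne_zero hκ p.1
  have h4 := jp_quarter p.1
  have h5 := jp_quarter p.2
  rw [h1, sym_neg_eq_symPlus hκ, qker, flat, kerGamma, h2, ← cpi_eq]
  push_cast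
  field_simp
  linear_combination -(cpi * v (p.1 - p.2) * symMinus κ p.2) * (h4 * (jp (1 / 4) p.1 * jp (-(1 / 4)) p.1 *
    (jp (1 / 4) p.2 * jp (-(1 / 4)) p.2)) + h4 * (jp (1 / 4) p.2 * jp (-(1 / 4)) p.2) + h5)

omit S in
lemma kerComp_eq (K L : ℝ → ℝ → ℂ) (p : ℝ × ℝ) : kerComp K L p.1 p.2 =
    kcomp (fun p => K p.1 p.2) (fun p => L p.1 p.2) p := rfl

lemma kerOdd_ae {κ : ℝ} (hκ : 1 ≤ |κ|) {ε : ℤˣ} {w : ℝ → ℂ} {q v : Lp ℂ 2 μ}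
    (hw : w =ᵐ[volume] q) (hv : rHat ε w =ᵐ[volume] v) (m : ℕ) :
    (fun p : ℝ × ℝ => kerOdd ε κ w m p.1 p.2) =ᵐ[volume] fun p =>
      (-1) ^ m * (((symMinus κ p.1)⁻¹ * jp (-(1 / 4)) p.1) *
        alt S.isKW.mul (S.X κ q) (S.X (-κ) v) m p * (jp (1 / 4) p.2 * symPlus κ p.2)) := by
  induction m with
  | zero => simpa only [pow_zero, one_mul, kerOdd, alt] using S.kerLambda_ae hκ hw
  | succ m ih =>
    set X := S.X κ q
    set X' := S.X (-κ) v
    have h1 : (fun p : ℝ × ℝ => kerComp (kerGamma ε κ w) (kerOdd ε κ w m) p.1 p.2) =ᵐ[volume]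
        fun p => (-1) ^ (m + 1) * (((symPlus κ p.1)⁻¹ * jp (-(1 / 4)) p.1) *
          S.isKW.mul X' (alt S.isKW.mul X X' m) p * (jp (1 / 4) p.2 * symPlus κ p.2)) := by
      simp only [kerComp_eq]
      refine (kcomp_congr (S.kerGamma_ae hκ hv) ih).trans ?_
      filter_upwards [S.isKW.coeFn_mul X' (alt S.isKW.mul X X' m)] with p hp
      rw [hp, kcomp, kcomp, ← integral_const_mul, ← integral_mul_const, ← integral_const_mul]
      refine integral_congr_ae (.of_forall fun ζ => ?_)
      have h3 := symMinus_ne_zero hκ ζ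
      have h4 := jp_quarter ζ
      simp only
      rw [pow_succ]
      field_simp
      linear_combination (- X' (p.1, ζ) * alt S.isKW.mul X X' m (ζ, p.2) * jp (-(1 / 4)) p.1 *
        jp (1 / 4) p.2 * symPlus κ p.2 * (symPlus κ p.1)⁻¹) * h4
    simp only [kerOdd, kerComp_eq]
    refine (kcomp_congr (S.kerLambda_ae hκ hw) h1).trans ?_
    filter_upwards [S.isKW.coeFn_mul X (S.isKW.mul X' (alt S.isKW.mul X X' m))] with p hp
    rw [alt, hp, kcomp, kcomp, ← integral_const_mul, ← integral_mul_const, ← integral_const_mul]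
    refine integral_congr_ae (.of_forall fun ζ => ?_)
    have h3 := symPlus_ne_zero hκ ζ
    have h4 := jp_quarter ζ
    simp only
    field_simp
    linear_combination (X (p.1, ζ) * S.isKW.mul X' (alt S.isKW.mul X X' m) (ζ, p.2) *
      jp (-(1 / 4)) p.1 * jp (1 / 4) p.2 * symPlus κ p.2 * (symMinus κ p.1)⁻¹) * h4

lemma traceTerm_eq {κ : ℝ} (hκ : 1 ≤ |κ|) {ε : ℤˣ} {w : ℝ → ℂ} {q v : Lp ℂ 2 μ}
    (hw : w =ᵐ[volume] q) (hv : rHat ε w =ᵐ[volume] v) (m : ℕ) :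
    traceTerm ε κ w m =
      (-1) ^ (m + 1) * S.isKW.tr (alt S.isKW.mul (S.X κ q) (S.X (-κ) v) m) (S.X (-κ) v) := by
  set X := S.X κ q
  set X' := S.X (-κ) v
  have hi := (S.isKW.integrable_tr (alt S.isKW.mul X X' m) X').const_mul ((-1) ^ (m + 1) : ℂ)
  have he : (fun p : ℝ × ℝ => kerOdd ε κ w m p.1 p.2 * kerGamma ε κ w p.2 p.1) =ᵐ[volume]
      fun p => (-1) ^ (m + 1) * (alt S.isKW.mul X X' m p * X' p.swap) := by
    filter_upwards [S.kerOdd_ae hκ hw hv m, ae_swap (S.kerGamma_ae hκ hv)] with p h1 h2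
    simp only [Prod.fst_swap, Prod.snd_swap] at h2
    rw [h1, h2]
    have h3 := symPlus_ne_zero hκ p.2
    have h4 := symMinus_ne_zero hκ p.1
    have h5 := jp_quarter p.1
    have h6 := jp_quarter p.2
    rw [pow_succ]
    field_simp
    linear_combination (- alt S.isKW.mul X X' m p * X' p.swap) *
      (h5 * (jp (1 / 4) p.2 * jp (-(1 / 4)) p.2) + h6)
  rw [S.isKW.tr_apply, ← integral_const_mul]
  rw [Measure.volume_eq_prod] at hi he ⊢
  rw [← integral_congr_ae he, integral_prod _ (hi.congr he.symm)]
  rfl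

lemma ATerm_eq {κ : ℝ} (hκ : 1 ≤ |κ|) {ε : ℤˣ} {w : ℝ → ℂ} {q v : Lp ℂ 2 μ}
    (hw : w =ᵐ[volume] q) (hv : rHat ε w =ᵐ[volume] v) (m : ℕ) :
    ATerm ε κ w m = -(((m : ℂ) + 1)⁻¹ *
      S.isKW.tr (alt S.isKW.mul (S.X κ q) (S.X (-κ) v) m) (S.X (-κ) v)) := by
  rw [ATerm, S.traceTerm_eq hκ hw hv, pow_succ]
  have : ((-1 : ℂ) ^ m) * (-1) ^ m = 1 := by rw [← mul_pow]; norm_num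
  rw [div_eq_mul_inv]
  linear_combination (-(((m : ℂ) + 1)⁻¹ *
      S.isKW.tr (alt S.isKW.mul (S.X κ q) (S.X (-κ) v) m) (S.X (-κ) v))) * this

lemma summable_ATerm {κ : ℝ} (hκ : 1 ≤ |κ|) {ε : ℤˣ} {w : ℝ → ℂ} {q v : Lp ℂ 2 μ}
    (hw : w =ᵐ[volume] q) (hv : rHat ε w =ᵐ[volume] v) (hq : ‖q‖ ≤ rad s) (hv' : ‖v‖ ≤ rad s) :
    Summable fun m => ‖ATerm ε κ w m‖ := by
  simp only [S.ATerm_eq hκ hw hv, norm_neg]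
  exact S.isKW.isTraceAlgebra.summable_logDet (S.norm_X_le_half κ hq) (S.norm_X_le_half _ hv')
    (by norm_num)

lemma A_eq {κ : ℝ} (hκ : 1 ≤ |κ|) {ε : ℤˣ} {w : ℝ → ℂ} {q v : Lp ℂ 2 μ}
    (hw : w =ᵐ[volume] q) (hv : rHat ε w =ᵐ[volume] v) :
    A ε κ w = - (Real.sign κ) * S.logd κ q v := by
  rw [A, logd, logDet]
  simp only [S.ATerm_eq hκ hw hv, tsum_neg]
  ring

lemma resolvent12_ae {κ : ℝ} (hκ : 1 ≤ |κ|) {ε : ℤˣ} {w : ℝ → ℂ} {q v : Lp ℂ 2 μ}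
    (hw : w =ᵐ[volume] q) (hv : rHat ε w =ᵐ[volume] v) (hq : ‖q‖ ≤ rad s) (hv' : ‖v‖ ≤ rad s) :
    (fun p : ℝ × ℝ => resolvent12 ε κ w p.1 p.2) =ᵐ[volume]
      flat (rmul _ (isMult_sym (-κ)) (S.Z κ q v)) := by
  have hs := S.isKW.isTraceAlgebra.summable_norm_alt (S.norm_X_le_half κ hq)
    (S.norm_X_le_half (-κ) hv') (by norm_num)
  have h3 : ∀ᵐ p : ℝ × ℝ, ∀ m, kerOdd ε κ w m p.1 p.2 =
      (-1) ^ m * (((symMinus κ p.1)⁻¹ * jp (-(1 / 4)) p.1) *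
        alt S.isKW.mul (S.X κ q) (S.X (-κ) v) m p * (jp (1 / 4) p.2 * symPlus κ p.2)) := by
    rw [ae_all_iff]
    exact S.kerOdd_ae hκ hw hv
  filter_upwards [S.ae_tsum hs, h3, coeFn_rmul S.isKW (isMult_sym (-κ)) (S.Z κ q v)]
    with p h1 h2 h4
  rw [flat, h4, resolvent12]
  have h5 := h1.mul_left (((jp (-(1 / 4)) p.1 * jp (-(1 / 4)) p.2 : ℝ) : ℂ) * sym (-κ) p.2)
  rw [_root_.mul_assoc] at h5
  rw [Z, altSum, ← h5.tsum_eq]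
  refine tsum_congr fun m => ?_
  have h6 : ((-1 : ℂ) ^ m) * (-1) ^ m = 1 := by rw [← mul_pow]; norm_num
  have h7 := mul_inv_cancel₀ (symMinus_ne_zero hκ p.1)
  have h8 := jp_quarter p.2
  rw [h2, sym_neg_eq_symPlus hκ, pow_succ]
  push_cast
  set T := (jp (-(1 / 4)) p.1 : ℂ) * alt S.isKW.mul (S.X κ q) (S.X (-κ) v) m p * jp (1 / 4) p.2 *
    symPlus κ p.2 * symPlus κ p.2 with hT
  linear_combination -(T * (-1) ^ m * (-1) ^ m) * h7 - T * h6 + T * h8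

lemma green12_eq {κ : ℝ} (hκ : 1 ≤ |κ|) {ε : ℤˣ} {w : ℝ → ℂ} {q v : Lp ℂ 2 μ}
    (hw : w =ᵐ[volume] q) (hv : rHat ε w =ᵐ[volume] v) (hq : ‖q‖ ≤ rad s) (hv' : ‖v‖ ≤ rad s)
    (x : ℝ) : green12 ε κ w x x = cpi * ∫ h : ℝ, Complex.exp (Complex.I * (x * h)) * S.G κ q v h := by
  set Y := rmul _ (isMult_sym (-κ)) (S.Z κ q v) with hY
  have h0 := S.integrable_flat Y
  have h1 : Integrable fun p : ℝ × ℝ => flat Y p * Complex.exp (Complex.I * (x * (p.1 - p.2 : ℝ))) := by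
    refine h0.mul_bdd (c := 1) (Continuous.aestronglyMeasurable (by fun_prop))
      (.of_forall fun p => ?_)
    rw [Complex.norm_exp]
    simp
  have h2 := integral_diag_mul (f := fun h : ℝ => Complex.exp (Complex.I * (x * h))) h1
  rw [green12, ← cpi_mul_cpi, _root_.mul_assoc]
  congr 1
  have h3 : ∫ p : ℝ × ℝ, Complex.exp (Complex.I * (x * p.1 - x * p.2)) * resolvent12 ε κ w p.1 p.2 =
      ∫ p : ℝ × ℝ, flat Y p * Complex.exp (Complex.I * (x * (p.1 - p.2 : ℝ))) := by
    refine integral_congr_ae ?_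
    filter_upwards [S.resolvent12_ae hκ hw hv hq hv'] with p hp
    rw [hp, mul_comm, ← hY]
    push_cast
    ring_nf
  rw [h3, ← h2, ← integral_const_mul]
  refine integral_congr_ae ?_
  filter_upwards [S.coeFn_D Y] with h hh
  rw [G, ← hY, hh, dker]
  ring

lemma integrable_D (X : Lp ℂ 2 (kmeas (kw (tex s) ω))) : Integrable (S.D X) :=
  ((integrable_diag (S.integrable_flat X)).const_mul cpi).congr (S.coeFn_D X).symm

lemma g12_eq {κ : ℝ} (hκ : 1 ≤ |κ|) {ε : ℤˣ} {w : ℝ → ℂ} {q v : Lp ℂ 2 μ}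
    (hw : w =ᵐ[volume] q) (hv : rHat ε w =ᵐ[volume] v) (hq : ‖q‖ ≤ rad s) (hv' : ‖v‖ ≤ rad s)
    (x : ℝ) : g12 ε κ w x =
      Real.sign κ * (cpi * ∫ h : ℝ, Complex.exp (Complex.I * (x * h)) * S.G κ q v h) := by
  rw [g12, S.green12_eq hκ hw hv hq hv']

omit S in
lemma integrable_exp_mul {F φ : ℝ → ℂ} (hF : Integrable F) (hφ : Integrable φ) :
    Integrable fun p : ℝ × ℝ => Complex.exp (Complex.I * (p.1 * p.2)) * F p.2 * φ p.1 := by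
  have h1 := hφ.mul_prod hF
  refine (h1.bdd_mul (c := 1) (f := fun p : ℝ × ℝ => Complex.exp (Complex.I * (p.1 * p.2)))
    (Continuous.aestronglyMeasurable (by fun_prop)) (.of_forall fun p => ?_)).congr
    (.of_forall fun p => ?_)
  · rw [Complex.norm_exp]
    simp
  · simp only
    ring

omit S in
lemma integral_invFourier_mul {F φ : ℝ → ℂ} (hF : Integrable F) (hφ : Integrable φ) :
    ∫ x : ℝ, (cpi * ∫ h : ℝ, Complex.exp (Complex.I * (x * h)) * F h) * φ x =
      ∫ h, F h * fourierT φ (-h) := by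
  have h1 := integrable_exp_mul hF hφ
  have e1 : ∫ x : ℝ, (cpi * ∫ h : ℝ, Complex.exp (Complex.I * (x * h)) * F h) * φ x =
      cpi * ∫ x : ℝ, ∫ h : ℝ, Complex.exp (Complex.I * (x * h)) * F h * φ x := by
    rw [← integral_const_mul]
    refine integral_congr_ae (.of_forall fun x => ?_)
    simp only
    rw [_root_.mul_assoc, ← integral_mul_const]
  rw [e1, integral_integral_swap h1, ← integral_const_mul]
  refine integral_congr_ae (.of_forall fun h => ?_)
  simp only [fourierT]
  rw [← cpi_eq, ← integral_const_mul, ← integral_const_mul, ← integral_const_mul]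
  refine integral_congr_ae (.of_forall fun x => ?_)
  simp only
  push_cast
  rw [show -(Complex.I * -(h : ℂ) * x) = Complex.I * (x * h) by ring]
  ring

omit S in
lemma integrable_invFourier_mul {F φ : ℝ → ℂ} (hF : Integrable F) (hφ : Integrable φ) :
    Integrable fun x : ℝ => (cpi * ∫ h : ℝ, Complex.exp (Complex.I * (x * h)) * F h) * φ x := by
  refine ((integrable_exp_mul hF hφ).integral_prod_left.const_mul cpi).congr (.of_forall fun x => ?_)
  simp only
  rw [_root_.mul_assoc, ← integral_mul_const]

lemma integral_g12 {κ : ℝ} (hκ : 1 ≤ |κ|) {ε : ℤˣ} {w : ℝ → ℂ} {q v : Lp ℂ 2 μ}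
    (hw : w =ᵐ[volume] q) (hv : rHat ε w =ᵐ[volume] v) (hq : ‖q‖ ≤ rad s) (hv' : ‖v‖ ≤ rad s)
    {φ : ℝ → ℂ} (hφ : Integrable φ) :
    ∫ x, g12 ε κ w x * φ x = Real.sign κ * ∫ h, S.G κ q v h * fourierT φ (-h) := by
  simp only [S.g12_eq hκ hw hv hq hv', _root_.mul_assoc (Real.sign κ : ℂ)]
  rw [integral_const_mul, integral_invFourier_mul (F := S.G κ q v) (S.integrable_D _) hφ]

lemma integrable_g12 {κ : ℝ} (hκ : 1 ≤ |κ|) {ε : ℤˣ} {w : ℝ → ℂ} {q v : Lp ℂ 2 μ}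
    (hw : w =ᵐ[volume] q) (hv : rHat ε w =ᵐ[volume] v) (hq : ‖q‖ ≤ rad s) (hv' : ‖v‖ ≤ rad s)
    {φ : ℝ → ℂ} (hφ : Integrable φ) : Integrable fun x => g12 ε κ w x * φ x := by
  simp only [S.g12_eq hκ hw hv hq hv', _root_.mul_assoc (Real.sign κ : ℂ)]
  exact (integrable_invFourier_mul (S.integrable_D _) hφ).const_mul _

end IsSob

end

end AKNS

namespace AKNS

noncomputable section

open scoped ENNReal NNReal FourierTransform ContDiff
open Filter Topology

/-! ### The Fourier transform on Schwartz functions -/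

/-- Dilation of the line. -/
def dilation (c : ℝ) (hc : c ≠ 0) : ℝ ≃L[ℝ] ℝ := ContinuousLinearEquiv.unitsEquivAut ℝ (Units.mk0 c hc)

lemma dilation_apply (c : ℝ) (hc : c ≠ 0) (x : ℝ) : dilation c hc x = x * c := by
  simp [dilation]

lemma two_pi_ne_zero' : (2 * Real.pi : ℝ) ≠ 0 := by positivity

lemma fourierT_eq_fourier (f : ℝ → ℂ) (ξ : ℝ) :
    fourierT f ξ = cpi * 𝓕 f (ξ * (2 * Real.pi)⁻¹) := by
  rw [fourierT, ← cpi_eq, Real.fourier_real_eq_integral_exp_smul]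
  congr 1
  refine integral_congr_ae (.of_forall fun x => ?_)
  simp only [smul_eq_mul]
  congr 2
  have : (Real.pi : ℂ) ≠ 0 := by exact_mod_cast Real.pi_ne_zero
  push_cast
  field_simp

/-- The unitary Fourier transform of a Schwartz function. -/
def sft (φ : 𝓢(ℝ, ℂ)) : 𝓢(ℝ, ℂ) :=
  cpi • SchwartzMap.compCLMOfContinuousLinearEquiv ℂ
    (dilation (2 * Real.pi)⁻¹ (inv_ne_zero two_pi_ne_zero')) (𝓕 φ)

lemma sft_apply (φ : 𝓢(ℝ, ℂ)) (ξ : ℝ) : sft φ ξ = fourierT φ ξ := by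
  rw [fourierT_eq_fourier, sft, smul_apply, smul_eq_mul,
    SchwartzMap.compCLMOfContinuousLinearEquiv_apply, Function.comp_apply, dilation_apply,
    SchwartzMap.fourier_coe]

lemma coe_sft (φ : 𝓢(ℝ, ℂ)) : ⇑(sft φ) = fourierT φ := funext (sft_apply φ)

/-- The inverse unitary Fourier transform of a Schwartz function. -/
def isft (ψ : 𝓢(ℝ, ℂ)) : 𝓢(ℝ, ℂ) :=
  𝓕⁻ (cpi⁻¹ • SchwartzMap.compCLMOfContinuousLinearEquiv ℂ
    (dilation (2 * Real.pi) two_pi_ne_zero') ψ)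

lemma sft_isft (ψ : 𝓢(ℝ, ℂ)) : sft (isft ψ) = ψ := by
  ext ξ
  rw [sft, isft, FourierTransform.fourier_fourierInv_eq, smul_apply,
    SchwartzMap.compCLMOfContinuousLinearEquiv_apply, Function.comp_apply, smul_apply,
    SchwartzMap.compCLMOfContinuousLinearEquiv_apply, Function.comp_apply, dilation_apply,
    dilation_apply, smul_smul, mul_inv_cancel₀ cpi_ne_zero, one_smul,
    inv_mul_cancel_right₀ two_pi_ne_zero']

lemma fourier_inversion (φ : 𝓢(ℝ, ℂ)) (x : ℝ) :
    φ x = cpi * ∫ h : ℝ, Complex.exp (Complex.I * (x * h)) * fourierT φ h := by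
  have h1 : φ x = (𝓕⁻ (𝓕 φ) : 𝓢(ℝ, ℂ)) x := by rw [FourierTransform.fourierInv_fourier_eq]
  have h2 : (𝓕⁻ (𝓕 φ) : 𝓢(ℝ, ℂ)) x =
      ∫ v : ℝ, Complex.exp (Complex.I * (x * (v * (2 * Real.pi) : ℝ))) * 𝓕 (φ : ℝ → ℂ) v := by
    rw [SchwartzMap.fourierInv_coe, Real.fourierInv_eq']
    refine integral_congr_ae (.of_forall fun v => ?_)
    simp only [smul_eq_mul, RCLike.inner_apply, conj_trivial, SchwartzMap.fourier_coe]
    congr 2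
    push_cast
    ring
  rw [h1, h2, ← integral_const_mul]
  have h3 := Measure.integral_comp_mul_right
    (fun h : ℝ => cpi * (Complex.exp (Complex.I * (x * h)) * fourierT φ h)) (2 * Real.pi)
  rw [abs_of_pos (by positivity), eq_inv_smul_iff₀ two_pi_ne_zero'] at h3
  rw [← h3, ← integral_smul]
  refine integral_congr_ae (.of_forall fun v => ?_)
  simp only [fourierT_eq_fourier]
  rw [mul_inv_cancel_right₀ two_pi_ne_zero', Complex.real_smul]
  have h4 := cpi_mul_cpi
  have h5 : ((2 * Real.pi : ℝ) : ℂ) ≠ 0 := by exact_mod_cast two_pi_ne_zero'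
  calc _ = (((2 * Real.pi : ℝ) : ℂ) * (cpi * cpi)) *
      (Complex.exp (Complex.I * (x * (v * (2 * Real.pi) : ℝ))) * 𝓕 (φ : ℝ → ℂ) v) := by
        rw [h4, mul_inv_cancel₀ h5, one_mul]
    _ = _ := by ring

lemma integrable_fourierT (φ : 𝓢(ℝ, ℂ)) : Integrable (fourierT φ) := by
  rw [← coe_sft]
  exact (sft φ).integrable

/-- Parseval's identity, in bilinear form. -/
lemma integral_mul_eq (f φ : 𝓢(ℝ, ℂ)) : ∫ x, f x * φ x = ∫ h, fourierT f h * fourierT φ (-h) := by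
  rw [← IsSob.integral_invFourier_mul (integrable_fourierT f) φ.integrable]
  simp only [← fourier_inversion]

lemma fourierT_deriv (φ : 𝓢(ℝ, ℂ)) (ξ : ℝ) :
    fourierT (SchwartzMap.derivCLM ℂ ℂ φ) ξ = Complex.I * ξ * fourierT φ ξ := by
  have h : 𝓕 (deriv φ) = fun x : ℝ => (2 * Real.pi * Complex.I * x) • (𝓕 (φ : ℝ → ℂ) x) :=
    Real.fourier_deriv φ.integrable φ.differentiable (SchwartzMap.derivCLM ℂ ℂ φ).integrable
  have e : ⇑(SchwartzMap.derivCLM ℂ ℂ φ) = deriv φ := funext (SchwartzMap.derivCLM_apply ℂ φ)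
  rw [fourierT_eq_fourier, e, h, fourierT_eq_fourier]
  simp only [smul_eq_mul]
  have : (Real.pi : ℂ) ≠ 0 := by exact_mod_cast Real.pi_ne_zero
  push_cast
  field_simp

lemma fourierT_conj (f : ℝ → ℂ) (ξ : ℝ) :
    fourierT (fun x => conj (f x)) ξ = conj (fourierT f (-ξ)) := by
  rw [fourierT, fourierT, ← cpi_eq, map_mul, IsSob.conj_cpi, ← integral_conj]
  congr 1
  refine integral_congr_ae (.of_forall fun x => ?_)
  simp only [map_mul, ← Complex.exp_conj, map_neg, Complex.conj_I, Complex.conj_ofReal]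
  congr 2
  push_cast
  ring

lemma fourierT_add_smul (f φ : 𝓢(ℝ, ℂ)) (θ : ℝ) (ξ : ℝ) :
    fourierT (f + θ • φ : 𝓢(ℝ, ℂ)) ξ = fourierT f ξ + θ * fourierT φ ξ := by
  have h : ∀ ψ : 𝓢(ℝ, ℂ), Integrable fun x : ℝ => Complex.exp (-(Complex.I * ξ * x)) * ψ x := by
    intro ψ
    refine ψ.integrable.bdd_mul (c := 1) (Continuous.aestronglyMeasurable (by fun_prop))
      (.of_forall fun x => ?_)
    rw [Complex.norm_exp]
    simp
  simp only [fourierT, ← cpi_eq]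
  rw [mul_left_comm, ← mul_add, ← integral_const_mul (θ : ℂ), ← integral_add (h f) ((h φ).const_mul _)]
  congr 1
  refine integral_congr_ae (.of_forall fun x => ?_)
  simp only [add_apply, smul_apply, Complex.real_smul]
  ring

lemma memLp_sobolev {s : ℝ} (hs : s ≤ 0) {f : ℝ → ℂ} (hf : MemLp f 2) :
    MemLp f 2 (sobolevMeasure s) := by
  refine hf.mono_measure ?_
  conv_rhs => rw [← withDensity_one (μ := (volume : Measure ℝ))]
  rw [sobolevMeasure]
  refine withDensity_mono (.of_forall fun ξ => ?_)
  simp only [Pi.one_apply, ENNReal.ofReal_le_one]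
  exact Real.rpow_le_one_of_one_le_of_nonpos (by nlinarith [sq_nonneg ξ]) hs

lemma exists_isOfSchwartz {s : ℝ} (hs : s ≤ 0) (φ : 𝓢(ℝ, ℂ)) : ∃ q : Hs s, IsOfSchwartz q φ := by
  have h : MemLp (fourierT φ) 2 (sobolevMeasure s) := by
    refine memLp_sobolev hs ?_
    rw [← coe_sft]
    exact (sft φ).memLp 2
  exact ⟨h.toLp _, (isWeighted_sobolev s).ae_eq_iff.1 h.coeFn_toLp⟩

lemma isSob_locallyIntegrable {s : ℝ} (q : Hs s) : LocallyIntegrable q := by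
  have hw := isWeighted_sobolev s
  rw [locallyIntegrable_iff]
  intro K hK
  have hc : Continuous fun ξ : ℝ => (4 + ξ ^ 2) ^ (-s) :=
    Continuous.rpow_const (by fun_prop) fun x => Or.inl (by positivity)
  obtain ⟨C, hC⟩ := hK.bddAbove_image hc.continuousOn
  have hC' : ∀ x ∈ K, (4 + x ^ 2) ^ (-s) ≤ C := fun x hx => hC ⟨x, hx, rfl⟩
  have h2 : MemLp q 2 (volume.restrict K) := by
    refine ⟨(Lp.stronglyMeasurable q).aestronglyMeasurable, ?_⟩
    rw [eLpNorm_lt_top_iff_lintegral_rpow_enorm_lt_top two_ne_zero ENNReal.ofNat_ne_top]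
    simp only [ENNReal.toReal_ofNat, ENNReal.rpow_ofNat]
    calc ∫⁻ x in K, ‖q x‖ₑ ^ 2 ≤ ∫⁻ x in K, ENNReal.ofReal C *
          (dens s (fun _ => 1) x * ‖q x‖ₑ ^ 2) := by
          refine setLIntegral_mono' hK.measurableSet fun x hx => ?_
          rw [← _root_.mul_assoc]
          refine le_mul_of_one_le_left' ?_
          rw [dens, ENNReal.ofReal_one, one_pow, one_mul, ← ENNReal.ofReal_mul
            ((Real.rpow_nonneg (by positivity) _).trans (hC' x hx)), ENNReal.one_le_ofReal]
          calc (1 : ℝ) = (4 + x ^ 2) ^ (-s) * (4 + x ^ 2) ^ s := by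
                rw [← Real.rpow_add (by positivity)]
                simp
            _ ≤ _ := by
                gcongr
                exact hC' x hx
      _ ≤ ∫⁻ x, ENNReal.ofReal C * (dens s (fun _ => 1) x * ‖q x‖ₑ ^ 2) :=
          setLIntegral_le_lintegral _ _
      _ < ⊤ := by
          rw [lintegral_const_mul' _ _ ENNReal.ofReal_ne_top]
          exact ENNReal.mul_lt_top ENNReal.ofReal_lt_top (hw.lintegral_lt_top q)
  have : IsFiniteMeasure (volume.restrict K) := ⟨by
    rw [Measure.restrict_apply_univ]; exact hK.measure_lt_top⟩
  exact h2.integrable one_le_two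

/-- An element of `H^s` is determined by its action on Schwartz functions. -/
lemma ae_eq_of_pair {f : ℝ → ℂ} (hf : LocallyIntegrable f)
    (h : ∀ φ : 𝓢(ℝ, ℂ), ∫ ξ, f ξ * fourierT φ (-ξ) = 0) : f =ᵐ[volume] 0 := by
  refine ae_eq_zero_of_integral_contDiff_smul_eq_zero hf fun g hg hgs => ?_
  have hg1 : ContDiff ℝ ∞ fun x : ℝ => (g (-x) : ℂ) :=
    Complex.ofRealCLM.contDiff.comp (hg.comp contDiff_neg)
  have hg2 : HasCompactSupport fun x : ℝ => (g (-x) : ℂ) :=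
    (hgs.comp_homeomorph (Homeomorph.neg ℝ)).comp_left (g := fun x : ℝ => (x : ℂ))
      Complex.ofReal_zero
  have := h (isft (hg2.toSchwartzMap hg1))
  rw [← coe_sft, sft_isft] at this
  rw [← this]
  refine integral_congr_ae (.of_forall fun x => ?_)
  simp only [HasCompactSupport.toSchwartzMap_toFun, neg_neg]
  rw [Complex.real_smul, mul_comm]

end

end AKNS

namespace AKNS

noncomputable section

open scoped ENNReal NNReal
open Filter Topology

/-! ### The Hamiltonian structure -/

lemma hasFunctDeriv_of_re {ε : ℤˣ} {F : 𝓢(ℝ, ℂ) → ℂ} {q : 𝓢(ℝ, ℂ)} {V : ℝ → ℂ}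
    (h : ∀ f : 𝓢(ℝ, ℂ), HasDerivAt (fun θ : ℝ => F (q + θ • f))
      (2 * ((ε : ℤ) : ℂ) * ((∫ x : ℝ, conj (f x) * V x).re : ℂ)) 0) :
    HasFunctDeriv ε F q (fun x => ((ε : ℤ) : ℂ) * conj (V x)) V := by
  intro f
  refine (h f).congr_deriv ?_
  have e1 : ∫ x : ℝ, f x * (((ε : ℤ) : ℂ) * conj (V x)) =
      ((ε : ℤ) : ℂ) * conj (∫ x : ℝ, conj (f x) * V x) := by
    rw [← integral_conj, ← integral_const_mul]
    refine integral_congr_ae (.of_forall fun x => ?_)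
    simp only [map_mul, Complex.conj_conj]
    ring
  rw [e1, ← mul_add, add_comm, Complex.add_conj]
  push_cast
  ring

lemma HasDerivAt.re_ofReal {f : ℝ → ℂ} {f' : ℂ} {t : ℝ} (h : HasDerivAt f f' t) :
    HasDerivAt (fun t => ((f t).re : ℂ)) (f'.re : ℂ) t :=
  (Complex.reCLM.hasFDerivAt.comp_hasDerivAt t h).ofReal_comp

lemma HasDerivAt.im_ofReal {f : ℝ → ℂ} {f' : ℂ} {t : ℝ} (h : HasDerivAt f f' t) :
    HasDerivAt (fun t => ((f t).im : ℂ)) (f'.im : ℂ) t :=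
  (Complex.imCLM.hasFDerivAt.comp_hasDerivAt t h).ofReal_comp

/-- The complex conjugate of a Schwartz function. -/
def sconj (f : 𝓢(ℝ, ℂ)) : 𝓢(ℝ, ℂ) :=
  SchwartzMap.postcompCLM (𝕜 := ℝ) (Complex.conjCLE : ℂ →L[ℝ] ℂ) f

lemma sconj_apply (f : 𝓢(ℝ, ℂ)) (x : ℝ) : sconj f x = conj (f x) := rfl

lemma integrable_mul_schwartz (f g : 𝓢(ℝ, ℂ)) : Integrable fun x => f x * g x :=
  (f.memLp 2).integrable_mul (g.memLp 2)

lemma deriv_conj_schwartz (f : 𝓢(ℝ, ℂ)) (x : ℝ) :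
    deriv (sconj f) x = conj (deriv f x) :=
  (Complex.conjCLE.hasFDerivAt.comp_hasDerivAt x (f.hasDerivAt x)).deriv

lemma hasDerivAt_quadratic (a b c : ℂ) :
    HasDerivAt (fun θ : ℝ => a + θ * b + (θ : ℂ) ^ 2 * c) b 0 := by
  have h0 : HasDerivAt (fun θ : ℝ => (θ : ℂ)) 1 0 := (hasDerivAt_id (0 : ℝ)).ofReal_comp
  refine (((h0.mul_const b).const_add a).add ((h0.pow 2).mul_const c)).congr_deriv ?_
  simp

/-- The sesquilinear form `∫ f ḡ`. -/
def sesq (f g : 𝓢(ℝ, ℂ)) : ℂ := ∫ x, f x * sconj g x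

lemma sesq_expand (q f a b : 𝓢(ℝ, ℂ)) (θ : ℝ) : ∫ x, (q + θ • f) x * sconj (a + θ • b) x =
    sesq q a + θ * (sesq f a + sesq q b) + (θ : ℂ) ^ 2 * sesq f b := by
  have i (f g : 𝓢(ℝ, ℂ)) : Integrable fun x => f x * sconj g x := integrable_mul_schwartz f (sconj g)
  have i2 : Integrable fun x => (θ : ℂ) * (f x * sconj a x + q x * sconj b x) :=
    ((i f a).add (i q b)).const_mul _
  have i3 : Integrable fun x => q x * sconj a x +
      (θ : ℂ) * (f x * sconj a x + q x * sconj b x) := (i q a).add i2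
  have i4 : Integrable fun x => (θ : ℂ) ^ 2 * (f x * sconj b x) := (i f b).const_mul _
  simp only [sesq]
  rw [← integral_add (i f a) (i q b), ← integral_const_mul, ← integral_const_mul,
    ← integral_add (i q a) i2, ← integral_add i3 i4]
  refine integral_congr_ae (.of_forall fun x => ?_)
  simp only [sconj_apply, add_apply, smul_apply, Complex.real_smul, map_add, map_mul,
    Complex.conj_ofReal]
  ring

lemma conj_sesq (f g : 𝓢(ℝ, ℂ)) : conj (sesq f g) = sesq g f := by
  rw [sesq, ← integral_conj]
  refine integral_congr_ae (.of_forall fun x => ?_)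
  simp only [sconj_apply, map_mul, Complex.conj_conj]
  ring

lemma sesq_deriv (f g : 𝓢(ℝ, ℂ)) :
    sesq f (SchwartzMap.derivCLM ℂ ℂ g) = - sesq (SchwartzMap.derivCLM ℂ ℂ f) g := by
  have h := SchwartzMap.integral_mul_deriv_eq_neg_deriv_mul f (sconj g)
  simp only [deriv_conj_schwartz] at h
  simpa only [sesq, sconj_apply, SchwartzMap.derivCLM_apply] using h

lemma mass_eq (ε : ℤˣ) (q : 𝓢(ℝ, ℂ)) : mass ε q = ((ε : ℤ) : ℂ) * sesq q q := by
  rw [mass, sesq, ← integral_const_mul]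
  refine integral_congr_ae (.of_forall fun x => ?_)
  simp only [sconj_apply]
  ring

lemma momentum_eq (ε : ℤˣ) (q : 𝓢(ℝ, ℂ)) :
    momentum ε q = Complex.I⁻¹ * (((ε : ℤ) : ℂ) * sesq q (SchwartzMap.derivCLM ℂ ℂ q)) := by
  suffices e : ∫ x : ℝ, q x * deriv (fun y : ℝ => ((ε : ℤ) : ℂ) * conj (q y)) x =
      ∫ x : ℝ, ((ε : ℤ) : ℂ) * (q x * sconj (SchwartzMap.derivCLM ℂ ℂ q) x) by
    rw [momentum, e, sesq, integral_const_mul]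
  refine integral_congr_ae (.of_forall fun x => ?_)
  have h : deriv (fun y : ℝ => ((ε : ℤ) : ℂ) * conj (q y)) x = ((ε : ℤ) : ℂ) * conj (deriv q x) := by
    rw [deriv_const_mul_field, ← deriv_conj_schwartz q x]
    rfl
  simp only [h, sconj_apply, SchwartzMap.derivCLM_apply]
  ring

lemma hasDerivAt_mass (ε : ℤˣ) (q f : 𝓢(ℝ, ℂ)) : HasDerivAt (fun θ : ℝ => mass ε (q + θ • f))
    (2 * ((ε : ℤ) : ℂ) * ((∫ x : ℝ, conj (f x) * q x).re : ℂ)) 0 := by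
  simp only [mass_eq]
  have e : ∀ θ : ℝ, sesq (q + θ • f) (q + θ • f) = _ := fun θ => sesq_expand q f q f θ
  simp only [e]
  refine ((hasDerivAt_quadratic _ _ _).const_mul _).congr_deriv ?_
  have h1 : ∫ x : ℝ, conj (f x) * q x = sesq q f :=
    integral_congr_ae (.of_forall fun x => by simp only [sconj_apply]; ring)
  rw [h1, ← conj_sesq q f, add_comm (conj _), Complex.add_conj]
  push_cast
  ring

lemma hasDerivAt_momentum (ε : ℤˣ) (q f : 𝓢(ℝ, ℂ)) :
    HasDerivAt (fun θ : ℝ => momentum ε (q + θ • f))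
      (2 * ((ε : ℤ) : ℂ) * ((∫ x : ℝ, conj (f x) * (Complex.I * deriv q x)).re : ℂ)) 0 := by
  simp only [momentum_eq]
  have e : ∀ θ : ℝ, sesq (q + θ • f) (SchwartzMap.derivCLM ℂ ℂ (q + θ • f)) =
      sesq q (SchwartzMap.derivCLM ℂ ℂ q) + θ * (sesq f (SchwartzMap.derivCLM ℂ ℂ q) +
        sesq q (SchwartzMap.derivCLM ℂ ℂ f)) +
      (θ : ℂ) ^ 2 * sesq f (SchwartzMap.derivCLM ℂ ℂ f) := fun θ => by
    have : SchwartzMap.derivCLM ℂ ℂ (q + θ • f) =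
      SchwartzMap.derivCLM ℂ ℂ q + θ • SchwartzMap.derivCLM ℂ ℂ f := by
        rw [map_add]
        congr 1
        ext x
        simp only [SchwartzMap.derivCLM_apply, smul_apply]
        exact ((f.hasDerivAt x).const_smul θ).deriv
    rw [this]
    exact sesq_expand q f _ _ θ
  simp only [e]
  refine (((hasDerivAt_quadratic _ _ _).const_mul _).const_mul _).congr_deriv ?_
  have h1 : ∫ x : ℝ, conj (f x) * (Complex.I * deriv q x) =
      Complex.I * sesq (SchwartzMap.derivCLM ℂ ℂ q) f := by
    rw [sesq, ← integral_const_mul]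
    refine integral_congr_ae (.of_forall fun x => ?_)
    simp only [sconj_apply, SchwartzMap.derivCLM_apply]
    ring
  rw [h1, sesq_deriv q f, ← conj_sesq _ f]
  have e2 := Complex.add_conj (Complex.I * sesq (SchwartzMap.derivCLM ℂ ℂ q) f)
  rw [map_mul, Complex.conj_I] at e2
  rw [Complex.inv_I]
  push_cast at e2
  linear_combination ((ε : ℤ) : ℂ) * e2

lemma im_mass (ε : ℤˣ) (q : 𝓢(ℝ, ℂ)) : (mass ε q).im = 0 := by
  rw [← Complex.conj_eq_iff_im, mass_eq, map_mul, conj_sesq, conj_int_units]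

lemma im_momentum (ε : ℤˣ) (q : 𝓢(ℝ, ℂ)) : (momentum ε q).im = 0 := by
  rw [← Complex.conj_eq_iff_im, momentum_eq, map_mul, map_mul, conj_sesq, conj_int_units, sesq_deriv,
    map_inv₀, Complex.conj_I, Complex.inv_I, inv_neg, Complex.inv_I]
  ring

lemma ae_rHat {s : ℝ} {ω : ℝ → ℝ} {μ : Measure ℝ} (S : IsSob s ω μ) {ε : ℤˣ} {w : ℝ → ℂ}
    {q : Lp ℂ 2 μ} (h : w =ᵐ[volume] q) : rHat ε w =ᵐ[volume] S.J ε q := by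
  filter_upwards [ae_neg h, S.coeFn_J ε q] with x h1 h2
  rw [h2, rHat, rHat, h1]

section Hamiltonian

variable {s : ℝ} (hs : s ∈ Ioo (-(1 / 2) : ℝ) 0) {ε : ℤˣ} {κ : ℝ} (hκ : 1 ≤ κ) {q : Hs s}
  {f : 𝓢(ℝ, ℂ)} (hq : ‖q‖ < rad s) (hf : IsOfSchwartz q f)
include hs hκ hq hf

lemma hasDerivAt_A (φ : 𝓢(ℝ, ℂ)) : HasDerivAt (fun θ : ℝ => A ε κ (fourierT (f + θ • φ : 𝓢(ℝ, ℂ))))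
    (-((ε : ℤ) : ℂ) * ((∫ x, g12 ε κ (fourierT f) x * conj (φ x)) -
      conj (∫ x, g12 ε (-κ) (fourierT f) x * conj (φ x)))) 0 := by
  have S := isSob_sobolev hs
  have hκ1 : 1 ≤ |κ| := hκ.trans (le_abs_self κ)
  have hκ2 : 1 ≤ |-κ| := by rwa [abs_neg]
  obtain ⟨p, hp⟩ := exists_isOfSchwartz hs.2.le φ
  have hpos : 0 < κ := by linarith
  set w : ℝ → Hs s := fun θ => q + θ • p with hw
  have hw' : ∀ θ : ℝ, fourierT (f + θ • φ : 𝓢(ℝ, ℂ)) =ᵐ[volume] w θ := by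
    intro θ
    filter_upwards [hf, hp, S.coeFn_add_vol q (θ • p),
      S.hμ.ae_eq_iff.1 (Lp.coeFn_smul θ p)] with ξ h1 h2 h3 h4
    rw [fourierT_add_smul, hw, h3, h4, h1, Pi.smul_apply, h2, Complex.real_smul]
  have hd : ∀ θ : ℝ, HasDerivAt w p θ := fun θ =>
    (((hasDerivAt_id θ).smul_const p).const_add q).congr_deriv (one_smul ℝ p)
  have hv : ∀ θ : ℝ, HasDerivAt (fun θ => S.J ε (w θ)) (S.J ε p) θ := fun θ =>
    (S.J ε).hasFDerivAt.comp_hasDerivAt θ (hd θ)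
  obtain ⟨η, hη, hη'⟩ : ∃ η > 0, ∀ θ ∈ Metric.ball (0 : ℝ) η, ‖w θ‖ ≤ rad s := by
    have hc : Continuous fun θ : ℝ => ‖w θ‖ := by fun_prop
    have h0 : ‖w 0‖ < rad s := by simpa [hw] using hq
    obtain ⟨η, hη, h⟩ := Metric.mem_nhds_iff.1 (hc.continuousAt.eventually_lt_const h0)
    exact ⟨η, hη, fun θ hθ => le_of_lt (h hθ)⟩
  have hder := S.hasDerivAt_logd κ (w := w) (v := fun θ => S.J ε (w θ)) (w' := fun _ => p)
    (v' := fun _ => S.J ε p) (I := Metric.ball 0 η) (C := ‖p‖) Metric.isOpen_ball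
    (convex_ball _ _).isPreconnected (fun θ _ => hd θ) (fun θ _ => hv θ) hη'
    (fun θ hθ => (S.norm_J_le ε _).trans (hη' θ hθ)) (fun _ _ => le_rfl)
    (fun _ _ => S.norm_J_le ε p) (Metric.mem_ball_self hη)
  have e0 : w 0 = q := by simp [hw]
  have hA : ∀ θ : ℝ, A ε κ (fourierT (f + θ • φ : 𝓢(ℝ, ℂ))) =
      - S.logd κ (w θ) (S.J ε (w θ)) := fun θ => by
    rw [S.A_eq hκ1 (hw' θ) (ae_rHat S (hw' θ)), Real.sign_of_pos hpos]
    push_cast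
    ring
  simp only [hA]
  refine hder.neg.congr_deriv ?_
  have hfq : fourierT f =ᵐ[volume] q := Filter.EventuallyEq.symm hf
  have hcφ : Integrable fun x => conj (φ x) := (sconj φ).integrable
  rw [e0, S.dlogd_eq_integral, S.integral_g12 hκ1 hfq (ae_rHat S hfq) hq.le
    ((S.norm_J_le ε q).trans hq.le) hcφ, S.integral_g12 hκ2 hfq (ae_rHat S hfq) hq.le
    ((S.norm_J_le ε q).trans hq.le) hcφ, Real.sign_neg, Real.sign_of_pos hpos]
  have e1 : ∫ k, S.G κ q (S.J ε q) k * S.J ε p (-k) = ((ε : ℤ) : ℂ) *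
      ∫ k, S.G κ q (S.J ε q) k * fourierT (fun x => conj (φ x)) (-k) := by
    rw [← integral_const_mul]
    refine integral_congr_ae ?_
    filter_upwards [ae_neg (S.coeFn_J ε p), hp] with k h1 h2
    rw [h1, rHat, neg_neg, h2, fourierT_conj, neg_neg]
    ring
  have e2 : ∫ k, S.G (-κ) (S.J ε q) q k * p (-k) = ((ε : ℤ) : ℂ) *
      conj (∫ k, S.G (-κ) q (S.J ε q) k * fourierT (fun x => conj (φ x)) (-k)) := by
    have e3 := S.J_G ε (-κ) hq.le ((S.norm_J_le ε q).trans hq.le)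
    rw [S.J_J] at e3
    rw [← e3, ← integral_conj, ← integral_const_mul, ← integral_neg_eq_self]
    refine integral_congr_ae ?_
    filter_upwards [ae_neg (S.coeFn_J ε (S.G (-κ) q (S.J ε q))), hp] with k h1 h2
    rw [h1, rHat, neg_neg, h2, fourierT_conj, neg_neg, map_mul, Complex.conj_conj]
    ring
  rw [e1, e2]
  push_cast
  simp only [map_mul, map_neg, map_one]
  ring

lemma generatesAt_hamNLS : GeneratesAt ε (hamNLS ε κ) f (fun x =>
    4 * (κ : ℂ) ^ 3 * (g12 ε κ (fourierT f) x - g12 ε (-κ) (fourierT f) x)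
      + 4 * (κ : ℂ) ^ 2 * f x) := by
  have S := isSob_sobolev hs
  have hκ1 : 1 ≤ |κ| := hκ.trans (le_abs_self κ)
  have hκ2 : 1 ≤ |-κ| := by rwa [abs_neg]
  have hfq : fourierT f =ᵐ[volume] q := Filter.EventuallyEq.symm hf
  refine ⟨fun g => ?_, hasFunctDeriv_of_re fun φ => ?_⟩
  · rw [hamNLS, Complex.add_im, ← Complex.ofReal_pow, ← Complex.ofReal_pow]
    have h1 : (mass ε g).im = 0 := im_mass ε g
    have h2 (n : ℕ) : ((κ ^ n : ℝ) : ℂ).im = 0 := Complex.ofReal_im _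
    simp only [Complex.mul_im, h1, h2]
    simp
  · have h := ((HasDerivAt.re_ofReal (hasDerivAt_A hs hκ hq hf (ε := ε) φ)).const_mul
      (-8 * (κ : ℂ) ^ 3)).add ((hasDerivAt_mass ε f φ).const_mul (4 * (κ : ℂ) ^ 2))
    refine h.congr_deriv ?_
    have hcφ : Integrable fun x => conj (φ x) := (sconj φ).integrable
    have i1 := S.integrable_g12 hκ1 hfq (ae_rHat S (ε := ε) hfq) hq.le
      ((S.norm_J_le ε q).trans hq.le) hcφ
    have i2 := S.integrable_g12 hκ2 hfq (ae_rHat S (ε := ε) hfq) hq.le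
      ((S.norm_J_le ε q).trans hq.le) hcφ
    have i3 : Integrable fun x => f x * conj (φ x) := integrable_mul_schwartz f (sconj φ)
    have e : ∫ x, conj (φ x) * (4 * (κ : ℂ) ^ 3 * (g12 ε κ (fourierT f) x -
        g12 ε (-κ) (fourierT f) x) + 4 * (κ : ℂ) ^ 2 * f x) =
        ((4 * κ ^ 3 : ℝ) : ℂ) * ((∫ x, g12 ε κ (fourierT f) x * conj (φ x)) -
          ∫ x, g12 ε (-κ) (fourierT f) x * conj (φ x)) +
        ((4 * κ ^ 2 : ℝ) : ℂ) * ∫ x, conj (φ x) * f x := by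
      have i4 : Integrable fun x => ((4 * κ ^ 3 : ℝ) : ℂ) * (g12 ε κ (fourierT f) x * conj (φ x) -
        g12 ε (-κ) (fourierT f) x * conj (φ x)) := (i1.sub i2).const_mul _
      have i5 : Integrable fun x => ((4 * κ ^ 2 : ℝ) : ℂ) * (conj (φ x) * f x) :=
        (i3.congr (.of_forall fun x => mul_comm _ _)).const_mul _
      rw [← integral_sub i1 i2, ← integral_const_mul, ← integral_const_mul, ← integral_add i4 i5]
      refine integral_congr_ae (.of_forall fun x => ?_)
      push_cast
      ring
    rw [e]
    have hε : -((ε : ℤ) : ℂ) = ((-((ε : ℤ) : ℝ) : ℝ) : ℂ) := by push_cast; rfl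
    rw [hε, Complex.re_ofReal_mul, Complex.sub_re, Complex.conj_re, Complex.add_re,
      Complex.re_ofReal_mul, Complex.re_ofReal_mul, Complex.sub_re]
    push_cast
    ring

lemma generatesAt_hamMKdV : GeneratesAt ε (hamMKdV ε κ) f (fun x => Complex.I *
    (8 * (κ : ℂ) ^ 4 * (g12 ε κ (fourierT f) x + g12 ε (-κ) (fourierT f) x)
      + 4 * (κ : ℂ) ^ 2 * deriv f x)) := by
  have S := isSob_sobolev hs
  have hκ1 : 1 ≤ |κ| := hκ.trans (le_abs_self κ)
  have hκ2 : 1 ≤ |-κ| := by rwa [abs_neg]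
  have hfq : fourierT f =ᵐ[volume] q := Filter.EventuallyEq.symm hf
  refine ⟨fun g => ?_, hasFunctDeriv_of_re fun φ => ?_⟩
  · rw [hamMKdV, Complex.add_im, ← Complex.ofReal_pow, ← Complex.ofReal_pow]
    have h1 : (momentum ε g).im = 0 := im_momentum ε g
    have h2 (n : ℕ) : ((κ ^ n : ℝ) : ℂ).im = 0 := Complex.ofReal_im _
    simp only [Complex.mul_im, h1, h2]
    simp
  · have h := ((HasDerivAt.im_ofReal (hasDerivAt_A hs hκ hq hf (ε := ε) φ)).const_mul
      (16 * (κ : ℂ) ^ 4)).add ((hasDerivAt_momentum ε f φ).const_mul (4 * (κ : ℂ) ^ 2))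
    refine h.congr_deriv ?_
    have hcφ : Integrable fun x => conj (φ x) := (sconj φ).integrable
    have i1 := S.integrable_g12 hκ1 hfq (ae_rHat S (ε := ε) hfq) hq.le
      ((S.norm_J_le ε q).trans hq.le) hcφ
    have i2 := S.integrable_g12 hκ2 hfq (ae_rHat S (ε := ε) hfq) hq.le
      ((S.norm_J_le ε q).trans hq.le) hcφ
    have i3 : Integrable fun x => conj (φ x) * (Complex.I * deriv f x) := by
      refine ((integrable_mul_schwartz (sconj φ) (SchwartzMap.derivCLM ℂ ℂ f)).const_mul
        Complex.I).congr (.of_forall fun x => ?_)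
      simp only [sconj_apply, SchwartzMap.derivCLM_apply]
      ring
    have e : ∫ x, conj (φ x) * (Complex.I * (8 * (κ : ℂ) ^ 4 * (g12 ε κ (fourierT f) x +
        g12 ε (-κ) (fourierT f) x) + 4 * (κ : ℂ) ^ 2 * deriv f x)) =
        ((8 * κ ^ 4 : ℝ) : ℂ) * (Complex.I * ((∫ x, g12 ε κ (fourierT f) x * conj (φ x)) +
          ∫ x, g12 ε (-κ) (fourierT f) x * conj (φ x))) +
        ((4 * κ ^ 2 : ℝ) : ℂ) * ∫ x, conj (φ x) * (Complex.I * deriv f x) := by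
      have i4 : Integrable fun x => ((8 * κ ^ 4 : ℝ) : ℂ) * (Complex.I *
        (g12 ε κ (fourierT f) x * conj (φ x) + g12 ε (-κ) (fourierT f) x * conj (φ x))) :=
        ((i1.add i2).const_mul _).const_mul _
      have i5 : Integrable fun x => ((4 * κ ^ 2 : ℝ) : ℂ) * (conj (φ x) * (Complex.I * deriv f x)) :=
        i3.const_mul _
      rw [← integral_add i1 i2, ← integral_const_mul, ← integral_const_mul, ← integral_const_mul,
        ← integral_add i4 i5]
      refine integral_congr_ae (.of_forall fun x => ?_)
      push_cast
      ring
    rw [e]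
    have hε : -((ε : ℤ) : ℂ) = ((-((ε : ℤ) : ℝ) : ℝ) : ℂ) := by push_cast; rfl
    rw [hε, Complex.im_ofReal_mul, Complex.sub_im, Complex.conj_im, Complex.add_re,
      Complex.re_ofReal_mul, Complex.re_ofReal_mul, Complex.I_mul_re, Complex.add_im]
    push_cast
    ring

end Hamiltonian

end

end AKNS

namespace AKNS

noncomputable section

open scoped ENNReal NNReal
open Filter Topology

/-! ### Scaling -/

/-- The dilate `w(ϰ ·)`. -/
def dil (ϰ : ℝ) (w : ℝ → ℂ) (ξ : ℝ) : ℂ := w (ϰ * ξ)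

lemma cpow_real_mul {ϰ : ℝ} (hϰ : 0 < ϰ) {z : ℂ} (hz : z ≠ 0) (c : ℂ) :
    ((ϰ : ℂ) * z) ^ c = (ϰ : ℂ) ^ c * z ^ c := by
  have h : (ϰ : ℂ) ≠ 0 := by exact_mod_cast hϰ.ne'
  rw [Complex.cpow_def_of_ne_zero (mul_ne_zero h hz), Complex.cpow_def_of_ne_zero h,
    Complex.cpow_def_of_ne_zero hz, Complex.log_ofReal_mul hϰ hz, ← Complex.exp_add,
    Complex.ofReal_log hϰ.le]
  ring_nf

lemma one_sub_I_ne_zero (ξ : ℝ) : (((1 : ℝ) : ℂ) - Complex.I * ξ) ≠ 0 := by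
  intro h
  have := congrArg Complex.re h
  simp at this

lemma one_add_I_ne_zero (ξ : ℝ) : (((1 : ℝ) : ℂ) + Complex.I * ξ) ≠ 0 := by
  intro h
  have := congrArg Complex.re h
  simp at this

lemma symMinus_dil {ϰ : ℝ} (hϰ : 0 < ϰ) (ξ : ℝ) :
    symMinus ϰ (ϰ * ξ) = (ϰ : ℂ) ^ (-(1 / 2) : ℂ) * symMinus 1 ξ := by
  rw [symMinus, symMinus, ← cpow_real_mul hϰ (one_sub_I_ne_zero ξ)]
  congr 1
  push_cast
  ring

lemma symPlus_dil {ϰ : ℝ} (hϰ : 0 < ϰ) (ξ : ℝ) :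
    symPlus ϰ (ϰ * ξ) = (ϰ : ℂ) ^ (-(1 / 2) : ℂ) * symPlus 1 ξ := by
  rw [symPlus, symPlus, ← cpow_real_mul hϰ (one_add_I_ne_zero ξ)]
  congr 1
  push_cast
  ring

lemma cpow_half_mul_self {ϰ : ℝ} (hϰ : 0 < ϰ) :
    (ϰ : ℂ) ^ (-(1 / 2) : ℂ) * (ϰ : ℂ) ^ (-(1 / 2) : ℂ) = (ϰ : ℂ)⁻¹ := by
  have h : (ϰ : ℂ) ≠ 0 := by exact_mod_cast hϰ.ne'
  rw [← Complex.cpow_add _ _ h, ← Complex.cpow_neg_one]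
  norm_num

lemma kerLambda_dil {ϰ : ℝ} (hϰ : 0 < ϰ) (w : ℝ → ℂ) (ξ η : ℝ) :
    kerLambda ϰ w (ϰ * ξ) (ϰ * η) = (ϰ : ℂ)⁻¹ * kerLambda 1 (dil ϰ w) ξ η := by
  rw [kerLambda, kerLambda, symMinus_dil hϰ, symPlus_dil hϰ, ← cpow_half_mul_self hϰ, dil, mul_sub]
  ring

lemma kerGamma_dil (ε : ℤˣ) {ϰ : ℝ} (hϰ : 0 < ϰ) (w : ℝ → ℂ) (ξ η : ℝ) :
    kerGamma ε ϰ w (ϰ * ξ) (ϰ * η) = (ϰ : ℂ)⁻¹ * kerGamma ε 1 (dil ϰ w) ξ η := by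
  rw [kerGamma, kerGamma, symMinus_dil hϰ, symPlus_dil hϰ, ← cpow_half_mul_self hϰ, rHat, rHat, dil,
    mul_neg, mul_sub]
  ring

lemma kerComp_dil {ϰ : ℝ} (hϰ : 0 < ϰ) {K L K' L' : ℝ → ℝ → ℂ}
    (hK : ∀ ξ η, K (ϰ * ξ) (ϰ * η) = (ϰ : ℂ)⁻¹ * K' ξ η)
    (hL : ∀ ξ η, L (ϰ * ξ) (ϰ * η) = (ϰ : ℂ)⁻¹ * L' ξ η) (ξ η : ℝ) :
    kerComp K L (ϰ * ξ) (ϰ * η) = (ϰ : ℂ)⁻¹ * kerComp K' L' ξ η := by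
  have h : (ϰ : ℂ) ≠ 0 := by exact_mod_cast hϰ.ne'
  have e := Measure.integral_comp_mul_left (fun ζ => K (ϰ * ξ) ζ * L ζ (ϰ * η)) ϰ
  simp only [hK, hL] at e
  rw [abs_of_pos (inv_pos.2 hϰ), Complex.real_smul] at e
  have e2 : ∫ ζ : ℝ, (ϰ : ℂ)⁻¹ * K' ξ ζ * ((ϰ : ℂ)⁻¹ * L' ζ η) =
      (ϰ : ℂ)⁻¹ * ((ϰ : ℂ)⁻¹ * kerComp K' L' ξ η) := by
    rw [kerComp, ← integral_const_mul, ← integral_const_mul]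
    refine integral_congr_ae (.of_forall fun ζ => ?_)
    ring
  rw [e2] at e
  push_cast at e
  exact (mul_left_cancel₀ (inv_ne_zero h) e).symm

lemma kerOdd_dil (ε : ℤˣ) {ϰ : ℝ} (hϰ : 0 < ϰ) (w : ℝ → ℂ) (m : ℕ) (ξ η : ℝ) :
    kerOdd ε ϰ w m (ϰ * ξ) (ϰ * η) = (ϰ : ℂ)⁻¹ * kerOdd ε 1 (dil ϰ w) m ξ η := by
  induction m generalizing ξ η with
  | zero => exact kerLambda_dil hϰ w ξ η
  | succ m ih =>
    exact kerComp_dil hϰ (kerLambda_dil hϰ w) (kerComp_dil hϰ (kerGamma_dil ε hϰ w) ih) ξ η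

lemma traceTerm_dil (ε : ℤˣ) {ϰ : ℝ} (hϰ : 0 < ϰ) (w : ℝ → ℂ) (m : ℕ) :
    traceTerm ε ϰ w m = traceTerm ε 1 (dil ϰ w) m := by
  have h : (ϰ : ℂ) ≠ 0 := by exact_mod_cast hϰ.ne'
  have e := Measure.integral_comp_mul_left
    (fun ξ => kerComp (kerOdd ε ϰ w m) (kerGamma ε ϰ w) ξ ξ) ϰ
  simp only [kerComp_dil hϰ (kerOdd_dil ε hϰ w m) (kerGamma_dil ε hϰ w)] at e
  rw [abs_of_pos (inv_pos.2 hϰ), Complex.real_smul, integral_const_mul] at e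
  push_cast at e
  exact (mul_left_cancel₀ (inv_ne_zero h) e).symm

lemma A_dil (ε : ℤˣ) {ϰ : ℝ} (hϰ : 0 < ϰ) (w : ℝ → ℂ) : A ε ϰ w = A ε 1 (dil ϰ w) := by
  simp only [A, ATerm, traceTerm_dil ε hϰ w, Real.sign_of_pos hϰ, Real.sign_of_pos one_pos]

lemma lintegral_comp_mul_left {ϰ : ℝ} (hϰ : 0 < ϰ) (F : ℝ → ℝ≥0∞) :
    ∫⁻ ξ, F (ϰ * ξ) = ENNReal.ofReal ϰ⁻¹ * ∫⁻ ξ, F ξ := by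
  have e : MeasurableEmbedding fun ξ : ℝ => ϰ * ξ := measurableEmbedding_mulLeft₀ hϰ.ne'
  rw [← e.lintegral_map, Real.map_volume_mul_left hϰ.ne', lintegral_smul_measure,
    abs_of_pos (inv_pos.2 hϰ), smul_eq_mul]

lemma exists_dil {s : ℝ} (hs : s ∈ Ioo (-(1 / 2) : ℝ) 0) {ϰ : ℝ} (hϰ : 1 ≤ ϰ) (q : Hs s) :
    ∃ q' : Hs s, dil ϰ q =ᵐ[volume] q' ∧ ‖q'‖ ≤ ϰ ^ (-(1 / 2 + s)) * ‖q‖ := by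
  have S := isSob_sobolev hs
  have h0 : 0 < ϰ := by linarith
  have hm : AEStronglyMeasurable (dil ϰ q) :=
    ((Lp.stronglyMeasurable q).comp_measurable (by fun_prop)).aestronglyMeasurable
  have hle : ∫⁻ ξ, dens s (fun _ => 1) ξ * ‖dil ϰ q ξ‖ₑ ^ 2 ≤
      (ENNReal.ofReal (ϰ ^ (-(1 / 2 + s))) * ‖q‖ₑ) ^ 2 := by
    have e : ∀ ξ, dens s (fun _ => 1) ξ = ENNReal.ofReal ((4 + (ϰ * ξ / ϰ) ^ 2) ^ s) := fun ξ => by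
      rw [dens, mul_div_cancel_left₀ _ h0.ne']; simp
    simp only [dil, e]
    rw [lintegral_comp_mul_left h0 fun x => ENNReal.ofReal ((4 + (x / ϰ) ^ 2) ^ s) * ‖q x‖ₑ ^ 2,
      mul_pow, S.hμ.enorm_sq, ← ENNReal.ofReal_pow (by positivity), ← Real.rpow_natCast (n := 2),
      ← Real.rpow_mul h0.le]
    have e2 : ϰ ^ (-(1 / 2 + s) * ((2 : ℕ) : ℝ)) = ϰ⁻¹ * ϰ ^ (-2 * s) := by
      rw [← Real.rpow_neg_one, ← Real.rpow_add h0]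
      congr 1
      push_cast
      ring
    rw [e2, ENNReal.ofReal_mul (by positivity), _root_.mul_assoc]
    refine mul_le_mul_right ?_ _
    rw [← lintegral_const_mul' _ _ ENNReal.ofReal_ne_top]
    refine lintegral_mono fun x => ?_
    rw [← _root_.mul_assoc]
    refine mul_le_mul_left ?_ _
    rw [dens]
    simp only [ENNReal.ofReal_one, one_pow, one_mul]
    rw [← ENNReal.ofReal_mul (by positivity)]
    refine ENNReal.ofReal_le_ofReal ?_
    have e3 : 4 + (x / ϰ) ^ 2 = (4 * ϰ ^ 2 + x ^ 2) / ϰ ^ 2 := by field_simp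
    rw [e3, Real.div_rpow (by positivity) (by positivity), div_eq_mul_inv, mul_comm,
      ← Real.rpow_natCast ϰ 2, ← Real.rpow_mul h0.le, ← Real.rpow_neg h0.le]
    push_cast
    rw [show -(2 * s) = -2 * s by ring]
    gcongr ?_ * ?_
    refine Real.rpow_le_rpow_of_nonpos (by positivity) ?_ hs.2.le
    rw [Real.rpow_two]
    nlinarith
  have hmem : MemLp (dil ϰ q) 2 (sobolevMeasure s) :=
    S.hμ.memLp hm (hle.trans_lt (by finiteness))
  refine ⟨hmem.toLp _, (S.hμ.ae_eq_iff.1 hmem.coeFn_toLp).symm, ?_⟩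
  have h1 := S.hμ.eLpNorm_le hle
  rw [Lp.norm_toLp]
  have := ENNReal.toReal_mono (by finiteness) h1
  rwa [ENNReal.toReal_mul, toReal_enorm, ENNReal.toReal_ofReal (by positivity)] at this

/-! ### The leading term of `α` -/

/-- The quadratic part `∫ 2ϰ |w|² / (4ϰ² + ξ²)` of `α(ϰ)`. -/
def leading (ϰ : ℝ) (w : ℝ → ℂ) : ℝ≥0∞ :=
  ∫⁻ ξ, ENNReal.ofReal (2 * ϰ / (4 * ϰ ^ 2 + ξ ^ 2)) * ‖w ξ‖ₑ ^ 2

lemma leading_dil {ϰ : ℝ} (hϰ : 0 < ϰ) (w : ℝ → ℂ) : leading 1 (dil ϰ w) = leading ϰ w := by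
  have e : ∀ ξ, ENNReal.ofReal (2 * 1 / (4 * 1 ^ 2 + ξ ^ 2)) = ENNReal.ofReal ϰ *
      ENNReal.ofReal (2 * ϰ / (4 * ϰ ^ 2 + (ϰ * ξ) ^ 2)) := fun ξ => by
    rw [← ENNReal.ofReal_mul hϰ.le]
    congr 1
    field_simp
  simp only [leading, e, dil, _root_.mul_assoc]
  rw [lintegral_const_mul' _ _ ENNReal.ofReal_ne_top, lintegral_comp_mul_left hϰ
    fun x => ENNReal.ofReal (2 * ϰ / (4 * ϰ ^ 2 + x ^ 2)) * ‖w x‖ₑ ^ 2, ← _root_.mul_assoc,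
    ← ENNReal.ofReal_mul hϰ.le, mul_inv_cancel₀ hϰ.ne', ENNReal.ofReal_one, one_mul]

lemma leading_congr {ϰ : ℝ} {w w' : ℝ → ℂ} (h : w =ᵐ[volume] w') : leading ϰ w = leading ϰ w' := by
  refine lintegral_congr_ae ?_
  filter_upwards [h] with ξ hξ
  rw [hξ]

section Leading

variable {s : ℝ} (hs : s ∈ Ioo (-(1 / 2) : ℝ) 0)
include hs

lemma leading_one_le (q : Hs s) : leading 1 q ≤ ‖q‖ₑ ^ 2 := by
  rw [(isSob_sobolev hs).hμ.enorm_sq]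
  refine lintegral_mono fun ξ => mul_le_mul_left ?_ _
  rw [dens]
  simp only [ENNReal.ofReal_one, one_pow, one_mul]
  refine ENNReal.ofReal_le_ofReal ?_
  have h4 : (1 : ℝ) ≤ 4 + ξ ^ 2 := by nlinarith [sq_nonneg ξ]
  have h : (4 + ξ ^ 2) ^ (-(1 / 2) : ℝ) ≤ (4 + ξ ^ 2) ^ s :=
    Real.rpow_le_rpow_of_exponent_le h4 hs.1.le
  refine le_trans ?_ h
  rw [Real.rpow_neg (by positivity), ← Real.sqrt_eq_rpow]
  have h2 : (2 : ℝ) ≤ Real.sqrt (4 + ξ ^ 2) := Real.le_sqrt_of_sq_le (by nlinarith [sq_nonneg ξ])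
  have h3 := Real.mul_self_sqrt (show (0 : ℝ) ≤ 4 + ξ ^ 2 by positivity)
  rw [div_le_iff₀ (by positivity), inv_mul_eq_div, le_div_iff₀ (by linarith)]
  nlinarith

lemma re_tr_X (ε : ℤˣ) (q : Hs s) :
    -(((ε : ℤ) : ℝ) * ((isSob_sobolev hs).isKW.tr ((isSob_sobolev hs).X 1 q)
      ((isSob_sobolev hs).X (-1) ((isSob_sobolev hs).J ε q))).re) = (leading 1 q).toReal := by
  set S := isSob_sobolev hs
  rw [S.X_apply (-1), ← tr_rmul S.isKW, S.tr_Q]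
  have h1 : (1 : ℝ) ≤ |1| := by simp
  have hp : ∀ h : ℝ, ((2 * (1 : ℝ) : ℂ) - Complex.I * h) ≠ 0 := fun h h0 => by
    have := congrArg Complex.re h0
    simp at this
  have e : ∫ k, S.D (rmul _ (isMult_sym (-1)) (S.X 1 q)) k * S.J ε q (-k) =
      -((ε : ℤ) : ℂ) * ∫ k : ℝ, ((2 * (1 : ℝ) : ℂ) - Complex.I * k)⁻¹ * ((‖q k‖ ^ 2 : ℝ) : ℂ) := by
    rw [← integral_const_mul]
    refine integral_congr_ae ?_
    filter_upwards [S.D_X h1 q, ae_neg (S.coeFn_J ε q)] with k h2 h3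
    rw [h3, rHat, neg_neg]
    rw [Real.sign_of_pos one_pos] at h2
    have h4 : S.D (rmul _ (isMult_sym (-1)) (S.X 1 q)) k =
        ((2 * (1 : ℝ) : ℂ) - Complex.I * k)⁻¹ * (-q k) := by
      rw [eq_inv_mul_iff_mul_eq₀ (hp k), h2]
      push_cast
      ring
    rw [h4, Complex.ofReal_pow, ← Complex.mul_conj']
    ring
  have hint : Integrable fun k : ℝ =>
      ((2 * (1 : ℝ) : ℂ) - Complex.I * k)⁻¹ * ((‖q k‖ ^ 2 : ℝ) : ℂ) := by
    have hm : Measurable q := (Lp.stronglyMeasurable q).measurable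
    refine ⟨Measurable.aestronglyMeasurable (by fun_prop), ?_⟩
    refine lt_of_le_of_lt (lintegral_mono fun k => ?_) (S.hμ.lintegral_lt_top q)
    rw [enorm_mul, Complex.ofReal_pow, enorm_pow]
    have e1 : ‖((‖q k‖ : ℝ) : ℂ)‖ₑ = ‖q k‖ₑ := by
      rw [← ofReal_norm, Complex.norm_real, norm_norm, ofReal_norm]
    rw [e1]
    refine mul_le_mul_left ?_ _
    rw [dens]
    simp only [ENNReal.ofReal_one, one_pow, one_mul]
    rw [← ofReal_norm]
    refine ENNReal.ofReal_le_ofReal ?_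
    have h4 : (1 : ℝ) ≤ 4 + k ^ 2 := by nlinarith [sq_nonneg k]
    have h : (4 + k ^ 2) ^ (-(1 / 2) : ℝ) ≤ (4 + k ^ 2) ^ s :=
      Real.rpow_le_rpow_of_exponent_le h4 hs.1.le
    refine le_trans (le_of_eq ?_) h
    rw [Real.rpow_neg (by positivity), ← Real.sqrt_eq_rpow, norm_inv]
    have := norm_res 2 k
    push_cast at this ⊢
    rw [mul_one, this]
    norm_num
  have hre : ∀ k : ℝ, (((2 * (1 : ℝ) : ℂ) - Complex.I * k)⁻¹ * ((‖q k‖ ^ 2 : ℝ) : ℂ)).re =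
      2 * 1 / (4 * 1 ^ 2 + k ^ 2) * ‖q k‖ ^ 2 := fun k => by
    have hn := normSq_res 2 k
    rw [Complex.re_mul_ofReal, Complex.inv_re]
    push_cast at hn ⊢
    rw [mul_one, hn]
    norm_num
  have hre2 : (∫ k : ℝ, ((2 * (1 : ℝ) : ℂ) - Complex.I * k)⁻¹ * ((‖q k‖ ^ 2 : ℝ) : ℂ)).re =
      ∫ k : ℝ, 2 * 1 / (4 * 1 ^ 2 + k ^ 2) * ‖q k‖ ^ 2 := by
    have := integral_re hint
    simp only [RCLike.re_to_complex] at this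
    rw [← this]
    exact integral_congr_ae (.of_forall hre)
  have hε : -((ε : ℤ) : ℂ) = ((-((ε : ℤ) : ℝ) : ℝ) : ℂ) := by push_cast; rfl
  rw [e, hε, Complex.re_ofReal_mul, hre2]
  have hεε : ((ε : ℤ) : ℝ) * ((ε : ℤ) : ℝ) = 1 := by
    rcases Int.units_eq_one_or ε with h | h <;> simp [h]
  have hm : Measurable q := (Lp.stronglyMeasurable q).measurable
  rw [integral_eq_lintegral_of_nonneg_ae (.of_forall fun k => by simp only [Pi.zero_apply]; positivity)
    (Measurable.aestronglyMeasurable (by fun_prop)), leading]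
  have e5 : ∀ k, ENNReal.ofReal (2 * 1 / (4 * 1 ^ 2 + k ^ 2) * ‖q k‖ ^ 2) =
      ENNReal.ofReal (2 * 1 / (4 * 1 ^ 2 + k ^ 2)) * ‖q k‖ₑ ^ 2 := fun k => by
    rw [ENNReal.ofReal_mul (by positivity), ENNReal.ofReal_pow (norm_nonneg _), ofReal_norm]
  simp only [e5]
  linear_combination (∫⁻ k, ENNReal.ofReal (2 * 1 / (4 * 1 ^ 2 + k ^ 2)) * ‖q k‖ₑ ^ 2).toReal * hεε

/-- `α(ϰ)` is its quadratic part up to a quartic error. -/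
lemma abs_alpha_sub_le (ε : ℤˣ) {ϰ : ℝ} (hϰ : 1 ≤ ϰ) {q : Hs s} (hq : ‖q‖ ≤ rad s) :
    leading ϰ q < ⊤ ∧ |alpha ε ϰ q - (leading ϰ q).toReal| ≤
      2 * qConst s ^ 4 * ϰ ^ (-2 * (1 + 2 * s)) * ‖q‖ ^ 4 := by
  set S := isSob_sobolev hs with hS
  have h0 : 0 < ϰ := by linarith
  obtain ⟨q', h1, h2⟩ := exists_dil hs hϰ q
  have h3 : ‖q'‖ ≤ ‖q‖ := h2.trans (mul_le_of_le_one_left (norm_nonneg _)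
    (Real.rpow_le_one_of_one_le_of_nonpos hϰ (by linarith [hs.1])))
  rw [← leading_dil h0, leading_congr h1]
  refine ⟨(leading_one_le hs q').trans_lt (by finiteness), ?_⟩
  rw [alpha, A_dil ε h0, S.A_eq (κ := 1) (by simp) h1 (ae_rHat S h1), ← re_tr_X hs ε q',
    Real.sign_of_pos one_pos, IsSob.logd]
  have h4 := S.norm_X_le 1 q'
  have h5 := (S.norm_X_le (-1) (S.J ε q')).trans
    (mul_le_mul_of_nonneg_left (S.norm_J_le ε q') (qConst s).2)
  have h6 : (qConst s : ℝ) * ‖q'‖ ≤ 1 / 2 := by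
    have hc : (0 : ℝ) ≤ qConst s := (qConst s).2
    calc (qConst s : ℝ) * ‖q'‖ ≤ (qConst s + 1) * rad s := by
          gcongr
          · linarith
          · exact h3.trans hq
      _ = 1 / 2 := by rw [rad]; field_simp
  have h7 := S.isKW.isTraceAlgebra.norm_logDet_sub_le h4 h5 h6
  have h8 := (Complex.abs_re_le_norm _).trans h7
  have hε : |((ε : ℤ) : ℝ)| = 1 := by
    rcases Int.units_eq_one_or ε with h | h <;> simp [h]
  have e : ∀ a b : ℂ, ((ε : ℤ) : ℝ) * (-((1 : ℝ) : ℂ) * a).re - -(((ε : ℤ) : ℝ) * b.re) =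
      -((ε : ℤ) : ℝ) * (a - b).re := fun a b => by
    simp
    ring
  rw [e, abs_mul, abs_neg, hε, one_mul]
  refine h8.trans ?_
  have e2 : ϰ ^ (-2 * (1 + 2 * s)) = (ϰ ^ (-(1 / 2 + s))) ^ 4 := by
    rw [← Real.rpow_natCast, ← Real.rpow_mul h0.le]
    congr 1
    push_cast
    ring
  rw [e2]
  calc 2 * ((qConst s : ℝ) * ‖q'‖) ^ 4 ≤ 2 * ((qConst s : ℝ) * (ϰ ^ (-(1 / 2 + s)) * ‖q‖)) ^ 4 := by
        gcongr
    _ = _ := by ring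

end Leading

end

end AKNS

namespace AKNS

noncomputable section

open scoped ENNReal NNReal
open Filter Topology

/-! ### Coercivity of the conserved quantities -/

/-- The weight of `|w(ξ)|²` in the quadratic part of `2^(n (2 s + 1)) α(2^n)`. -/
def dyadic (s : ℝ) (n : ℕ) (ξ : ℝ) : ℝ := 2 * ((4 : ℝ) ^ n) ^ (s + 1) / (4 * 4 ^ n + ξ ^ 2)

lemma dyadic_eq (s : ℝ) (n : ℕ) (ξ : ℝ) :
    dyadic s n ξ = ((2 : ℝ) ^ n) ^ (1 + 2 * s) * (2 * 2 ^ n / (4 * (2 ^ n) ^ 2 + ξ ^ 2)) := by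
  have e : ((2 : ℝ) ^ n) ^ 2 = 4 ^ n := by rw [← pow_mul, mul_comm, pow_mul]; norm_num
  have e2 : ((4 : ℝ) ^ n) ^ (s + 1) = ((2 : ℝ) ^ n) ^ (1 + 2 * s) * 2 ^ n := by
    rw [← e, ← Real.rpow_natCast ((2 : ℝ) ^ n) 2, ← Real.rpow_mul (by positivity)]
    nth_rewrite 3 [← Real.rpow_one ((2 : ℝ) ^ n)]
    rw [← Real.rpow_add (by positivity)]
    congr 1
    push_cast
    ring
  rw [dyadic, e, e2]
  ring

section

variable {s : ℝ} (hs : s ∈ Ioo (-(1 / 2) : ℝ) 0)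
include hs

lemma exists_le_dyadic (ξ : ℝ) : ∃ n, (4 + ξ ^ 2) ^ s ≤ 10 * dyadic s n ξ := by
  obtain ⟨n, h1, h2⟩ := exists_nat_pow_near (x := (4 + ξ ^ 2) / 4) (y := (4 : ℝ))
    (by nlinarith [sq_nonneg ξ]) (by norm_num)
  refine ⟨n, ?_⟩
  rw [pow_succ (4 : ℝ) n] at h2
  have hT : (1 : ℝ) ≤ 4 ^ n := one_le_pow₀ (by norm_num)
  set T : ℝ := 4 ^ n
  have hT0 : 0 < T := by linarith
  have h3 : (4 + ξ ^ 2) ^ s ≤ T ^ s :=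
    Real.rpow_le_rpow_of_nonpos hT0 (by linarith) hs.2.le
  refine h3.trans ?_
  rw [dyadic, ← mul_div_assoc, le_div_iff₀ (by positivity), Real.rpow_add hT0, Real.rpow_one]
  have h4 : 0 < T ^ s := by positivity
  have : 4 * T + ξ ^ 2 ≤ 20 * T := by linarith
  nlinarith

lemma dyadic_le (ξ : ℝ) : ∃ m : ℕ, ∀ n : ℕ, dyadic s n ξ ≤
    4 * (4 + ξ ^ 2) ^ s * ((4 : ℝ) ^ s) ^ (n - m + (m - n)) := by
  obtain ⟨m, h1, h2⟩ := exists_nat_pow_near (x := (4 + ξ ^ 2) / 4) (y := (4 : ℝ))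
    (by nlinarith [sq_nonneg ξ]) (by norm_num)
  refine ⟨m, fun n => ?_⟩
  rw [pow_succ (4 : ℝ) m] at h2
  have hM : (1 : ℝ) ≤ 4 ^ m := one_le_pow₀ (by norm_num)
  have hN : (1 : ℝ) ≤ 4 ^ n := one_le_pow₀ (by norm_num)
  have h3 : ((4 : ℝ) ^ m) ^ s ≤ 4 * (4 + ξ ^ 2) ^ s := by
    have h5 : ((4 : ℝ) * (4 * 4 ^ m)) ^ s ≤ (4 + ξ ^ 2) ^ s :=
      Real.rpow_le_rpow_of_nonpos (by positivity) (by linarith) hs.2.le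
    rw [Real.mul_rpow (by norm_num) (by positivity), Real.mul_rpow (by norm_num) (by positivity)] at h5
    have h6 : (1 / 2 : ℝ) ≤ 4 ^ s := by
      have : (4 : ℝ) ^ (-(1 / 2) : ℝ) ≤ 4 ^ s :=
        Real.rpow_le_rpow_of_exponent_le (by norm_num) hs.1.le
      refine le_trans (le_of_eq ?_) this
      rw [show (4 : ℝ) = 2 ^ (2 : ℝ) by norm_num, ← Real.rpow_mul (by norm_num)]
      norm_num [Real.rpow_neg_one]
    have h7 : 0 < ((4 : ℝ) ^ m) ^ s := by positivity
    nlinarith [mul_le_mul h6 h6 (by norm_num) (by positivity)]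
  refine le_trans ?_ (mul_le_mul_of_nonneg_right h3 (by positivity))
  have hp : ∀ k : ℕ, ((4 : ℝ) ^ s) ^ k = ((4 : ℝ) ^ k) ^ s := fun k => by
    rw [← Real.rpow_natCast, ← Real.rpow_mul (by norm_num), mul_comm,
      Real.rpow_mul (by norm_num), Real.rpow_natCast]
  rw [hp, ← Real.mul_rpow (by positivity) (by positivity), ← pow_add]
  rcases le_total m n with h | h
  · rw [show m + (n - m + (m - n)) = n by omega, dyadic, Real.rpow_add (by positivity),
      Real.rpow_one, div_le_iff₀ (by positivity)]
    have : (0 : ℝ) < ((4 : ℝ) ^ n) ^ s := by positivity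
    nlinarith [sq_nonneg ξ, mul_pos this (show (0 : ℝ) < 4 ^ n by positivity),
      mul_nonneg this.le (sq_nonneg ξ)]
  · obtain ⟨k, rfl⟩ := Nat.exists_eq_add_of_le h
    rw [show n + k + (n - (n + k) + (n + k - n)) = n + 2 * k by omega, dyadic,
      div_le_iff₀ (by positivity), Real.rpow_add (by positivity), Real.rpow_one, pow_add,
      Real.mul_rpow (by positivity) (by positivity)]
    rw [pow_add] at h1
    have h8 : (4 : ℝ) ^ n * 4 ^ k ≤ (4 * 4 ^ n + ξ ^ 2) := by
      have : (1 : ℝ) ≤ 4 ^ n := hN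
      nlinarith
    have h9 : (1 : ℝ) ≤ ((4 : ℝ) ^ (2 * k)) ^ s * 4 ^ k := by
      have : (4 : ℝ) ^ k = (4 ^ (2 * k)) ^ (1 / 2 : ℝ) := by
        rw [← Real.rpow_natCast, ← Real.rpow_natCast, ← Real.rpow_mul (by norm_num)]
        congr 1
        push_cast
        ring
      rw [this, ← Real.rpow_add (by positivity)]
      exact Real.one_le_rpow (one_le_pow₀ (by norm_num)) (by linarith [hs.1])
    have h10 : (0 : ℝ) < ((4 : ℝ) ^ n) ^ s := by positivity
    have h11 : 4 * ((4 : ℝ) ^ n * 4 ^ k) ≤ 4 * 4 ^ n + ξ ^ 2 + 4 * 4 ^ n := by nlinarith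
    have h12 : 2 * (4 : ℝ) ^ n * 4 ^ k ≤ 4 * 4 ^ n + ξ ^ 2 := by
      nlinarith [one_le_pow₀ (n := k) (show (1 : ℝ) ≤ 4 by norm_num)]
    calc 2 * (((4 : ℝ) ^ n) ^ s * 4 ^ n) = ((4 : ℝ) ^ n) ^ s * (1 * (2 * 4 ^ n)) := by ring
      _ ≤ ((4 : ℝ) ^ n) ^ s * (((4 : ℝ) ^ (2 * k)) ^ s * 4 ^ k * (2 * 4 ^ n)) := by gcongr
      _ = ((4 : ℝ) ^ n) ^ s * ((4 : ℝ) ^ (2 * k)) ^ s * (2 * 4 ^ n * 4 ^ k) := by ring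
      _ ≤ _ := by gcongr

end

lemma tsum_pow_dist_le (ρ : ℝ≥0∞) (m : ℕ) :
    ∑' n : ℕ, ρ ^ (n - m + (m - n)) ≤ 2 * (1 - ρ)⁻¹ := by
  have key : ∀ m : ℕ, ∑' n : ℕ, ρ ^ (n - m + (m - n)) ≤
      ∑ j ∈ Finset.range m, ρ ^ (j + 1) + ∑' n : ℕ, ρ ^ n := by
    intro m
    induction m with
    | zero => simp only [Finset.range_zero, Finset.sum_empty, zero_add, zero_tsub, add_zero, tsub_zero, le_refl]
    | succ m ih =>
      have e : ∑' n : ℕ, ρ ^ (n - (m + 1) + (m + 1 - n)) = ρ ^ (m + 1) +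
          ∑' n : ℕ, ρ ^ (n - m + (m - n)) := by
        rw [tsum_eq_zero_add' (f := fun n : ℕ => ρ ^ (n - (m + 1) + (m + 1 - n))) ENNReal.summable]
        simp only [Nat.add_sub_add_right, zero_tsub, tsub_zero, zero_add]
      rw [e, Finset.sum_range_succ]
      rw [add_right_comm, add_comm]
      exact add_le_add ih le_rfl
  refine (key m).trans ?_
  rw [two_mul, ENNReal.tsum_geometric]
  refine add_le_add ?_ le_rfl
  rw [← ENNReal.tsum_geometric]
  refine le_trans (ENNReal.sum_le_tsum _) ?_
  rw [tsum_eq_zero_add' (f := fun n => ρ ^ n) ENNReal.summable]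
  exact le_add_self

section

variable {s : ℝ} (hs : s ∈ Ioo (-(1 / 2) : ℝ) 0)
include hs

omit hs in
lemma tsum_leading (w : Hs s) : ∑' n : ℕ, ENNReal.ofReal (((2 : ℝ) ^ n) ^ (1 + 2 * s)) *
    leading (2 ^ n) w = ∫⁻ ξ, (∑' n, ENNReal.ofReal (dyadic s n ξ)) * ‖w ξ‖ₑ ^ 2 := by
  have hm : Measurable w := (Lp.stronglyMeasurable w).measurable
  simp only [← ENNReal.tsum_mul_right]
  rw [lintegral_tsum fun n => Measurable.aemeasurable (by unfold dyadic; fun_prop)]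
  congr 1
  ext n
  rw [leading, ← lintegral_const_mul' _ _ ENNReal.ofReal_ne_top]
  congr 1
  ext ξ
  rw [← _root_.mul_assoc, ← ENNReal.ofReal_mul (by positivity), dyadic_eq]

lemma enorm_sq_le_tsum_leading (w : Hs s) : ‖w‖ₑ ^ 2 ≤
    10 * ∑' n : ℕ, ENNReal.ofReal (((2 : ℝ) ^ n) ^ (1 + 2 * s)) * leading (2 ^ n) w := by
  rw [tsum_leading, (isSob_sobolev hs).hμ.enorm_sq, ← lintegral_const_mul' _ _ (by simp)]
  refine lintegral_mono fun ξ => ?_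
  rw [← _root_.mul_assoc]
  refine mul_le_mul_left ?_ _
  obtain ⟨n, hn⟩ := exists_le_dyadic hs ξ
  rw [dens]
  simp only [ENNReal.ofReal_one, one_pow, one_mul]
  refine (ENNReal.ofReal_le_ofReal hn).trans ?_
  rw [ENNReal.ofReal_mul (by norm_num)]
  simp only [ENNReal.ofReal_ofNat]
  gcongr
  exact ENNReal.le_tsum n

lemma tsum_leading_le (w : Hs s) : ∑' n : ℕ, ENNReal.ofReal (((2 : ℝ) ^ n) ^ (1 + 2 * s)) *
    leading (2 ^ n) w ≤ 4 * (2 * (1 - ENNReal.ofReal (4 ^ s))⁻¹) * ‖w‖ₑ ^ 2 := by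
  have h4 : ENNReal.ofReal ((4 : ℝ) ^ s) < 1 := by
    rw [ENNReal.ofReal_lt_one]
    exact Real.rpow_lt_one_of_one_lt_of_neg (by norm_num) hs.2
  rw [tsum_leading, (isSob_sobolev hs).hμ.enorm_sq, ← lintegral_const_mul' _ _
    (ENNReal.mul_ne_top (by simp) (ENNReal.mul_ne_top (by simp)
      (ENNReal.inv_ne_top.2 (tsub_pos_of_lt h4).ne')))]
  refine lintegral_mono fun ξ => ?_
  rw [← _root_.mul_assoc]
  refine mul_le_mul_left ?_ _
  obtain ⟨m, hm⟩ := dyadic_le hs ξ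
  rw [dens]
  simp only [ENNReal.ofReal_one, one_pow, one_mul]
  calc ∑' n, ENNReal.ofReal (dyadic s n ξ) ≤ ∑' n : ℕ, 4 * ENNReal.ofReal ((4 + ξ ^ 2) ^ s) *
        ENNReal.ofReal ((4 : ℝ) ^ s) ^ (n - m + (m - n)) := by
        refine ENNReal.tsum_le_tsum fun n => (ENNReal.ofReal_le_ofReal (hm n)).trans (le_of_eq ?_)
        rw [ENNReal.ofReal_mul (by positivity), ENNReal.ofReal_mul (by norm_num),
          ENNReal.ofReal_pow (by positivity)]
        simp
    _ ≤ 4 * ENNReal.ofReal ((4 + ξ ^ 2) ^ s) * (2 * (1 - ENNReal.ofReal (4 ^ s))⁻¹) := by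
        rw [ENNReal.tsum_mul_left]
        gcongr
        exact tsum_pow_dist_le _ m
    _ = _ := by ring

/-- The values `α(2^n)` control the `H^s` norm up to quartic errors. -/
lemma norm_sq_le_of_alpha : ∃ C : ℝ, 0 ≤ C ∧ ∀ (ε : ℤˣ) (w w₀ : Hs s), ‖w‖ ≤ rad s →
    ‖w₀‖ ≤ rad s → (∀ n : ℕ, alpha ε (2 ^ n) w = alpha ε (2 ^ n) w₀) →
    ‖w‖ ^ 2 ≤ C * (‖w₀‖ ^ 2 + ‖w‖ ^ 4 + ‖w₀‖ ^ 4) := by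
  have h4 : ENNReal.ofReal ((4 : ℝ) ^ s) < 1 := by
    rw [ENNReal.ofReal_lt_one]
    exact Real.rpow_lt_one_of_one_lt_of_neg (by norm_num) hs.2
  set c₁ : ℝ≥0∞ := 4 * (2 * (1 - ENNReal.ofReal (4 ^ s))⁻¹) with hc₁
  have hc₁' : c₁ ≠ ⊤ := ENNReal.mul_ne_top (by simp) (ENNReal.mul_ne_top (by simp)
      (ENNReal.inv_ne_top.2 (tsub_pos_of_lt h4).ne'))
  set σ : ℝ := 2 ^ (-(1 + 2 * s)) with hσ
  have hσ0 : 0 ≤ σ := by positivity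
  have hσ1 : ENNReal.ofReal σ < 1 := by
    rw [ENNReal.ofReal_lt_one]
    exact Real.rpow_lt_one_of_one_lt_of_neg (by norm_num) (by linarith [hs.1])
  set c₂ : ℝ≥0∞ := (1 - ENNReal.ofReal σ)⁻¹ with hc₂
  have hc₂' : c₂ ≠ ⊤ := ENNReal.inv_ne_top.2 (tsub_pos_of_lt hσ1).ne'
  set c₃ : ℝ := 2 * qConst s ^ 4 with hc₃
  have hc₃0 : 0 ≤ c₃ := by positivity
  refine ⟨10 * (c₁.toReal + c₃ * c₂.toReal), by positivity, fun ε w w₀ hw hw₀ h => ?_⟩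
  have key : ∀ n : ℕ, ENNReal.ofReal (((2 : ℝ) ^ n) ^ (1 + 2 * s)) * leading (2 ^ n) w ≤
      ENNReal.ofReal (((2 : ℝ) ^ n) ^ (1 + 2 * s)) * leading (2 ^ n) w₀ +
        ENNReal.ofReal (c₃ * (‖w‖ ^ 4 + ‖w₀‖ ^ 4)) * ENNReal.ofReal σ ^ n := by
    intro n
    have h2n : (1 : ℝ) ≤ 2 ^ n := one_le_pow₀ (by norm_num)
    obtain ⟨f1, e1⟩ := abs_alpha_sub_le hs ε h2n hw
    obtain ⟨f2, e2⟩ := abs_alpha_sub_le hs ε h2n hw₀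
    rw [h n] at e1
    have e3 := (abs_le.1 e1).1
    have e4 := (abs_le.1 e2).2
    rw [← ENNReal.ofReal_toReal f1.ne, ← ENNReal.ofReal_toReal f2.ne,
      ← ENNReal.ofReal_mul (by positivity), ← ENNReal.ofReal_mul (by positivity),
      ← ENNReal.ofReal_pow hσ0, ← ENNReal.ofReal_mul (by positivity),
      ← ENNReal.ofReal_add (by positivity) (by positivity)]
    refine ENNReal.ofReal_le_ofReal ?_
    have e5 : ((2 : ℝ) ^ n) ^ (1 + 2 * s) * ((2 : ℝ) ^ n) ^ (-2 * (1 + 2 * s)) = σ ^ n := by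
      rw [← Real.rpow_add (by positivity), hσ, ← Real.rpow_natCast, ← Real.rpow_natCast,
        ← Real.rpow_mul (by norm_num), ← Real.rpow_mul (by norm_num)]
      congr 1
      ring
    have e6 : (0 : ℝ) ≤ ((2 : ℝ) ^ n) ^ (1 + 2 * s) := by positivity
    rw [← e5]
    have e7 : (leading (2 ^ n) w).toReal ≤ (leading (2 ^ n) w₀).toReal +
        c₃ * (‖w‖ ^ 4 + ‖w₀‖ ^ 4) * ((2 : ℝ) ^ n) ^ (-2 * (1 + 2 * s)) := by
      linarith
    calc _ ≤ _ := mul_le_mul_of_nonneg_left e7 e6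
      _ = _ := by ring
  have h1 : ‖w‖ₑ ^ 2 ≤ 10 * (c₁ * ‖w₀‖ₑ ^ 2 + ENNReal.ofReal (c₃ * (‖w‖ ^ 4 + ‖w₀‖ ^ 4)) * c₂) := by
    refine (enorm_sq_le_tsum_leading hs w).trans ?_
    gcongr
    refine (ENNReal.tsum_le_tsum key).trans ?_
    rw [ENNReal.tsum_add, ENNReal.tsum_mul_left, ENNReal.tsum_geometric]
    gcongr
    exact tsum_leading_le hs w₀
  clear_value c₁ c₂ c₃
  have h2 := ENNReal.toReal_mono (by finiteness) h1
  rw [ENNReal.toReal_mul, ENNReal.toReal_add (by finiteness) (by finiteness), ENNReal.toReal_mul,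
    ENNReal.toReal_mul, ENNReal.toReal_ofReal (by positivity), ENNReal.toReal_pow,
    ENNReal.toReal_pow, toReal_enorm, toReal_enorm, ENNReal.toReal_ofNat] at h2
  have n1 : 0 ≤ c₁.toReal := ENNReal.toReal_nonneg
  have n2 : 0 ≤ c₃ * c₂.toReal := by positivity
  have n3 : 0 ≤ c₁.toReal * (‖w‖ ^ 4 + ‖w₀‖ ^ 4) := by positivity
  have n4 : 0 ≤ c₃ * c₂.toReal * ‖w₀‖ ^ 2 := by positivity
  nlinarith

/-- Solutions of small norm with the same values of `α` have comparable norms. -/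
lemma exists_norm_le_of_alpha : ∃ R K : ℝ, 0 < R ∧ R < rad s ∧ 1 ≤ K ∧ ∀ (ε : ℤˣ) (w w₀ : Hs s),
    ‖w‖ ≤ R → ‖w₀‖ ≤ R → (∀ n : ℕ, alpha ε (2 ^ n) w = alpha ε (2 ^ n) w₀) → ‖w‖ ≤ K * ‖w₀‖ := by
  obtain ⟨C, hC, h⟩ := norm_sq_le_of_alpha hs
  have hr : 0 < rad s := IsSob.rad_pos
  set R : ℝ := min (rad s / 2) (1 / (2 * (C + 1))) with hR
  have hR0 : 0 < R := by positivity
  have hR1 : R < rad s := (min_le_left _ _).trans_lt (by linarith)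
  have hR2 : R * (2 * (C + 1)) ≤ 1 := by
    rw [← le_div_iff₀ (by positivity)]
    exact min_le_right _ _
  have hR3 : R ≤ 1 := by nlinarith
  have hR4 : C * R ^ 2 ≤ 1 / 2 := by nlinarith
  refine ⟨R, 2 * (C + 1), hR0, hR1, by linarith, fun ε w w₀ hw hw₀ hα => ?_⟩
  have h1 := h ε w w₀ (hw.trans hR1.le) (hw₀.trans hR1.le) hα
  have a1 : ‖w‖ ^ 4 ≤ R ^ 2 * ‖w‖ ^ 2 := by
    have : ‖w‖ ^ 2 ≤ R ^ 2 := by gcongr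
    nlinarith [sq_nonneg ‖w‖]
  have a2 : ‖w₀‖ ^ 4 ≤ 1 * ‖w₀‖ ^ 2 := by
    have : ‖w₀‖ ^ 2 ≤ 1 ^ 2 := by
      gcongr
      linarith
    nlinarith [sq_nonneg ‖w₀‖]
  have a3 : C * ‖w‖ ^ 4 ≤ 1 / 2 * ‖w‖ ^ 2 := by
    nlinarith [sq_nonneg ‖w‖]
  have a4 : ‖w‖ ^ 2 ≤ 4 * C * ‖w₀‖ ^ 2 := by nlinarith
  refine abs_le_of_sq_le_sq' ?_ (by positivity) |>.2
  rw [mul_pow]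
  nlinarith [sq_nonneg ‖w₀‖]

end

end

end AKNS

namespace AKNS

noncomputable section

open scoped ENNReal NNReal
open Filter Topology

/-! ### Global flows of vector fields that are Lipschitz on a ball -/

section Flow

variable {E : Type*} [NormedAddCommGroup E] [NormedSpace ℝ E]

/-- The radial retraction onto the closed ball of radius `R`. -/
def radial (R : ℝ) (x : E) : E := if ‖x‖ ≤ R then x else (R / ‖x‖) • x

lemma radial_of_le {R : ℝ} {x : E} (hx : ‖x‖ ≤ R) : radial R x = x := if_pos hx

lemma norm_radial_le {R : ℝ} (hR : 0 ≤ R) (x : E) : ‖radial R x‖ ≤ R := by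
  unfold radial
  split_ifs with h
  · exact h
  · have hx : 0 < ‖x‖ := hR.trans_lt (not_le.1 h)
    rw [norm_smul, Real.norm_of_nonneg (by positivity), div_mul_cancel₀ _ hx.ne']

lemma norm_radial_sub_le_of_lt {R : ℝ} (hR : 0 ≤ R) {x y : E} (hx : ¬ ‖x‖ ≤ R) (hy : ‖y‖ ≤ R) :
    ‖radial R x - radial R y‖ ≤ 2 * ‖x - y‖ := by
  have hx' := not_le.1 hx
  have hx0 : 0 < ‖x‖ := hR.trans_lt hx'
  rw [radial_of_le hy, radial, if_neg hx]
  have e : (R / ‖x‖) • x - y = (x - y) - ((‖x‖ - R) / ‖x‖) • x := by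
    rw [sub_div, div_self hx0.ne', sub_smul, one_smul]
    abel
  rw [e]
  refine (norm_sub_le _ _).trans ?_
  rw [norm_smul, Real.norm_of_nonneg (div_nonneg (by linarith) hx0.le), div_mul_cancel₀ _ hx0.ne']
  linarith [norm_sub_norm_le x y]

lemma norm_radial_sub_le {R : ℝ} (hR : 0 ≤ R) (x y : E) :
    ‖radial R x - radial R y‖ ≤ 2 * ‖x - y‖ := by
  by_cases hx : ‖x‖ ≤ R <;> by_cases hy : ‖y‖ ≤ R
  · rw [radial_of_le hx, radial_of_le hy]
    linarith [norm_nonneg (x - y)]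
  · rw [← norm_neg, neg_sub, ← norm_neg (x - y), neg_sub]
    exact norm_radial_sub_le_of_lt hR hy hx
  · exact norm_radial_sub_le_of_lt hR hx hy
  · have hx0 : 0 < ‖x‖ := hR.trans_lt (not_le.1 hx)
    have hy0 : 0 < ‖y‖ := hR.trans_lt (not_le.1 hy)
    rw [radial, if_neg hx, radial, if_neg hy]
    have e : (R / ‖x‖) • x - (R / ‖y‖) • y = (R / ‖y‖) • ((x - y) + ((‖y‖ - ‖x‖) / ‖x‖) • x) := by
      rw [sub_div, div_self hx0.ne', sub_smul, one_smul, smul_add, smul_sub, smul_sub, smul_smul,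
        div_mul_div_cancel₀ hy0.ne']
      abel
    rw [e, norm_smul, Real.norm_of_nonneg (by positivity)]
    have h1 : R / ‖y‖ ≤ 1 := (div_le_one hy0).2 (not_le.1 hy).le
    have h2 : ‖(x - y) + ((‖y‖ - ‖x‖) / ‖x‖) • x‖ ≤ 2 * ‖x - y‖ := by
      refine (norm_add_le _ _).trans ?_
      rw [norm_smul, Real.norm_eq_abs, abs_div, abs_norm, div_mul_cancel₀ _ hx0.ne', abs_sub_comm]
      linarith [abs_norm_sub_norm_le x y]
    calc _ ≤ 1 * (2 * ‖x - y‖) := by gcongr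
      _ = _ := one_mul _

lemma norm_le_gronwallBound {f f' : ℝ → E} {K η t₀ t : ℝ}
    (hf : ∀ τ ∈ uIcc t₀ t, HasDerivAt f (f' τ) τ)
    (hb : ∀ τ ∈ uIcc t₀ t, ‖f' τ‖ ≤ K * ‖f τ‖ + η) :
    ‖f t‖ ≤ gronwallBound ‖f t₀‖ K η |t - t₀| := by
  rcases le_total t₀ t with h | h
  · rw [uIcc_of_le h] at hf hb
    rw [abs_of_nonneg (sub_nonneg.2 h)]
    exact norm_le_gronwallBound_of_norm_deriv_right_le
      (fun τ hτ => (hf τ hτ).continuousAt.continuousWithinAt)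
      (fun τ hτ => (hf τ (Ico_subset_Icc_self hτ)).hasDerivWithinAt) le_rfl
      (fun τ hτ => hb τ (Ico_subset_Icc_self hτ)) t ⟨h, le_rfl⟩
  · rw [uIcc_of_ge h] at hf hb
    have hm : ∀ τ ∈ Icc (-t₀) (-t), -τ ∈ Icc t t₀ := fun τ hτ =>
      ⟨by linarith [hτ.2], by linarith [hτ.1]⟩
    have hd : ∀ τ ∈ Icc (-t₀) (-t), HasDerivAt (fun τ => f (-τ)) (-f' (-τ)) τ := fun τ hτ => by
      have := (hf (-τ) (hm τ hτ)).scomp τ (hasDerivAt_neg τ)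
      rwa [neg_one_smul] at this
    have key := norm_le_gronwallBound_of_norm_deriv_right_le (f := fun τ => f (-τ))
      (f' := fun τ => -f' (-τ)) (a := -t₀) (b := -t) (δ := ‖f t₀‖) (K := K) (ε := η)
      (fun τ hτ => (hd τ hτ).continuousAt.continuousWithinAt)
      (fun τ hτ => (hd τ (Ico_subset_Icc_self hτ)).hasDerivWithinAt) (by rw [neg_neg])
      (fun τ hτ => by rw [norm_neg]; exact hb _ (hm τ (Ico_subset_Icc_self hτ))) (-t)
      ⟨neg_le_neg h, le_rfl⟩
    rw [neg_neg] at key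
    rwa [abs_of_nonpos (sub_nonpos.2 h), neg_sub, show t₀ - t = -t - -t₀ by ring]

lemma norm_sub_le_exp {f g f' g' : ℝ → E} {K t₀ t : ℝ}
    (hf : ∀ τ ∈ uIcc t₀ t, HasDerivAt f (f' τ) τ) (hg : ∀ τ ∈ uIcc t₀ t, HasDerivAt g (g' τ) τ)
    (hb : ∀ τ ∈ uIcc t₀ t, ‖f' τ - g' τ‖ ≤ K * ‖f τ - g τ‖) :
    ‖f t - g t‖ ≤ ‖f t₀ - g t₀‖ * Real.exp (K * |t - t₀|) := by
  have := norm_le_gronwallBound (η := 0) (fun τ hτ => (hf τ hτ).sub (hg τ hτ))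
    (fun τ hτ => by rw [add_zero]; exact hb τ hτ)
  rwa [gronwallBound_ε0] at this

lemma eq_of_deriv_eq {f g f' g' : ℝ → E} {K t₀ t : ℝ}
    (hf : ∀ τ ∈ uIcc t₀ t, HasDerivAt f (f' τ) τ) (hg : ∀ τ ∈ uIcc t₀ t, HasDerivAt g (g' τ) τ)
    (hb : ∀ τ ∈ uIcc t₀ t, ‖f' τ - g' τ‖ ≤ K * ‖f τ - g τ‖) (h0 : f t₀ = g t₀) : f t = g t := by
  have := norm_sub_le_exp hf hg hb
  rw [h0, sub_self, norm_zero, zero_mul] at this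
  exact sub_eq_zero.1 (norm_le_zero_iff.1 this)

/-- A bounded Lipschitz vector field has a global flow. -/
lemma exists_global_flow [CompleteSpace E] {F : E → E} {K : ℝ≥0} {B : ℝ} (hF : LipschitzWith K F)
    (hB : ∀ x, ‖F x‖ ≤ B) : ∃ φ : ℝ → E → E, (∀ x, φ 0 x = x) ∧
      ∀ x t, HasDerivAt (fun t => φ t x) (F (φ t x)) t := by
  have hB0 : 0 ≤ B := (norm_nonneg _).trans (hB 0)
  have key : ∀ (x : E) (T : ℕ), ∃ u : ℝ → E, u 0 = x ∧
      ∀ t ∈ Ioo (-(T + 1 : ℝ)) (T + 1), HasDerivAt u (F (u t)) t := by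
    intro x T
    have hT : (0 : ℝ) < T + 1 := by positivity
    have hpl : IsPicardLindelof (fun _ : ℝ => F) (tmin := -(T + 1 : ℝ)) (tmax := T + 1)
        ⟨0, by linarith, hT.le⟩ x (⟨B * (T + 1), by positivity⟩) 0 ⟨B, hB0⟩ K :=
      { lipschitzOnWith := fun _ _ => hF.lipschitzOnWith
        continuousOn := fun _ _ => continuousOn_const
        norm_le := fun _ _ y _ => hB y
        mul_max_le := by simp; exact le_rfl }
    obtain ⟨u, h1, h2⟩ := hpl.exists_eq_forall_mem_Icc_hasDerivWithinAt₀
    exact ⟨u, h1, fun t ht => (h2 t (Ioo_subset_Icc_self ht)).hasDerivAt (Icc_mem_nhds ht.1 ht.2)⟩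
  choose u hu0 hu using key
  have hsub : ∀ {T : ℕ} {t : ℝ}, |t| < T + 1 → ∀ τ ∈ uIcc 0 t, τ ∈ Ioo (-(T + 1 : ℝ)) (T + 1) := by
    intro T t ht τ hτ
    have h1 : |τ| ≤ |t| := by
      have := abs_sub_left_of_mem_uIcc hτ
      simpa using this
    exact abs_lt.1 (h1.trans_lt ht)
  have huniq : ∀ (x : E) (T T' : ℕ) (t : ℝ), |t| < T + 1 → |t| < T' + 1 → u x T t = u x T' t := by
    intro x T T' t h h'
    refine eq_of_deriv_eq (K := K) (t₀ := 0) (fun τ hτ => hu x T τ (hsub h τ hτ))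
      (fun τ hτ => hu x T' τ (hsub h' τ hτ)) (fun τ _ => ?_) (by rw [hu0, hu0])
    exact hF.norm_sub_le _ _
  refine ⟨fun t x => u x ⌈|t|⌉₊ t, fun x => hu0 x _, fun x t => ?_⟩
  have ht : |t| < (⌈|t|⌉₊ : ℕ) + 1 := (Nat.le_ceil _).trans_lt (lt_add_one _)
  refine (hu x _ t (abs_lt.1 ht)).congr_of_eventuallyEq ?_
  have : ∀ᶠ τ : ℝ in 𝓝 t, |τ| < (⌈|t|⌉₊ : ℕ) + 1 := continuous_abs.continuousAt.eventually_lt_const ht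
  filter_upwards [this] with τ hτ
  exact huniq x _ _ τ ((Nat.le_ceil _).trans_lt (lt_add_one _)) hτ

/-- A vector field that is Lipschitz on a ball has a global flow, if it is cut off outside. -/
lemma exists_truncated_flow [CompleteSpace E] {F : E → E} {K : ℝ≥0} {R : ℝ} (hR : 0 ≤ R)
    (hF : LipschitzOnWith K F (Metric.closedBall 0 R)) :
    ∃ φ : ℝ → E → E, (∀ x, φ 0 x = x) ∧
      (∀ x t, HasDerivAt (fun t => φ t x) (F (radial R (φ t x))) t) ∧
      Continuous fun p : ℝ × E => φ p.1 p.2 := by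
  have hmem : ∀ x : E, radial R x ∈ Metric.closedBall (0 : E) R := fun x => by
    rw [mem_closedBall_zero_iff]
    exact norm_radial_le hR x
  have hlip : LipschitzWith (K * 2) fun x => F (radial R x) := by
    refine LipschitzWith.of_dist_le_mul fun x y => ?_
    refine (hF.dist_le_mul _ (hmem x) _ (hmem y)).trans ?_
    rw [NNReal.coe_mul, _root_.mul_assoc, dist_eq_norm, dist_eq_norm]
    gcongr
    exact norm_radial_sub_le hR x y
  have hbd : ∀ x : E, ‖F (radial R x)‖ ≤ ‖F 0‖ + K * R := fun x => by
    have h1 := hF.dist_le_mul _ (hmem x) 0 (by simpa using hR)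
    rw [dist_eq_norm, dist_zero_right] at h1
    have h2 := norm_le_norm_add_norm_sub' (F (radial R x)) (F 0)
    have h3 : (K : ℝ) * ‖radial R x‖ ≤ K * R := by
      gcongr
      exact norm_radial_le hR x
    linarith
  obtain ⟨φ, h0, h1⟩ := exists_global_flow hlip hbd
  refine ⟨φ, h0, h1, ?_⟩
  have hd : ∀ t x y, ‖φ t x - φ t y‖ ≤ ‖x - y‖ * Real.exp ((K * 2 : ℝ≥0) * |t|) := by
    intro t x y
    have := norm_sub_le_exp (K := (K * 2 : ℝ≥0)) (t₀ := 0) (t := t) (fun τ _ => h1 x τ)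
      (fun τ _ => h1 y τ) fun τ _ => hlip.norm_sub_le _ _
    rwa [h0, h0, sub_zero] at this
  rw [continuous_iff_continuousAt]
  rintro ⟨t, x⟩
  rw [ContinuousAt, tendsto_iff_norm_sub_tendsto_zero]
  have c1 : Tendsto (fun p : ℝ × E => ‖p.2 - x‖ * Real.exp ((K * 2 : ℝ≥0) * |p.1|) +
      ‖φ p.1 x - φ t x‖) (𝓝 (t, x)) (𝓝 0) := by
    have hc : Continuous fun t => φ t x :=
      continuous_iff_continuousAt.2 fun t => (h1 x t).continuousAt
    have : Continuous fun p : ℝ × E => ‖p.2 - x‖ * Real.exp ((K * 2 : ℝ≥0) * |p.1|) +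
      ‖φ p.1 x - φ t x‖ := by fun_prop
    have h := this.tendsto (t, x)
    simpa using h
  refine squeeze_zero (fun _ => norm_nonneg _) (fun p => ?_) c1
  calc ‖φ p.1 p.2 - φ t x‖ ≤ ‖φ p.1 p.2 - φ p.1 x‖ + ‖φ p.1 x - φ t x‖ := norm_sub_le_norm_sub_add_norm_sub _ _ _
    _ ≤ _ := by
      gcongr
      exact hd _ _ _

end Flow

lemma lt_of_bootstrap_of_nonneg {g : ℝ → ℝ} (hg : Continuous g) {c R : ℝ} (hcR : c < R) (h0 : g 0 ≤ c)
    (h : ∀ t, 0 ≤ t → (∀ τ ∈ Icc 0 t, g τ < R) → g t ≤ c) {t : ℝ} (ht : 0 ≤ t) : g t < R := by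
  by_contra hc
  rw [not_lt] at hc
  have hK : IsCompact (Icc 0 t ∩ {τ | R ≤ g τ}) :=
    isCompact_Icc.inter_right (isClosed_le continuous_const hg)
  obtain ⟨t₁, ⟨ht₁, hR⟩, hmin⟩ := hK.exists_isLeast ⟨t, ⟨ht, le_rfl⟩, hc⟩
  have hR : R ≤ g t₁ := hR
  have hlt : ∀ τ, 0 ≤ τ → τ < t₁ → g τ < R := fun τ h1 h2 => by
    by_contra h3
    exact absurd (hmin ⟨⟨h1, h2.le.trans ht₁.2⟩, not_lt.1 h3⟩) (not_le.2 h2)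
  have hpos : 0 < t₁ := by
    rcases ht₁.1.eq_or_lt with e | e
    · rw [← e] at hR
      linarith
    · exact e
  have hle : ∀ τ ∈ Ico 0 t₁, g τ ≤ c := fun τ hτ =>
    h τ hτ.1 fun σ hσ => hlt σ hσ.1 (hσ.2.trans_lt hτ.2)
  have : g t₁ ≤ c := by
    have hcl : t₁ ∈ closure (Ico 0 t₁) := by
      rw [closure_Ico hpos.ne]
      exact ⟨hpos.le, le_rfl⟩
    exact closure_minimal (s := Ico 0 t₁) (t := {τ | g τ ≤ c}) hle
      (isClosed_le hg continuous_const) hcl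
  linarith

/-- A continuity argument. -/
lemma le_of_bootstrap {g : ℝ → ℝ} (hg : Continuous g) {c R : ℝ} (hcR : c < R) (h0 : g 0 ≤ c)
    (h : ∀ t, (∀ τ ∈ uIcc 0 t, g τ < R) → g t ≤ c) (t : ℝ) : g t ≤ c := by
  have h1 : ∀ t, 0 ≤ t → g t < R := fun t ht => lt_of_bootstrap_of_nonneg hg hcR h0
    (fun t ht h2 => h t (by rwa [uIcc_of_le ht])) ht
  have h2 : ∀ t, 0 ≤ t → g (-t) < R := fun t ht => by
    refine lt_of_bootstrap_of_nonneg (g := fun t => g (-t)) (by fun_prop) hcR (by simpa using h0)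
      (fun t ht h2 => h (-t) fun τ hτ => ?_) ht
    rw [uIcc_of_ge (by linarith)] at hτ
    simpa using h2 (-τ) ⟨by linarith [hτ.2], by linarith [hτ.1]⟩
  refine h t fun τ _ => ?_
  rcases le_total 0 τ with hτ | hτ
  · exact h1 τ hτ
  · simpa using h2 (-τ) (by linarith)

/-- Two curves that solve the same equation as long as they are small agree on intervals. -/
lemma eqOn_of_local {E : Type*} [TopologicalSpace E] [T2Space E] {J : Set ℝ} (hJ : IsOpen J)
    (hJ' : IsPreconnected J) {t₀ : ℝ} (ht₀ : t₀ ∈ J) {f g : ℝ → E} (hf : ContinuousOn f J)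
    (hg : ContinuousOn g J) (h0 : f t₀ = g t₀)
    (h : ∀ t ∈ J, f t = g t → ∀ᶠ τ in 𝓝 t, f τ = g τ) : EqOn f g J := by
  set u : Set ℝ := {t | ∀ᶠ τ in 𝓝 t, f τ = g τ} with hu
  have hsub : J ⊆ u := by
    refine hJ'.subset_of_closure_inter_subset isOpen_setOfPred_eventually_nhds
      ⟨t₀, ht₀, h t₀ ht₀ h0⟩ ?_
    rintro t ⟨ht, htJ⟩
    refine h t htJ ?_
    have hnb : J ∈ 𝓝 t := hJ.mem_nhds htJ
    have hne : (𝓝[u] t).NeBot := mem_closure_iff_nhdsWithin_neBot.1 ht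
    have l1 : Tendsto f (𝓝[u] t) (𝓝 (f t)) := (hf.continuousAt hnb).mono_left nhdsWithin_le_nhds
    have l2 : Tendsto g (𝓝[u] t) (𝓝 (g t)) := (hg.continuousAt hnb).mono_left nhdsWithin_le_nhds
    refine tendsto_nhds_unique_of_eventuallyEq l1 l2 ?_
    filter_upwards [self_mem_nhdsWithin] with τ hτ
    exact (show ∀ᶠ σ in 𝓝 τ, f σ = g σ from hτ).self_of_nhds
  exact fun t ht => (show ∀ᶠ σ in 𝓝 t, f σ = g σ from hsub ht).self_of_nhds

end

end AKNS

namespace AKNS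

noncomputable section

open scoped ENNReal NNReal
open Filter Topology

/-! ### The vector field -/

namespace IsSob

variable {s : ℝ} {ω : ℝ → ℝ} {μ : Measure ℝ} (S : IsSob s ω μ)
include S

/-- The regularized vector fields, on the Fourier side. -/
def field (ε : ℤˣ) (κ : ℝ) (c : ℂ) (d : ℝ) (w : Lp ℂ 2 μ) : Lp ℂ 2 μ :=
  c • S.G κ w (S.J ε w) - conj c • S.G (-κ) w (S.J ε w) + (Complex.I * d) • w

omit S in
/-- The Lipschitz constant of `field`. -/
def _root_.AKNS.fieldConst (s : ℝ) (c : ℂ) (d : ℝ) : ℝ≥0 :=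
  2 * ‖c‖₊ * (dConst s * (2 * qConst s * 2)) + ‖d‖₊

lemma norm_field_sub_le (ε : ℤˣ) (κ : ℝ) (c : ℂ) (d : ℝ) {w w' : Lp ℂ 2 μ} (hw : ‖w‖ ≤ rad s)
    (hw' : ‖w'‖ ≤ rad s) :
    ‖S.field ε κ c d w - S.field ε κ c d w'‖ ≤ fieldConst s c d * ‖w - w'‖ := by
  have hv := (S.norm_J_le ε w).trans hw
  have hv' := (S.norm_J_le ε w').trans hw'
  have hJ : ‖S.J ε w - S.J ε w'‖ ≤ ‖w - w'‖ := by
    rw [← map_sub]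
    exact S.norm_J_le ε _
  have key : ∀ κ, ‖S.G κ w (S.J ε w) - S.G κ w' (S.J ε w')‖ ≤
      dConst s * (2 * qConst s * 2) * ‖w - w'‖ := fun κ => by
    refine (S.norm_G_sub_le κ hw hv hw' hv').trans ?_
    calc (dConst s : ℝ) * (2 * qConst s * (‖w - w'‖ + ‖S.J ε w - S.J ε w'‖)) ≤
        dConst s * (2 * qConst s * (‖w - w'‖ + ‖w - w'‖)) := by gcongr
      _ = _ := by ring
  have e : S.field ε κ c d w - S.field ε κ c d w' =
      c • (S.G κ w (S.J ε w) - S.G κ w' (S.J ε w')) -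
        conj c • (S.G (-κ) w (S.J ε w) - S.G (-κ) w' (S.J ε w')) + (Complex.I * d) • (w - w') := by
    simp only [field, smul_sub]
    abel
  rw [e]
  refine (norm_add_le _ _).trans ?_
  refine (add_le_add (norm_sub_le _ _) le_rfl).trans ?_
  rw [norm_smul, norm_smul, norm_smul, RCLike.norm_conj, norm_mul, Complex.norm_I, one_mul,
    Complex.norm_real]
  have h1 := mul_le_mul_of_nonneg_left (key κ) (norm_nonneg c)
  have h2 := mul_le_mul_of_nonneg_left (key (-κ)) (norm_nonneg c)
  simp only [fieldConst]
  push_cast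
  linarith

lemma lipschitzOnWith_field (ε : ℤˣ) (κ : ℝ) (c : ℂ) (d : ℝ) {R : ℝ} (hR : R ≤ rad s) :
    LipschitzOnWith (fieldConst s c d) (S.field ε κ c d) (Metric.closedBall 0 R) := by
  refine LipschitzOnWith.of_dist_le_mul fun x hx y hy => ?_
  rw [mem_closedBall_zero_iff] at hx hy
  rw [dist_eq_norm, dist_eq_norm]
  exact S.norm_field_sub_le ε κ c d (hx.trans hR) (hy.trans hR)

lemma J_field (ε : ℤˣ) (κ : ℝ) (c : ℂ) (d : ℝ) {w : Lp ℂ 2 μ} (hw : ‖w‖ ≤ rad s) :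
    S.J ε (S.field ε κ c d w) = conj c • S.G κ (S.J ε w) w - c • S.G (-κ) (S.J ε w) w -
      (Complex.I * d) • S.J ε w := by
  have hv := (S.norm_J_le ε w).trans hw
  rw [field, map_add, map_sub, J_smul, J_smul, J_smul, S.J_G ε κ hw hv, S.J_G ε (-κ) hw hv, J_J,
    Complex.conj_conj, map_mul, Complex.conj_I, Complex.conj_ofReal, neg_mul, neg_smul,
    ← sub_eq_add_neg]

lemma emb_field {ω₀ : ℝ → ℝ} {μ₀ : Measure ℝ} (S₀ : IsSob s ω₀ μ₀) (hle : ∀ x, ω₀ x ≤ ω x) (ε : ℤˣ)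
    (κ : ℝ) (c : ℂ) (d : ℝ) {w : Lp ℂ 2 μ} (hw : ‖w‖ ≤ rad s) :
    S.emb S₀ hle (S.field ε κ c d w) = S₀.field ε κ c d (S.emb S₀ hle w) := by
  have hv := (S.norm_J_le ε w).trans hw
  rw [field, map_add, map_sub, map_smul, map_smul, map_smul, S.emb_G S₀ hle κ hw hv,
    S.emb_G S₀ hle (-κ) hw hv, S.emb_J (S₀ := S₀) (hle := hle), field]

lemma dlogd_comb (κ : ℝ) (w v f g f' g' f'' g'' : Lp ℂ 2 μ) (a b c : ℂ) :
    S.dlogd κ w v (a • f - b • f' + c • f'') (a • g - b • g' + c • g'') =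
      a * S.dlogd κ w v f g - b * S.dlogd κ w v f' g' + c * S.dlogd κ w v f'' g'' := by
  simp only [dlogd, map_add, map_sub, map_smul, smul_eq_mul]
  ring

end IsSob

lemma IsSob.dlogd_field {s : ℝ} {μ : Measure ℝ} (S : IsSob s (fun _ => 1) μ) (ε : ℤˣ) {κ ϰ : ℝ}
    (hκ : 1 ≤ |κ|) (hϰ : 1 ≤ |ϰ|) (c : ℂ) (d : ℝ) {w : Lp ℂ 2 μ} (hw : ‖w‖ < rad s) :
    S.dlogd ϰ w (S.J ε w) (S.field ε κ c d w) (S.J ε (S.field ε κ c d w)) = 0 := by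
  have hv := (S.norm_J_le ε w).trans_lt hw
  have h1 := S.bracket hκ hϰ hw hv
  have h2 := S.bracket (κ := -κ) (by rwa [abs_neg]) hϰ hw hv
  rw [neg_neg] at h2
  have h3 := S.dlogd_self ϰ hw.le hv.le
  have e : S.J ε (S.field ε κ c d w) = c • (-S.G (-κ) (S.J ε w) w) -
      conj c • (-S.G κ (S.J ε w) w) + (Complex.I * d) • (-S.J ε w) := by
    rw [S.J_field ε κ c d hw.le]
    simp only [smul_neg]
    abel
  rw [e, field, S.dlogd_comb, h1, h2, h3]
  ring

/-! ### Translations in physical space -/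

/-- The symbol `e^{ibξ}` of a translation. -/
def modul (b ξ : ℝ) : ℂ := Complex.exp (Complex.I * (b * ξ : ℝ))

lemma norm_modul (b ξ : ℝ) : ‖modul b ξ‖ = 1 := by
  rw [modul, mul_comm, Complex.norm_exp_ofReal_mul_I]

lemma isMult_modul (b : ℝ) : IsMult (modul b) 1 where
  meas := by unfold modul; fun_prop
  bound ξ := by rw [← ofReal_norm, norm_modul]; simp

lemma modul_add (b b' ξ : ℝ) : modul (b + b') ξ = modul b ξ * modul b' ξ := by
  rw [modul, modul, modul, ← Complex.exp_add]
  congr 1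
  push_cast
  ring

lemma modul_zero (ξ : ℝ) : modul 0 ξ = 1 := by simp [modul]

lemma modul_add_right (b ξ η : ℝ) : modul b (ξ + η) = modul b ξ * modul b η := by
  rw [modul, modul, modul, ← Complex.exp_add]
  congr 1
  push_cast
  ring

lemma modul_neg (b ξ : ℝ) : modul b (-ξ) = modul (-b) ξ := by
  rw [modul, modul]
  congr 2
  push_cast
  ring

lemma conj_modul (b ξ : ℝ) : conj (modul b ξ) = modul (-b) ξ := by
  rw [modul, modul, ← Complex.exp_conj, map_mul, Complex.conj_I, Complex.conj_ofReal]
  congr 1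
  push_cast
  ring

/-- The translation operator, on the Fourier side. -/
def shift (μ : Measure ℝ) (b : ℝ) : Lp ℂ 2 μ →L[ℂ] Lp ℂ 2 μ :=
  (isL2Op_mul (isMult_modul b).meas (isMult_modul b).bound).toCLM

lemma norm_shift_le {μ : Measure ℝ} (b : ℝ) (f : Lp ℂ 2 μ) : ‖shift μ b f‖ ≤ ‖f‖ := by
  have := (isL2Op_mul (μ := μ) (isMult_modul b).meas (isMult_modul b).bound).norm_le f
  rwa [NNReal.coe_one, one_mul] at this

lemma IsWeighted.coeFn_shift {μ : Measure ℝ} {ρ : ℝ → ℝ≥0∞} (h : IsWeighted μ ρ) (b : ℝ)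
    (f : Lp ℂ 2 μ) : shift μ b f =ᵐ[volume] fun x => modul b x * f x :=
  h.ae_eq_iff.1 ((isL2Op_mul (isMult_modul b).meas (isMult_modul b).bound).coeFn f)

lemma IsWeighted.shift_shift {μ : Measure ℝ} {ρ : ℝ → ℝ≥0∞} (h : IsWeighted μ ρ) (b b' : ℝ)
    (f : Lp ℂ 2 μ) : shift μ b (shift μ b' f) = shift μ (b + b') f := by
  refine Lp.ext (h.ae_eq_iff.2 ?_)
  filter_upwards [h.coeFn_shift b (shift μ b' f), h.coeFn_shift b' f,
    h.coeFn_shift (b + b') f] with x h1 h2 h3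
  rw [h1, h2, h3, modul_add]
  ring

lemma IsWeighted.shift_zero {μ : Measure ℝ} {ρ : ℝ → ℝ≥0∞} (h : IsWeighted μ ρ)
    (f : Lp ℂ 2 μ) : shift μ 0 f = f := by
  refine Lp.ext (h.ae_eq_iff.2 ?_)
  filter_upwards [h.coeFn_shift 0 f] with x h1
  rw [h1, modul_zero, one_mul]

lemma IsWeighted.norm_shift {μ : Measure ℝ} {ρ : ℝ → ℝ≥0∞} (h : IsWeighted μ ρ) (b : ℝ)
    (f : Lp ℂ 2 μ) : ‖shift μ b f‖ = ‖f‖ := by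
  refine le_antisymm (norm_shift_le b f) ?_
  have := norm_shift_le (-b) (shift μ b f)
  rwa [h.shift_shift, neg_add_cancel, h.shift_zero] at this

section Kernel

variable {τ : ℝ × ℝ → ℝ≥0∞} (hτ : IsKernelWeight τ)

/-- Conjugation of a kernel by a translation. -/
def kshift (τ : ℝ × ℝ → ℝ≥0∞) (b : ℝ) : Lp ℂ 2 (kmeas τ) →L[ℂ] Lp ℂ 2 (kmeas τ) :=
  (lmul τ (isMult_modul b)).comp (rmul τ (isMult_modul (-b)))

include hτ

lemma coeFn_kshift (b : ℝ) (X : Lp ℂ 2 (kmeas τ)) :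
    kshift τ b X =ᵐ[volume] fun p => modul b (p.1 - p.2) * X p := by
  filter_upwards [coeFn_lmul hτ (isMult_modul b) (rmul τ (isMult_modul (-b)) X),
    coeFn_rmul hτ (isMult_modul (-b)) X] with p h1 h2
  rw [kshift, ContinuousLinearMap.comp_apply, h1, h2, sub_eq_add_neg, modul_add_right, modul_neg]
  ring

lemma kshift_mul (b : ℝ) (X Y : Lp ℂ 2 (kmeas τ)) :
    kshift τ b (hτ.mul X Y) = hτ.mul (kshift τ b X) (kshift τ b Y) := by
  refine Lp.ext (hτ.isWeighted.ae_eq_iff.2 ?_)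
  refine .trans ?_ ((hτ.coeFn_mul _ _).trans
    (kcomp_congr (coeFn_kshift hτ b X) (coeFn_kshift hτ b Y))).symm
  filter_upwards [coeFn_kshift hτ b (hτ.mul X Y), hτ.coeFn_mul X Y] with p h1 h2
  rw [h1, h2, kcomp, kcomp, ← integral_const_mul]
  refine integral_congr_ae (.of_forall fun ζ => ?_)
  simp only
  rw [show p.1 - p.2 = (p.1 - ζ) + (ζ - p.2) by ring, modul_add_right]
  ring

lemma kshift_rmul {p : ℝ → ℂ} {C : ℝ≥0} (h : IsMult p C) (b : ℝ) (X : Lp ℂ 2 (kmeas τ)) :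
    kshift τ b (rmul τ h X) = rmul τ h (kshift τ b X) := by
  refine Lp.ext (hτ.isWeighted.ae_eq_iff.2 ?_)
  filter_upwards [coeFn_kshift hτ b (rmul τ h X), coeFn_rmul hτ h X,
    coeFn_rmul hτ h (kshift τ b X), coeFn_kshift hτ b X] with p h1 h2 h3 h4
  rw [h1, h2, h3, h4]
  ring

lemma kshift_alt (b : ℝ) (x y : Lp ℂ 2 (kmeas τ)) (m : ℕ) :
    kshift τ b (alt hτ.mul x y m) = alt hτ.mul (kshift τ b x) (kshift τ b y) m := by
  induction m with
  | zero => rfl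
  | succ m ih => rw [alt, kshift_mul hτ, kshift_mul hτ, ih, alt]

end Kernel

namespace IsSob

variable {s : ℝ} {ω : ℝ → ℝ} {μ : Measure ℝ} (S : IsSob s ω μ)
include S

lemma kshift_X (κ b : ℝ) (u : Lp ℂ 2 μ) :
    kshift (kw (tex s) ω) b (S.X κ u) = S.X κ (shift μ b u) := by
  refine Lp.ext (S.isKW.isWeighted.ae_eq_iff.2 ?_)
  filter_upwards [coeFn_kshift S.isKW b (S.X κ u), S.coeFn_X κ u, S.coeFn_X κ (shift μ b u),
    ae_diff (S.hμ.coeFn_shift b u)] with p h1 h2 h3 h4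
  rw [h1, h2, h3, qker, qker, flat, flat, h4]
  ring

lemma D_kshift (b : ℝ) (X : Lp ℂ 2 (kmeas (kw (tex s) ω))) :
    S.D (kshift (kw (tex s) ω) b X) = shift μ b (S.D X) := by
  refine Lp.ext (S.hμ.ae_eq_iff.2 ?_)
  filter_upwards [S.coeFn_D (kshift (kw (tex s) ω) b X), S.hμ.coeFn_shift b (S.D X), S.coeFn_D X,
    diag_congr (flat_congr (coeFn_kshift S.isKW b X))] with k h1 h2 h3 h4
  rw [h1, h2, h3, dker, dker, h4, diag, diag, mul_left_comm, ← integral_const_mul (modul b k)]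
  refine congrArg (cpi * ·) (integral_congr_ae (.of_forall fun ξ => ?_))
  simp only [flat, shear, sub_sub_cancel]
  ring

lemma G_shift (κ b : ℝ) {w v : Lp ℂ 2 μ} (hw : ‖w‖ ≤ rad s) (hv : ‖v‖ ≤ rad s) :
    S.G κ (shift μ b w) (shift μ b v) = shift μ b (S.G κ w v) := by
  have hs := S.isKW.isTraceAlgebra.summable_alt (S.norm_X_le_half κ hw) (S.norm_X_le_half (-κ) hv)
    (by norm_num)
  rw [G, G, ← D_kshift, kshift_rmul S.isKW, Z, Z, altSum, altSum,
    ContinuousLinearMap.map_tsum _ hs]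
  simp only [kshift_alt S.isKW, kshift_X]

lemma J_shift (ε : ℤˣ) (b : ℝ) (u : Lp ℂ 2 μ) : S.J ε (shift μ b u) = shift μ b (S.J ε u) := by
  refine Lp.ext (S.hμ.ae_eq_iff.2 ?_)
  filter_upwards [S.coeFn_J ε (shift μ b u), ae_neg (S.hμ.coeFn_shift b u),
    S.hμ.coeFn_shift b (S.J ε u), S.coeFn_J ε u] with x h1 h2 h3 h4
  rw [h1, rHat, h2, h3, h4, rHat, map_mul, modul_neg, conj_modul, neg_neg]
  ring

lemma field_shift (ε : ℤˣ) (κ : ℝ) (c : ℂ) (d b : ℝ) {w : Lp ℂ 2 μ} (hw : ‖w‖ ≤ rad s) :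
    S.field ε κ c d (shift μ b w) = shift μ b (S.field ε κ c d w) := by
  have hv := (S.norm_J_le ε w).trans hw
  rw [field, field, J_shift, S.G_shift κ b hw hv, S.G_shift (-κ) b hw hv, map_add, map_sub,
    map_smul, map_smul, map_smul]

end IsSob

lemma kerOdd_modul (ε : ℤˣ) (κ b : ℝ) {w w' : ℝ → ℂ} (h : ∀ ξ, w' ξ = modul b ξ * w ξ) (m : ℕ)
    (ξ η : ℝ) : kerOdd ε κ w' m ξ η = modul b (ξ - η) * kerOdd ε κ w m ξ η ∧
      kerComp (kerOdd ε κ w' m) (kerGamma ε κ w') ξ η =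
        modul b (ξ - η) * kerComp (kerOdd ε κ w m) (kerGamma ε κ w) ξ η := by
  have hL : ∀ ξ η, kerLambda κ w' ξ η = modul b (ξ - η) * kerLambda κ w ξ η := fun ξ η => by
    rw [kerLambda, kerLambda, h]
    ring
  have hG : ∀ ξ η, kerGamma ε κ w' ξ η = modul b (ξ - η) * kerGamma ε κ w ξ η := fun ξ η => by
    rw [kerGamma, kerGamma, rHat, rHat, h, map_mul, conj_modul, modul_neg, neg_neg]
    ring
  have hC : ∀ {K L K' L' : ℝ → ℝ → ℂ}, (∀ ξ η, K' ξ η = modul b (ξ - η) * K ξ η) →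
      (∀ ξ η, L' ξ η = modul b (ξ - η) * L ξ η) →
      ∀ ξ η, kerComp K' L' ξ η = modul b (ξ - η) * kerComp K L ξ η := by
    intro K L K' L' hK hL ξ η
    rw [kerComp, kerComp, ← integral_const_mul]
    refine integral_congr_ae (.of_forall fun ζ => ?_)
    simp only
    rw [hK, hL, show ξ - η = (ξ - ζ) + (ζ - η) by ring, modul_add_right]
    ring
  have hO : ∀ ξ η, kerOdd ε κ w' m ξ η = modul b (ξ - η) * kerOdd ε κ w m ξ η := by
    induction m with
    | zero => exact hL
    | succ m ih => exact hC hL (hC hG ih)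
  exact ⟨hO ξ η, hC hO hG ξ η⟩

lemma traceTerm_modul (ε : ℤˣ) (κ b : ℝ) {w w' : ℝ → ℂ} (h : ∀ ξ, w' ξ = modul b ξ * w ξ) (m : ℕ) :
    traceTerm ε κ w' m = traceTerm ε κ w m := by
  rw [traceTerm, traceTerm]
  refine integral_congr_ae (.of_forall fun ξ => ?_)
  simp only
  rw [(kerOdd_modul ε κ b h m ξ ξ).2, sub_self, modul]
  simp

lemma alpha_modul (ε : ℤˣ) (κ b : ℝ) (w : ℝ → ℂ) :
    alpha ε κ (fun ξ => modul b ξ * w ξ) = alpha ε κ w := by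
  simp only [alpha, A, ATerm, traceTerm_modul ε κ b (w := w) (fun _ => rfl)]

section

variable {s : ℝ} (hs : s ∈ Ioo (-(1 / 2) : ℝ) 0)
include hs

lemma A_congr (ε : ℤˣ) {ϰ : ℝ} (hϰ : 1 ≤ |ϰ|) {w : ℝ → ℂ} {q : Hs s} (h : w =ᵐ[volume] q) :
    A ε ϰ w = A ε ϰ q := by
  have S := isSob_sobolev hs
  rw [S.A_eq hϰ h (ae_rHat S h), S.A_eq hϰ .rfl (ae_rHat S .rfl)]

lemma alpha_shift (ε : ℤˣ) {ϰ : ℝ} (hϰ : 1 ≤ |ϰ|) (b : ℝ) (q : Hs s) :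
    alpha ε ϰ (shift (sobolevMeasure s) b q) = alpha ε ϰ q := by
  rw [← alpha_modul ε ϰ b q, alpha, alpha, A_congr hs ε hϰ ((isWeighted_sobolev s).coeFn_shift b q).symm]

/-- A solution of the truncated equation stays small, and conserves `α`. -/
lemma flow_bounds {R K : ℝ} (hR0 : 0 < R) (hR : R < rad s) (hK : 1 ≤ K)
    (hRK : ∀ (ε : ℤˣ) (w w₀ : Hs s), ‖w‖ ≤ R → ‖w₀‖ ≤ R →
      (∀ n : ℕ, alpha ε (2 ^ n) w = alpha ε (2 ^ n) w₀) → ‖w‖ ≤ K * ‖w₀‖)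
    (ε : ℤˣ) {κ : ℝ} (hκ : 1 ≤ κ) (c : ℂ) (d : ℝ) {u : ℝ → Hs s}
    (hu : ∀ t, HasDerivAt u ((isSob_sobolev hs).field ε κ c d (radial R (u t))) t)
    (h0 : K * ‖u 0‖ < R) (t : ℝ) :
    ‖u t‖ ≤ K * ‖u 0‖ ∧ ∀ ϰ : ℝ, 1 ≤ ϰ → alpha ε ϰ (u t) = alpha ε ϰ (u 0) := by
  set S := isSob_sobolev hs
  have hκ1 : 1 ≤ |κ| := hκ.trans (le_abs_self κ)
  have huc : Continuous u := continuous_iff_continuousAt.2 fun t => (hu t).continuousAt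
  have h00 : ‖u 0‖ ≤ K * ‖u 0‖ := le_mul_of_one_le_left (norm_nonneg _) hK
  have hcons : ∀ t, (∀ τ ∈ uIcc 0 t, ‖u τ‖ < R) → ∀ ϰ : ℝ, 1 ≤ ϰ →
      alpha ε ϰ (u t) = alpha ε ϰ (u 0) := by
    intro t ht ϰ hϰ
    have hϰ1 : 1 ≤ |ϰ| := hϰ.trans (le_abs_self ϰ)
    have hder : ∀ τ ∈ uIcc 0 t, HasDerivAt (fun t => S.logd ϰ (u t) (S.J ε (u t))) 0 τ := by
      intro τ hτ
      have hlt := ht τ hτ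
      obtain ⟨η, hη, hball⟩ := Metric.mem_nhds_iff.1
        (huc.norm.continuousAt.eventually_lt_const hlt)
      have hb : ∀ σ ∈ Metric.ball τ η, ‖u σ‖ < R := fun σ hσ => hball hσ
      have hu' : ∀ σ ∈ Metric.ball τ η, HasDerivAt u (S.field ε κ c d (u σ)) σ := fun σ hσ => by
        have := hu σ
        rwa [radial_of_le (hb σ hσ).le] at this
      have hbd : ∀ σ ∈ Metric.ball τ η, ‖S.field ε κ c d (u σ)‖ ≤
          ‖S.field ε κ c d 0‖ + fieldConst s c d * R := fun σ hσ => by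
        have h1 := S.norm_field_sub_le ε κ c d (w := u σ) (w' := 0) ((hb σ hσ).le.trans hR.le)
          (by rw [norm_zero]; exact (hR0.trans hR).le)
        rw [sub_zero] at h1
        have h2 := norm_le_norm_add_norm_sub' (S.field ε κ c d (u σ)) (S.field ε κ c d 0)
        have h3 : (fieldConst s c d : ℝ) * ‖u σ‖ ≤ fieldConst s c d * R := by
          gcongr
          exact (hb σ hσ).le
        linarith
      have := S.hasDerivAt_logd ϰ (w := u) (v := fun t => S.J ε (u t))
        (w' := fun σ => S.field ε κ c d (u σ)) (v' := fun σ => S.J ε (S.field ε κ c d (u σ)))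
        (I := Metric.ball τ η) Metric.isOpen_ball (convex_ball _ _).isPreconnected hu'
        (fun σ hσ => (S.J ε).hasFDerivAt.comp_hasDerivAt σ (hu' σ hσ))
        (fun σ hσ => (hb σ hσ).le.trans hR.le)
        (fun σ hσ => (S.norm_J_le ε _).trans ((hb σ hσ).le.trans hR.le)) hbd
        (fun σ hσ => (S.norm_J_le ε _).trans (hbd σ hσ)) (Metric.mem_ball_self hη)
      rwa [S.dlogd_field ε hκ1 hϰ1 c d (hlt.trans hR)] at this
    have hconst := (convex_uIcc 0 t).norm_image_sub_le_of_norm_hasDerivWithin_le (C := 0)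
      (fun τ hτ => (hder τ hτ).hasDerivWithinAt) (fun _ _ => by simp) left_mem_uIcc right_mem_uIcc
    rw [zero_mul, norm_le_zero_iff, sub_eq_zero] at hconst
    simp only [alpha]
    rw [S.A_eq hϰ1 .rfl (ae_rHat S .rfl), S.A_eq hϰ1 .rfl (ae_rHat S .rfl), hconst]
  have hsmall : ∀ t, ‖u t‖ ≤ K * ‖u 0‖ := by
    refine le_of_bootstrap huc.norm h0 h00 fun t ht => ?_
    refine hRK ε (u t) (u 0) (ht t right_mem_uIcc).le (ht 0 left_mem_uIcc).le fun n => ?_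
    exact hcons t ht _ (one_le_pow₀ (by norm_num))
  exact ⟨hsmall t, hcons t fun τ _ => (hsmall τ).trans_lt h0⟩

end

end

end AKNS

namespace AKNS

noncomputable section

open scoped ENNReal NNReal
open Filter Topology

/-! ### The pairing with Schwartz functions -/

lemma dens_one (σ ξ : ℝ) : dens σ (fun _ => 1) ξ = ENNReal.ofReal ((4 + ξ ^ 2) ^ σ) := by
  simp [dens]

lemma integrable_pair {σ : ℝ} (q : Hs σ) (φ : 𝓢(ℝ, ℂ)) :
    Integrable fun ξ => q ξ * fourierT φ (-ξ) := by
  obtain ⟨n, hn⟩ := exists_nat_ge (-σ / 2)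
  have hq : Measurable q := (Lp.stronglyMeasurable q).measurable
  have hφ : Measurable fun ξ => fourierT φ (-ξ) := by
    rw [← coe_sft]
    exact (sft φ).continuous.measurable.comp measurable_neg
  refine ⟨(hq.mul hφ).aestronglyMeasurable, ?_⟩
  have hg : Function.HasTemperateGrowth fun ξ : ℝ => (((4 + ξ ^ 2) ^ n : ℝ) : ℂ) := by fun_prop
  set ψ : 𝓢(ℝ, ℂ) := SchwartzMap.smulLeftCLM ℂ (fun ξ : ℝ => (((4 + ξ ^ 2) ^ n : ℝ) : ℂ)) (sft φ)
    with hψ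
  have hψ' : ∀ ξ, ψ ξ = (((4 + ξ ^ 2) ^ n : ℝ) : ℂ) * fourierT φ ξ := fun ξ => by
    rw [hψ, SchwartzMap.smulLeftCLM_apply_apply hg, sft_apply, smul_eq_mul]
  have hψ2 : MemLp (fun ξ : ℝ => ψ (-ξ)) 2 (volume : Measure ℝ) :=
    (ψ.memLp 2 (volume : Measure ℝ)).comp_measurePreserving
      (Measure.measurePreserving_neg (volume : Measure ℝ))
  have hfin : ∫⁻ ξ, ‖ψ (-ξ)‖ₑ ^ 2 < ⊤ := by
    have := (eLpNorm_lt_top_iff_lintegral_rpow_enorm_lt_top two_ne_zero ENNReal.ofNat_ne_top).1 hψ2.2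
    simpa using this
  have hd : Measurable fun ξ : ℝ => ENNReal.ofReal ((4 + ξ ^ 2) ^ (σ / 2)) := by fun_prop
  have hψm : Measurable fun ξ : ℝ => ψ (-ξ) := ψ.continuous.measurable.comp measurable_neg
  have h1 : ∫⁻ ξ, ‖q ξ * fourierT φ (-ξ)‖ₑ ≤
      ∫⁻ ξ, (ENNReal.ofReal ((4 + ξ ^ 2) ^ (σ / 2)) * ‖q ξ‖ₑ) * ‖ψ (-ξ)‖ₑ := by
    refine lintegral_mono fun ξ => ?_
    rw [hψ', enorm_mul, enorm_mul, neg_sq, ← ofReal_norm (((4 + ξ ^ 2) ^ n : ℝ) : ℂ),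
      Complex.norm_real, Real.norm_of_nonneg (by positivity)]
    have h4 : (1 : ℝ) ≤ (4 + ξ ^ 2) ^ (σ / 2) * (4 + ξ ^ 2) ^ n := by
      rw [← Real.rpow_natCast (4 + ξ ^ 2) n, ← Real.rpow_add (by positivity)]
      exact Real.one_le_rpow (by nlinarith [sq_nonneg ξ]) (by linarith)
    calc ‖q ξ‖ₑ * ‖fourierT φ (-ξ)‖ₑ ≤ ENNReal.ofReal ((4 + ξ ^ 2) ^ (σ / 2) * (4 + ξ ^ 2) ^ n) *
          (‖q ξ‖ₑ * ‖fourierT φ (-ξ)‖ₑ) :=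
          le_mul_of_one_le_left' (by rwa [ENNReal.one_le_ofReal])
      _ = _ := by
          rw [ENNReal.ofReal_mul (by positivity)]
          ring
  have h2 := sq_lintegral_mul_le (μ := volume) (hd.mul hq.enorm).aemeasurable hψm.enorm.aemeasurable
  have h3 : ∫⁻ ξ, (ENNReal.ofReal ((4 + ξ ^ 2) ^ (σ / 2)) * ‖q ξ‖ₑ) ^ 2 < ⊤ := by
    refine lt_of_eq_of_lt (lintegral_congr fun ξ => ?_) ((isWeighted_sobolev σ).lintegral_lt_top q)
    rw [mul_pow, dens_one, ← ENNReal.ofReal_pow (by positivity), ← Real.rpow_natCast,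
      ← Real.rpow_mul (by positivity)]
    norm_num
  have h5 := h2.trans_lt (ENNReal.mul_lt_top h3 hfin)
  refine h1.trans_lt ?_
  by_contra hc
  rw [not_lt, top_le_iff] at hc
  simp only [Pi.mul_apply] at h5
  rw [hc] at h5
  simp at h5

lemma pair_congr {σ σ' : ℝ} {q : Hs σ} {q' : Hs σ'} (h : q =ᵐ[volume] q') (φ : 𝓢(ℝ, ℂ)) :
    pair q φ = pair q' φ := by
  refine integral_congr_ae ?_
  filter_upwards [h] with ξ hξ
  rw [hξ]

lemma coeFn_add_sob {σ : ℝ} (q q' : Hs σ) : ⇑(q + q') =ᵐ[volume] fun ξ => q ξ + q' ξ :=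
  (isWeighted_sobolev σ).ae_eq_iff.1 (Lp.coeFn_add q q')

lemma coeFn_smul_sob {σ : ℝ} (c : ℂ) (q : Hs σ) : ⇑(c • q) =ᵐ[volume] fun ξ => c * q ξ :=
  (isWeighted_sobolev σ).ae_eq_iff.1 (Lp.coeFn_smul c q)

lemma pair_add {σ : ℝ} (q q' : Hs σ) (φ : 𝓢(ℝ, ℂ)) : pair (q + q') φ = pair q φ + pair q' φ := by
  rw [pair, pair, pair, ← integral_add (integrable_pair q φ) (integrable_pair q' φ)]
  refine integral_congr_ae ?_
  filter_upwards [coeFn_add_sob q q'] with ξ h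
  rw [h, add_mul]

lemma pair_smul {σ : ℝ} (c : ℂ) (q : Hs σ) (φ : 𝓢(ℝ, ℂ)) : pair (c • q) φ = c * pair q φ := by
  rw [pair, pair, ← integral_const_mul]
  refine integral_congr_ae ?_
  filter_upwards [coeFn_smul_sob c q] with ξ h
  rw [h, _root_.mul_assoc]

lemma pair_sub {σ : ℝ} (q q' : Hs σ) (φ : 𝓢(ℝ, ℂ)) : pair (q - q') φ = pair q φ - pair q' φ := by
  have := pair_add q ((-1 : ℂ) • q') φ
  rw [pair_smul, neg_smul, one_smul, ← sub_eq_add_neg] at this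
  rw [this]
  ring

lemma pair_ext {σ : ℝ} {q q' : Hs σ} (h : ∀ φ, pair q φ = pair q' φ) : q = q' := by
  rw [← sub_eq_zero]
  refine Lp.ext ((isWeighted_sobolev σ).ae_eq_iff.2 ?_)
  refine (ae_eq_of_pair (isSob_locallyIntegrable (q - q')) fun φ => ?_).trans
    ((isWeighted_sobolev σ).ae_eq_iff.1 (Lp.coeFn_zero ℂ 2 (sobolevMeasure σ))).symm
  have := pair_sub q q' φ
  rw [h φ, sub_self] at this
  exact this

/-! ### The inclusion and the derivative as operators -/

lemma isL2Op_incl (σ : ℝ) :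
    IsL2Op ℂ (sobolevMeasure σ) (sobolevMeasure (σ - 1)) (fun f => f) 1 where
  congr f g h := (isWeighted_sobolev _).ae_eq_iff.2 ((isWeighted_sobolev _).ae_eq_iff.1 h)
  meas f := (Lp.stronglyMeasurable f).aestronglyMeasurable
  bound f := by
    rw [ENNReal.coe_one, one_mul, Lp.enorm_def]
    exact eLpNorm_mono_measure _ (sobolevMeasure_sub_one_le σ)
  add f g := .rfl
  smul c f := .rfl

/-- The inclusion `H^σ ⊆ H^(σ-1)` as an operator. -/
def inclL (σ : ℝ) : Hs σ →L[ℂ] Hs (σ - 1) := (isL2Op_incl σ).toCLM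

lemma coeFn_inclL {σ : ℝ} (q : Hs σ) : inclL σ q =ᵐ[volume] q :=
  (isWeighted_sobolev _).ae_eq_iff.1 ((isL2Op_incl σ).coeFn q)

lemma incl_eq {σ : ℝ} (q : Hs σ) : incl q = inclL σ q := by
  refine Lp.ext ((isWeighted_sobolev _).ae_eq_iff.2 (.trans ?_ (coeFn_inclL q).symm))
  exact (isWeighted_sobolev _).ae_eq_iff.1 (MemLp.coeFn_toLp _)

lemma inclL_injective (σ : ℝ) : Function.Injective (inclL σ) := fun q q' h => by
  refine Lp.ext ((isWeighted_sobolev _).ae_eq_iff.2 ((coeFn_inclL q).symm.trans ?_))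
  rw [h]
  exact coeFn_inclL q'

lemma isL2Op_dx (σ : ℝ) : IsL2Op ℂ (sobolevMeasure σ) (sobolevMeasure (σ - 1))
    (fun f ξ => Complex.I * ξ * f ξ) 1 where
  congr f g h := (isWeighted_sobolev _).ae_eq_iff.2 (by
    filter_upwards [(isWeighted_sobolev _).ae_eq_iff.1 h] with x hx
    rw [hx])
  meas f := (Measurable.aestronglyMeasurable (by fun_prop)).mul
    (Lp.stronglyMeasurable f).aestronglyMeasurable
  bound f := (isWeighted_sobolev _).eLpNorm_le (by
    rw [ENNReal.coe_one, one_mul, (isWeighted_sobolev σ).enorm_sq]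
    refine lintegral_mono fun ξ => ?_
    rw [dens_one, dens_one, enorm_mul, mul_pow, ← _root_.mul_assoc]
    refine mul_le_mul_left ?_ _
    rw [← ofReal_norm, norm_mul, Complex.norm_I, one_mul, Complex.norm_real, Real.norm_eq_abs,
      ← ENNReal.ofReal_pow (abs_nonneg _), sq_abs, ← ENNReal.ofReal_mul (by positivity)]
    refine ENNReal.ofReal_le_ofReal ?_
    rw [Real.rpow_sub_one (by positivity), div_mul_eq_mul_div, div_le_iff₀ (by positivity)]
    gcongr
    linarith)
  add f g := by
    refine .of_forall fun x => ?_
    simp only [Pi.add_apply]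
    ring
  smul c f := by
    refine .of_forall fun x => ?_
    simp only [Pi.smul_apply, smul_eq_mul]
    ring

/-- The derivative as an operator from `H^σ` to `H^(σ-1)`. -/
def dxL (σ : ℝ) : Hs σ →L[ℂ] Hs (σ - 1) := (isL2Op_dx σ).toCLM

lemma coeFn_dxL {σ : ℝ} (q : Hs σ) : dxL σ q =ᵐ[volume] fun ξ => Complex.I * ξ * q ξ :=
  (isWeighted_sobolev _).ae_eq_iff.1 ((isL2Op_dx σ).coeFn q)

lemma pair_dxL {σ : ℝ} (q : Hs σ) (φ : 𝓢(ℝ, ℂ)) :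
    pair (dxL σ q) φ = - pair q (SchwartzMap.derivCLM ℂ ℂ φ) := by
  rw [pair, pair, ← integral_neg]
  refine integral_congr_ae ?_
  filter_upwards [coeFn_dxL q] with ξ h
  rw [h, fourierT_deriv]
  push_cast
  ring

lemma inclL_shift {σ : ℝ} (b : ℝ) (q : Hs σ) :
    inclL σ (shift (sobolevMeasure σ) b q) = shift (sobolevMeasure (σ - 1)) b (inclL σ q) := by
  refine Lp.ext ((isWeighted_sobolev _).ae_eq_iff.2 ?_)
  filter_upwards [coeFn_inclL (shift (sobolevMeasure σ) b q), (isWeighted_sobolev σ).coeFn_shift b q,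
    (isWeighted_sobolev (σ - 1)).coeFn_shift b (inclL σ q), coeFn_inclL q] with ξ h1 h2 h3 h4
  rw [h1, h2, h3, h4]

lemma dxL_shift {σ : ℝ} (b : ℝ) (q : Hs σ) :
    dxL σ (shift (sobolevMeasure σ) b q) = shift (sobolevMeasure (σ - 1)) b (dxL σ q) := by
  refine Lp.ext ((isWeighted_sobolev _).ae_eq_iff.2 ?_)
  filter_upwards [coeFn_dxL (shift (sobolevMeasure σ) b q), (isWeighted_sobolev σ).coeFn_shift b q,
    (isWeighted_sobolev (σ - 1)).coeFn_shift b (dxL σ q), coeFn_dxL q] with ξ h1 h2 h3 h4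
  rw [h1, h2, h3, h4]
  ring

/-! ### Continuity and differentiability of translations -/

/-- Dominated convergence for multiplication operators. -/
lemma IsWeighted.tendsto_zero_of_dominated {μ : Measure ℝ} {ρ : ℝ → ℝ≥0∞} (h : IsWeighted μ ρ)
    {l : Filter ℝ} [l.IsCountablyGenerated] {f : ℝ → ℂ} (hf : Measurable f) {p : ℝ → ℝ → ℂ}
    (hp : ∀ t, Measurable (p t)) {F : ℝ → Lp ℂ 2 μ}
    (hF : ∀ t, F t =ᵐ[volume] fun ξ => p t ξ * f ξ) {G : ℝ → ℝ≥0∞} (hG : ∫⁻ ξ, G ξ < ⊤)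
    (hb : ∀ t ξ, ρ ξ * ‖p t ξ * f ξ‖ₑ ^ 2 ≤ G ξ) (hl : ∀ ξ, Tendsto (fun t => p t ξ) l (𝓝 0)) :
    Tendsto F l (𝓝 0) := by
  have hm := h.meas
  have h1 : Tendsto (fun t => ∫⁻ ξ, ρ ξ * ‖p t ξ * f ξ‖ₑ ^ 2) l (𝓝 (∫⁻ _ : ℝ, 0)) := by
    refine tendsto_lintegral_filter_of_dominated_convergence G ?_
      (.of_forall fun t => .of_forall fun ξ => hb t ξ) hG.ne (.of_forall fun ξ => ?_)
    · refine .of_forall fun t => ?_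
      have := hp t
      fun_prop
    · have h2 : Tendsto (fun t => p t ξ * f ξ) l (𝓝 0) := by
        simpa using (hl ξ).mul_const (f ξ)
      have h3 : Tendsto (fun t => ‖p t ξ * f ξ‖ₑ ^ 2) l (𝓝 0) := by
        have := ((ENNReal.continuous_pow 2).tendsto _).comp h2.enorm
        simp only [enorm_zero, ne_eq, OfNat.ofNat_ne_zero, not_false_eq_true, zero_pow] at this
        exact this
      simpa using ENNReal.Tendsto.const_mul h3 (Or.inr (h.ne_top ξ))
  rw [lintegral_zero] at h1
  have h4 : ∀ t, ‖F t‖ₑ ^ 2 = ∫⁻ ξ, ρ ξ * ‖p t ξ * f ξ‖ₑ ^ 2 := fun t => by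
    rw [h.enorm_sq]
    refine lintegral_congr_ae ?_
    filter_upwards [hF t] with ξ hξ
    rw [hξ]
  rw [tendsto_zero_iff_norm_tendsto_zero]
  have h5 : Tendsto (fun t => (‖F t‖ₑ ^ 2).toReal) l (𝓝 0) := by
    simp only [h4]
    have := (ENNReal.tendsto_toReal ENNReal.zero_ne_top).comp h1
    rwa [ENNReal.toReal_zero] at this
  have h6 : Tendsto (fun t => Real.sqrt ((‖F t‖ₑ ^ 2).toReal)) l (𝓝 0) := by
    have := (Real.continuous_sqrt.tendsto 0).comp h5
    rwa [Real.sqrt_zero] at this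
  refine h6.congr fun t => ?_
  rw [ENNReal.toReal_pow, toReal_enorm, Real.sqrt_sq (norm_nonneg _)]

lemma hasDerivAt_modul (b ξ : ℝ) :
    HasDerivAt (fun b => modul b ξ) (Complex.I * ξ * modul b ξ) b := by
  have h : HasDerivAt (fun b : ℝ => Complex.I * ((b * ξ : ℝ) : ℂ)) (Complex.I * ξ) b := by
    have := ((hasDerivAt_id b).mul_const ξ).ofReal_comp.const_mul Complex.I
    simpa using this
  refine h.cexp.congr_deriv ?_
  rw [modul]
  ring

lemma norm_modul_sub_le (b b' ξ : ℝ) : ‖modul b ξ - modul b' ξ‖ ≤ |b - b'| * |ξ| := by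
  have e : modul b ξ - modul b' ξ = modul b' ξ * (modul (b - b') ξ - 1) := by
    rw [mul_sub, ← modul_add, add_sub_cancel, mul_one]
  rw [e, norm_mul, norm_modul, one_mul, modul, ← abs_mul]
  exact Real.norm_exp_I_mul_ofReal_sub_one_le

lemma measurable_modul (b : ℝ) : Measurable (modul b) := (isMult_modul b).meas

lemma IsWeighted.continuous_shift {μ : Measure ℝ} {ρ : ℝ → ℝ≥0∞} (h : IsWeighted μ ρ)
    (f : Lp ℂ 2 μ) : Continuous fun b => shift μ b f := by
  rw [continuous_iff_continuousAt]
  intro b₀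
  rw [ContinuousAt, ← tendsto_sub_nhds_zero_iff]
  have hf : Measurable f := (Lp.stronglyMeasurable f).measurable
  refine h.tendsto_zero_of_dominated hf (p := fun b ξ => modul b ξ - modul b₀ ξ)
    (fun b => (measurable_modul b).sub (measurable_modul b₀)) (fun b => ?_)
    (G := fun ξ => 4 * (ρ ξ * ‖f ξ‖ₑ ^ 2)) ?_ (fun b ξ => ?_) fun ξ => ?_
  · filter_upwards [h.ae_eq_iff.1 (Lp.coeFn_sub (shift μ b f) (shift μ b₀ f)), h.coeFn_shift b f,
      h.coeFn_shift b₀ f] with ξ h1 h2 h3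
    rw [h1, Pi.sub_apply, h2, h3]
    ring
  · rw [lintegral_const_mul' _ _ (by simp)]
    exact ENNReal.mul_lt_top (by simp) (h.lintegral_lt_top f)
  · rw [enorm_mul, mul_pow, mul_left_comm]
    refine mul_le_mul_left ?_ _
    have h2 : ‖modul b ξ - modul b₀ ξ‖ₑ ≤ 2 := by
      rw [← ofReal_norm, ENNReal.ofReal_le_ofNat]
      refine (norm_sub_le _ _).trans ?_
      rw [norm_modul, norm_modul]
      norm_num
    calc ‖modul b ξ - modul b₀ ξ‖ₑ ^ 2 ≤ 2 ^ 2 := by gcongr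
      _ = 4 := by norm_num
  · have := (hasDerivAt_modul b₀ ξ).continuousAt.tendsto.sub_const (modul b₀ ξ)
    rwa [sub_self] at this

lemma IsWeighted.tendsto_shift {X : Type*} {μ : Measure ℝ}
    {ρ : ℝ → ℝ≥0∞} (h : IsWeighted μ ρ) {b : X → ℝ} {f : X → Lp ℂ 2 μ} {l : Filter X}
    {b₀ : ℝ} {f₀ : Lp ℂ 2 μ} (hb : Tendsto b l (𝓝 b₀)) (hf : Tendsto f l (𝓝 f₀)) :
    Tendsto (fun x => shift μ (b x) (f x)) l (𝓝 (shift μ b₀ f₀)) := by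
  have h1 : Tendsto (fun x => shift μ (b x) f₀) l (𝓝 (shift μ b₀ f₀)) :=
    ((h.continuous_shift f₀).tendsto b₀).comp hb
  have h2 : Tendsto (fun x => shift μ (b x) (f x) - shift μ (b x) f₀) l (𝓝 0) := by
    refine squeeze_zero_norm (fun x => ?_) (tendsto_iff_norm_sub_tendsto_zero.1 hf)
    rw [← map_sub]
    exact norm_shift_le _ _
  simpa using h2.add h1

lemma hasDerivAt_shift {σ : ℝ} (q : Hs σ) (b₀ : ℝ) :
    HasDerivAt (fun b => shift (sobolevMeasure (σ - 1)) b (inclL σ q))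
      (shift (sobolevMeasure (σ - 1)) b₀ (dxL σ q)) b₀ := by
  have h := isWeighted_sobolev (σ - 1)
  set μ := sobolevMeasure (σ - 1)
  rw [hasDerivAt_iff_tendsto_slope, ← tendsto_sub_nhds_zero_iff]
  have hf : Measurable q := (Lp.stronglyMeasurable q).measurable
  refine h.tendsto_zero_of_dominated hf
    (p := fun b ξ => slope (fun b => modul b ξ) b₀ b - Complex.I * ξ * modul b₀ ξ)
    (fun b => ?_) (fun b => ?_) (G := fun ξ => 4 * (dens σ (fun _ => 1) ξ * ‖q ξ‖ₑ ^ 2)) ?_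
    (fun b ξ => ?_) fun ξ => ?_
  · have h1 := measurable_modul b
    have h2 := measurable_modul b₀
    simp only [slope, vsub_eq_sub]
    fun_prop
  · simp only [slope, vsub_eq_sub, Complex.real_smul]
    filter_upwards [h.ae_eq_iff.1 (Lp.coeFn_sub (((b - b₀)⁻¹ : ℝ) • (shift μ b (inclL σ q) -
      shift μ b₀ (inclL σ q))) (shift μ b₀ (dxL σ q))),
      h.ae_eq_iff.1 (Lp.coeFn_smul ((b - b₀)⁻¹ : ℝ) (shift μ b (inclL σ q) -
        shift μ b₀ (inclL σ q))),
      h.ae_eq_iff.1 (Lp.coeFn_sub (shift μ b (inclL σ q)) (shift μ b₀ (inclL σ q))),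
      h.coeFn_shift b (inclL σ q), h.coeFn_shift b₀ (inclL σ q), h.coeFn_shift b₀ (dxL σ q),
      coeFn_inclL q, coeFn_dxL q] with ξ h1 h2 h3 h4 h5 h6 h7 h8
    rw [h1, Pi.sub_apply, h2, Pi.smul_apply, h3, Pi.sub_apply, h4, h5, h6, h7, h8, Complex.real_smul]
    ring
  · rw [lintegral_const_mul' _ _ (by simp)]
    exact ENNReal.mul_lt_top (by simp) ((isWeighted_sobolev σ).lintegral_lt_top q)
  · have h1 : ‖slope (fun b => modul b ξ) b₀ b - Complex.I * ξ * modul b₀ ξ‖ ≤ 2 * |ξ| := by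
      refine (norm_sub_le _ _).trans ?_
      rw [norm_mul, norm_mul, norm_modul, Complex.norm_I, Complex.norm_real, Real.norm_eq_abs,
        one_mul, mul_one, two_mul]
      refine add_le_add ?_ le_rfl
      simp only [slope, vsub_eq_sub]
      rw [norm_smul, norm_inv, Real.norm_eq_abs]
      rcases eq_or_ne b b₀ with rfl | hne
      · simp
      · rw [inv_mul_le_iff₀ (abs_pos.2 (sub_ne_zero.2 hne))]
        exact norm_modul_sub_le b b₀ ξ
    rw [enorm_mul, mul_pow, ← _root_.mul_assoc, ← _root_.mul_assoc]
    refine mul_le_mul_left ?_ _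
    rw [dens_one, dens_one, ← ofReal_norm, ← ENNReal.ofReal_pow (norm_nonneg _),
      ← ENNReal.ofReal_mul (by positivity), show (4 : ℝ≥0∞) = ENNReal.ofReal 4 by simp,
      ← ENNReal.ofReal_mul (by norm_num)]
    refine ENNReal.ofReal_le_ofReal ?_
    rw [Real.rpow_sub_one (by positivity), div_mul_eq_mul_div, div_le_iff₀ (by positivity)]
    have h2 : ‖slope (fun b => modul b ξ) b₀ b - Complex.I * ξ * modul b₀ ξ‖ ^ 2 ≤ 4 * ξ ^ 2 := by
      calc _ ≤ (2 * |ξ|) ^ 2 := by gcongr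
        _ = 4 * ξ ^ 2 := by rw [mul_pow, sq_abs]; norm_num
    have h3 : (0 : ℝ) < (4 + ξ ^ 2) ^ σ := by positivity
    nlinarith
  · have h1 := (hasDerivAt_iff_tendsto_slope.1 (hasDerivAt_modul b₀ ξ)).sub_const
      (Complex.I * ξ * modul b₀ ξ)
    rwa [sub_self] at h1

/-- Differentiation of a curve in a moving frame. -/
lemma hasDerivAt_shift_comp {σ : ℝ} (b : ℝ) {Q : ℝ → Hs (σ - 1)} {Q' : Hs (σ - 1)} {t : ℝ}
    (hQ : HasDerivAt Q Q' t) {q : Hs σ} (hq : Q t = inclL σ q) :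
    HasDerivAt (fun τ => shift (sobolevMeasure (σ - 1)) (b * τ) (Q τ))
      (shift (sobolevMeasure (σ - 1)) (b * t) (Q' + (b : ℂ) • dxL σ q)) t := by
  have h := isWeighted_sobolev (σ - 1)
  set μ := sobolevMeasure (σ - 1)
  have h1 : HasDerivAt (fun τ => shift μ (b * τ) (Q t)) (b • shift μ (b * t) (dxL σ q)) t := by
    rw [hq]
    have hb : HasDerivAt (fun τ : ℝ => b * τ) b t := by
      simpa using (hasDerivAt_id t).const_mul b
    exact (hasDerivAt_shift q (b * t)).scomp t hb
  have h2 : HasDerivAt (fun τ => shift μ (b * τ) (Q τ - Q t)) (shift μ (b * t) Q') t := by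
    rw [hasDerivAt_iff_tendsto_slope] at hQ ⊢
    have hb : Tendsto (fun τ : ℝ => b * τ) (𝓝[≠] t) (𝓝 (b * t)) :=
      ((continuous_const.mul continuous_id).tendsto t).mono_left nhdsWithin_le_nhds
    have := h.tendsto_shift hb hQ
    refine this.congr fun τ => ?_
    simp only [slope, vsub_eq_sub, sub_self, map_zero, sub_zero]
    exact (shift μ (b * τ)).map_smul_of_tower _ _
  refine ((h1.add h2).congr_deriv ?_).congr_of_eventuallyEq (.of_forall fun τ => ?_)
  · rw [map_add, map_smul, Complex.coe_smul]
    exact add_comm _ _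
  · simp only [Pi.add_apply, map_sub, add_sub_cancel]
    rfl

/-- If a curve is differentiable in a larger space and its derivative there is a continuous curve in
the original space, then it is differentiable. -/
lemma hasDerivAt_of_injective {E E' : Type*} [NormedAddCommGroup E] [NormedSpace ℝ E]
    [CompleteSpace E] [NormedAddCommGroup E'] [NormedSpace ℝ E'] {L : E →L[ℝ] E'}
    (hL : Function.Injective L) {u g : ℝ → E} {I : Set ℝ} (hI : IsOpen I) (hI' : I.OrdConnected)
    (hg : ContinuousOn g I) (hu : ∀ t ∈ I, HasDerivAt (fun τ => L (u τ)) (L (g t)) t) {t : ℝ}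
    (ht : t ∈ I) : HasDerivAt u (g t) t := by
  have hy : ∀ τ ∈ I, HasDerivAt (fun τ => ∫ x in t..τ, g x) (g τ) τ := by
    intro τ hτ
    have hsub : uIcc t τ ⊆ I := hI'.uIcc_subset ht hτ
    exact intervalIntegral.integral_hasDerivAt_right ((hg.mono hsub).intervalIntegrable)
      (hg.stronglyMeasurableAtFilter hI τ hτ) (hg.continuousAt (hI.mem_nhds hτ))
  have hz : ∀ τ ∈ I, u τ = u t + ∫ x in t..τ, g x := by
    intro τ hτ
    refine hL ?_
    have hsub : uIcc t τ ⊆ I := hI'.uIcc_subset ht hτ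
    refine eq_of_deriv_eq (K := 0) (fun σ hσ => hu σ (hsub hσ)) (fun σ hσ =>
      L.hasFDerivAt.comp_hasDerivAt σ ((hy σ (hsub hσ)).const_add (u t))) (fun σ _ => by simp)
      (by simp)
  refine ((hy t ht).const_add (u t)).congr_of_eventuallyEq ?_
  filter_upwards [hI.mem_nhds ht] with τ hτ using hz τ hτ

end

end AKNS

namespace AKNS

noncomputable section

open scoped ENNReal NNReal
open Filter Topology

/-! ### Well-posedness -/

section

variable {s : ℝ} (hs : s ∈ Ioo (-(1 / 2) : ℝ) 0)

lemma pair_field {ε : ℤˣ} {κ : ℝ} (hκ : 1 ≤ κ) (c : ℂ) (d : ℝ) {q : Hs s} (hq : ‖q‖ ≤ rad s)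
    (φ : 𝓢(ℝ, ℂ)) :
    pair ((isSob_sobolev hs).field ε κ c d q) φ = c * (∫ x : ℝ, g12 ε κ q x * φ x) +
      conj c * (∫ x : ℝ, g12 ε (-κ) q x * φ x) + Complex.I * d * pair q φ := by
  have S := isSob_sobolev hs
  have hJ := (S.norm_J_le ε q).trans hq
  have hpos : 0 < κ := by linarith
  have hκ1 : 1 ≤ |κ| := hκ.trans (le_abs_self κ)
  rw [IsSob.field, pair_add, pair_sub, pair_smul, pair_smul, pair_smul,
    S.integral_g12 hκ1 .rfl (ae_rHat S .rfl) hq hJ φ.integrable,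
    S.integral_g12 (by rwa [abs_neg]) .rfl (ae_rHat S .rfl) hq hJ φ.integrable,
    Real.sign_neg, Real.sign_of_pos hpos]
  simp only [pair]
  push_cast
  ring

include hs in
lemma integrable_g12_mul {ε : ℤˣ} {κ : ℝ} (hκ : 1 ≤ |κ|) {q : Hs s} (hq : ‖q‖ ≤ rad s)
    (φ : 𝓢(ℝ, ℂ)) : Integrable fun x => g12 ε κ q x * φ x := by
  have S := isSob_sobolev hs
  exact S.integrable_g12 hκ .rfl (ae_rHat S .rfl) hq ((S.norm_J_le ε q).trans hq) φ.integrable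

lemma pair_field_nls {ε : ℤˣ} {κ : ℝ} (hκ : 1 ≤ κ) {q : Hs s} (hq : ‖q‖ ≤ rad s) (φ : 𝓢(ℝ, ℂ)) :
    Complex.I * pair ((isSob_sobolev hs).field ε κ (-4 * Complex.I * (κ : ℂ) ^ 3) (-4 * κ ^ 2) q) φ =
      4 * (κ : ℂ) ^ 3 * (∫ x : ℝ, (g12 ε κ q x - g12 ε (-κ) q x) * φ x)
        + 4 * (κ : ℂ) ^ 2 * pair q φ := by
  have hκ1 : 1 ≤ |κ| := hκ.trans (le_abs_self κ)
  have hc : conj (-4 * Complex.I * (κ : ℂ) ^ 3) = 4 * Complex.I * (κ : ℂ) ^ 3 := by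
    simp only [map_mul, map_neg, map_pow, Complex.conj_ofReal, Complex.conj_I, map_ofNat]
    ring
  simp only [sub_mul]
  rw [pair_field hs hκ _ _ hq, integral_sub (integrable_g12_mul hs hκ1 hq φ)
    (integrable_g12_mul hs (by rwa [abs_neg]) hq φ), hc]
  push_cast
  linear_combination (4 * (κ : ℂ) ^ 3 * ((∫ x : ℝ, g12 ε (-κ) q x * φ x) -
    ∫ x : ℝ, g12 ε κ q x * φ x) - 4 * (κ : ℂ) ^ 2 * pair q φ) * Complex.I_sq

lemma pair_field_mkdv {ε : ℤˣ} {κ : ℝ} (hκ : 1 ≤ κ) {q : Hs s} (hq : ‖q‖ ≤ rad s) (φ : 𝓢(ℝ, ℂ)) :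
    pair (inclL s ((isSob_sobolev hs).field ε κ (8 * (κ : ℂ) ^ 4) 0 q) +
      ((4 * κ ^ 2 : ℝ) : ℂ) • dxL s q) φ =
      8 * (κ : ℂ) ^ 4 * (∫ x : ℝ, (g12 ε κ q x + g12 ε (-κ) q x) * φ x)
        - 4 * (κ : ℂ) ^ 2 * pair q (SchwartzMap.derivCLM ℂ ℂ φ) := by
  have hκ1 : 1 ≤ |κ| := hκ.trans (le_abs_self κ)
  have hc : conj (8 * (κ : ℂ) ^ 4) = 8 * (κ : ℂ) ^ 4 := by
    simp only [map_mul, map_pow, Complex.conj_ofReal, map_ofNat]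
  simp only [add_mul]
  rw [pair_add, pair_smul, pair_dxL, pair_congr (coeFn_inclL _), pair_field hs hκ _ _ hq,
    integral_add (integrable_g12_mul hs hκ1 hq φ)
    (integrable_g12_mul hs (by rwa [abs_neg]) hq φ), hc]
  push_cast
  ring

/-- Two solutions of an equation with a vector field that is Lipschitz in a ball agree, as long as
the first one stays in the interior of this ball. -/
lemma eqOn_of_lipschitzOnWith {E : Type*} [NormedAddCommGroup E] [NormedSpace ℝ E] {F : E → E}
    {K : ℝ≥0} {R : ℝ} (hF : LipschitzOnWith K F (Metric.closedBall 0 R)) {J : Set ℝ}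
    (hJ : IsOpen J) (hJ' : J.OrdConnected) {t₀ : ℝ} (ht₀ : t₀ ∈ J) {u v : ℝ → E}
    (hu : ContinuousOn u J) (hv : ContinuousOn v J) (hR : ∀ t ∈ J, ‖u t‖ < R)
    (hdu : ∀ t ∈ J, HasDerivAt u (F (u t)) t)
    (hdv : ∀ I ⊆ J, IsOpen I → I.OrdConnected → (∀ t ∈ I, ‖v t‖ < R) →
      ∀ t ∈ I, HasDerivAt v (F (v t)) t)
    (h0 : u t₀ = v t₀) : EqOn u v J := by
  refine eqOn_of_local hJ hJ'.isPreconnected ht₀ hu hv h0 fun t ht htuv => ?_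
  have h1 : ∀ᶠ τ in 𝓝 t, τ ∈ J ∧ ‖v τ‖ < R :=
    Filter.Eventually.and (hJ.mem_nhds ht) ((hv.continuousAt (hJ.mem_nhds ht)).norm.eventually_lt_const
      (show ‖v t‖ < R from htuv ▸ hR t ht))
  obtain ⟨η, hη, hball⟩ := Metric.mem_nhds_iff.1 h1
  have hord : (Metric.ball t η).OrdConnected := (convex_ball t η).ordConnected
  have hdv' := hdv _ (fun τ hτ => (hball hτ).1) Metric.isOpen_ball hord fun τ hτ => (hball hτ).2
  filter_upwards [Metric.ball_mem_nhds t hη] with τ hτ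
  have hsub : uIcc t τ ⊆ Metric.ball t η := hord.uIcc_subset (Metric.mem_ball_self hη) hτ
  refine eq_of_deriv_eq (K := K) (fun σ hσ => hdu σ (hball (hsub hσ)).1)
    (fun σ hσ => hdv' σ (hsub hσ)) (fun σ hσ => ?_) htuv
  have := hF.dist_le_mul (u σ) (mem_closedBall_zero_iff.2 (hR σ (hball (hsub hσ)).1).le) (v σ)
    (mem_closedBall_zero_iff.2 (hball (hsub hσ)).2.le)
  rwa [dist_eq_norm, dist_eq_norm] at this

lemma IsWeighted.continuousOn_shift {X : Type*} [TopologicalSpace X] {μ : Measure ℝ}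
    {ρ : ℝ → ℝ≥0∞} (h : IsWeighted μ ρ) {b : X → ℝ} {f : X → Lp ℂ 2 μ} {A : Set X}
    (hb : ContinuousOn b A) (hf : ContinuousOn f A) :
    ContinuousOn (fun x => shift μ (b x) (f x)) A :=
  fun x hx => h.tendsto_shift (hb x hx) (hf x hx)

lemma hasDerivAt_inclL {q : ℝ → Hs s} {q' : Hs s} {t : ℝ} (h : HasDerivAt q q' t) :
    HasDerivAt (fun t => inclL s (q t)) (inclL s q') t :=
  ((inclL s).restrictScalars ℝ).hasFDerivAt.comp_hasDerivAt t h

/-- A continuous flow of small solutions of the autonomous equation. -/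
structure IsSmallFlow {μ : Measure ℝ} (F : Lp ℂ 2 μ → Lp ℂ 2 μ) (R δ : ℝ)
    (φ : ℝ → Lp ℂ 2 μ → Lp ℂ 2 μ) : Prop where
  zero : ∀ q, φ 0 q = q
  continuous : Continuous fun p : ℝ × Lp ℂ 2 μ => φ p.1 p.2
  norm_lt : ∀ q, ‖q‖ ≤ δ → ∀ t, ‖φ t q‖ < R
  hasDerivAt : ∀ q, ‖q‖ ≤ δ → ∀ t, HasDerivAt (fun t => φ t q) (F (φ t q)) t

variable {R K : ℝ} (hR0 : 0 < R) (hR : R < rad s) (hK : 1 ≤ K)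
    (hRK : ∀ (ε : ℤˣ) (w w₀ : Hs s), ‖w‖ ≤ R → ‖w₀‖ ≤ R →
      (∀ n : ℕ, alpha ε (2 ^ n) w = alpha ε (2 ^ n) w₀) → ‖w‖ ≤ K * ‖w₀‖) (ε : ℤˣ) {κ : ℝ}
    (hκ : 1 ≤ κ)

include hR0 hR hK hRK hκ

/-- The flow of `field` for small data. -/
lemma exists_flow (c : ℂ) (d : ℝ) :
    ∃ φ : ℝ → Hs s → Hs s, IsSmallFlow ((isSob_sobolev hs).field ε κ c d) R (R / (2 * K)) φ ∧
      ∀ q, ‖q‖ ≤ R / (2 * K) → ∀ t, ∀ ϰ : ℝ, 1 ≤ ϰ → alpha ε ϰ (φ t q) = alpha ε ϰ q := by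
  have S := isSob_sobolev hs
  obtain ⟨φ, h0, hd, hc⟩ := exists_truncated_flow hR0.le (S.lipschitzOnWith_field ε κ c d hR.le)
  suffices h : ∀ q, ‖q‖ ≤ R / (2 * K) → ∀ t, ‖φ t q‖ < R ∧
      HasDerivAt (fun t => φ t q) ((isSob_sobolev hs).field ε κ c d (φ t q)) t ∧
        ∀ ϰ : ℝ, 1 ≤ ϰ → alpha ε ϰ (φ t q) = alpha ε ϰ q from
    ⟨φ, ⟨h0, hc, fun q hq t => (h q hq t).1, fun q hq t => (h q hq t).2.1⟩,
      fun q hq t => (h q hq t).2.2⟩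
  intro q hq t
  have hK0 : 0 < K := by linarith
  have hKq : K * ‖q‖ < R := by
    rw [le_div_iff₀ (by positivity)] at hq
    nlinarith
  obtain ⟨h1, h2⟩ := flow_bounds hs hR0 hR hK hRK ε hκ c d (u := fun t => φ t q) (hd q)
    (by simpa only [h0] using hKq) t
  simp only [h0] at h1 h2
  have h3 : ‖φ t q‖ < R := h1.trans_lt hKq
  refine ⟨h3, ?_, h2⟩
  have := hd q t
  rwa [radial_of_le h3.le] at this

end

section

variable {s : ℝ} (hs : s ∈ Ioo (-(1 / 2) : ℝ) 0) {ε : ℤˣ} {κ : ℝ} (hκ : 1 ≤ κ) {R δ : ℝ}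
  (hR : R < rad s) {φ : ℝ → Hs s → Hs s}

include hκ hR

lemma isGlobalSolutionMap_nls (hφ : IsSmallFlow
    ((isSob_sobolev hs).field ε κ (-4 * Complex.I * (κ : ℂ) ^ 3) (-4 * κ ^ 2)) R δ φ) :
    IsGlobalSolutionMap (IsNLSSolution ε κ) {q : Hs s | ‖q‖ ≤ δ} φ where
  initial q _ := hφ.zero q
  solves q hq := ⟨fun t _ => (hφ.hasDerivAt q hq t).continuousAt.continuousWithinAt,
    fun t _ => ⟨_, hφ.hasDerivAt q hq t,
      fun f => pair_field_nls hs hκ ((hφ.norm_lt q hq t).le.trans hR.le) f⟩⟩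
  continuous := hφ.continuous.continuousOn
  unique q hq J hJ hJ' h0 v hv hv0 t ht := by
    refine (eqOn_of_lipschitzOnWith ((isSob_sobolev hs).lipschitzOnWith_field ε κ _ _ hR.le) hJ hJ'
      h0 (u := fun t => φ t q)
      (fun t _ => (hφ.hasDerivAt q hq t).continuousAt.continuousWithinAt) hv.1
      (fun t _ => hφ.norm_lt q hq t) (fun t _ => hφ.hasDerivAt q hq t) ?_
      ((hφ.zero q).trans hv0.symm) ht).symm
    intro I hI _ _ hvR t ht
    obtain ⟨w, hw, hwp⟩ := hv.2 t (hI ht)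
    refine hw.congr_deriv (pair_ext fun f => mul_left_cancel₀ Complex.I_ne_zero ?_)
    rw [hwp f, pair_field_nls hs hκ ((hvR t ht).le.trans hR.le)]

lemma isGlobalSolutionMap_mkdv (hφ : IsSmallFlow
    ((isSob_sobolev hs).field ε κ (8 * (κ : ℂ) ^ 4) 0) R δ φ) :
    IsGlobalSolutionMap (IsMKdVSolution ε κ) {q : Hs s | ‖q‖ ≤ δ}
      (fun t q => shift (sobolevMeasure s) (4 * κ ^ 2 * t) (φ t q)) where
  initial q _ := by rw [mul_zero, (isWeighted_sobolev s).shift_zero, hφ.zero]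
  solves q hq := by
    have h1 : Continuous fun t : ℝ => 4 * κ ^ 2 * t := by fun_prop
    have h2 : Continuous fun t : ℝ => φ t q := hφ.continuous.comp (.prodMk_left q)
    refine ⟨(isWeighted_sobolev s).continuousOn_shift h1.continuousOn h2.continuousOn, fun t _ => ?_⟩
    have hn := (hφ.norm_lt q hq t).le.trans hR.le
    have hn' := (norm_shift_le (4 * κ ^ 2 * t) (φ t q)).trans hn
    have h2 := hasDerivAt_shift_comp (4 * κ ^ 2) (hasDerivAt_inclL (hφ.hasDerivAt q hq t)) rfl
    refine ⟨_, h2.congr_of_eventuallyEq (.of_forall fun τ => ?_), fun f => ?_⟩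
    · simp only [incl_eq, inclL_shift]
    rw [← pair_field_mkdv hs hκ hn', IsSob.field_shift _ _ _ _ _ _ hn, map_add, map_smul,
      inclL_shift, dxL_shift]
  continuous := by
    have h1 : Continuous fun p : ℝ × Hs s => 4 * κ ^ 2 * p.1 := by fun_prop
    exact (isWeighted_sobolev s).continuousOn_shift h1.continuousOn hφ.continuous.continuousOn
  unique q hq J hJ hJ' h0 v hv hv0 t ht := by
    have hw := isWeighted_sobolev s
    have h1 : Continuous fun t : ℝ => -(4 * κ ^ 2) * t := by fun_prop
    have hcv := hw.continuousOn_shift h1.continuousOn hv.1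
    have key := eqOn_of_lipschitzOnWith
      ((isSob_sobolev hs).lipschitzOnWith_field ε κ (8 * (κ : ℂ) ^ 4) 0 hR.le) hJ hJ'
      h0 (u := fun t => φ t q) (v := fun t => shift (sobolevMeasure s) (-(4 * κ ^ 2) * t) (v t))
      (fun t _ => (hφ.hasDerivAt q hq t).continuousAt.continuousWithinAt) hcv
      (fun t _ => hφ.norm_lt q hq t) (fun t _ => hφ.hasDerivAt q hq t) ?_
      (by rw [hφ.zero, mul_zero, hw.shift_zero, hv0]) ht
    · simp only at key
      rw [key, hw.shift_shift, neg_mul, add_neg_cancel, hw.shift_zero]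
    intro I hI hIo hIc hvR
    refine fun t ht => hasDerivAt_of_injective (L := (inclL s).restrictScalars ℝ)
      (g := fun t => (isSob_sobolev hs).field ε κ (8 * (κ : ℂ) ^ 4) 0
        (shift (sobolevMeasure s) (-(4 * κ ^ 2) * t) (v t))) (inclL_injective s) hIo hIc ?_ ?_ ht
    · exact ((isSob_sobolev hs).lipschitzOnWith_field ε κ (8 * (κ : ℂ) ^ 4) 0
        hR.le).continuousOn.comp (hcv.mono hI) fun t ht => mem_closedBall_zero_iff.2 (hvR t ht).le
    intro t ht
    have hn := hvR t ht
    rw [hw.norm_shift] at hn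
    replace hn := hn.le.trans hR.le
    obtain ⟨w, hwd, hwp⟩ := hv.2 t (hI ht)
    have hwe : w = inclL s ((isSob_sobolev hs).field ε κ (8 * (κ : ℂ) ^ 4) 0 (v t)) +
        ((4 * κ ^ 2 : ℝ) : ℂ) • dxL s (v t) :=
      pair_ext fun f => by rw [hwp f, pair_field_mkdv hs hκ hn]
    have h2 := hasDerivAt_shift_comp (-(4 * κ ^ 2)) hwd (incl_eq (v t))
    simp only [incl_eq, ← inclL_shift] at h2
    refine h2.congr_deriv ?_
    rw [IsSob.field_shift _ _ _ _ _ _ hn, hwe]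
    push_cast
    rw [neg_smul, add_neg_cancel_right, ← inclL_shift]
    rfl

end

end

end AKNS

namespace AKNS

noncomputable section

open scoped ENNReal NNReal
open Filter Topology

/-! ### Translations of the frequency variable -/

lemma ae_add_fst {p : ℝ × ℝ → Prop} (b : ℝ) (h : ∀ᵐ q, p q) : ∀ᵐ q : ℝ × ℝ, p (q.1 + b, q.2) := by
  have h1 : MeasurePreserving (fun q : ℝ × ℝ => (q.1 + b, q.2)) :=
    (measurePreserving_add_right (volume : Measure ℝ) b).prod (MeasurePreserving.id volume)
  exact h1.quasiMeasurePreserving.ae h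

lemma ae_add {p : ℝ → Prop} (b : ℝ) (h : ∀ᵐ x, p x) : ∀ᵐ x : ℝ, p (x + b) :=
  (measurePreserving_add_right (volume : Measure ℝ) b).quasiMeasurePreserving.ae h

/-- The norm bound of translations. -/
def tlConst (ω : ℝ → ℝ) (b : ℝ) : ℝ≥0 := Real.toNNReal (ω b * (2 * (1 + b ^ 2)))

lemma dens_le_tl {s : ℝ} (hs : s ∈ Ioo (-(1 / 2) : ℝ) 0) {ω : ℝ → ℝ} (hω : IsFreqWeight ω) (b ξ : ℝ) :
    dens s ω ξ ≤ (tlConst ω b : ℝ≥0∞) ^ 2 * dens s ω (ξ + b) := by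
  have hb := zero_le_one.trans (hω.one_le b)
  have h0 := zero_le_one.trans (hω.one_le ξ)
  have h1 : ω ξ ≤ ω b * ω (ξ + b) := by
    have := hω.submul (-b) (ξ + b)
    rwa [hω.even, neg_add_cancel_comm_assoc] at this
  have h2 : (4 + ξ ^ 2) ^ s ≤ (2 * (1 + b ^ 2)) ^ 2 * (4 + (ξ + b) ^ 2) ^ s := by
    have h3 : 4 + (ξ + b) ^ 2 ≤ 2 * (1 + b ^ 2) * (4 + ξ ^ 2) := by
      nlinarith [sq_nonneg (ξ - b), sq_nonneg (b * ξ), sq_nonneg b, sq_nonneg ξ]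
    have h4 := Real.rpow_le_rpow_of_nonpos (by positivity) h3 hs.2.le
    rw [Real.mul_rpow (by positivity) (by positivity)] at h4
    have h5 : (1 : ℝ) ≤ (2 * (1 + b ^ 2)) ^ 2 * (2 * (1 + b ^ 2)) ^ s := by
      rw [← Real.rpow_natCast (2 * (1 + b ^ 2)) 2, ← Real.rpow_add (by positivity)]
      refine Real.one_le_rpow (by nlinarith [sq_nonneg b]) ?_
      have := hs.1
      push_cast
      linarith
    have h6 : (0 : ℝ) < (4 + ξ ^ 2) ^ s := by positivity
    calc (4 + ξ ^ 2) ^ s ≤ (2 * (1 + b ^ 2)) ^ 2 * (2 * (1 + b ^ 2)) ^ s * (4 + ξ ^ 2) ^ s :=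
          le_mul_of_one_le_left h6.le h5
      _ ≤ _ := by rw [_root_.mul_assoc]; gcongr
  have h0' := zero_le_one.trans (hω.one_le (ξ + b))
  rw [dens, dens, tlConst, ← ENNReal.ofReal, ← ENNReal.ofReal_pow h0, ← ENNReal.ofReal_mul (by positivity),
    ← ENNReal.ofReal_pow (by positivity), ← ENNReal.ofReal_pow h0', ← ENNReal.ofReal_mul (by positivity),
    ← ENNReal.ofReal_mul (by positivity)]
  refine ENNReal.ofReal_le_ofReal ?_
  calc ω ξ ^ 2 * (4 + ξ ^ 2) ^ s ≤ (ω b * ω (ξ + b)) ^ 2 *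
        ((2 * (1 + b ^ 2)) ^ 2 * (4 + (ξ + b) ^ 2) ^ s) := by gcongr
    _ = _ := by ring

namespace IsSob

variable {s : ℝ} {ω : ℝ → ℝ} {μ : Measure ℝ} (S : IsSob s ω μ)

include S in
lemma isL2Op_tl (b : ℝ) : IsL2Op ℂ μ μ (fun f ξ => f (ξ + b)) (tlConst ω b) where
  congr f g h := S.hμ.ae_eq_iff.2 (ae_add b (S.hμ.ae_eq_iff.1 h))
  meas f := S.hμ.aesm
    ((Lp.stronglyMeasurable f).comp_measurable (measurable_add_const b)).aestronglyMeasurable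
  bound f := S.hμ.eLpNorm_le (by
    rw [mul_pow, S.hμ.enorm_sq, ← lintegral_add_right_eq_self (fun ξ => dens s ω ξ * ‖f ξ‖ₑ ^ 2) b,
      ← lintegral_const_mul' _ _ (by simp)]
    refine lintegral_mono fun ξ => ?_
    rw [← _root_.mul_assoc]
    exact mul_le_mul_left (dens_le_tl S.hs S.hω b ξ) _)
  add f g := .rfl
  smul c f := .rfl

/-- Translation of the frequency variable. -/
def tl (b : ℝ) : Lp ℂ 2 μ →L[ℂ] Lp ℂ 2 μ := (S.isL2Op_tl b).toCLM

lemma coeFn_tl (b : ℝ) (f : Lp ℂ 2 μ) : S.tl b f =ᵐ[volume] fun ξ => f (ξ + b) :=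
  S.hμ.ae_eq_iff.1 ((S.isL2Op_tl b).coeFn f)

/-- The first difference. -/
def dif (b : ℝ) : Lp ℂ 2 μ →L[ℂ] Lp ℂ 2 μ := S.tl b - ContinuousLinearMap.id ℂ _

lemma dif_apply (b : ℝ) (f : Lp ℂ 2 μ) : S.dif b f = S.tl b f - f := rfl

/-- The kernels `X'` arises from `X` by translation of the first frequency variable, up to the
normalizing weights. -/
def _root_.AKNS.TRel (b : ℝ) (X X' : ℝ × ℝ → ℂ) : Prop :=
  ∀ᵐ q : ℝ × ℝ, (jp (-(1 / 4)) q.1 : ℂ) * X' q = jp (-(1 / 4)) (q.1 + b) * X (q.1 + b, q.2)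

variable {b : ℝ} {X X' : Lp ℂ 2 (kmeas (kw (tex s) ω))}

include S in
lemma tRel_rmul (h : TRel b X X') {p : ℝ → ℂ} {C : ℝ≥0} (hp : IsMult p C) :
    TRel b (rmul _ hp X) (rmul _ hp X') := by
  filter_upwards [h, coeFn_rmul S.isKW hp X', ae_add_fst b (coeFn_rmul S.isKW hp X)] with q h1 h2 h3
  rw [h2, h3, mul_left_comm, h1]
  ring

lemma tRel_mul (h : TRel b X X') (V : Lp ℂ 2 (kmeas (kw (tex s) ω))) :
    TRel b (S.isKW.mul X V) (S.isKW.mul X' V) := by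
  filter_upwards [ae_sections h, S.isKW.coeFn_mul X' V, ae_add_fst b (S.isKW.coeFn_mul X V)]
    with q h1 h2 h3
  rw [h2, h3, kcomp, kcomp, ← integral_const_mul, ← integral_const_mul]
  refine integral_congr_ae ?_
  filter_upwards [h1.1] with ζ hζ
  rw [← _root_.mul_assoc, hζ, _root_.mul_assoc]

include S in
lemma tRel_add {Y Y' : Lp ℂ 2 (kmeas (kw (tex s) ω))} (h : TRel b X X') (h' : TRel b Y Y') :
    TRel b ⇑(X + Y) ⇑(X' + Y') := by
  filter_upwards [h, h', S.isKW.coeFn_add_vol X' Y', ae_add_fst b (S.isKW.coeFn_add_vol X Y)]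
    with q h1 h2 h3 h4
  rw [h3, h4, Pi.add_apply, Pi.add_apply, mul_add, mul_add, h1, h2]

lemma tl_D (h : TRel b X X') : S.tl b (S.D X) = S.D X' := by
  refine Lp.ext (S.hμ.ae_eq_iff.2 ?_)
  filter_upwards [S.coeFn_tl b (S.D X), ae_add b (S.coeFn_D X), S.coeFn_D X', ae_shear_sections h]
    with k h1 h2 h3 h4
  rw [h1, h2, h3, dker, dker, diag, diag]
  congr 1
  rw [← integral_add_right_eq_self _ b]
  refine integral_congr_ae ?_
  filter_upwards [h4] with ξ hξ
  simp only [shear, flat] at hξ ⊢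
  rw [show ξ + b - (k + b) = ξ - k by ring]
  push_cast
  linear_combination (-(jp (-(1 / 4)) (ξ - k)) : ℂ) * hξ

lemma tRel_Q {p : ℝ → ℂ} {C C' : ℝ≥0} (hp : IsMult (fun ξ => jp (1 / 2) ξ * p ξ) C)
    (hp' : IsMult (fun ξ => jp (1 / 2) ξ * p (ξ + b)) C') (f : Lp ℂ 2 μ) :
    TRel b (lmul (kw (tex s) ω) hp (S.Q f)) (lmul (kw (tex s) ω) hp' (S.Q (S.tl b f))) := by
  have e : ∀ ξ, jp (-(1 / 4)) ξ * jp (1 / 2) ξ * jp (-(1 / 4)) ξ = 1 := fun ξ => by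
    rw [← jp_add, ← jp_add]
    norm_num [jp_zero]
  filter_upwards [coeFn_lmul S.isKW hp' (S.Q (S.tl b f)), ae_add_fst b (coeFn_lmul S.isKW hp (S.Q f)),
    S.coeFn_Q (S.tl b f), ae_add_fst b (S.coeFn_Q f), ae_diff (S.coeFn_tl b f)] with q h1 h2 h3 h4 h5
  rw [h1, h2, h3, h4, qker, qker, flat, flat, h5]
  simp only
  have e1 : (jp (-(1 / 4)) q.1 * jp (1 / 2) q.1 * jp (-(1 / 4)) q.1 : ℂ) = 1 := mod_cast e q.1
  have e2 : (jp (-(1 / 4)) (q.1 + b) * jp (1 / 2) (q.1 + b) * jp (-(1 / 4)) (q.1 + b) : ℂ) = 1 :=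
    mod_cast e (q.1 + b)
  rw [show q.1 + b - q.2 = q.1 - q.2 + b by ring]
  push_cast
  linear_combination (p (q.1 + b) * jp (-(1 / 4)) q.2 * (cpi * f (q.1 - q.2 + b))) * (e1 - e2)

end IsSob

end

end AKNS

namespace AKNS

noncomputable section

open scoped ENNReal NNReal
open Filter Topology

/-! ### Differences of the resolvent symbol -/

/-- All differences of `p` up to order `n` decay like `(1 + ξ²) ^ (-1/2)`. -/
def IsDiffMult (n : ℕ) (C : ℝ≥0) (b : ℝ) (p : ℝ → ℂ) : Prop :=
  ∀ i j : ℕ, i + j ≤ n →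
    IsMult (fun ξ => jp (1 / 2) ξ * ((fwdDiff b)^[j] p) (ξ + i * b)) (C * ‖b‖₊ ^ j)

lemma fwdDiff_iter_translate (b c : ℝ) (p : ℝ → ℂ) (j : ℕ) :
    (fwdDiff b)^[j] (fun ξ => p (ξ + c)) = fun ξ => (fwdDiff b)^[j] p (ξ + c) := by
  induction j with
  | zero => rfl
  | succ j ih =>
    rw [Function.iterate_succ_apply', ih, Function.iterate_succ_apply']
    ext ξ
    simp only [fwdDiff, add_right_comm]

namespace IsDiffMult

variable {n : ℕ} {C : ℝ≥0} {b : ℝ} {p : ℝ → ℂ}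

lemma isMult (h : IsDiffMult n C b p) : IsMult (fun ξ => jp (1 / 2) ξ * p ξ) C := by
  have := h 0 0 (by simp)
  simpa using this

lemma translate (h : IsDiffMult (n + 1) C b p) : IsDiffMult n C b fun ξ => p (ξ + b) := by
  intro i j hij
  have := h (i + 1) j (by omega)
  simp only [fwdDiff_iter_translate]
  convert this using 4
  push_cast
  ring

lemma diff (h : IsDiffMult (n + 1) C b p) : IsDiffMult n (C * ‖b‖₊) b (fwdDiff b p) := by
  intro i j hij
  have := h i (j + 1) (by omega)
  rw [Function.iterate_succ_apply] at this
  rwa [_root_.mul_assoc, ← pow_succ']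

end IsDiffMult

/-- The symbol of `(κ - ∂)⁻¹`. -/
def res (κ ξ : ℝ) : ℂ := ((κ : ℂ) - Complex.I * ξ)⁻¹

lemma symbol_ne_zero {κ : ℝ} (hκ : 1 ≤ |κ|) (ξ : ℝ) : (κ : ℂ) - Complex.I * ξ ≠ 0 := by
  intro h
  have := congrArg Complex.re h
  simp only [Complex.sub_re, Complex.ofReal_re, Complex.mul_re, Complex.I_re, zero_mul,
    Complex.I_im, Complex.ofReal_im, mul_zero, sub_zero, Complex.zero_re] at this
  rw [this, abs_zero] at hκ
  linarith

lemma jp_mul_res {κ : ℝ} (hκ : 1 ≤ |κ|) (ξ : ℝ) : (jp (1 / 2) ξ : ℂ) * res κ ξ = sym κ ξ :=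
  (sym_eq hκ ξ).symm

lemma norm_jp_mul_res_le {κ : ℝ} (hκ : 1 ≤ |κ|) (ξ : ℝ) : jp (1 / 2) ξ * ‖res κ ξ‖ ≤ 1 := by
  have := (isMult_sym κ).bound ξ
  rw [← jp_mul_res hκ, ← ofReal_norm, norm_mul, Complex.norm_real, Real.norm_of_nonneg (jp_pos _ _).le,
    ENNReal.coe_one, ENNReal.ofReal_le_one] at this
  exact this

lemma norm_res_le {κ : ℝ} (hκ : 1 ≤ |κ|) (ξ : ℝ) : ‖res κ ξ‖ ≤ 1 :=
  (le_mul_of_one_le_left (norm_nonneg _) (one_le_jp (by norm_num) ξ)).trans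
    (norm_jp_mul_res_le hκ ξ)

lemma jp_half_le (c ξ : ℝ) : jp (1 / 2) ξ ≤ 2 * (1 + c ^ 2) * jp (1 / 2) (ξ + c) := by
  have h : 1 + ξ ^ 2 ≤ (2 * (1 + c ^ 2)) ^ 2 * (1 + (ξ + c) ^ 2) := by
    have h1 : 1 + ξ ^ 2 ≤ 2 * (1 + c ^ 2) * (1 + (ξ + c) ^ 2) := by
      nlinarith [sq_nonneg (ξ + 2 * c), sq_nonneg (c * (ξ + c)), sq_nonneg c, sq_nonneg (ξ + c)]
    have h2 : (1 : ℝ) ≤ 2 * (1 + c ^ 2) := by nlinarith [sq_nonneg c]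
    have h3 : 0 ≤ 1 + (ξ + c) ^ 2 := by positivity
    nlinarith [mul_le_mul_of_nonneg_right h2 (mul_nonneg (by linarith : 0 ≤ 2 * (1 + c ^ 2)) h3)]
  rw [jp, jp, ← Real.sqrt_eq_rpow, ← Real.sqrt_eq_rpow, Real.sqrt_le_left (by positivity), mul_pow,
    Real.sq_sqrt (by positivity)]
  exact h

lemma fwdDiff_res {κ : ℝ} (hκ : 1 ≤ |κ|) (b : ℝ) (j : ℕ) : (fwdDiff b)^[j] (res κ) =
    fun ξ => (j.factorial : ℂ) * (Complex.I * b) ^ j *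
      ∏ i ∈ Finset.range (j + 1), res κ (ξ + i * b) := by
  induction j with
  | zero => ext ξ; simp
  | succ j ih =>
    rw [Function.iterate_succ_apply', ih]
    ext ξ
    have e1 : ∏ i ∈ Finset.range (j + 1), res κ (ξ + b + i * b) =
        (∏ i ∈ Finset.range j, res κ (ξ + (i + 1 : ℕ) * b)) * res κ (ξ + (j + 1 : ℕ) * b) := by
      rw [Finset.prod_range_succ]
      congr 1
      · refine Finset.prod_congr rfl fun i _ => ?_
        congr 1
        push_cast
        ring
      · congr 1
        push_cast
        ring
    have e2 : ∏ i ∈ Finset.range (j + 1), res κ (ξ + i * b) =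
        (∏ i ∈ Finset.range j, res κ (ξ + (i + 1 : ℕ) * b)) * res κ ξ := by
      rw [Finset.prod_range_succ']
      simp
    have e3 : ∏ i ∈ Finset.range (j + 1 + 1), res κ (ξ + i * b) =
        (∏ i ∈ Finset.range j, res κ (ξ + (i + 1 : ℕ) * b)) * res κ (ξ + (j + 1 : ℕ) * b) *
          res κ ξ := by
      rw [Finset.prod_range_succ', Finset.prod_range_succ]
      simp
    have e4 : res κ (ξ + (j + 1 : ℕ) * b) - res κ ξ =
        (j + 1) * (Complex.I * b) * (res κ (ξ + (j + 1 : ℕ) * b) * res κ ξ) := by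
      have h1 := symbol_ne_zero hκ ξ
      have h2 := symbol_ne_zero hκ (ξ + (j + 1 : ℕ) * b)
      rw [res, res]
      field_simp
      push_cast
      ring
    rw [fwdDiff, e1, e2, e3, Nat.factorial_succ]
    push_cast at e4 ⊢
    linear_combination ((j.factorial : ℂ) * (Complex.I * b) ^ j *
      ∏ i ∈ Finset.range j, res κ (ξ + (i + 1) * b)) * e4

lemma exists_isDiffMult_res {κ : ℝ} (hκ : 1 ≤ |κ|) (n : ℕ) :
    ∃ C : ℝ≥0, ∀ b : ℝ, |b| ≤ 1 → IsDiffMult n C b (res κ) := by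
  refine ⟨n.factorial * (2 * (1 + n ^ 2)), fun b hb i j hij => ⟨?_, fun ξ => ?_⟩⟩
  · rw [fwdDiff_res hκ]
    have h1 : Measurable (res κ) := by unfold res; fun_prop
    have h2 : ∀ k : ℕ, Measurable fun ξ : ℝ => res κ (ξ + i * b + k * b) := fun k =>
      h1.comp (by fun_prop)
    have h3 := measurable_jp (1 / 2)
    have h4 := Finset.measurable_prod (Finset.range (j + 1)) fun k _ => h2 k
    exact (Complex.measurable_ofReal.comp h3).mul (measurable_const.mul h4)
  · rw [fwdDiff_res hκ, ← ofReal_norm, ENNReal.ofReal_le_iff_le_toReal ENNReal.coe_ne_top]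
    have hprod : ‖∏ k ∈ Finset.range (j + 1), res κ (ξ + i * b + k * b)‖ ≤ ‖res κ (ξ + i * b)‖ := by
      rw [Finset.prod_range_succ', norm_mul]
      simp only [Nat.cast_zero, zero_mul, add_zero]
      refine mul_le_of_le_one_left (norm_nonneg _) ?_
      rw [norm_prod]
      exact Finset.prod_le_one (fun _ _ => norm_nonneg _) fun _ _ => norm_res_le hκ _
    have hc : (i * b) ^ 2 ≤ (n : ℝ) ^ 2 := by
      rw [mul_pow]
      have h1 : b ^ 2 ≤ 1 := (sq_le_one_iff_abs_le_one b).2 hb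
      have h2 : (i : ℝ) ≤ n := by exact_mod_cast (by omega : i ≤ n)
      have h3 : (i : ℝ) ^ 2 ≤ n ^ 2 := by gcongr
      nlinarith [sq_nonneg (i : ℝ)]
    have hj : (j.factorial : ℝ) ≤ n.factorial := by
      exact_mod_cast Nat.factorial_le (by omega)
    simp only [norm_mul, norm_pow, Complex.norm_real, Complex.norm_I, one_mul, Complex.norm_natCast,
      Real.norm_of_nonneg (jp_pos _ _).le, Real.norm_eq_abs]
    have h5 : jp (1 / 2) ξ * ‖∏ k ∈ Finset.range (j + 1), res κ (ξ + i * b + k * b)‖ ≤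
        2 * (1 + n ^ 2) := by
      calc _ ≤ 2 * (1 + (i * b) ^ 2) * jp (1 / 2) (ξ + i * b) * ‖res κ (ξ + i * b)‖ := by
            have h6 := (jp_pos (1 / 2) (ξ + i * b)).le
            exact mul_le_mul (jp_half_le _ _) hprod (norm_nonneg _) (by positivity)
        _ = 2 * (1 + (i * b) ^ 2) * (jp (1 / 2) (ξ + i * b) * ‖res κ (ξ + i * b)‖) := by ring
        _ ≤ 2 * (1 + n ^ 2) * 1 := by
            have h6 := (jp_pos (1 / 2) (ξ + i * b)).le
            exact mul_le_mul (by linarith) (norm_jp_mul_res_le hκ _) (by positivity) (by positivity)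
        _ = _ := mul_one _
    rw [ENNReal.coe_toReal]
    push_cast
    rw [Real.norm_eq_abs]
    calc jp (1 / 2) ξ * (j.factorial * |b| ^ j *
          ‖∏ k ∈ Finset.range (j + 1), res κ (ξ + i * b + k * b)‖) =
          j.factorial * (jp (1 / 2) ξ *
            ‖∏ k ∈ Finset.range (j + 1), res κ (ξ + i * b + k * b)‖) * |b| ^ j := by ring
      _ ≤ _ := by
          have h6 := mul_nonneg (jp_pos (1 / 2) ξ).le
            (norm_nonneg (∏ k ∈ Finset.range (j + 1), res κ (ξ + i * b + k * b)))
          gcongr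

namespace IsSob

variable {s : ℝ} {ω : ℝ → ℝ} {μ : Measure ℝ} (S : IsSob s ω μ)

/-! ### Differences of the diagonal Green's function -/

/-- The diagonal Green's function as a linear map in its first argument, with an arbitrary symbol in
place of that of the free resolvent. -/
def pop (κ : ℝ) (V : Lp ℂ 2 (kmeas (kw (tex s) ω))) {p : ℝ → ℂ} {C : ℝ≥0}
    (hp : IsMult p C) : Lp ℂ 2 μ →L[ℂ] Lp ℂ 2 μ :=
  S.D.comp ((rmul _ (isMult_sym (-κ))).comp
    ((ContinuousLinearMap.id ℂ _ + S.isKW.mul.flip V).comp ((lmul _ hp).comp S.Q)))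

lemma pop_apply (κ : ℝ) (V : Lp ℂ 2 (kmeas (kw (tex s) ω))) {p : ℝ → ℂ} {C : ℝ≥0}
    (hp : IsMult p C) (f : Lp ℂ 2 μ) : S.pop κ V hp f = S.D (rmul _ (isMult_sym (-κ))
      (lmul _ hp (S.Q f) + S.isKW.mul (lmul _ hp (S.Q f)) V)) := rfl

/-- The bound of `pop`. -/
def _root_.AKNS.popConst (s : ℝ) : ℝ := dConst s * (qConst s * 2)

omit S in
lemma _root_.AKNS.popConst_nonneg (s : ℝ) : 0 ≤ popConst s := by unfold popConst; positivity

lemma norm_pop_le (κ : ℝ) {V : Lp ℂ 2 (kmeas (kw (tex s) ω))} (hV : ‖V‖ ≤ 1) {p : ℝ → ℂ} {C : ℝ≥0}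
    (hp : IsMult p C) (f : Lp ℂ 2 μ) : ‖S.pop κ V hp f‖ ≤ C * popConst s * ‖f‖ := by
  rw [pop_apply]
  have h1 : ‖lmul (kw (tex s) ω) hp (S.Q f)‖ ≤ C * (qConst s * ‖f‖) :=
    (norm_lmul_le hp _).trans (by gcongr; exact S.norm_Q_le f)
  have h2 := S.isKW.isTraceAlgebra.norm_mul (lmul (kw (tex s) ω) hp (S.Q f)) V
  calc _ ≤ dConst s * (C * (qConst s * ‖f‖) + C * (qConst s * ‖f‖) * 1) := by
        refine (S.norm_D_le _).trans ?_
        gcongr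
        refine (norm_rmul_sym_le _ _).trans ((norm_add_le _ _).trans ?_)
        refine add_le_add h1 (h2.trans ?_)
        gcongr
    _ = _ := by rw [popConst]; ring

variable {b : ℝ} {p : ℝ → ℂ} {C : ℝ≥0}

lemma tl_pop (κ : ℝ) (V : Lp ℂ 2 (kmeas (kw (tex s) ω))) {C' : ℝ≥0}
    (hp : IsMult (fun ξ => jp (1 / 2) ξ * p ξ) C)
    (hp' : IsMult (fun ξ => jp (1 / 2) ξ * p (ξ + b)) C') (f : Lp ℂ 2 μ) :
    S.tl b (S.pop κ V hp f) = S.pop κ V hp' (S.tl b f) := by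
  rw [pop_apply, pop_apply]
  have h := S.tRel_Q hp hp' f
  exact S.tl_D (S.tRel_rmul (S.tRel_add h (S.tRel_mul h V)) _)

omit S in
lemma _root_.AKNS.lmul_sub_eq {τ : ℝ × ℝ → ℝ≥0∞} (hτ : IsKernelWeight τ) {p p' p'' : ℝ → ℂ}
    {C C' C'' : ℝ≥0} (hp : IsMult p C) (hp' : IsMult p' C') (hp'' : IsMult p'' C'')
    (h : ∀ ξ, p'' ξ = p ξ - p' ξ) (f : Lp ℂ 2 (kmeas τ)) :
    lmul τ hp'' f = lmul τ hp f - lmul τ hp' f := by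
  refine Lp.ext (hτ.isWeighted.ae_eq_iff.2 ?_)
  filter_upwards [coeFn_lmul hτ hp f, coeFn_lmul hτ hp' f, coeFn_lmul hτ hp'' f,
    hτ.isWeighted.ae_eq_iff.1 (Lp.coeFn_sub (lmul τ hp f) (lmul τ hp' f))] with q h1 h2 h3 h4
  rw [h4, Pi.sub_apply, h1, h2, h3, h, sub_mul]

lemma dif_pop {n : ℕ} (κ : ℝ) (V : Lp ℂ 2 (kmeas (kw (tex s) ω))) (h : IsDiffMult (n + 1) C b p)
    (f : Lp ℂ 2 μ) : S.dif b (S.pop κ V h.isMult f) =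
      S.pop κ V h.translate.isMult (S.dif b f) + S.pop κ V h.diff.isMult f := by
  have e : S.pop κ V h.diff.isMult f = S.pop κ V h.translate.isMult f - S.pop κ V h.isMult f := by
    simp only [pop_apply]
    rw [lmul_sub_eq S.isKW h.translate.isMult h.isMult h.diff.isMult
      (fun ξ => by rw [fwdDiff]; ring), map_sub, sub_apply, ← map_sub, ← map_sub]
    congr 2
    abel
  rw [dif_apply, S.tl_pop κ V h.isMult h.translate.isMult, e, dif_apply, map_sub]
  abel

/-- The quantity that controls the `n`-th difference of `pop`. -/
def difSum (b : ℝ) : ℕ → Lp ℂ 2 μ → ℝ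
  | 0, f => ‖f‖
  | n + 1, f => difSum b n (S.dif b f) + |b| * difSum b n f

lemma difSum_nonneg (b : ℝ) (n : ℕ) (f : Lp ℂ 2 μ) : 0 ≤ S.difSum b n f := by
  induction n generalizing f with
  | zero => exact norm_nonneg f
  | succ n ih => exact add_nonneg (ih _) (mul_nonneg (abs_nonneg _) (ih _))

lemma norm_dif_pop_le (κ : ℝ) {V : Lp ℂ 2 (kmeas (kw (tex s) ω))} (hV : ‖V‖ ≤ 1) {n : ℕ}
    (h : IsDiffMult n C b p) (f : Lp ℂ 2 μ) :
    ‖(S.dif b)^[n] (S.pop κ V h.isMult f)‖ ≤ C * popConst s * S.difSum b n f := by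
  induction n generalizing C p f with
  | zero => exact S.norm_pop_le κ hV _ f
  | succ n ih =>
    rw [Function.iterate_succ_apply, S.dif_pop κ V h, iterate_map_add]
    refine (norm_add_le _ _).trans ((add_le_add (ih h.translate _) (ih h.diff _)).trans_eq ?_)
    rw [difSum]
    push_cast
    rw [Real.norm_eq_abs]
    ring

lemma difSum_le {n : ℕ} {f : Lp ℂ 2 μ} {M : ℝ}
    (h : ∀ j < n, ‖(S.dif b)^[j] f‖ ≤ M * |b| ^ j) :
    S.difSum b n f ≤ ‖(S.dif b)^[n] f‖ + (2 ^ n - 1) * M * |b| ^ n := by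
  induction n generalizing f M with
  | zero => simp [difSum]
  | succ n ih =>
    have h1 := ih (f := S.dif b f) (M := M * |b|) fun j hj => by
      have := h (j + 1) (by omega)
      rwa [Function.iterate_succ_apply, pow_succ', ← _root_.mul_assoc] at this
    have h2 := ih (f := f) (M := M) fun j hj => h j (by omega)
    have h3 := h n (by omega)
    have hb := abs_nonneg b
    rw [difSum, Function.iterate_succ_apply]
    calc _ ≤ (‖(S.dif b)^[n] (S.dif b f)‖ + (2 ^ n - 1) * (M * |b|) * |b| ^ n) +
          |b| * (M * |b| ^ n + (2 ^ n - 1) * M * |b| ^ n) := by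
          refine add_le_add h1 (mul_le_mul_of_nonneg_left (h2.trans (by gcongr)) hb)
      _ = _ := by ring

lemma exists_norm_dif_G_le {κ : ℝ} (hκ : 1 ≤ |κ|) (n : ℕ) : ∃ L : ℝ, 0 ≤ L ∧ ∀ b : ℝ, |b| ≤ 1 →
    ∀ w v : Lp ℂ 2 μ, ‖w‖ ≤ rad s → ‖v‖ ≤ rad s →
      ‖(S.dif b)^[n] (S.G κ w v)‖ ≤ L * S.difSum b n w := by
  obtain ⟨C, hC⟩ := exists_isDiffMult_res hκ n
  refine ⟨C * popConst s, mul_nonneg C.2 (popConst_nonneg s), fun b hb w v hw hv => ?_⟩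
  have hx := S.norm_X_le_half κ hw
  have hy := S.norm_X_le_half (-κ) hv
  set V := S.isKW.mul (S.X (-κ) v) (S.Z κ w v) with hVdef
  have hV : ‖V‖ ≤ 1 := by
    have h1 := S.isKW.isTraceAlgebra.norm_mul (S.X (-κ) v) (S.Z κ w v)
    have h2 : ‖S.Z κ w v‖ ≤ 1 :=
      (S.isKW.isTraceAlgebra.norm_altSum_le hx hy).trans (by linarith)
    have h3 := norm_nonneg (S.Z κ w v)
    nlinarith [norm_nonneg (S.X (-κ) v)]
  have e : S.G κ w v = S.pop κ V (hC b hb).isMult w := by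
    have hl : lmul (kw (tex s) ω) (hC b hb).isMult (S.Q w) = S.X κ w := by
      refine Lp.ext (S.isKW.isWeighted.ae_eq_iff.2 ?_)
      filter_upwards [coeFn_lmul S.isKW (hC b hb).isMult (S.Q w),
        coeFn_lmul S.isKW (isMult_sym κ) (S.Q w)] with q h1 h2
      rw [h1, X_apply, h2, jp_mul_res hκ]
    rw [pop_apply, hl, G]
    congr 2
    exact S.isKW.isTraceAlgebra.altSum_eq hx hy (by norm_num)
  rw [e]
  exact S.norm_dif_pop_le κ hV (hC b hb) w

lemma norm_dif_le_difSum (b : ℝ) (n : ℕ) (f : Lp ℂ 2 μ) : ‖(S.dif b)^[n] f‖ ≤ S.difSum b n f := by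
  induction n generalizing f with
  | zero => exact le_rfl
  | succ n ih =>
    rw [Function.iterate_succ_apply, difSum]
    exact (ih _).trans (le_add_of_nonneg_right (mul_nonneg (abs_nonneg _) (S.difSum_nonneg _ _ _)))

lemma exists_norm_dif_field_le (ε : ℤˣ) {κ : ℝ} (hκ : 1 ≤ |κ|) (c : ℂ) (d : ℝ) (n : ℕ) :
    ∃ L : ℝ, 0 ≤ L ∧ ∀ b : ℝ, |b| ≤ 1 → ∀ w : Lp ℂ 2 μ, ‖w‖ ≤ rad s →
      ‖(S.dif b)^[n] (S.field ε κ c d w)‖ ≤ L * S.difSum b n w := by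
  obtain ⟨L₁, h₁, hL₁⟩ := S.exists_norm_dif_G_le hκ n
  obtain ⟨L₂, h₂, hL₂⟩ := S.exists_norm_dif_G_le (κ := -κ) (by rwa [abs_neg]) n
  refine ⟨‖c‖ * L₁ + ‖c‖ * L₂ + |d|, by positivity, fun b hb w hw => ?_⟩
  have hv := (S.norm_J_le ε w).trans hw
  have e1 := hL₁ b hb w _ hw hv
  have e2 := hL₂ b hb w _ hw hv
  have e3 := S.norm_dif_le_difSum b n w
  have e4 : (S.dif b)^[n] (S.field ε κ c d w) = c • (S.dif b)^[n] (S.G κ w (S.J ε w)) -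
      conj c • (S.dif b)^[n] (S.G (-κ) w (S.J ε w)) + (Complex.I * d) • (S.dif b)^[n] w := by
    rw [← FunLike.coe_pow_eq_iterate, field, map_add, map_sub, map_smul, map_smul, map_smul]
  have e0 := S.difSum_nonneg b n w
  rw [e4]
  refine (norm_add_le _ _).trans ((add_le_add (norm_sub_le _ _) le_rfl).trans ?_)
  rw [norm_smul, norm_smul, norm_smul, RCLike.norm_conj, norm_mul, Complex.norm_I, one_mul,
    Complex.norm_real, Real.norm_eq_abs]
  calc _ ≤ ‖c‖ * (L₁ * S.difSum b n w) + ‖c‖ * (L₂ * S.difSum b n w) + |d| * S.difSum b n w := by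
        gcongr
    _ = _ := by ring

lemma hasDerivAt_dif {u : ℝ → Lp ℂ 2 μ} {u' : Lp ℂ 2 μ} {t : ℝ} (h : HasDerivAt u u' t) (b : ℝ)
    (n : ℕ) : HasDerivAt (fun t => (S.dif b)^[n] (u t)) ((S.dif b)^[n] u') t := by
  simp only [← FunLike.coe_pow_eq_iterate]
  exact ((S.dif b ^ n).restrictScalars ℝ).hasFDerivAt.comp_hasDerivAt t h

/-- Regularity in the frequency variable persists. -/
lemma exists_norm_dif_flow_le (ε : ℤˣ) {κ : ℝ} (hκ : 1 ≤ |κ|) (c : ℂ) (d : ℝ) {u : ℝ → Lp ℂ 2 μ}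
    (hu : ∀ t, HasDerivAt u (S.field ε κ c d (u t)) t) (hn : ∀ t, ‖u t‖ ≤ rad s)
    (h0 : ∀ n : ℕ, ∃ C : ℝ, ∀ b : ℝ, |b| ≤ 1 → ‖(S.dif b)^[n] (u 0)‖ ≤ C * |b| ^ n) (T : ℝ) (n : ℕ) :
    ∃ C : ℝ, ∀ b : ℝ, |b| ≤ 1 → ∀ t : ℝ, |t| ≤ T → ‖(S.dif b)^[n] (u t)‖ ≤ C * |b| ^ n := by
  induction n using Nat.strong_induction_on with
  | _ n ih =>
    obtain ⟨C₀, hC₀⟩ := h0 n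
    obtain ⟨L, hL0, hL⟩ := S.exists_norm_dif_field_le ε hκ c d n
    choose! C hC using ih
    set M := ∑ j ∈ Finset.range n, |C j|
    have hM0 : 0 ≤ M := Finset.sum_nonneg fun _ _ => abs_nonneg _
    set E := L * ((2 ^ n - 1) * M)
    have hE0 : 0 ≤ E := mul_nonneg hL0 (mul_nonneg (sub_nonneg.2 (one_le_pow₀ one_le_two)) hM0)
    refine ⟨|C₀| * Real.exp ((L + 1) * T) + E / (L + 1) * Real.exp ((L + 1) * T),
      fun b hb t ht => ?_⟩
    have hb0 := abs_nonneg b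
    have hsub : ∀ τ ∈ uIcc 0 t, |τ| ≤ T := fun τ hτ => by
      have := abs_sub_left_of_mem_uIcc hτ
      simp only [sub_zero] at this
      exact this.trans ht
    have key := norm_le_gronwallBound (f := fun t => (S.dif b)^[n] (u t)) (K := L + 1)
      (η := E * |b| ^ n) (t₀ := 0) (t := t) (fun τ _ => S.hasDerivAt_dif (hu τ) b n) fun τ hτ => by
        have h1 := S.difSum_le (b := b) (n := n) (f := u τ) (M := M) fun j hj => by
          refine (hC j hj b hb τ (hsub τ hτ)).trans ?_
          gcongr
          exact (le_abs_self _).trans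
            (Finset.single_le_sum (f := fun j => |C j|) (fun _ _ => abs_nonneg _) (Finset.mem_range.2 hj))
        calc _ ≤ L * S.difSum b n (u τ) := hL b hb (u τ) (hn τ)
          _ ≤ L * (‖(S.dif b)^[n] (u τ)‖ + (2 ^ n - 1) * M * |b| ^ n) := by gcongr
          _ = L * ‖(S.dif b)^[n] (u τ)‖ + E * |b| ^ n := by simp only [E]; ring
          _ ≤ _ := by nlinarith [norm_nonneg ((S.dif b)^[n] (u τ))]
    refine key.trans ?_
    rw [gronwallBound_of_K_ne_0 (by positivity), sub_zero]
    have h2 : Real.exp ((L + 1) * |t|) ≤ Real.exp ((L + 1) * T) := by gcongr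
    have h3 : ‖(S.dif b)^[n] (u 0)‖ ≤ |C₀| * |b| ^ n :=
      (hC₀ b hb).trans (by gcongr; exact le_abs_self _)
    calc _ ≤ |C₀| * |b| ^ n * Real.exp ((L + 1) * T) +
          E * |b| ^ n / (L + 1) * (Real.exp ((L + 1) * T)) := by
          exact add_le_add (mul_le_mul h3 h2 (Real.exp_pos _).le (by positivity))
            (mul_le_mul_of_nonneg_left (by linarith) (by positivity))
      _ = _ := by ring

end IsSob

end

end AKNS

namespace AKNS

noncomputable section

open scoped ENNReal NNReal
open Filter Topology

/-! ### Persistence of decay in the frequency variable -/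

/-- The function `q` decays rapidly, in the sense of `L²`. -/
def HasDecay (s : ℝ) (q : ℝ → ℂ) : Prop := ∀ N : ℕ, ∫⁻ ξ, dens s (wt 1 N) ξ * ‖q ξ‖ₑ ^ 2 < ⊤

lemma wt_zero (N : ℕ) : wt 0 N = fun _ => 1 := by
  ext ξ
  simp [wt]

lemma wt_mono {a a' : ℝ} (ha : 0 ≤ a) (h : a ≤ a') (N : ℕ) (ξ : ℝ) : wt a N ξ ≤ wt a' N ξ := by
  unfold wt
  gcongr

lemma wt_one_le {a : ℝ} (ha : 0 < a) (ha' : a ≤ 1) (N : ℕ) (ξ : ℝ) :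
    wt 1 N ξ ≤ a⁻¹ ^ N * wt a N ξ := by
  rw [wt, wt, ← mul_pow]
  refine pow_le_pow_left₀ (by positivity) ?_ N
  rw [mul_add, mul_one, inv_mul_cancel_left₀ ha.ne', one_mul]
  gcongr
  exact (one_le_inv₀ ha).2 ha'

lemma tendsto_lintegral_wt {s : ℝ} {q : ℝ → ℂ} (hq : Measurable q) {N : ℕ}
    (h : ∫⁻ ξ, dens s (wt 1 N) ξ * ‖q ξ‖ₑ ^ 2 < ⊤) :
    Tendsto (fun n : ℕ => ∫⁻ ξ, dens s (wt (1 / ((n : ℝ) + 1)) N) ξ * ‖q ξ‖ₑ ^ 2) atTop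
      (𝓝 (∫⁻ ξ, dens s (fun _ => 1) ξ * ‖q ξ‖ₑ ^ 2)) := by
  have ha : ∀ n : ℕ, (0 : ℝ) ≤ 1 / ((n : ℝ) + 1) := fun n => by positivity
  have ha' : ∀ n : ℕ, 1 / ((n : ℝ) + 1) ≤ 1 := fun n => by
    rw [div_le_one (by positivity)]
    linarith [n.cast_nonneg (α := ℝ)]
  refine tendsto_lintegral_of_dominated_convergence (fun ξ => dens s (wt 1 N) ξ * ‖q ξ‖ₑ ^ 2)
    (fun n => ?_) (fun n => .of_forall fun ξ => ?_) h.ne (.of_forall fun ξ => ?_)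
  · exact (measurable_dens (isFreqWeight_wt (ha n) N)).mul (hq.enorm.pow_const 2)
  · exact mul_le_mul_left (dens_mono s (fun x => wt_mono (ha n) (ha' n) N x) ξ) _
  · have h1 : Tendsto (fun n : ℕ => wt (1 / ((n : ℝ) + 1)) N ξ) atTop (𝓝 1) := by
      have hc : Continuous fun a : ℝ => wt a N ξ := by unfold wt; fun_prop
      have := (hc.tendsto 0).comp (tendsto_one_div_add_atTop_nhds_zero_nat (𝕜 := ℝ))
      rwa [wt_zero] at this
    have h2 : Tendsto (fun n : ℕ => dens s (wt (1 / ((n : ℝ) + 1)) N) ξ) atTop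
        (𝓝 (dens s (fun _ => 1) ξ)) := by
      unfold dens
      refine ENNReal.Tendsto.mul_const ?_ (Or.inr ENNReal.ofReal_ne_top)
      exact ((ENNReal.continuous_pow 2).tendsto _).comp (ENNReal.tendsto_ofReal h1)
    exact ENNReal.Tendsto.mul_const h2 (Or.inr (by finiteness))

namespace IsSob

variable {s : ℝ} {ω : ℝ → ℝ} {μ : Measure ℝ} (S : IsSob s ω μ)

lemma norm_field_le (ε : ℤˣ) (κ : ℝ) (c : ℂ) (d : ℝ) {w : Lp ℂ 2 μ} (hw : ‖w‖ ≤ rad s) :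
    ‖S.field ε κ c d w‖ ≤ fieldConst s c d * ‖w‖ := by
  have h0 : ‖(0 : Lp ℂ 2 μ)‖ ≤ rad s := by rw [norm_zero]; exact IsSob.rad_pos.le
  have hG : ∀ κ, S.G κ 0 0 = 0 := fun κ => by
    have := S.norm_G_le κ h0 h0
    rwa [norm_zero, mul_zero, mul_zero, mul_zero, norm_le_zero_iff] at this
  have h := S.norm_field_sub_le ε κ c d hw h0
  have e : S.field ε κ c d 0 = 0 := by
    rw [field, map_zero, hG, hG, smul_zero, smul_zero, smul_zero, sub_zero, add_zero]
  rwa [e, sub_zero, sub_zero] at h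

end IsSob

section

variable {s : ℝ} (hs : s ∈ Ioo (-(1 / 2) : ℝ) 0) {ε : ℤˣ} {κ : ℝ} {c : ℂ} {d : ℝ}
  {R : ℝ} (hR : R < rad s) {u : ℝ → Hs s}
  (hu : ∀ t, HasDerivAt u ((isSob_sobolev hs).field ε κ c d (u t)) t) (hn : ∀ t, ‖u t‖ ≤ R)

include hR hu hn

lemma hasDecay_flow_of_abs_sub_le {t₀ : ℝ} (h : HasDecay s (u t₀)) {t : ℝ}
    (ht : |t - t₀| ≤ ((rad s - R) / 2) / (fieldConst s c d * rad s + 1)) : HasDecay s (u t) := by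
  intro N
  have S₀ := isSob_sobolev hs
  have hrad := IsSob.rad_pos (s := s)
  have hR0 : 0 ≤ R := (norm_nonneg _).trans (hn 0)
  set R₁ := (rad s + R) / 2 with hR₁
  have hRR : R < R₁ := by rw [hR₁]; linarith
  have hlim := tendsto_lintegral_wt (Lp.stronglyMeasurable (u t₀)).measurable (h N)
  rw [← (isWeighted_sobolev s).enorm_sq] at hlim
  have hlt : ‖u t₀‖ₑ ^ 2 < ENNReal.ofReal R₁ ^ 2 := by
    refine ENNReal.pow_lt_pow_left two_ne_zero ?_
    rw [← ofReal_norm]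
    exact (ENNReal.ofReal_lt_ofReal_iff (by linarith)).2 ((hn t₀).trans_lt hRR)
  obtain ⟨n, hint⟩ := (hlim.eventually_lt_const hlt).exists
  set a : ℝ := 1 / ((n : ℝ) + 1)
  have ha : 0 < a := by positivity
  have ha' : a ≤ 1 := by
    rw [div_le_one (by positivity)]
    linarith [n.cast_nonneg (α := ℝ)]
  have S := isSob_wt hs ha.le N
  set μ := wtMeasure s a N
  have hb : eLpNorm (u t₀) 2 μ ≤ ENNReal.ofReal R₁ := S.hμ.eLpNorm_le hint.le
  have hmem : MemLp (u t₀) 2 μ :=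
    ⟨S.hμ.aesm (Lp.stronglyMeasurable (u t₀)).aestronglyMeasurable, hb.trans_lt ENNReal.ofReal_lt_top⟩
  set U₀ : Lp ℂ 2 μ := hmem.toLp _
  have hU₀ : ‖U₀‖ ≤ R₁ := by
    rw [Lp.norm_toLp]
    exact ENNReal.toReal_le_of_le_ofReal (by linarith) hb
  have hle : ∀ x, (fun _ : ℝ => (1 : ℝ)) x ≤ wt a N x := fun x => S.hω.one_le x
  obtain ⟨φ, h0, hd, -⟩ := exists_truncated_flow hrad.le (S.lipschitzOnWith_field ε κ c d le_rfl)
  set U : ℝ → Lp ℂ 2 μ := fun τ => φ (τ - t₀) U₀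
  have hUd : ∀ τ, HasDerivAt U (S.field ε κ c d (radial (rad s) (U τ))) τ := fun τ => by
    have := (hd U₀ (τ - t₀)).scomp τ ((hasDerivAt_id τ).sub_const t₀)
    rwa [one_smul] at this
  set B : ℝ := fieldConst s c d * rad s with hB
  have hB0 : 0 ≤ B := by positivity
  have hbound : ∀ τ, |τ - t₀| ≤ |t - t₀| → ‖U τ‖ ≤ rad s := fun τ hτ => by
    have := norm_le_gronwallBound (K := 0) (η := B) (t₀ := t₀) (t := τ) (fun σ _ => hUd σ)
      fun σ _ => by
        rw [zero_mul, zero_add]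
        have h1 := norm_radial_le hrad.le (U σ)
        exact (S.norm_field_le ε κ c d h1).trans (mul_le_mul_of_nonneg_left h1 (NNReal.coe_nonneg _))
    rw [gronwallBound_K0] at this
    have e : U t₀ = U₀ := by simp only [U, sub_self, h0]
    rw [e] at this
    rw [le_div_iff₀ (by positivity)] at ht
    have h3 : B * |τ - t₀| ≤ (rad s - R) / 2 := by
      nlinarith [abs_nonneg (t - t₀), mul_le_mul_of_nonneg_left hτ hB0]
    linarith
  have hmemu : ∀ τ ∈ uIcc t₀ t, |τ - t₀| ≤ |t - t₀| := fun τ hτ => abs_sub_left_of_mem_uIcc hτ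
  have hembd : ∀ τ ∈ uIcc t₀ t, HasDerivAt (fun τ => S.emb S₀ hle (U τ))
      (S₀.field ε κ c d (S.emb S₀ hle (U τ))) τ := fun τ hτ => by
    have h1 := hbound τ (hmemu τ hτ)
    have h2 := hUd τ
    rw [radial_of_le h1] at h2
    rw [← S.emb_field S₀ hle ε κ c d h1]
    exact ((S.emb S₀ hle).restrictScalars ℝ).hasFDerivAt.comp_hasDerivAt τ h2
  have hut : u t = S.emb S₀ hle (U t) := by
    refine eq_of_deriv_eq (K := fieldConst s c d) (t₀ := t₀) (fun τ _ => hu τ) hembd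
      (fun τ hτ => S₀.norm_field_sub_le ε κ c d ((hn τ).trans hR.le)
        ((S.norm_emb_le S₀ hle _).trans (hbound τ (hmemu τ hτ)))) ?_
    refine Lp.ext (S₀.hμ.ae_eq_iff.2 ?_)
    simp only [U, sub_self, h0]
    exact ((S.coeFn_emb S₀ hle U₀).trans (S.hμ.ae_eq_iff.1 hmem.coeFn_toLp)).symm
  have hfin := S.hμ.lintegral_lt_top (U t)
  have hae : u t =ᵐ[volume] U t := by
    rw [hut]
    exact S.coeFn_emb S₀ hle (U t)
  have hae' : ∫⁻ ξ, dens s (wt 1 N) ξ * ‖u t ξ‖ₑ ^ 2 = ∫⁻ ξ, dens s (wt 1 N) ξ * ‖U t ξ‖ₑ ^ 2 := by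
    refine lintegral_congr_ae ?_
    filter_upwards [hae] with ξ hξ
    rw [hξ]
  rw [hae']
  refine lt_of_le_of_lt ?_ (ENNReal.mul_lt_top (ENNReal.pow_lt_top (n := 2)
    (ENNReal.ofReal_lt_top (r := a⁻¹ ^ N))) hfin)
  rw [← lintegral_const_mul' _ _ (by finiteness)]
  refine lintegral_mono fun ξ => ?_
  rw [← _root_.mul_assoc]
  refine mul_le_mul_left ?_ _
  rw [dens, dens, ← _root_.mul_assoc, ← mul_pow, ← ENNReal.ofReal_mul (by positivity)]
  gcongr
  exact wt_one_le ha ha' N ξ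

lemma hasDecay_flow (h : HasDecay s (u 0)) (t : ℝ) : HasDecay s (u t) := by
  have hrad := IsSob.rad_pos (s := s)
  set τ := ((rad s - R) / 2) / (fieldConst s c d * rad s + 1) with hτ
  have hτ0 : 0 < τ := by
    have : 0 < rad s - R := by linarith
    positivity
  have key : ∀ n : ℕ, ∀ t : ℝ, |t| ≤ n * τ → HasDecay s (u t) := by
    intro n
    induction n with
    | zero =>
      intro t ht
      rw [Nat.cast_zero, zero_mul, abs_nonpos_iff] at ht
      rwa [ht]
    | succ n ih =>
      intro t ht
      push_cast at ht
      have h1 : |t| / (n + 1) ≤ τ := by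
        rw [div_le_iff₀ (by positivity)]
        linarith
      refine hasDecay_flow_of_abs_sub_le hs hR hu hn (ih (n * (t / (n + 1))) ?_) ?_
      · rw [abs_mul, abs_div, Nat.abs_cast, abs_of_pos (by positivity : (0 : ℝ) < n + 1)]
        gcongr
      · have e : t - n * (t / (n + 1)) = t / (n + 1) := by
          field_simp
          ring
        rwa [e, abs_div, abs_of_pos (by positivity : (0 : ℝ) < n + 1)]
  obtain ⟨n, hn'⟩ := exists_nat_ge (|t| / τ)
  exact key n t ((div_le_iff₀ hτ0).1 hn')

end

end

end AKNS

namespace AKNS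

noncomputable section

open scoped ENNReal NNReal
open Filter Topology

/-! ### The inverse Fourier integral -/

/-- The inverse unitary Fourier transform. -/
def invF (f : ℝ → ℂ) (x : ℝ) : ℂ := cpi * ∫ ξ, modul x ξ * f ξ

lemma invF_eq (f : ℝ → ℂ) (x : ℝ) :
    invF f x = cpi * ∫ ξ : ℝ, Complex.exp (Complex.I * (x * ξ)) * f ξ := by
  simp only [invF, modul, Complex.ofReal_mul]

lemma norm_cpi_le : ‖cpi‖ ≤ 1 := by
  rw [cpi, norm_inv, Complex.norm_real, Real.norm_of_nonneg (Real.sqrt_nonneg _)]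
  refine inv_le_one_of_one_le₀ (Real.one_le_sqrt.2 ?_)
  linarith [Real.pi_gt_three]

lemma norm_invF_le (f : ℝ → ℂ) (x : ℝ) : ‖invF f x‖ ≤ ∫ ξ, ‖f ξ‖ := by
  rw [invF, norm_mul]
  refine (mul_le_of_le_one_left (norm_nonneg _) norm_cpi_le).trans
    ((norm_integral_le_integral_norm _).trans_eq ?_)
  simp only [norm_mul, norm_modul, one_mul]

lemma integrable_modul_mul {f : ℝ → ℂ} (hf : Integrable f) (x : ℝ) :
    Integrable fun ξ => modul x ξ * f ξ :=
  hf.bdd_mul (c := 1) (measurable_modul x).aestronglyMeasurable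
    (.of_forall fun ξ => (norm_modul x ξ).le)

lemma hasDerivAt_invF {f : ℝ → ℂ} (hf : Integrable f)
    (hf' : Integrable fun ξ : ℝ => Complex.I * ξ * f ξ) (x : ℝ) :
    HasDerivAt (invF f) (invF (fun ξ : ℝ => Complex.I * ξ * f ξ) x) x := by
  have h := hasDerivAt_integral_of_dominated_loc_of_deriv_le (μ := volume) (x₀ := x)
    (F := fun x ξ => modul x ξ * f ξ) (F' := fun x ξ => modul x ξ * (Complex.I * ξ * f ξ))
    (bound := fun ξ : ℝ => ‖Complex.I * ξ * f ξ‖) univ_mem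
    (.of_forall fun x => (integrable_modul_mul hf x).1) (integrable_modul_mul hf x)
    (integrable_modul_mul hf' x).1
    (.of_forall fun ξ x _ => by rw [norm_mul, norm_modul, one_mul]) hf'.norm
    (.of_forall fun ξ x _ =>
      ((hasDerivAt_modul x ξ).mul_const (f ξ)).congr_deriv (by ring))
  exact h.2.const_mul cpi

lemma integrable_fwdDiff {f : ℝ → ℂ} (hf : Integrable f) (b : ℝ) (n : ℕ) :
    Integrable ((fwdDiff b)^[n] f) := by
  induction n with
  | zero => exact hf
  | succ n ih =>
    rw [Function.iterate_succ_apply']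
    exact (ih.comp_add_right b).sub ih

lemma invF_fwdDiff {f : ℝ → ℂ} (hf : Integrable f) (b x : ℝ) (n : ℕ) :
    invF ((fwdDiff b)^[n] f) x = (modul x (-b) - 1) ^ n * invF f x := by
  induction n with
  | zero => simp
  | succ n ih =>
    have h := integrable_fwdDiff hf b n
    rw [Function.iterate_succ_apply', pow_succ', _root_.mul_assoc, ← ih]
    set g := (fwdDiff b)^[n] f
    have e1 : ∫ ξ, modul x ξ * g (ξ + b) = modul x (-b) * ∫ ξ, modul x ξ * g ξ := by
      rw [← integral_const_mul, ← integral_add_right_eq_self (fun ξ => modul x (-b) * (modul x ξ * g ξ)) b]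
      refine integral_congr_ae (.of_forall fun ξ => ?_)
      simp only
      have m : modul x b * modul x (-b) = 1 := by rw [← modul_add_right, add_neg_cancel]; simp [modul]
      rw [modul_add_right]
      linear_combination (-(modul x ξ * g (ξ + b))) * m
    have e2 : ∀ ξ, modul x ξ * fwdDiff b g ξ = modul x ξ * g (ξ + b) - modul x ξ * g ξ :=
      fun ξ => by rw [fwdDiff, mul_sub]
    simp only [invF, e2]
    rw [integral_sub (integrable_modul_mul (h.comp_add_right b) x) (integrable_modul_mul h x), e1]
    ring

/-! ### Weighted integrals -/

/-- The constant of the embedding of weighted `L²` in weighted `L¹`. -/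
def decConst : ℝ≥0∞ := ∫⁻ ξ : ℝ, ENNReal.ofReal (4 * (1 + ξ ^ 2)⁻¹)

lemma decConst_lt_top : decConst < ⊤ := (integrable_inv_one_add_sq.const_mul 4).lintegral_lt_top

lemma measurable_wt (a : ℝ) (N : ℕ) : Measurable (wt a N) := by unfold wt; fun_prop

variable {s : ℝ} {f : ℝ → ℂ}

lemma sq_lintegral_wt_le (hs : s ∈ Ioo (-(1 / 2) : ℝ) 0) (hf : Measurable f) (N : ℕ) :
    (∫⁻ ξ, ENNReal.ofReal (wt 1 N ξ) * ‖f ξ‖ₑ) ^ 2 ≤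
      decConst * ∫⁻ ξ, dens s (wt 1 (N + 2)) ξ * ‖f ξ‖ₑ ^ 2 := by
  have hw := measurable_wt 1 (N + 2)
  have h := sq_lintegral_mul_le (μ := volume)
    (f := fun ξ : ℝ => ENNReal.ofReal (((1 + |ξ|) ^ 2)⁻¹ * (4 + ξ ^ 2) ^ (-s / 2)))
    (g := fun ξ => ENNReal.ofReal (wt 1 (N + 2) ξ) * ENNReal.ofReal ((4 + ξ ^ 2) ^ (s / 2)) * ‖f ξ‖ₑ)
    (Measurable.aemeasurable (by fun_prop)) (Measurable.aemeasurable (by fun_prop))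
  refine le_trans (le_of_eq ?_) (h.trans (mul_le_mul' (lintegral_mono fun ξ => ?_)
    (le_of_eq (lintegral_congr fun ξ => ?_))))
  · congr 1
    refine lintegral_congr fun ξ => ?_
    have hw0 : 0 ≤ wt 1 (N + 2) ξ := by unfold wt; positivity
    rw [← _root_.mul_assoc, ← ENNReal.ofReal_mul hw0, ← ENNReal.ofReal_mul (by positivity)]
    congr 2
    rw [wt, wt, one_mul, pow_add, mul_mul_mul_comm, mul_comm (((1 + |ξ|) ^ 2)⁻¹), _root_.mul_assoc ((1 + |ξ|) ^ N),
      mul_inv_cancel₀ (by positivity), mul_one, ← Real.rpow_add (by positivity)]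
    rw [show -s / 2 + s / 2 = 0 by ring, Real.rpow_zero, mul_one]
  · rw [← ENNReal.ofReal_pow (by positivity)]
    refine ENNReal.ofReal_le_ofReal ?_
    have h1 : ((4 + ξ ^ 2) ^ (-s / 2)) ^ 2 ≤ 4 + ξ ^ 2 := by
      rw [← Real.rpow_natCast, ← Real.rpow_mul (by positivity)]
      have := hs.1
      have h2 := Real.rpow_le_rpow_of_exponent_le (x := 4 + ξ ^ 2) (y := -s / 2 * (2 : ℕ)) (z := 1)
        (by nlinarith [sq_nonneg ξ]) (by push_cast; linarith)
      rwa [Real.rpow_one] at h2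
    have hx := sq_abs ξ
    have hx0 := abs_nonneg ξ
    have h3 : 4 + ξ ^ 2 ≤ 4 * (1 + |ξ|) ^ 2 := by nlinarith
    have h4 : 1 + ξ ^ 2 ≤ (1 + |ξ|) ^ 2 := by nlinarith
    rw [mul_pow]
    calc (((1 + |ξ|) ^ 2)⁻¹) ^ 2 * ((4 + ξ ^ 2) ^ (-s / 2)) ^ 2 ≤
          (((1 + |ξ|) ^ 2)⁻¹) ^ 2 * (4 * (1 + |ξ|) ^ 2) := by gcongr; exact h1.trans h3
      _ = 4 * ((1 + |ξ|) ^ 2)⁻¹ := by field_simp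
      _ ≤ 4 * (1 + ξ ^ 2)⁻¹ := by gcongr
  · rw [mul_pow, mul_pow, dens, ← ENNReal.ofReal_pow (p := (4 + ξ ^ 2) ^ (s / 2)) (by positivity),
      ← Real.rpow_natCast ((4 + ξ ^ 2) ^ (s / 2)), ← Real.rpow_mul (by positivity)]
    norm_num

lemma sq_lintegral_dens_le (hf : Measurable f) (N : ℕ) :
    (∫⁻ ξ, dens s (wt 1 N) ξ * ‖f ξ‖ₑ ^ 2) ^ 2 ≤
      (∫⁻ ξ, dens s (fun _ => 1) ξ * ‖f ξ‖ₑ ^ 2) * ∫⁻ ξ, dens s (wt 1 (N + N)) ξ * ‖f ξ‖ₑ ^ 2 := by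
  have hw := measurable_wt 1 N
  have h := sq_lintegral_mul_le (μ := volume)
    (f := fun ξ : ℝ => ENNReal.ofReal ((4 + ξ ^ 2) ^ (s / 2)) * ‖f ξ‖ₑ)
    (g := fun ξ => ENNReal.ofReal (wt 1 N ξ) ^ 2 * ENNReal.ofReal ((4 + ξ ^ 2) ^ (s / 2)) * ‖f ξ‖ₑ)
    (Measurable.aemeasurable (by fun_prop)) (Measurable.aemeasurable (by fun_prop))
  have e : ∀ ξ : ℝ, ENNReal.ofReal ((4 + ξ ^ 2) ^ s) = ENNReal.ofReal ((4 + ξ ^ 2) ^ (s / 2)) ^ 2 :=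
    fun ξ => by
      rw [← ENNReal.ofReal_pow (by positivity), ← Real.rpow_natCast ((4 + ξ ^ 2) ^ (s / 2)),
        ← Real.rpow_mul (by positivity)]
      norm_num
  refine le_trans (le_of_eq ?_) (h.trans_eq ?_)
  · congr 1
    refine lintegral_congr fun ξ => ?_
    rw [dens, e]
    ring
  · congr 1
    · refine lintegral_congr fun ξ => ?_
      rw [dens, e, ENNReal.ofReal_one]
      ring
    · refine lintegral_congr fun ξ => ?_
      have hw0 : 0 ≤ wt 1 N ξ := by unfold wt; positivity
      have e2 : wt 1 (N + N) ξ = wt 1 N ξ * wt 1 N ξ := by rw [wt, wt, pow_add]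
      rw [dens, e, e2, ENNReal.ofReal_mul hw0]
      ring

lemma HasDecay.integrable (hs : s ∈ Ioo (-(1 / 2) : ℝ) 0) (hf : Measurable f) (h : HasDecay s f)
    (N : ℕ) : Integrable fun ξ : ℝ => (Complex.I * ξ) ^ N * f ξ := by
  refine ⟨(Measurable.aestronglyMeasurable (by fun_prop)), ?_⟩
  have h1 := (sq_lintegral_wt_le hs hf N).trans_lt (ENNReal.mul_lt_top decConst_lt_top (h (N + 2)))
  have h2 : ∫⁻ ξ, ENNReal.ofReal (wt 1 N ξ) * ‖f ξ‖ₑ < ⊤ := by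
    by_contra hc
    rw [not_lt, top_le_iff] at hc
    rw [hc] at h1
    simp at h1
  refine lt_of_le_of_lt (lintegral_mono fun ξ => ?_) h2
  rw [enorm_mul]
  refine mul_le_mul_left ?_ _
  rw [← ofReal_norm, norm_pow, norm_mul, Complex.norm_I, one_mul, Complex.norm_real, wt, one_mul,
    Real.norm_eq_abs]
  gcongr
  linarith

/-! ### Schwartz functions -/

/-- Rapid decay. -/
def Rapid (f : ℝ → ℂ) : Prop := ∀ N : ℕ, ∃ C : ℝ, ∀ x, (1 + |x|) ^ N * ‖f x‖ ≤ C

/-- Rapid decay is inherited by derivatives (an inequality of Landau). -/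
lemma Rapid.deriv {f f' f'' : ℝ → ℂ} (h : Rapid f) (hf : ∀ x, HasDerivAt f (f' x) x)
    (hf' : ∀ x, HasDerivAt f' (f'' x) x) {M : ℝ} (hM : ∀ x, ‖f'' x‖ ≤ M) : Rapid f' := by
  have hM0 : 0 ≤ M := (norm_nonneg _).trans (hM 0)
  have taylor : ∀ x y : ℝ, x ≤ y → ‖f y - f x - (y - x : ℝ) * f' x‖ ≤ M * (y - x) * (y - x) := by
    intro x y hxy
    have h1 : ∀ t ∈ Icc x y, ‖f' t - f' x‖ ≤ M * (y - x) := fun t ht => by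
      have := (convex_Icc x y).norm_image_sub_le_of_norm_hasDerivWithin_le (f := f') (C := M)
        (fun τ _ => (hf' τ).hasDerivWithinAt) (fun τ _ => hM τ) (left_mem_Icc.2 hxy) ht
      refine this.trans ?_
      rw [Real.norm_of_nonneg (sub_nonneg.2 ht.1)]
      gcongr
      exact ht.2
    have h2 := (convex_Icc x y).norm_image_sub_le_of_norm_hasDerivWithin_le
      (f := fun t : ℝ => f t - (t : ℂ) * f' x) (f' := fun t => f' t - f' x) (C := M * (y - x))
      (fun τ _ => by
        have h3 : HasDerivAt (fun t : ℝ => (t : ℂ) * f' x) (f' x) τ := by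
          simpa using (hasDerivAt_id τ).ofReal_comp.mul_const (f' x)
        exact ((hf τ).sub h3).hasDerivWithinAt) h1 (left_mem_Icc.2 hxy) (right_mem_Icc.2 hxy)
    rw [Real.norm_of_nonneg (sub_nonneg.2 hxy)] at h2
    have e : f y - f x - (y - x : ℝ) * f' x = f y - y * f' x - (f x - x * f' x) := by
      push_cast
      ring
    rw [e]
    exact h2
  intro N
  obtain ⟨C, hC⟩ := h (2 * N)
  have hC0 : 0 ≤ C := by
    have := hC 0
    simp only [abs_zero, add_zero, one_pow, one_mul] at this
    exact (norm_nonneg _).trans this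
  refine ⟨C + 4 ^ N * C + M, fun x => ?_⟩
  set p := 1 + |x| with hp
  have hp1 : 1 ≤ p := le_add_of_nonneg_right (abs_nonneg x)
  have hp0 : 0 < p ^ N := by positivity
  set η := (p ^ N)⁻¹ with hη
  have hη0 : 0 < η := by positivity
  have hη1 : η ≤ 1 := inv_le_one_of_one_le₀ (one_le_pow₀ hp1)
  have h1 := taylor x (x + η) (by linarith)
  rw [add_sub_cancel_left] at h1
  have h2 : η * ‖f' x‖ ≤ ‖f (x + η)‖ + ‖f x‖ + M * η * η := by
    have e : (η : ℂ) * f' x = f (x + η) - f x - (f (x + η) - f x - (η : ℂ) * f' x) := by ring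
    have h3 : ‖(η : ℂ) * f' x‖ ≤ ‖f (x + η)‖ + ‖f x‖ + M * η * η := by
      rw [e]
      exact (norm_sub_le _ _).trans (add_le_add (norm_sub_le _ _) h1)
    rwa [norm_mul, Complex.norm_real, Real.norm_of_nonneg hη0.le] at h3
  have hpp : p ^ (2 * N) = p ^ N * p ^ N := by rw [two_mul, pow_add]
  have h4 : p ^ N * p ^ N * ‖f x‖ ≤ C := hpp ▸ hC x
  have h5 : p ^ N * p ^ N * ‖f (x + η)‖ ≤ 4 ^ N * C := by
    have h6 : p ≤ 2 * (1 + |x + η|) := by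
      have := abs_sub_abs_le_abs_sub x (x + η)
      rw [sub_add_cancel_left, abs_neg, abs_of_pos hη0] at this
      have := abs_nonneg (x + η)
      linarith
    have h7 : p ^ (2 * N) ≤ 4 ^ N * (1 + |x + η|) ^ (2 * N) := by
      calc p ^ (2 * N) ≤ (2 * (1 + |x + η|)) ^ (2 * N) := by gcongr
        _ = _ := by rw [mul_pow, pow_mul 2 2 N]; norm_num
    rw [← hpp]
    calc p ^ (2 * N) * ‖f (x + η)‖ ≤ 4 ^ N * (1 + |x + η|) ^ (2 * N) * ‖f (x + η)‖ := by gcongr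
      _ = 4 ^ N * ((1 + |x + η|) ^ (2 * N) * ‖f (x + η)‖) := by ring
      _ ≤ _ := by gcongr; exact hC _
  have e1 : p ^ N * η = 1 := mul_inv_cancel₀ hp0.ne'
  calc p ^ N * ‖f' x‖ = p ^ N * p ^ N * (η * ‖f' x‖) := by linear_combination (-p ^ N * ‖f' x‖) * e1
    _ ≤ p ^ N * p ^ N * (‖f (x + η)‖ + ‖f x‖ + M * η * η) := by gcongr
    _ = p ^ N * p ^ N * ‖f (x + η)‖ + p ^ N * p ^ N * ‖f x‖ + M * (p ^ N * η) * (p ^ N * η) := by ring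
    _ ≤ C + 4 ^ N * C + M := by rw [e1]; linarith

end

end AKNS

namespace AKNS

noncomputable section

open scoped ENNReal NNReal
open Filter Topology

/-! ### Finite differences in the Sobolev space -/

variable {s : ℝ}

lemma IsSob.coeFn_dif_iter {ω : ℝ → ℝ} {μ : Measure ℝ} (S : IsSob s ω μ) (b : ℝ) (n : ℕ)
    (f : Lp ℂ 2 μ) : ⇑((S.dif b)^[n] f) =ᵐ[volume] (fwdDiff b)^[n] f := by
  induction n with
  | zero => rfl
  | succ n ih =>
    rw [Function.iterate_succ_apply', Function.iterate_succ_apply', S.dif_apply]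
    filter_upwards [ih, ae_add b ih, S.coeFn_tl b ((S.dif b)^[n] f),
      S.hμ.ae_eq_iff.1 (Lp.coeFn_sub (S.tl b ((S.dif b)^[n] f)) ((S.dif b)^[n] f))] with ξ h1 h2 h3 h4
    rw [h4, Pi.sub_apply, h3, h1, h2, fwdDiff]

lemma hasDerivAt_fwdDiff_iter {f f' : ℝ → ℂ} (h : ∀ x, HasDerivAt f (f' x) x) (b : ℝ) (n : ℕ) (x : ℝ) :
    HasDerivAt ((fwdDiff b)^[n] f) ((fwdDiff b)^[n] f' x) x := by
  induction n generalizing x with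
  | zero => exact h x
  | succ n ih =>
    rw [Function.iterate_succ_apply', Function.iterate_succ_apply']
    exact ((ih (x + b)).comp_add_const x b).sub (ih x)

lemma exists_norm_schwartz_le (ψ : 𝓢(ℝ, ℂ)) (N : ℕ) : ∃ C : ℝ, ∀ x, (1 + |x|) ^ N * ‖ψ x‖ ≤ C := by
  have := SchwartzMap.one_add_le_sup_seminorm_apply (𝕜 := ℂ) (m := (N, 0)) le_rfl le_rfl ψ
  simp only [norm_iteratedFDeriv_zero, Real.norm_eq_abs] at this
  exact ⟨_, this⟩

lemma exists_norm_fwdDiff_le (n : ℕ) (ψ : 𝓢(ℝ, ℂ)) : ∃ C : ℝ, 0 ≤ C ∧ ∀ b : ℝ, |b| ≤ 1 → ∀ ξ,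
    ‖(fwdDiff b)^[n] ψ ξ‖ ≤ C * |b| ^ n * (1 + ξ ^ 2)⁻¹ := by
  induction n generalizing ψ with
  | zero =>
    obtain ⟨C, hC⟩ := exists_norm_schwartz_le ψ 2
    have hC0 : 0 ≤ C := le_trans (by positivity) (hC 0)
    refine ⟨C, hC0, fun b _ ξ => ?_⟩
    rw [Function.iterate_zero, id, pow_zero, mul_one, ← div_eq_mul_inv, le_div_iff₀ (by positivity),
      mul_comm]
    refine le_trans ?_ (hC ξ)
    gcongr
    nlinarith [abs_nonneg ξ, sq_abs ξ]
  | succ n ih =>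
    obtain ⟨C, hC0, hC⟩ := ih (SchwartzMap.derivCLM ℂ ℂ ψ)
    refine ⟨3 * C, by positivity, fun b hb ξ => ?_⟩
    have hd : ∀ x, HasDerivAt ψ (SchwartzMap.derivCLM ℂ ℂ ψ x) x := fun x => by
      rw [SchwartzMap.derivCLM_apply]
      exact ψ.differentiableAt.hasDerivAt
    rw [Function.iterate_succ_apply', fwdDiff]
    have h1 : ∀ η ∈ uIcc ξ (ξ + b), ‖(fwdDiff b)^[n] (SchwartzMap.derivCLM ℂ ℂ ψ) η‖ ≤
        C * |b| ^ n * (3 * (1 + ξ ^ 2)⁻¹) := fun η hη => by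
      refine (hC b hb η).trans ?_
      have h2 : |η - ξ| ≤ 1 := (abs_sub_left_of_mem_uIcc hη).trans (by rwa [add_sub_cancel_left])
      have h3 : (η - ξ) ^ 2 ≤ 1 := (sq_le_one_iff_abs_le_one _).2 h2
      gcongr
      rw [← div_eq_mul_inv, inv_eq_one_div, div_le_div_iff₀ (by positivity) (by positivity)]
      nlinarith [sq_nonneg (ξ - 2 * η)]
    have h2 := (convex_uIcc ξ (ξ + b)).norm_image_sub_le_of_norm_hasDerivWithin_le
      (fun τ _ => (hasDerivAt_fwdDiff_iter hd b n τ).hasDerivWithinAt) h1 left_mem_uIcc right_mem_uIcc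
    refine h2.trans (le_of_eq ?_)
    rw [add_sub_cancel_left, Real.norm_eq_abs]
    ring

lemma exists_norm_dif_schwartz_le (hs : s ∈ Ioo (-(1 / 2) : ℝ) 0) {q : Hs s} {ψ : 𝓢(ℝ, ℂ)}
    (h : q =ᵐ[volume] ψ) (n : ℕ) :
    ∃ C : ℝ, ∀ b : ℝ, |b| ≤ 1 → ‖((isSob_sobolev hs).dif b)^[n] q‖ ≤ C * |b| ^ n := by
  have S := isSob_sobolev hs
  have hmeas : Measurable fun ξ : ℝ => (1 + ξ ^ 2)⁻¹ := by fun_prop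
  have hm₀ : MemLp (fun ξ : ℝ => (1 + ξ ^ 2)⁻¹) 2 := by
    rw [memLp_two_iff_integrable_sq hmeas.aestronglyMeasurable]
    refine integrable_inv_one_add_sq.mono' (hmeas.pow_const 2).aestronglyMeasurable
      (.of_forall fun ξ => ?_)
    rw [Real.norm_of_nonneg (by positivity)]
    exact pow_le_of_le_one (by positivity)
      (inv_le_one_of_one_le₀ (by nlinarith [sq_nonneg ξ])) two_ne_zero
  have hm : MemLp (fun ξ : ℝ => (((1 + ξ ^ 2)⁻¹ : ℝ) : ℂ)) 2 (sobolevMeasure s) :=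
    memLp_sobolev hs.2.le hm₀.ofReal
  obtain ⟨C, hC0, hC⟩ := exists_norm_fwdDiff_le n ψ
  refine ⟨C * ‖hm.toLp _‖, fun b hb => ?_⟩
  rw [mul_right_comm]
  refine Lp.norm_le_mul_norm_of_ae_le_mul (S.hμ.ae_iff.2 ?_)
  have h1 : ∀ m : ℕ, (fwdDiff b)^[m] q =ᵐ[volume] (fwdDiff b)^[m] ψ := fun m => by
    induction m with
    | zero => exact h
    | succ m ih =>
      rw [Function.iterate_succ_apply', Function.iterate_succ_apply']
      filter_upwards [ih, ae_add b ih] with ξ h1 h2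
      rw [fwdDiff, fwdDiff, h1, h2]
  filter_upwards [S.coeFn_dif_iter b n q, h1 n, S.hμ.ae_eq_iff.1 hm.coeFn_toLp] with ξ h2 h3 h4
  rw [h2, h3, h4, Complex.norm_real, Real.norm_of_nonneg (by positivity)]
  exact hC b hb ξ

lemma HasDecay.congr {f g : ℝ → ℂ} (h : HasDecay s f) (e : f =ᵐ[volume] g) : HasDecay s g := fun N => by
  refine lt_of_eq_of_lt (lintegral_congr_ae ?_) (h N)
  filter_upwards [e] with ξ hξ
  rw [hξ]

lemma hasDecay_schwartz (hs : s ≤ 0) (ψ : 𝓢(ℝ, ℂ)) : HasDecay s ψ := fun N => by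
  obtain ⟨C, hC⟩ := exists_norm_schwartz_le ψ (N + 1)
  refine lt_of_le_of_lt (lintegral_mono fun ξ => ?_)
    (integrable_inv_one_add_sq.const_mul (C ^ 2)).lintegral_lt_top
  have hw : 0 ≤ wt 1 N ξ := by unfold wt; positivity
  have h1 : (4 + ξ ^ 2) ^ s ≤ 1 :=
    Real.rpow_le_one_of_one_le_of_nonpos (by nlinarith [sq_nonneg ξ]) hs
  rw [dens, ← ofReal_norm, ← ENNReal.ofReal_pow hw, ← ENNReal.ofReal_mul (by positivity),
    ← ENNReal.ofReal_pow (norm_nonneg _), ← ENNReal.ofReal_mul (by positivity)]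
  refine ENNReal.ofReal_le_ofReal ?_
  rw [← div_eq_mul_inv, le_div_iff₀ (by positivity)]
  have h2 : 1 + ξ ^ 2 ≤ (1 + |ξ|) ^ 2 := by nlinarith [abs_nonneg ξ, sq_abs ξ]
  calc wt 1 N ξ ^ 2 * (4 + ξ ^ 2) ^ s * ‖ψ ξ‖ ^ 2 * (1 + ξ ^ 2)
      ≤ wt 1 N ξ ^ 2 * 1 * ‖ψ ξ‖ ^ 2 * (1 + |ξ|) ^ 2 := by gcongr
    _ = ((1 + |ξ|) ^ (N + 1) * ‖ψ ξ‖) ^ 2 := by rw [wt, one_mul]; ring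
    _ ≤ C ^ 2 := by gcongr; exact hC ξ

/-! ### Functions with smooth and rapidly decreasing Fourier transforms -/

lemma lintegral_fwdDiff_le (hs : s ∈ Ioo (-(1 / 2) : ℝ) 0) {f : ℝ → ℂ} (hf : Measurable f) {b : ℝ}
    (hb : |b| ≤ 1) (n : ℕ) : Measurable ((fwdDiff b)^[n] f) ∧
    ∫⁻ ξ, dens s (wt 1 4) ξ * ‖(fwdDiff b)^[n] f ξ‖ₑ ^ 2 ≤
      (2 * (64 ^ 2 + 1)) ^ n * ∫⁻ ξ, dens s (wt 1 4) ξ * ‖f ξ‖ₑ ^ 2 := by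
  have hω := isFreqWeight_wt zero_le_one 4
  have hm := measurable_dens (s := s) hω
  have hc : (tlConst (wt 1 4) b : ℝ≥0∞) ≤ 64 := by
    have h : b ^ 2 ≤ 1 := (sq_le_one_iff_abs_le_one b).2 hb
    have h1 : tlConst (wt 1 4) b ≤ 64 := by
      rw [tlConst, Real.toNNReal_le_iff_le_coe]
      have h2 : wt 1 4 b ≤ 16 := by
        rw [wt, one_mul]
        calc (1 + |b|) ^ 4 ≤ (1 + 1) ^ 4 := by gcongr
          _ = 16 := by norm_num
      push_cast
      nlinarith [sq_nonneg b]
    exact_mod_cast h1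
  induction n with
  | zero => simpa using hf
  | succ n ih =>
    obtain ⟨hg, ih⟩ := ih
    rw [Function.iterate_succ_apply']
    set g := (fwdDiff b)^[n] f
    have hg' : Measurable fun ξ => g (ξ + b) := hg.comp (measurable_add_const b)
    refine ⟨hg'.sub hg, ?_⟩
    have h1 : ∫⁻ ξ, dens s (wt 1 4) ξ * ‖g (ξ + b)‖ₑ ^ 2 ≤
        64 ^ 2 * ∫⁻ ξ, dens s (wt 1 4) ξ * ‖g ξ‖ₑ ^ 2 := by
      rw [← lintegral_add_right_eq_self (fun ξ => dens s (wt 1 4) ξ * ‖g ξ‖ₑ ^ 2) b,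
        ← lintegral_const_mul' _ _ (by finiteness)]
      refine lintegral_mono fun ξ => ?_
      rw [← _root_.mul_assoc]
      exact mul_le_mul_left ((dens_le_tl hs hω b ξ).trans (mul_le_mul_left (pow_le_pow_left' hc 2) _)) _
    calc ∫⁻ ξ, dens s (wt 1 4) ξ * ‖fwdDiff b g ξ‖ₑ ^ 2
        ≤ ∫⁻ ξ, 2 * (dens s (wt 1 4) ξ * ‖g (ξ + b)‖ₑ ^ 2 + dens s (wt 1 4) ξ * ‖g ξ‖ₑ ^ 2) := by
          refine lintegral_mono fun ξ => ?_
          rw [← mul_add, mul_left_comm]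
          refine mul_le_mul_right ?_ _
          refine (pow_le_pow_left' (enorm_sub_le (a := g (ξ + b)) (b := g ξ)) 2).trans ?_
          simp only [enorm_eq_nnnorm]
          have := add_sq_le (a := ‖g (ξ + b)‖₊) (b := ‖g ξ‖₊)
          exact_mod_cast this
      _ = 2 * ((∫⁻ ξ, dens s (wt 1 4) ξ * ‖g (ξ + b)‖ₑ ^ 2) +
            ∫⁻ ξ, dens s (wt 1 4) ξ * ‖g ξ‖ₑ ^ 2) := by
          rw [lintegral_const_mul' _ _ (by finiteness), lintegral_add_left (by fun_prop)]
      _ ≤ 2 * (64 ^ 2 * (∫⁻ ξ, dens s (wt 1 4) ξ * ‖g ξ‖ₑ ^ 2) +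
            ∫⁻ ξ, dens s (wt 1 4) ξ * ‖g ξ‖ₑ ^ 2) := by gcongr
      _ = 2 * (64 ^ 2 + 1) * ∫⁻ ξ, dens s (wt 1 4) ξ * ‖g ξ‖ₑ ^ 2 := by ring
      _ ≤ _ := by
          rw [pow_succ' (2 * (64 ^ 2 + 1) : ℝ≥0∞) n, _root_.mul_assoc _ ((2 * (64 ^ 2 + 1) : ℝ≥0∞) ^ n)]
          exact mul_le_mul_right ih _

lemma exists_integral_fwdDiff_le (hs : s ∈ Ioo (-(1 / 2) : ℝ) 0) {q : Hs s} (h : HasDecay s q)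
    (hd : ∀ n, ∃ C : ℝ, ∀ b : ℝ, |b| ≤ 1 → ‖((isSob_sobolev hs).dif b)^[n] q‖ ≤ C * |b| ^ n) (n : ℕ) :
    ∃ C : ℝ, ∀ b : ℝ, |b| ≤ 1 → ∫ ξ, ‖(fwdDiff b)^[2 * n] q ξ‖ ≤ C * |b| ^ n := by
  have S := isSob_sobolev hs
  have hq := (Lp.stronglyMeasurable q).measurable
  have hqi : Integrable q := by simpa using h.integrable hs hq 0
  obtain ⟨C, hC⟩ := hd (2 * n)
  set E : ℝ≥0∞ := (2 * (64 ^ 2 + 1)) ^ (2 * n) * ∫⁻ ξ, dens s (wt 1 4) ξ * ‖q ξ‖ₑ ^ 2 with hE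
  have hET : decConst ^ 2 * E ≠ ⊤ := by
    have := decConst_lt_top.ne
    have := (h 4).ne
    finiteness
  refine ⟨(decConst ^ 2 * E).toReal * C ^ 2 + 1, fun b hb => ?_⟩
  obtain ⟨hm, hle⟩ := lintegral_fwdDiff_le hs hq hb (2 * n)
  have h1 := sq_lintegral_wt_le hs hm 0
  have h2 := sq_lintegral_dens_le (s := s) hm 2
  have h3 : ∫⁻ ξ, dens s (fun _ => 1) ξ * ‖(fwdDiff b)^[2 * n] q ξ‖ₑ ^ 2 ≤
      ENNReal.ofReal (C * |b| ^ (2 * n)) ^ 2 := by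
    have h4 := S.hμ.enorm_sq (((isSob_sobolev hs).dif b)^[2 * n] q)
    have h5 : ∫⁻ ξ, dens s (fun _ => 1) ξ * ‖(fwdDiff b)^[2 * n] q ξ‖ₑ ^ 2 =
        ‖((isSob_sobolev hs).dif b)^[2 * n] q‖ₑ ^ 2 := by
      rw [h4]
      refine lintegral_congr_ae ?_
      filter_upwards [S.coeFn_dif_iter b (2 * n) q] with ξ hξ
      rw [hξ]
    rw [h5, ← ofReal_norm]
    exact pow_le_pow_left' (ENNReal.ofReal_le_ofReal (hC b hb)) 2
  have hI : ENNReal.ofReal (∫ ξ, ‖(fwdDiff b)^[2 * n] q ξ‖) =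
      ∫⁻ ξ, ENNReal.ofReal (wt 1 0 ξ) * ‖(fwdDiff b)^[2 * n] q ξ‖ₑ := by
    rw [ofReal_integral_norm_eq_lintegral_enorm (integrable_fwdDiff hqi b _)]
    simp [wt]
  have h4 : ENNReal.ofReal (∫ ξ, ‖(fwdDiff b)^[2 * n] q ξ‖) ^ 4 ≤
      decConst ^ 2 * E * ENNReal.ofReal (C * |b| ^ (2 * n)) ^ 2 := by
    rw [hI]
    calc _ = ((∫⁻ ξ, ENNReal.ofReal (wt 1 0 ξ) * ‖(fwdDiff b)^[2 * n] q ξ‖ₑ) ^ 2) ^ 2 := by ring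
      _ ≤ (decConst * ∫⁻ ξ, dens s (wt 1 2) ξ * ‖(fwdDiff b)^[2 * n] q ξ‖ₑ ^ 2) ^ 2 := by
          gcongr
      _ = decConst ^ 2 * (∫⁻ ξ, dens s (wt 1 2) ξ * ‖(fwdDiff b)^[2 * n] q ξ‖ₑ ^ 2) ^ 2 := by ring
      _ ≤ decConst ^ 2 * (ENNReal.ofReal (C * |b| ^ (2 * n)) ^ 2 * E) := by
          gcongr
          exact h2.trans (mul_le_mul' h3 hle)
      _ = _ := by ring
  have hI0 : 0 ≤ ∫ ξ, ‖(fwdDiff b)^[2 * n] q ξ‖ := integral_nonneg fun _ => norm_nonneg _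
  have hCb : 0 ≤ C * |b| ^ (2 * n) := (norm_nonneg _).trans (hC b hb)
  have h5 : (∫ ξ, ‖(fwdDiff b)^[2 * n] q ξ‖) ^ 4 ≤
      (decConst ^ 2 * E).toReal * (C * |b| ^ (2 * n)) ^ 2 := by
    rw [← ENNReal.ofReal_toReal hET, ← ENNReal.ofReal_pow hI0, ← ENNReal.ofReal_pow hCb,
      ← ENNReal.ofReal_mul ENNReal.toReal_nonneg, ENNReal.ofReal_le_ofReal_iff (by positivity)] at h4
    exact h4
  set M := (decConst ^ 2 * E).toReal * C ^ 2
  have hM : 0 ≤ M := by positivity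
  refine le_of_pow_le_pow_left₀ (n := 4) (by norm_num) (by positivity) (h5.trans ?_)
  have h6 : M ≤ (M + 1) ^ 4 := by
    have := le_self_pow₀ (a := M + 1) (by linarith) (show 4 ≠ 0 by norm_num)
    linarith
  calc (decConst ^ 2 * E).toReal * (C * |b| ^ (2 * n)) ^ 2 = M * (|b| ^ n) ^ 4 := by ring
    _ ≤ (M + 1) ^ 4 * (|b| ^ n) ^ 4 := by gcongr
    _ = _ := by ring

lemma rapid_invF (hs : s ∈ Ioo (-(1 / 2) : ℝ) 0) {q : Hs s} (h : HasDecay s q)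
    (hd : ∀ n, ∃ C : ℝ, ∀ b : ℝ, |b| ≤ 1 → ‖((isSob_sobolev hs).dif b)^[n] q‖ ≤ C * |b| ^ n) :
    Rapid (invF q) := by
  intro n
  have hqi : Integrable q := by
    simpa using h.integrable hs (Lp.stronglyMeasurable q).measurable 0
  obtain ⟨C, hC⟩ := exists_integral_fwdDiff_le hs h hd n
  set e : ℝ := ‖Complex.exp (Complex.I * (-1 : ℝ)) - 1‖ ^ (2 * n) with he
  have he0 : 0 < e := by
    refine pow_pos (norm_pos_iff.2 (sub_ne_zero.2 fun h1 => ?_)) _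
    have h2 := congrArg Complex.im h1
    rw [mul_comm, Complex.exp_ofReal_mul_I_im, Complex.one_im, Real.sin_neg, neg_eq_zero] at h2
    exact (Real.sin_pos_of_pos_of_lt_pi one_pos (by linarith [Real.pi_gt_three])).ne' h2
  refine ⟨2 ^ n * (∫ ξ, ‖q ξ‖) + 2 ^ n * (e⁻¹ * C), fun x => ?_⟩
  have hI : 0 ≤ ∫ ξ, ‖q ξ‖ := integral_nonneg fun _ => norm_nonneg _
  have hC0 : 0 ≤ C := by
    have := (integral_nonneg fun _ => norm_nonneg _).trans (hC 1 (by simp))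
    simpa using this
  rcases le_total |x| 1 with hx | hx
  · calc (1 + |x|) ^ n * ‖invF q x‖ ≤ (1 + 1) ^ n * ∫ ξ, ‖q ξ‖ := by
          gcongr
          exact norm_invF_le _ _
      _ = 2 ^ n * ∫ ξ, ‖q ξ‖ := by norm_num
      _ ≤ _ := le_add_of_nonneg_right (by positivity)
  · have hx0 : x ≠ 0 := fun h0 => by
      rw [h0, abs_zero] at hx
      linarith
    have h1 := norm_invF_le ((fwdDiff x⁻¹)^[2 * n] q) x
    have hb : |x⁻¹| ≤ 1 := by
      rw [abs_inv]
      exact inv_le_one_of_one_le₀ hx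
    have h2 := h1.trans (hC _ hb)
    rw [invF_fwdDiff hqi, norm_mul, norm_pow, modul, mul_neg, mul_inv_cancel₀ hx0, ← he, abs_inv] at h2
    have hxn : 0 < |x| ^ n := by positivity
    have h3 : |x| ^ n * ‖invF q x‖ ≤ e⁻¹ * C := by
      rw [le_inv_mul_iff₀ he0]
      rw [inv_pow, ← div_eq_mul_inv, le_div_iff₀ hxn] at h2
      linarith
    calc (1 + |x|) ^ n * ‖invF q x‖ ≤ (2 * |x|) ^ n * ‖invF q x‖ := by gcongr; linarith
      _ = 2 ^ n * (|x| ^ n * ‖invF q x‖) := by rw [mul_pow]; ring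
      _ ≤ 2 ^ n * (e⁻¹ * C) := by gcongr
      _ ≤ _ := le_add_of_nonneg_left (by positivity)

lemma exists_isOfSchwartz_of_decay (hs : s ∈ Ioo (-(1 / 2) : ℝ) 0) {q : Hs s} (h : HasDecay s q)
    (hd : ∀ n, ∃ C : ℝ, ∀ b : ℝ, |b| ≤ 1 → ‖((isSob_sobolev hs).dif b)^[n] q‖ ≤ C * |b| ^ n) :
    ∃ f, IsOfSchwartz q f := by
  have hi := h.integrable hs (Lp.stronglyMeasurable q).measurable
  have hqi : Integrable q := by simpa using hi 0
  set F : ℕ → ℝ → ℂ := fun n => invF fun ξ : ℝ => (Complex.I * ξ) ^ n * q ξ with hF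
  have hF0 : F 0 = invF q := by simp [hF]
  have hder : ∀ n x, HasDerivAt (F n) (F (n + 1) x) x := fun n x => by
    have e : (fun ξ : ℝ => Complex.I * ξ * ((Complex.I * ξ) ^ n * q ξ)) =
        fun ξ : ℝ => (Complex.I * ξ) ^ (n + 1) * q ξ := by
      ext ξ
      ring
    have := hasDerivAt_invF (hi n) (by rw [e]; exact hi (n + 1)) x
    rwa [e] at this
  have hrap : ∀ n, Rapid (F n) := fun n => by
    induction n with
    | zero => rw [hF0]; exact rapid_invF hs h hd
    | succ n ih => exact ih.deriv (hder n) (hder (n + 1)) fun x => norm_invF_le _ x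
  have hit : ∀ n, iteratedDeriv n (F 0) = F n := fun n => by
    induction n with
    | zero => exact iteratedDeriv_zero
    | succ n ih =>
      rw [iteratedDeriv_succ, ih]
      exact funext fun x => (hder n x).deriv
  let f : 𝓢(ℝ, ℂ) :=
    { toFun := F 0
      smooth' := contDiff_of_differentiable_iteratedDeriv fun m _ => by
        rw [hit m]
        exact fun x => (hder m x).differentiableAt
      decay' := fun k n => by
        obtain ⟨C, hC⟩ := hrap n k
        refine ⟨C, fun x => le_trans ?_ (hC x)⟩
        rw [norm_iteratedFDeriv_eq_norm_iteratedDeriv, hit n, Real.norm_eq_abs]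
        gcongr
        linarith }
  have hf : ∀ x, f x = invF q x := fun x => congrFun hF0 x
  obtain ⟨p, hp⟩ := exists_isOfSchwartz hs.2.le f
  have hpq : p = q := pair_ext fun φ => by
    have h1 : pair p φ = ∫ ξ, fourierT f ξ * fourierT φ (-ξ) := by
      refine integral_congr_ae ?_
      filter_upwards [hp] with ξ hξ
      rw [hξ]
    rw [h1, ← integral_mul_eq, pair, ← IsSob.integral_invFourier_mul hqi φ.integrable]
    simp only [hf, invF_eq]
  exact ⟨f, hpq ▸ hp⟩

lemma fourierT_translate (f : ℝ → ℂ) (c ξ : ℝ) :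
    fourierT (fun x => f (x + c)) ξ = modul c ξ * fourierT f ξ := by
  rw [fourierT, fourierT, mul_left_comm, ← integral_const_mul (modul c ξ)]
  congr 1
  rw [← integral_add_right_eq_self
    (fun x : ℝ => modul c ξ * (Complex.exp (-(Complex.I * ξ * x)) * f x)) c]
  refine integral_congr_ae (.of_forall fun x => ?_)
  simp only
  rw [modul, ← _root_.mul_assoc, ← Complex.exp_add]
  congr 2
  push_cast
  ring

lemma IsOfSchwartz.shift {q : Hs s} {f : 𝓢(ℝ, ℂ)} (h : IsOfSchwartz q f) (c : ℝ) :
    ∃ g, IsOfSchwartz (AKNS.shift (sobolevMeasure s) c q) g := by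
  refine ⟨f.compSubConstCLM ℂ (-c), ?_⟩
  have e : ⇑(f.compSubConstCLM ℂ (-c)) = fun x => f (x + c) := by
    ext x
    simp
  filter_upwards [h, (isWeighted_sobolev s).coeFn_shift c q] with ξ h1 h2
  rw [h2, h1, e, fourierT_translate]

/-- The flow preserves the Schwartz class. -/
lemma exists_isOfSchwartz_flow (hs : s ∈ Ioo (-(1 / 2) : ℝ) 0) {ε : ℤˣ} {κ : ℝ} (hκ : 1 ≤ |κ|)
    {c : ℂ} {d R : ℝ} (hR : R < rad s) {u : ℝ → Hs s}
    (hu : ∀ t, HasDerivAt u ((isSob_sobolev hs).field ε κ c d (u t)) t) (hn : ∀ t, ‖u t‖ ≤ R)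
    {f : 𝓢(ℝ, ℂ)} (h : IsOfSchwartz (u 0) f) (t : ℝ) : ∃ g, IsOfSchwartz (u t) g := by
  have h0 : u 0 =ᵐ[volume] sft f := by
    filter_upwards [h] with ξ hξ
    rw [hξ, sft_apply]
  refine exists_isOfSchwartz_of_decay hs (hasDecay_flow hs hR hu hn
    ((hasDecay_schwartz hs.2.le (sft f)).congr h0.symm) t) fun n => ?_
  obtain ⟨C, hC⟩ := (isSob_sobolev hs).exists_norm_dif_flow_le ε hκ c d hu
    (fun t => (hn t).trans hR.le) (exists_norm_dif_schwartz_le hs h0) |t| n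
  exact ⟨C, fun b hb => hC b hb t le_rfl⟩

end

end AKNS

namespace AKNS

noncomputable section

open scoped ENNReal NNReal
open Filter Topology

section

variable {s : ℝ} (hs : s ∈ Ioo (-(1 / 2) : ℝ) 0) {ε : ℤˣ} {κ : ℝ} {R δ : ℝ} {c : ℂ} {d : ℝ}
  (hR : R < rad s) {φ : ℝ → Hs s → Hs s}
  (hφ : IsSmallFlow ((isSob_sobolev hs).field ε κ c d) R δ φ)

include hR hφ

lemma IsSmallFlow.conservesAlpha (b : ℝ → ℝ)
    (hα : ∀ q, ‖q‖ ≤ δ → ∀ t, ∀ ϰ : ℝ, 1 ≤ ϰ → alpha ε ϰ (φ t q) = alpha ε ϰ q) :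
    ConservesAlpha ε {q : Hs s | ‖q‖ ≤ δ} fun t q => shift (sobolevMeasure s) (b t) (φ t q) := by
  intro q hq ϰ hϰ t
  have S := isSob_sobolev hs
  have hϰ1 : 1 ≤ |ϰ| := hϰ.trans (le_abs_self ϰ)
  have hn := (norm_shift_le (b t) (φ t q)).trans ((hφ.norm_lt q hq t).le.trans hR.le)
  refine ⟨S.summable_ATerm hϰ1 .rfl (ae_rHat S .rfl) hn ((S.norm_J_le ε _).trans hn), ?_⟩
  rw [alpha_shift hs ε hϰ1, hα q hq t ϰ hϰ]

lemma IsSmallFlow.preservesSchwartz (hκ : 1 ≤ κ) (b : ℝ → ℝ) :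
    PreservesSchwartz {q : Hs s | ‖q‖ ≤ δ} fun t q => shift (sobolevMeasure s) (b t) (φ t q) := by
  rintro q hq ⟨f, hf⟩ t
  obtain ⟨g, hg⟩ := exists_isOfSchwartz_flow hs (hκ.trans (le_abs_self κ)) hR (hφ.hasDerivAt q hq)
    (fun t => (hφ.norm_lt q hq t).le) (f := f) (by rwa [hφ.zero]) t
  exact hg.shift (b t)

end

end

end AKNS

theorem proposition4p9 (s : ℝ) (hs : s ∈ Ioo (-(1 / 2) : ℝ) 0) :
    ∃ δ : ℝ, 0 < δ ∧ ∀ (ε : ℤˣ) (κ : ℝ), 1 ≤ κ →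
      -- the two equations are the Hamiltonian flows on small Schwartz functions
      (∀ (q : Hs s) (f : 𝓢(ℝ, ℂ)), ‖q‖ ≤ δ → IsOfSchwartz q f →
        GeneratesAt ε (hamNLS ε κ) f (fun x =>
          4 * (κ : ℂ) ^ 3 * (g12 ε κ (fourierT f) x - g12 ε (-κ) (fourierT f) x)
            + 4 * (κ : ℂ) ^ 2 * f x) ∧
        GeneratesAt ε (hamMKdV ε κ) f (fun x => Complex.I *
          (8 * (κ : ℂ) ^ 4 * (g12 ε κ (fourierT f) x + g12 ε (-κ) (fourierT f) x)
            + 4 * (κ : ℂ) ^ 2 * deriv f x))) ∧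
      -- global well-posedness, conservation of `α`, and invariance of the Schwartz class
      (∃ Φ : ℝ → Hs s → Hs s,
        IsGlobalSolutionMap (IsNLSSolution ε κ) {q : Hs s | ‖q‖ ≤ δ} Φ ∧
        ConservesAlpha ε {q : Hs s | ‖q‖ ≤ δ} Φ ∧
        PreservesSchwartz {q : Hs s | ‖q‖ ≤ δ} Φ) ∧
      (∃ Φ : ℝ → Hs s → Hs s,
        IsGlobalSolutionMap (IsMKdVSolution ε κ) {q : Hs s | ‖q‖ ≤ δ} Φ ∧
        ConservesAlpha ε {q : Hs s | ‖q‖ ≤ δ} Φ ∧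
        PreservesSchwartz {q : Hs s | ‖q‖ ≤ δ} Φ) := by
  obtain ⟨R, K, hR0, hR, hK, hRK⟩ := exists_norm_le_of_alpha hs
  have hδ : R / (2 * K) < rad s := by
    refine lt_of_le_of_lt (div_le_self hR0.le ?_) hR
    linarith
  refine ⟨R / (2 * K), by positivity, fun ε κ hκ => ⟨fun q f hq hf => ?_, ?_, ?_⟩⟩
  · exact ⟨generatesAt_hamNLS hs hκ (hq.trans_lt hδ) hf, generatesAt_hamMKdV hs hκ (hq.trans_lt hδ) hf⟩
  · obtain ⟨φ, hφ, hα⟩ := exists_flow hs hR0 hR hK hRK ε hκ (-4 * Complex.I * (κ : ℂ) ^ 3) (-4 * κ ^ 2)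
    have h0 : (fun t q => shift (sobolevMeasure s) 0 (φ t q)) = φ := by
      ext t q : 2
      exact (isWeighted_sobolev s).shift_zero _
    refine ⟨φ, isGlobalSolutionMap_nls hs hκ hR hφ, ?_, ?_⟩
    · rw [← h0]
      exact hφ.conservesAlpha hs hR (fun _ => 0) hα
    · rw [← h0]
      exact hφ.preservesSchwartz hs hR hκ fun _ => 0
  · obtain ⟨φ, hφ, hα⟩ := exists_flow hs hR0 hR hK hRK ε hκ (8 * (κ : ℂ) ^ 4) 0
    exact ⟨_, isGlobalSolutionMap_mkdv hs hκ hR hφ,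
      hφ.conservesAlpha hs hR (fun t => 4 * κ ^ 2 * t) hα,
      hφ.preservesSchwartz hs hR hκ fun t => 4 * κ ^ 2 * t⟩
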